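/- **Theorem 2.** Let $a_\square(n)$ be the number of well-rounded sublattices of index $n$ in the square lattice $\mathbb{Z}[i]\subset\mathbb{C}$, where a sublattice is called well-rounded if its non-zero vectors of minimal length span $\mathbb{C}\cong\mathbb{R}^2$ over $\mathbb{R}$. Let $\zeta$ be the Riemann zeta function, $L(s,\chi_{-4})$ the $L$-function of the non-trivial Dirichlet character $\chi_{-4}$ modulo $4$, and $\gamma$ the Euler–Mascheroni constant. Then the summatory function $A_\square(x)=\sum_{1\le n\le x}a_\square(n)$ satisfies, as $x\to\infty$, $$\begin{aligned} A_\square(x) &= \frac{\log 3}{3}\,\frac{L(1,\chi_{-4})}{\zeta(2)}\,x(\log x-1)+c_\square x+O\bigl(x^{3/4}\log x\bigr)\\ &=\frac{\log 3}{2\pi}\,x\log x+\Bigl(c_\square-\frac{\log 3}{2\pi}\Bigr)x+O\bigl(x^{3/4}\log x\bigr), \end{aligned}$$ where $c_\square$ is the real number $$\begin{aligned} c_\square=\frac{L(1,\chi_{-4})}{\zeta(2)}\Biggl(&\zeta(2)+\frac{\log 3}{3}\Bigl(\frac{L'(1,\chi_{-4})}{L(1,\chi_{-4})}+\gamma-2\frac{\zeta'(2)}{\zeta(2)}\Bigr)+\frac{\log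 3}{3}\Bigl(2\gamma-\frac{\log 3}{4}-\frac{\log 2}{6}\Bigr)\\ &-\sum_{p=1}^\infty\frac1p\Bigl(\frac{\log 3}{2}-\sum_{p<q<p\sqrt3}\frac1q\Bigr)-\frac43\sum_{k=0}^\infty\frac1{2k+1}\Bigl(\frac{\log 3}{4}-\sum_{k<\ell<k\sqrt3+(\sqrt3-1)/2}\frac1{2\ell+1}\Bigr)\Biggr) \end{aligned}$$ (here $p,q,k,\ell$ run through integers, and both infinite series converge). Moreover $c_\square\approx 0.6272237$, correctly rounded to seven decimals, that is, $|c_\square-0.6272237|<5\cdot10^{-8}$. The Dirichlet series $\sum_{n\ge1}a_\square(n)n^{-s}$ converges for $\operatorname{Re}(s)>1$ and continues meromorphically to a neighbourhood of $s=1$, and $c_\square$ is the coefficient of $(s-1)^{-1}$ in its Laurent series there, whose principal part is $\frac{\log 3}{2\pi}(s-1)^{-2}+c_\square(s-1)^{-1}$. -/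

import Mathlib

open Filter Topology Asymptotics

noncomputable section

namespace WellRounded

/-- The non-zero vectors of minimal length of an additive subgroup `Λ` of a normed space. -/
def minimalVectors {E : Type*} [NormedAddCommGroup E] (Λ : AddSubgroup E) : Set E :=
  {v | v ∈ Λ ∧ v ≠ 0 ∧ ∀ w ∈ Λ, w ≠ 0 → ‖v‖ ≤ ‖w‖}

/-- `Λ` is well-rounded if its non-zero vectors of minimal length span the enveloping
real vector space. -/
def IsWellRounded {E : Type*} [NormedAddCommGroup E] [NormedSpace ℝ E]
    (Λ : AddSubgroup E) : Prop :=
  Submodule.span ℝ (minimalVectors Λ) = ⊤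

/-- The number of well-rounded sublattices of index `n` in `Γ`. -/
def wellRoundedCount {E : Type*} [NormedAddCommGroup E] [NormedSpace ℝ E]
    (Γ : AddSubgroup E) (n : ℕ) : ℕ :=
  {Λ : AddSubgroup E | Λ ≤ Γ ∧ IsWellRounded Λ ∧ Λ.relIndex Γ = n}.ncard

/-- The square lattice `ℤ[i]` in the Euclidean plane `ℂ`. -/
def squareLattice : AddSubgroup ℂ := GaussianInt.toComplex.toAddMonoidHom.range

/-- The number of well-rounded sublattices of index `n` in the square lattice. -/
def aSquare (n : ℕ) : ℕ := wellRoundedCount squareLattice n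

/-- The summatory function `x ↦ ∑_{1 ≤ n ≤ x} aSquare n`. -/
def ASquare (x : ℝ) : ℝ := ∑ n ∈ Finset.Icc 1 ⌊x⌋₊, (aSquare n : ℝ)

/-- The Dirichlet character `χ₋₄` modulo `4`, with complex values. -/
def chiNegFour : DirichletCharacter ℂ 4 := ZMod.χ₄.ringHomComp (Int.castRingHom ℂ)

/-- `(1 / p) * (log 3 / 2 - ∑_{p < q < p √3} 1 / q)`. -/
def seriesTermOne (p : ℕ) : ℝ :=
  1 / (p : ℝ) *
    (Real.log 3 / 2 - ∑ q ∈ Finset.Ioo p ⌈(p : ℝ) * √3⌉₊, 1 / (q : ℝ))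

/-- `(1 / (2 k + 1)) * (log 3 / 4 - ∑_{k < l < k √3 + (√3 - 1) / 2} 1 / (2 l + 1))`. -/
def seriesTermTwo (k : ℕ) : ℝ :=
  1 / (2 * (k : ℝ) + 1) *
    (1 / 4 * Real.log 3 -
      ∑ l ∈ Finset.Ioo k ⌈(k : ℝ) * √3 + (√3 - 1) / 2⌉₊, 1 / (2 * (l : ℝ) + 1))

/-- `L(1, χ₋₄)`. -/
def LOne : ℂ := chiNegFour.LFunction 1

/-- `L'(1, χ₋₄)`. -/
def LDerivOne : ℂ := deriv chiNegFour.LFunction 1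

/-- The explicit formula for the constant `c_□` (a complex expression, as the values of the
`L`-function and of the zeta function are complex numbers in Mathlib). -/
def cSquareFormula : ℂ :=
  LOne / riemannZeta 2 *
    (riemannZeta 2
      + (Real.log 3 : ℂ) / 3 *
        (LDerivOne / LOne + (Real.eulerMascheroniConstant : ℂ)
          - 2 * (deriv riemannZeta 2 / riemannZeta 2))
      + (Real.log 3 : ℂ) / 3 *
        (2 * (Real.eulerMascheroniConstant : ℂ) - (Real.log 3 : ℂ) / 4 - (Real.log 2 : ℂ) / 6)
      - ((∑' p : ℕ, seriesTermOne (p + 1) : ℝ) : ℂ)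
      - 4 / 3 * ((∑' k : ℕ, seriesTermTwo k : ℝ) : ℂ))

end WellRounded

end

/-! A sublattice of ℤ[i] is well-rounded exactly when it has two independent minimal vectors v, w.
These generate it and are the sides of a rhombus, so v + w and v - w are orthogonal. Hence v + w = p
y and v - w = i q y with coprime positive integers p, q and a Gaussian integer y. Minimality means
1/√3 ≤ p/q ≤ √3, and both inequalities are strict because √3 is irrational. Integrality of v and w
forces y = δ z, where δ = 1 + i if p and q are odd and δ = 2 otherwise; the index is N(z) times p q
or 2 p q respectively. With z in the first quadrant the parameters (z, p, q) are unique. So the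
count is a Dirichlet convolution (`aSquare_eq_sum`) of χ₋₄ * 1, which counts Gaussian integers of
given norm up to units (`ncard_quadrantFiber`), with the number of shapes (p, q) of given weight.

Both factors have a mean value with error O(√x log x). For χ₋₄ * 1 this is the hyperbola method. For
shapes one counts lattice points of the cone p < q < √3 p under a hyperbola and imposes coprimality
by Möbius inversion over squares (`hasMeanValue_shapeArith`). A second use of the hyperbola method
(`HasMeanValue.summatory_mul`) gives A x log x + B x + O(x^(3/4) log x) with A and B still
unidentified. By partial summation the Dirichlet series is then A/(s-1)² + (A+B)/(s-1) plus a
function analytic at 1 (`LSeries_eq_of_summatory`).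

The constants come from a second expression for the series on the real half-line s = 1 + u, u > 0:
it is L(s, χ₋₄) ζ(s) times a combination of 1/ζ(2s) and the cone sums ∑ p^(-s) ∑ q^(-s). Replacing
the inner sum over q by an integral leaves an elementary multiple of ζ(1 + 2u), and the error tends
to the two series of the theorem as u → 0⁺ (`tendsto_tsum_coneError`). Thus u² times the Dirichlet
series extends to u = 0, where its value and right derivative must be A and A + B
(`principalPart_unique`); that derivative is the explicit formula for c
(`hasDerivWithinAt_regularPart`). Only one-sided limits are needed, so the error series never has to
be continued.

For the numerical value, the terms of the two series behave like 1/(2p²) plus a fluctuation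
proportional to ({(√3-1)p} - 1/2)/p². The fluctuation cancels on average because the continued
fraction of √3 is periodic with small quotients, which pins down the tails to 6·10⁻⁹ and 22·10⁻⁹
after 2¹⁵ and 2¹⁴ steps (`abs_tsum_coneTerm_sub_le`). The partial sums are evaluated in integer
arithmetic with proved rounding bounds. The same arithmetic and the midpoint rule give the
logarithms, ζ'(2), L'(1, χ₋₄) and γ. -/

namespace WellRounded

open GaussianInt

/-! ### Gaussian integers of given norm (two squares) -/

/-- The divisor sum of the character `χ₋₄`. -/
def chiSum (n : ℕ) : ℤ := ∑ d ∈ n.divisors, ZMod.χ₄ (d : ZMod 4)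

/-- The divisors of `p * n` are those of `n` together with their multiples by `p`; the overlap
consists of `p` times the divisors of `n / p`. Inclusion-exclusion gives a recursion, which the
number of Gaussian integers of norm `n` satisfies as well. -/
lemma chiSum_prime_mul {p n : ℕ} (hp : p.Prime) (hn : n ≠ 0) :
    chiSum (p * n) = (1 + ZMod.χ₄ (p : ZMod 4)) * chiSum n
      - ZMod.χ₄ (p : ZMod 4) * (if p ∣ n then chiSum (n / p) else 0) := by
  have hinj : Function.Injective (fun d : ℕ => p * d) := fun a b h =>
    Nat.eq_of_mul_eq_mul_left hp.pos h
  have hunion : (p * n).divisors = n.divisors ∪ n.divisors.image (fun d => p * d) := by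
    ext d
    simp only [Nat.mem_divisors, Finset.mem_union, Finset.mem_image]
    constructor
    · rintro ⟨hd, h0⟩
      by_cases hpd : p ∣ d
      · obtain ⟨e, rfl⟩ := hpd
        exact Or.inr ⟨e, ⟨Nat.dvd_of_mul_dvd_mul_left hp.pos hd, hn⟩, rfl⟩
      · exact Or.inl ⟨((Nat.Prime.coprime_iff_not_dvd hp).2 hpd).symm.dvd_of_dvd_mul_left hd, hn⟩
    · rintro (⟨hd, -⟩ | ⟨e, ⟨he, -⟩, rfl⟩)
      · exact ⟨hd.mul_left p, mul_ne_zero hp.ne_zero hn⟩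
      · exact ⟨Nat.mul_dvd_mul_left p he, mul_ne_zero hp.ne_zero hn⟩
  have hinter : ∑ d ∈ n.divisors ∩ n.divisors.image (fun d => p * d), ZMod.χ₄ (d : ZMod 4)
      = ZMod.χ₄ (p : ZMod 4) * (if p ∣ n then chiSum (n / p) else 0) := by
    split_ifs with hpn
    · obtain ⟨m, rfl⟩ := hpn
      have hm : m ≠ 0 := by rintro rfl; simp at hn
      have : (p * m).divisors ∩ (p * m).divisors.image (fun d => p * d)
          = m.divisors.image (fun d => p * d) := by
        ext d
        simp only [Nat.mem_divisors, Finset.mem_inter, Finset.mem_image]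
        constructor
        · rintro ⟨⟨hd, -⟩, e, -, rfl⟩
          exact ⟨e, ⟨Nat.dvd_of_mul_dvd_mul_left hp.pos hd, hm⟩, rfl⟩
        · rintro ⟨e, ⟨he, -⟩, rfl⟩
          exact ⟨⟨Nat.mul_dvd_mul_left p he, hn⟩, e, ⟨he.mul_left p, hn⟩, rfl⟩
      rw [this, Finset.sum_image (fun a _ b _ h => hinj h), Nat.mul_div_cancel_left _ hp.pos,
        chiSum, Finset.mul_sum]
      exact Finset.sum_congr rfl fun d _ => by rw [Nat.cast_mul, map_mul]
    · rw [Finset.sum_eq_zero, mul_zero]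
      intro d hd
      simp only [Nat.mem_divisors, Finset.mem_inter, Finset.mem_image] at hd
      obtain ⟨⟨hd, -⟩, e, -, rfl⟩ := hd
      exact absurd (dvd_trans (dvd_mul_right p e) hd) hpn
  have h := Finset.sum_union_inter (s₁ := n.divisors) (s₂ := n.divisors.image (fun d => p * d))
    (f := fun d : ℕ => ZMod.χ₄ (d : ZMod 4))
  rw [hinter, Finset.sum_image (fun a _ b _ h => hinj h)] at h
  have h2 : ∑ d ∈ n.divisors, ZMod.χ₄ ((p * d : ℕ) : ZMod 4)
      = ZMod.χ₄ (p : ZMod 4) * chiSum n := by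
    rw [chiSum, Finset.mul_sum]
    exact Finset.sum_congr rfl fun d _ => by rw [Nat.cast_mul, map_mul]
  rw [h2] at h
  rw [chiSum, hunion]
  have h3 : ∑ d ∈ n.divisors, ZMod.χ₄ (d : ZMod 4) = chiSum n := rfl
  rw [h3] at h
  linarith

/-- The Gaussian integers of norm `n`. -/
def normFiber (n : ℕ) : Set GaussianInt := {z | z.norm = n}

lemma gaussianInt_norm_eq (z : GaussianInt) : z.norm = z.re ^ 2 + z.im ^ 2 := by
  rw [Zsqrtd.norm_def]; ring

lemma finite_normFiber (n : ℕ) : (normFiber n).Finite := by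
  refine Set.Finite.subset (Set.Finite.image (fun x : ℤ × ℤ => (⟨x.1, x.2⟩ : GaussianInt))
    ((Set.finite_Icc (-(n : ℤ)) n).prod (Set.finite_Icc (-(n : ℤ)) n))) ?_
  intro z hz
  have hz' : z.re ^ 2 + z.im ^ 2 = n := by rw [← gaussianInt_norm_eq]; exact hz
  refine ⟨(z.re, z.im), ⟨⟨?_, ?_⟩, ?_, ?_⟩, rfl⟩ <;> dsimp only <;> nlinarith

/-- Multiplication by `q` maps the elements of norm `n` bijectively onto the multiples of `q` of
norm `p * n`. -/
lemma ncard_normFiber_dvd {q : GaussianInt} {p : ℕ} (hp : 0 < p) (hq : q.norm = p) (n : ℕ) :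
    {z | z ∈ normFiber (p * n) ∧ q ∣ z}.ncard = (normFiber n).ncard := by
  have hq0 : q ≠ 0 := by rintro rfl; simp at hq; omega
  rw [← Set.ncard_image_of_injective (normFiber n) (mul_right_injective₀ hq0)]
  congr 1
  ext z
  simp only [normFiber, Set.mem_ofPred_eq, Set.mem_image]
  constructor
  · rintro ⟨hz, w, rfl⟩
    refine ⟨w, ?_, rfl⟩
    rw [Zsqrtd.norm_mul, hq] at hz
    push_cast at hz
    exact mul_left_cancel₀ (by exact_mod_cast hp.ne') hz
  · rintro ⟨w, hw, rfl⟩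
    exact ⟨by rw [Zsqrtd.norm_mul, hq, hw]; push_cast; ring, dvd_mul_right _ _⟩

lemma ncard_normFiber_natCast_dvd {p : ℕ} (hp : 0 < p) (n : ℕ) :
    {z | z ∈ normFiber (p * n) ∧ (p : GaussianInt) ∣ z}.ncard
      = if p ∣ n then (normFiber (n / p)).ncard else 0 := by
  have hnorm : (p : GaussianInt).norm = ((p * p : ℕ) : ℤ) := by
    rw [gaussianInt_norm_eq]; simp; ring
  split_ifs with h
  · obtain ⟨m, rfl⟩ := h
    rw [Nat.mul_div_cancel_left _ hp, ← mul_assoc]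
    exact ncard_normFiber_dvd (Nat.mul_pos hp hp) hnorm m
  · rw [Set.ncard_eq_zero ((finite_normFiber _).subset fun z hz => hz.1)]
    ext z
    simp only [Set.mem_ofPred_eq, Set.mem_empty_iff_false, iff_false, not_and]
    rintro hz ⟨w, rfl⟩
    apply h
    rw [normFiber, Set.mem_ofPred_eq, Zsqrtd.norm_mul, hnorm] at hz
    push_cast at hz
    rw [mul_assoc] at hz
    have := mul_left_cancel₀ (by exact_mod_cast hp.ne' : (p : ℤ) ≠ 0) hz
    exact_mod_cast Dvd.intro _ this

lemma prime_of_norm_prime {q : GaussianInt} {p : ℕ} (hp : p.Prime) (hq : q.norm = p) :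
    Prime q := by
  rw [← irreducible_iff_prime]
  refine ⟨fun h => ?_, fun {x y} h => ?_⟩
  · have := (Zsqrtd.norm_eq_one_iff (x := q)).2 h
    rw [hq] at this
    exact hp.one_lt.ne' (by simpa using this)
  · have h1 : x.norm.natAbs * y.norm.natAbs = p := by
      rw [← Int.natAbs_mul, ← Zsqrtd.norm_mul, ← h, hq]; simp
    rcases (Nat.prime_mul_iff.1 (h1 ▸ hp)) with ⟨-, h⟩ | ⟨-, h⟩
    · exact Or.inr (Zsqrtd.norm_eq_one_iff.1 h)
    · exact Or.inl (Zsqrtd.norm_eq_one_iff.1 h)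

lemma star_dvd_of_dvd_star {q z : GaussianInt} (h : q ∣ star z) : star q ∣ z := by
  obtain ⟨w, hw⟩ := h
  exact ⟨star w, by rw [← star_star z, hw, star_mul, mul_comm]⟩

lemma norm_eq_mul_star (z : GaussianInt) : ((z.norm : ℤ) : GaussianInt) = z * star z :=
  Zsqrtd.norm_eq_mul_conj z

lemma dvd_or_star_dvd {q z : GaussianInt} {p n : ℕ} (hq : Prime q) (hqp : q ∣ (p : GaussianInt))
    (hz : z ∈ normFiber (p * n)) : q ∣ z ∨ star q ∣ z := by
  have h : q ∣ z * star z := by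
    rw [← norm_eq_mul_star, show z.norm = ((p * n : ℕ) : ℤ) from hz]
    push_cast
    exact hqp.mul_right _
  exact (hq.dvd_or_dvd h).imp_right star_dvd_of_dvd_star

/-- The splitting of `p` decides which elements of norm `p * n` are multiples of what. For `p = 2`
all are divisible by 1 + i, and for `p ≡ 3` modulo 4 all are divisible by `p`. For `p ≡ 1`, with `p
= q * star q`, each is divisible by `q` or by `star q`, and by both exactly when `p` divides it. -/
lemma ncard_normFiber_prime_mul {p n : ℕ} (hp : p.Prime) :
    ((normFiber (p * n)).ncard : ℤ) = (1 + ZMod.χ₄ (p : ZMod 4)) * (normFiber n).ncard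
      - ZMod.χ₄ (p : ZMod 4) * (if p ∣ n then ((normFiber (n / p)).ncard : ℤ) else 0) := by
  have := Fact.mk hp
  have hcast : (if p ∣ n then ((normFiber (n / p)).ncard : ℤ) else 0)
      = ((if p ∣ n then (normFiber (n / p)).ncard else 0 : ℕ) : ℤ) := by split_ifs <;> simp
  rw [hcast, ← ncard_normFiber_natCast_dvd hp.pos]
  have hall : ∀ q : GaussianInt, (∀ z ∈ normFiber (p * n), q ∣ z) →
      (normFiber (p * n)).ncard = {z | z ∈ normFiber (p * n) ∧ q ∣ z}.ncard := by
    intro q h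
    congr 1
    ext z
    exact ⟨fun hz => ⟨hz, h z hz⟩, fun hz => hz.1⟩
  rcases hp.eq_two_or_odd with rfl | hodd
  · have hz : ∀ z ∈ normFiber (2 * n), (⟨1, 1⟩ : GaussianInt) ∣ z := by
      intro z hz
      have hz' : z.re ^ 2 + z.im ^ 2 = 2 * n := by
        rw [← gaussianInt_norm_eq]; exact_mod_cast hz
      have : (2 : ℤ) ∣ z.re + z.im := by
        have h : Even (z.re ^ 2 + z.im ^ 2) := ⟨n, by rw [hz']; ring⟩
        rw [Int.even_add, Int.even_pow' two_ne_zero, Int.even_pow' two_ne_zero] at h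
        exact (Int.even_add.2 h).two_dvd
      obtain ⟨k, hk⟩ := this
      refine ⟨⟨k, k - z.re⟩, ?_⟩
      ext <;> simp <;> linarith
    rw [hall _ hz, ncard_normFiber_dvd (p := 2) two_pos (by simp [gaussianInt_norm_eq]) n,
      show ((2 : ℕ) : ZMod 4) = 2 from rfl, show ZMod.χ₄ 2 = 0 by decide]
    ring
  · have h13 : p % 4 = 1 ∨ p % 4 = 3 := by omega
    rcases h13 with h1 | h3
    · obtain ⟨a, b, hab⟩ := Nat.Prime.sq_add_sq (p := p) (by omega)
      set q : GaussianInt := ⟨a, b⟩ with hqdef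
      have hq : q.norm = p := by rw [gaussianInt_norm_eq, ← hab]; push_cast; rfl
      have hq' : (star q).norm = p := by rw [gaussianInt_norm_eq, ← hab]; simp [hqdef]
      have hprime := prime_of_norm_prime hp hq
      have hprime' := prime_of_norm_prime hp hq'
      have hmul : (p : GaussianInt) = q * star q := by
        rw [← norm_eq_mul_star, hq]; simp
      -- Otherwise `star q` divides q + star q = 2a, and taking norms p divides (2a)², hence a; this
      -- contradicts a² + b² = p.
      have hnot : ¬ star q ∣ q := by
        intro h
        have h2 : star q ∣ (2 * a : ℕ) := by
          have : ((2 * a : ℕ) : GaussianInt) = q + star q := by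
            ext <;> simp [hqdef]; ring
          rw [this]; exact dvd_add h dvd_rfl
        have h3 : p ∣ (2 * a) ^ 2 := by
          obtain ⟨w, hw⟩ := h2
          have := congrArg Zsqrtd.norm hw
          rw [Zsqrtd.norm_mul, hq', Zsqrtd.norm_natCast] at this
          have h4 : (p : ℤ) ∣ ((2 * a) ^ 2 : ℕ) := ⟨w.norm, by rw [← this]; push_cast; ring⟩
          exact_mod_cast h4
        have h4 := hp.dvd_of_dvd_pow h3
        have h5 : p ∣ a := (hp.dvd_mul.1 h4).resolve_left fun h => by
          have := (Nat.prime_dvd_prime_iff_eq hp Nat.prime_two).1 h; omega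
        have ha : a ≠ 0 := by
          rintro rfl
          exact hp.prime.irreducible.not_isSquare ⟨b, by rw [← hab]; ring⟩
        have h6 := Nat.le_of_dvd (Nat.pos_of_ne_zero ha) h5
        have h7 := hp.two_le
        nlinarith
      have hunion : normFiber (p * n) = {z | z ∈ normFiber (p * n) ∧ q ∣ z} ∪
          {z | z ∈ normFiber (p * n) ∧ star q ∣ z} := by
        ext z
        constructor
        · intro hz
          exact (dvd_or_star_dvd hprime (hmul ▸ dvd_mul_right _ _) hz).imp
            (fun h => ⟨hz, h⟩) (fun h => ⟨hz, h⟩)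
        · rintro (h | h) <;> exact h.1
      have hinter : {z | z ∈ normFiber (p * n) ∧ (p : GaussianInt) ∣ z} =
          {z | z ∈ normFiber (p * n) ∧ q ∣ z} ∩ {z | z ∈ normFiber (p * n) ∧ star q ∣ z} := by
        ext z
        constructor
        · rintro ⟨hz, h⟩
          rw [hmul] at h
          exact ⟨⟨hz, dvd_of_mul_right_dvd h⟩, hz, dvd_of_mul_left_dvd h⟩
        · rintro ⟨⟨hz, w, rfl⟩, -, h2⟩
          refine ⟨hz, ?_⟩
          rw [hmul]
          exact mul_dvd_mul_left q ((hprime'.dvd_or_dvd h2).resolve_left hnot)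
      have hfin := (finite_normFiber (p * n))
      have := Set.ncard_union_add_ncard_inter {z | z ∈ normFiber (p * n) ∧ q ∣ z}
        {z | z ∈ normFiber (p * n) ∧ star q ∣ z} (hfin.subset fun z hz => hz.1)
        (hfin.subset fun z hz => hz.1)
      rw [← hunion, ← hinter, ncard_normFiber_dvd hp.pos hq, ncard_normFiber_dvd hp.pos hq'] at this
      have hχ : ZMod.χ₄ (p : ZMod 4) = 1 := ZMod.χ₄_nat_one_mod_four h1
      rw [hχ]
      zify at this
      linarith
    · have hprime := GaussianInt.prime_of_nat_prime_of_mod_four_eq_three p h3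
      have hz : ∀ z ∈ normFiber (p * n), (p : GaussianInt) ∣ z := by
        intro z hz
        rcases dvd_or_star_dvd hprime dvd_rfl hz with h | h
        · exact h
        · simpa using h
      rw [hall _ hz, ZMod.χ₄_nat_three_mod_four h3]
      ring

lemma ncard_normFiber_one : (normFiber 1).ncard = 4 := by
  have : normFiber 1 = ({⟨1, 0⟩, ⟨-1, 0⟩, ⟨0, 1⟩, ⟨0, -1⟩} : Finset GaussianInt) := by
    ext z
    simp only [normFiber, Set.mem_ofPred_eq, gaussianInt_norm_eq, Finset.coe_insert,
      Finset.coe_singleton, Set.mem_insert_iff, Set.mem_singleton_iff, Zsqrtd.ext_iff]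
    constructor
    · intro h
      push_cast at h
      have h1 : z.re ≤ 1 := by nlinarith
      have h2 : -1 ≤ z.re := by nlinarith
      have h3 : z.im ≤ 1 := by nlinarith
      have h4 : -1 ≤ z.im := by nlinarith
      generalize z.re = a at *
      generalize z.im = b at *
      interval_cases a <;> interval_cases b <;> simp_all
    · rintro (⟨h, h'⟩ | ⟨h, h'⟩ | ⟨h, h'⟩ | ⟨h, h'⟩) <;> rw [h, h'] <;> norm_num
  rw [this, Set.ncard_coe_finset]
  rfl

/-- Jacobi's two squares theorem. -/
theorem ncard_normFiber (n : ℕ) (hn : n ≠ 0) : ((normFiber n).ncard : ℤ) = 4 * chiSum n := by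
  induction n using Nat.strong_induction_on with
  | _ n ih =>
    by_cases h1 : n = 1
    · subst h1
      rw [ncard_normFiber_one]
      simp [chiSum]
    · obtain ⟨p, hp, m, rfl⟩ := Nat.exists_prime_and_dvd h1
      have hm : m ≠ 0 := by rintro rfl; simp at hn
      have hlt : m < p * m := by nlinarith [hp.two_le, Nat.pos_of_ne_zero hm]
      rw [ncard_normFiber_prime_mul hp, chiSum_prime_mul hp hm, ih m hlt hm]
      split_ifs with hpm
      · obtain ⟨k, rfl⟩ := hpm
        have hk : k ≠ 0 := by rintro rfl; simp at hm
        rw [Nat.mul_div_cancel_left _ hp.pos, ih k (by nlinarith [hp.two_le, Nat.pos_of_ne_zero hk]) hk]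
        ring
      · ring

/-- The Gaussian integers of norm `n` in the first quadrant, a set of representatives modulo
units. -/
def quadrantFiber (n : ℕ) : Set GaussianInt := {z | z.norm = n ∧ 0 < z.re ∧ 0 ≤ z.im}

lemma finite_quadrantFiber (n : ℕ) : (quadrantFiber n).Finite :=
  (finite_normFiber n).subset fun _ h => h.1

/-- The half-open quadrant and its rotations by powers of i tile the non-zero elements, so it
contains a quarter of the elements of norm `n`. -/
lemma ncard_quadrantFiber (n : ℕ) (hn : n ≠ 0) : ((quadrantFiber n).ncard : ℤ) = chiSum n := by
  have hfin := finite_quadrantFiber n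
  let f : Fin 4 → GaussianInt → GaussianInt := fun k z => (⟨0, 1⟩ : GaussianInt) ^ (k : ℕ) * z
  have hI : ∀ k : Fin 4, ((⟨0, 1⟩ : GaussianInt) ^ (k : ℕ)) ≠ 0 := fun k =>
    pow_ne_zero _ (by decide)
  have hf : ∀ k, Function.Injective (f k) := fun k => mul_right_injective₀ (hI k)
  have h0 : ∀ z : GaussianInt, f 0 z = z := fun z => by simp [f]
  have h1 : ∀ z : GaussianInt, f 1 z = ⟨-z.im, z.re⟩ := fun z => by
    ext <;> simp [f]
  have h2 : ∀ z : GaussianInt, f 2 z = ⟨-z.re, -z.im⟩ := fun z => by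
    ext <;> simp [f, pow_succ]
  have h3 : ∀ z : GaussianInt, f 3 z = ⟨z.im, -z.re⟩ := fun z => by
    ext <;> simp [f, pow_succ]
  have hunion : normFiber n = ((f 0 '' quadrantFiber n) ∪ (f 2 '' quadrantFiber n)) ∪
      ((f 1 '' quadrantFiber n) ∪ (f 3 '' quadrantFiber n)) := by
    ext z
    simp only [normFiber, quadrantFiber, gaussianInt_norm_eq, Set.mem_union, Set.mem_image,
      Set.mem_ofPred_eq, h0, h1, h2, h3]
    constructor
    · intro hz
      have hne : z.re ≠ 0 ∨ z.im ≠ 0 := by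
        by_contra! h
        rw [h.1, h.2] at hz
        exact hn (by exact_mod_cast (by linarith : (n : ℤ) = 0))
      rcases lt_trichotomy z.re 0 with ha | ha | ha
      · by_cases hb : 0 < z.im
        · exact Or.inr (Or.inl ⟨⟨z.im, -z.re⟩, ⟨by rw [← hz]; ring, hb, by simp; omega⟩,
            by ext <;> simp⟩)
        · exact Or.inl (Or.inr ⟨⟨-z.re, -z.im⟩, ⟨by rw [← hz]; ring, by simp; omega,
            by simp; omega⟩, by ext <;> simp⟩)
      · by_cases hb : 0 < z.im
        · exact Or.inr (Or.inl ⟨⟨z.im, -z.re⟩, ⟨by rw [← hz]; ring, hb, by simp; omega⟩,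
            by ext <;> simp⟩)
        · exact Or.inr (Or.inr ⟨⟨-z.im, z.re⟩, ⟨by rw [← hz]; ring, by simp; omega,
            by simp; omega⟩, by ext <;> simp⟩)
      · by_cases hb : 0 ≤ z.im
        · exact Or.inl (Or.inl ⟨z, ⟨hz, ha, hb⟩, rfl⟩)
        · exact Or.inr (Or.inr ⟨⟨-z.im, z.re⟩, ⟨by rw [← hz]; ring, by simp; omega,
            by simp; omega⟩, by ext <;> simp⟩)
    · rintro ((⟨w, ⟨hw, -⟩, rfl⟩ | ⟨w, ⟨hw, -⟩, rfl⟩) | (⟨w, ⟨hw, -⟩, rfl⟩ | ⟨w, ⟨hw, -⟩, rfl⟩)) <;>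
        rw [← hw] <;> ring
  have hd1 : Disjoint (f 0 '' quadrantFiber n) (f 2 '' quadrantFiber n) := by
    rw [Set.disjoint_left]
    rintro z ⟨w, ⟨-, hw⟩, rfl⟩ ⟨v, ⟨-, hv⟩, h⟩
    rw [h0, h2, Zsqrtd.ext_iff] at h
    simp at h; omega
  have hd2 : Disjoint (f 1 '' quadrantFiber n) (f 3 '' quadrantFiber n) := by
    rw [Set.disjoint_left]
    rintro z ⟨w, ⟨-, hw⟩, rfl⟩ ⟨v, ⟨-, hv⟩, h⟩
    rw [h1, h3, Zsqrtd.ext_iff] at h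
    simp at h; omega
  have hd3 : Disjoint ((f 0 '' quadrantFiber n) ∪ (f 2 '' quadrantFiber n))
      ((f 1 '' quadrantFiber n) ∪ (f 3 '' quadrantFiber n)) := by
    rw [Set.disjoint_left]
    rintro z (⟨w, ⟨-, hw⟩, rfl⟩ | ⟨w, ⟨-, hw⟩, rfl⟩) (⟨v, ⟨-, hv⟩, h⟩ | ⟨v, ⟨-, hv⟩, h⟩) <;>
      simp only [h0, h1, h2, h3, Zsqrtd.ext_iff] at h <;> omega
  have := ncard_normFiber n hn
  rw [hunion, Set.ncard_union_eq hd3 ((hfin.image _).union (hfin.image _))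
    ((hfin.image _).union (hfin.image _)), Set.ncard_union_eq hd1 (hfin.image _) (hfin.image _),
    Set.ncard_union_eq hd2 (hfin.image _) (hfin.image _), Set.ncard_image_of_injective _ (hf 0),
    Set.ncard_image_of_injective _ (hf 1), Set.ncard_image_of_injective _ (hf 2),
    Set.ncard_image_of_injective _ (hf 3)] at this
  push_cast at this
  linarith


/-! ### From sublattices of ℂ to groups of Gaussian integers -/

/-- The determinant of two Gaussian integers as vectors in the plane. -/
def cross (v w : GaussianInt) : ℤ := v.re * w.im - v.im * w.re

/-- The `ℤ`-basis `1, i` of the Gaussian integers. -/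
noncomputable def gaussianBasis : Module.Basis (Fin 2) ℤ GaussianInt :=
  Module.Basis.ofEquivFun
    { toFun := fun z => ![z.re, z.im]
      invFun := fun f => ⟨f 0, f 1⟩
      map_add' := fun x y => by ext i; fin_cases i <;> simp
      map_smul' := fun x y => by ext i; fin_cases i <;> simp
      left_inv := fun x => by simp
      right_inv := fun x => by ext i; fin_cases i <;> simp }

lemma gaussianBasis_repr_zero (z : GaussianInt) : gaussianBasis.repr z 0 = z.re := rfl
lemma gaussianBasis_repr_one (z : GaussianInt) : gaussianBasis.repr z 1 = z.im := rfl

/-- A non-zero determinant makes `v, w` a ℤ-basis of the group they generate, so the index is the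
absolute value of the determinant against `1, i`. -/
lemma index_closure_pair {v w : GaussianInt} (h : cross v w ≠ 0) :
    (AddSubgroup.closure {v, w}).index = (cross v w).natAbs := by
  set N := AddSubgroup.closure {v, w}
  have hv : v ∈ N := AddSubgroup.subset_closure (by simp)
  have hw : w ∈ N := AddSubgroup.subset_closure (by simp)
  let f : Fin 2 → N := ![⟨v, hv⟩, ⟨w, hw⟩]
  have hli : LinearIndependent ℤ f := by
    rw [LinearIndependent.pair_iff]
    intro s t hst
    have hst' : s • v + t • w = 0 := by
      have := congrArg (Subtype.val) hst
      simpa using this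
    rw [Zsqrtd.ext_iff] at hst'
    simp at hst'
    obtain ⟨h1, h2⟩ := hst'
    constructor
    · have : s * cross v w = 0 := by unfold cross; linear_combination w.im * h1 - w.re * h2
      exact (mul_eq_zero.1 this).resolve_right h
    · have : t * cross v w = 0 := by unfold cross; linear_combination v.re * h2 - v.im * h1
      exact (mul_eq_zero.1 this).resolve_right h
  have hsp : ⊤ ≤ Submodule.span ℤ (Set.range f) := by
    rintro ⟨u, hu⟩ -
    obtain ⟨m, n, rfl⟩ := AddSubgroup.mem_closure_pair.1 hu
    have : (⟨m • v + n • w, hu⟩ : N) = m • f 0 + n • f 1 := by ext <;> simp [f]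
    rw [this]
    exact add_mem (Submodule.smul_mem _ _ (Submodule.subset_span ⟨0, rfl⟩))
      (Submodule.smul_mem _ _ (Submodule.subset_span ⟨1, rfl⟩))
  rw [AddSubgroup.index_eq_natAbs_det gaussianBasis N (Module.Basis.mk hli hsp),
    Module.Basis.det_apply, Matrix.det_fin_two]
  simp only [Module.Basis.toMatrix_apply, Module.Basis.mk_apply, gaussianBasis_repr_zero,
    gaussianBasis_repr_one]
  congr 1
  simp [f, cross]; ring

/-- The minimal vectors of a group of Gaussian integers. -/
def minimalGaussian (M : AddSubgroup GaussianInt) : Set GaussianInt :=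
  {v | v ∈ M ∧ v ≠ 0 ∧ ∀ w ∈ M, w ≠ 0 → v.norm ≤ w.norm}

lemma norm_toComplex_le_iff (v w : GaussianInt) :
    ‖(v : ℂ)‖ ≤ ‖(w : ℂ)‖ ↔ v.norm ≤ w.norm := by
  rw [← sq_le_sq₀ (_root_.norm_nonneg _) (_root_.norm_nonneg _), ← Complex.normSq_eq_norm_sq,
    ← Complex.normSq_eq_norm_sq, ← GaussianInt.intCast_real_norm, ← GaussianInt.intCast_real_norm]
  exact Int.cast_le

lemma minimalVectors_map (M : AddSubgroup GaussianInt) :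
    minimalVectors (M.map GaussianInt.toComplex.toAddMonoidHom)
      = GaussianInt.toComplex '' minimalGaussian M := by
  ext x
  constructor
  · rintro ⟨⟨v, hv, rfl⟩, h0, h⟩
    refine ⟨v, ⟨hv, ?_, fun w hw hw0 => ?_⟩, rfl⟩
    · rintro rfl; simp at h0
    · exact (norm_toComplex_le_iff v w).1 (h _ ⟨w, hw, rfl⟩ (GaussianInt.toComplex_eq_zero.not.2 hw0))
  · rintro ⟨v, ⟨hv, h0, h⟩, rfl⟩
    refine ⟨⟨v, hv, rfl⟩, GaussianInt.toComplex_eq_zero.not.2 h0, ?_⟩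
    rintro _ ⟨w, hw, rfl⟩ hw0
    exact (norm_toComplex_le_iff v w).2 (h w hw (GaussianInt.toComplex_eq_zero.not.1 hw0))

lemma span_eq_top_iff (S : Set ℂ) : Submodule.span ℝ S = ⊤ ↔
    ∃ v ∈ S, ∃ w ∈ S, v.re * w.im - v.im * w.re ≠ 0 := by
  constructor
  · intro h
    by_contra! hc
    have h0 : ∀ v ∈ S, v = 0 := by
      intro v hv
      -- `φ` is the determinant with `v`. It vanishes on `S`, hence everywhere, and its value at `I
      -- * v` is the squared length of `v`.
      let φ : ℂ →ₗ[ℝ] ℝ := v.re • Complex.imLm - v.im • Complex.reLm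
      have hφ : Submodule.span ℝ S ≤ LinearMap.ker φ := by
        rw [Submodule.span_le]
        intro w hw
        simpa [φ] using hc v hv w hw
      have : φ (Complex.I * v) = 0 := hφ (h ▸ Submodule.mem_top)
      simp [φ] at this
      have hre : v.re = 0 := by nlinarith
      have him : v.im = 0 := by nlinarith
      exact Complex.ext hre him
    have : Submodule.span ℝ S = ⊥ := Submodule.span_eq_bot.2 h0
    rw [this] at h
    exact bot_ne_top h
  · rintro ⟨v, hv, w, hw, h⟩
    rw [Submodule.eq_top_iff']
    intro u
    set D := v.re * w.im - v.im * w.re with hD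
    have : u = ((u.re * w.im - u.im * w.re) / D) • v + ((v.re * u.im - v.im * u.re) / D) • w := by
      apply Complex.ext
      · simp; field_simp; rw [hD]; ring
      · simp; field_simp; rw [hD]; ring
    rw [this]
    exact add_mem (Submodule.smul_mem _ _ (Submodule.subset_span hv))
      (Submodule.smul_mem _ _ (Submodule.subset_span hw))

lemma isWellRounded_map_iff (M : AddSubgroup GaussianInt) :
    IsWellRounded (M.map GaussianInt.toComplex.toAddMonoidHom) ↔
      ∃ v ∈ minimalGaussian M, ∃ w ∈ minimalGaussian M, cross v w ≠ 0 := by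
  rw [IsWellRounded, minimalVectors_map, span_eq_top_iff]
  simp only [Set.exists_mem_image]
  have key : ∀ v w : GaussianInt, ((v : ℂ).re * (w : ℂ).im - (v : ℂ).im * (w : ℂ).re ≠ 0) ↔
      cross v w ≠ 0 := by
    intro v w
    rw [← GaussianInt.intCast_re, ← GaussianInt.intCast_re, ← GaussianInt.intCast_im,
      ← GaussianInt.intCast_im, cross]
    norm_cast
  simp only [key]

/-- The well-rounded sublattices of index `n`, as groups of Gaussian integers. -/
def wellRoundedGaussian (n : ℕ) : Set (AddSubgroup GaussianInt) :=
  {M | (∃ v ∈ minimalGaussian M, ∃ w ∈ minimalGaussian M, cross v w ≠ 0) ∧ M.index = n}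

lemma aSquare_eq_ncard (n : ℕ) : aSquare n = (wellRoundedGaussian n).ncard := by
  have hinj : Function.Injective
      (AddSubgroup.map GaussianInt.toComplex.toAddMonoidHom) :=
    AddSubgroup.map_injective GaussianInt.toComplex_injective
  rw [aSquare, wellRoundedCount, ← Set.ncard_image_of_injective _ hinj]
  congr 1
  ext Λ
  have hidx : ∀ M : AddSubgroup GaussianInt,
      (M.map GaussianInt.toComplex.toAddMonoidHom).relIndex squareLattice = M.index := by
    intro M
    rw [squareLattice, AddMonoidHom.range_eq_map]
    rw [AddSubgroup.relIndex_map_map_of_injective _ _ GaussianInt.toComplex_injective,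
      AddSubgroup.relIndex_top_right]
  constructor
  · rintro ⟨hle, hwr, hi⟩
    have hmap : (Λ.comap GaussianInt.toComplex.toAddMonoidHom).map
        GaussianInt.toComplex.toAddMonoidHom = Λ := AddSubgroup.map_comap_eq_self hle
    refine ⟨Λ.comap GaussianInt.toComplex.toAddMonoidHom, ⟨?_, ?_⟩, hmap⟩
    · rw [← isWellRounded_map_iff, hmap]; exact hwr
    · rw [← hidx, hmap]; exact hi
  · rintro ⟨M, ⟨hM, hi⟩, rfl⟩
    refine ⟨?_, (isWellRounded_map_iff M).2 hM, by rw [hidx]; exact hi⟩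
    rintro _ ⟨v, -, rfl⟩
    exact ⟨v, rfl⟩


/-! ### Reduced rhombi and the parameters of well-rounded sublattices -/

/-- The factor by which the diagonals of a reduced rhombus with side lengths in the ratio `p : q`
are divisible. -/
def diagonalFactor (p q : ℕ) : GaussianInt := if Odd p ∧ Odd q then ⟨1, 1⟩ else ⟨2, 0⟩

/-- The index of the smallest rhombic sublattice with diagonals in the ratio `p : q`. -/
def rhombusWeight (p q : ℕ) : ℕ := if Odd p ∧ Odd q then p * q else 2 * (p * q)

/-- A side of the smallest rhombus with diagonals in the ratio `p : q`. -/
def rhombusSide (p q : ℕ) : GaussianInt :=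
  if Odd p ∧ Odd q then ⟨((p : ℤ) - q) / 2, ((p : ℤ) + q) / 2⟩ else ⟨p, q⟩

/-- The other side of the smallest rhombus with diagonals in the ratio `p : q`. -/
def rhombusSide' (p q : ℕ) : GaussianInt :=
  if Odd p ∧ Odd q then ⟨((p : ℤ) + q) / 2, ((p : ℤ) - q) / 2⟩ else ⟨p, -q⟩

lemma two_mul_rhombusSide (p q : ℕ) :
    2 * rhombusSide p q = ⟨p, q⟩ * diagonalFactor p q := by
  unfold rhombusSide diagonalFactor
  split_ifs with h
  · obtain ⟨⟨a, rfl⟩, ⟨b, rfl⟩⟩ := h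
    ext <;> simp <;> omega
  · ext <;> simp <;> ring

lemma two_mul_rhombusSide' (p q : ℕ) :
    2 * rhombusSide' p q = ⟨p, -q⟩ * diagonalFactor p q := by
  unfold rhombusSide' diagonalFactor
  split_ifs with h
  · obtain ⟨⟨a, rfl⟩, ⟨b, rfl⟩⟩ := h
    ext <;> simp <;> omega
  · ext <;> simp <;> ring

lemma norm_diagonalFactor (p q : ℕ) :
    (p : ℤ) * q * (diagonalFactor p q).norm = 2 * rhombusWeight p q := by
  unfold diagonalFactor rhombusWeight
  split_ifs
  · rw [gaussianInt_norm_eq]; push_cast; ring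
  · rw [gaussianInt_norm_eq]; push_cast; ring

lemma diagonalFactor_ne_zero (p q : ℕ) : diagonalFactor p q ≠ 0 := by
  unfold diagonalFactor; split_ifs <;> decide

lemma diagonalFactor_comm (p q : ℕ) : diagonalFactor p q = diagonalFactor q p := by
  unfold diagonalFactor; simp only [and_comm]

/-- Modulo 2, p + iq is a unit if the parities differ and is 1 + i if both are odd. So divisibility
of (p + iq) y by 2 forces 2 ∣ y in the first case and only (1 + i) ∣ y in the second. -/
lemma diagonalFactor_dvd {p q : ℕ} (hpq : p.Coprime q) {y v : GaussianInt}
    (h : 2 * v = ⟨p, q⟩ * y) : diagonalFactor p q ∣ y := by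
  rw [Zsqrtd.ext_iff] at h
  simp at h
  obtain ⟨h1, h2⟩ := h
  unfold diagonalFactor
  split_ifs with ho
  · obtain ⟨⟨a, rfl⟩, ⟨b, rfl⟩⟩ := ho
    push_cast at h1 h2
    have : (2 : ℤ) ∣ y.re + y.im := ⟨v.re - a * y.re + b * y.im + y.im, by linarith⟩
    obtain ⟨k, hk⟩ := this
    exact ⟨⟨k, k - y.re⟩, by ext <;> simp <;> linarith⟩
  · have key : ∀ a b : ℤ, (2 : ℤ) ∣ a → (2 : ℤ) ∣ b → (⟨2, 0⟩ : GaussianInt) ∣ ⟨a, b⟩ := by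
      rintro _ _ ⟨c, rfl⟩ ⟨d, rfl⟩
      exact ⟨⟨c, d⟩, by ext <;> simp⟩
    have hnot : ¬ (Even p ∧ Even q) := fun ⟨he, he'⟩ => by
      have := Nat.dvd_gcd he.two_dvd he'.two_dvd
      rw [hpq] at this
      omega
    rw [not_and, Nat.not_odd_iff_even] at ho
    rcases Nat.even_or_odd p with hp | hp
    · have hq : Odd q := by rw [← Nat.not_even_iff_odd]; exact fun h => hnot ⟨hp, h⟩
      obtain ⟨a, rfl⟩ := hp
      obtain ⟨b, rfl⟩ := hq
      push_cast at h1 h2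
      exact key y.re y.im ⟨v.im - a * y.im - b * y.re, by linarith⟩
        ⟨-v.re + a * y.re - b * y.im, by linarith⟩
    · obtain ⟨b, rfl⟩ := ho hp
      obtain ⟨a, rfl⟩ := hp
      push_cast at h1 h2
      exact key y.re y.im ⟨v.re - a * y.re + b * y.im, by linarith⟩
        ⟨v.im - a * y.im - b * y.re, by linarith⟩

/-- `v`, `w` are the sides of a rhombus with diagonals `p y` and `i q y` that is strictly between
the two rhombi with an angle of 60 degrees. -/
structure IsReducedRhombus (v w y : GaussianInt) (p q : ℕ) : Prop where
  left_pos : 0 < p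
  right_pos : 0 < q
  left_lt : p ^ 2 < 3 * q ^ 2
  right_lt : q ^ 2 < 3 * p ^ 2
  ne_zero : y ≠ 0
  two_mul_left : 2 * v = ⟨p, q⟩ * y
  two_mul_right : 2 * w = ⟨p, -q⟩ * y

namespace IsReducedRhombus

variable {v w y : GaussianInt} {p q : ℕ}

lemma two_mul_cross (h : IsReducedRhombus v w y p q) : 2 * cross v w = -(p * q * y.norm) := by
  have h1 := h.two_mul_left
  have h2 := h.two_mul_right
  rw [Zsqrtd.ext_iff] at h1 h2
  simp at h1 h2
  have : 4 * cross v w = -(2 * (p * q * y.norm)) := by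
    rw [gaussianInt_norm_eq, cross]
    have : 4 * (v.re * w.im - v.im * w.re) = (2 * v.re) * (2 * w.im) - (2 * v.im) * (2 * w.re) := by
      ring
    rw [this, h1.1, h1.2, h2.1, h2.2]
    ring
  linarith

lemma cross_ne_zero (h : IsReducedRhombus v w y p q) : cross v w ≠ 0 := by
  intro h0
  have h1 := h.two_mul_cross
  rw [h0, mul_zero] at h1
  have h2 := GaussianInt.norm_pos.2 h.ne_zero
  have h3 : (0 : ℤ) < p := by exact_mod_cast h.left_pos
  have h4 : (0 : ℤ) < q := by exact_mod_cast h.right_pos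
  have : 0 < (p : ℤ) * q * y.norm := by positivity
  linarith

lemma four_mul_norm (h : IsReducedRhombus v w y p q) (m n : ℤ) :
    4 * (m • v + n • w).norm = ((m + n) ^ 2 * p ^ 2 + (m - n) ^ 2 * q ^ 2) * y.norm := by
  have h1 := h.two_mul_left
  have h2 := h.two_mul_right
  rw [Zsqrtd.ext_iff] at h1 h2
  simp at h1 h2
  rw [gaussianInt_norm_eq, gaussianInt_norm_eq]
  simp only [Zsqrtd.re_add, Zsqrtd.im_add, zsmul_eq_mul, Zsqrtd.re_mul, Zsqrtd.im_mul,
    Zsqrtd.re_intCast, Zsqrtd.im_intCast]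
  have : 4 * ((m * v.re + -1 * 0 * v.im + (n * w.re + -1 * 0 * w.im)) ^ 2 +
      (m * v.im + 0 * v.re + (n * w.im + 0 * w.re)) ^ 2) =
      (m * (2 * v.re) + n * (2 * w.re)) ^ 2 + (m * (2 * v.im) + n * (2 * w.im)) ^ 2 := by ring
  rw [this, h1.1, h1.2, h2.1, h2.2]
  ring

/-- With s = m + n and t = m - n, the norm of m v + n w is proportional to s²p² + t²q². If s and t
are even and not both zero, the form is at least 4 min(p², q²), which exceeds p² + q² by the strict
cone inequalities. If both are odd, it is at least p² + q², with equality only for s² = t² = 1. -/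
lemma quadratic_bound (h : IsReducedRhombus v w y p q) {s t : ℤ} (hst : Even (s + t))
    (h0 : s ≠ 0 ∨ t ≠ 0) : (s ^ 2 = 1 ∧ t ^ 2 = 1) ∨
      (p : ℤ) ^ 2 + q ^ 2 < s ^ 2 * p ^ 2 + t ^ 2 * q ^ 2 := by
  have hp : (0 : ℤ) < p := by exact_mod_cast h.left_pos
  have hq : (0 : ℤ) < q := by exact_mod_cast h.right_pos
  have h1 : (p : ℤ) ^ 2 < 3 * q ^ 2 := by exact_mod_cast h.left_lt
  have h2 : (q : ℤ) ^ 2 < 3 * p ^ 2 := by exact_mod_cast h.right_lt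
  have hp2 : 0 < (p : ℤ) ^ 2 := by positivity
  have hq2 : 0 < (q : ℤ) ^ 2 := by positivity
  generalize (p : ℤ) ^ 2 = P at *
  generalize (q : ℤ) ^ 2 = Q at *
  rcases Int.even_or_odd s with hs | hs
  · have ht : Even t := (Int.even_add.1 hst).1 hs
    right
    obtain ⟨a, rfl⟩ := hs
    obtain ⟨b, rfl⟩ := ht
    rcases h0 with h0 | h0
    · have : 1 ≤ a ^ 2 := by
        have : a ≠ 0 := by omega
        have : 0 < a ^ 2 := by positivity
        omega
      nlinarith [mul_nonneg (sq_nonneg b) hq2.le]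
    · have : 1 ≤ b ^ 2 := by
        have : b ≠ 0 := by omega
        have : 0 < b ^ 2 := by positivity
        omega
      nlinarith [mul_nonneg (sq_nonneg a) hp2.le]
  · have ht : Odd t := by
      rw [← Int.not_even_iff_odd] at hs ⊢
      exact fun h => hs ((Int.even_add.1 hst).2 h)
    have hs1 : 1 ≤ s ^ 2 := by
      have : s ≠ 0 := by rintro rfl; simp at hs
      have : 0 < s ^ 2 := by positivity
      omega
    have ht1 : 1 ≤ t ^ 2 := by
      have : t ≠ 0 := by rintro rfl; simp at ht
      have : 0 < t ^ 2 := by positivity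
      omega
    by_cases hs2 : s ^ 2 = 1
    · by_cases ht2 : t ^ 2 = 1
      · exact Or.inl ⟨hs2, ht2⟩
      · have : 2 ≤ t ^ 2 := by omega
        right; nlinarith
    · have : 2 ≤ s ^ 2 := by omega
      right; nlinarith

lemma minimalGaussian_closure (h : IsReducedRhombus v w y p q) :
    minimalGaussian (AddSubgroup.closure {v, w}) = {v, -v, w, -w} := by
  have hN := GaussianInt.norm_pos.2 h.ne_zero
  have hv : v ∈ AddSubgroup.closure {v, w} := AddSubgroup.subset_closure (by simp)
  have hw : w ∈ AddSubgroup.closure {v, w} := AddSubgroup.subset_closure (by simp)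
  have hnv : 4 * v.norm = ((p : ℤ) ^ 2 + q ^ 2) * y.norm := by
    have := h.four_mul_norm 1 0; simpa using this
  have hnw : 4 * w.norm = ((p : ℤ) ^ 2 + q ^ 2) * y.norm := by
    have := h.four_mul_norm 0 1; simpa using this
  have hne : ∀ m n : ℤ, m • v + n • w ≠ 0 → (m + n ≠ 0 ∨ m - n ≠ 0) := by
    intro m n h0
    by_contra! hc
    have hm : m = 0 := by omega
    have hn : n = 0 := by omega
    subst hm hn
    simp at h0
  have hpar : ∀ m n : ℤ, Even (m + n + (m - n)) := fun m n => ⟨m, by ring⟩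
  have hpos : 0 < v.norm := by
    have hp : (0 : ℤ) < p := by exact_mod_cast h.left_pos
    have : 0 < ((p : ℤ) ^ 2 + q ^ 2) * y.norm := by positivity
    omega
  have hv0 : v ≠ 0 := GaussianInt.norm_pos.1 hpos
  have hw0 : w ≠ 0 := GaussianInt.norm_pos.1 (by omega)
  have hmin : ∀ u ∈ AddSubgroup.closure {v, w}, u ≠ 0 → v.norm ≤ u.norm := by
    intro u hu hu0
    obtain ⟨m, n, rfl⟩ := AddSubgroup.mem_closure_pair.1 hu
    have h4 := h.four_mul_norm m n
    rcases h.quadratic_bound (hpar m n) (hne m n hu0) with ⟨h1, h2⟩ | h1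
    · rw [h1, h2] at h4; linarith
    · nlinarith
  ext u
  simp only [Set.mem_insert_iff, Set.mem_singleton_iff]
  constructor
  · rintro ⟨hu, hu0, hle⟩
    obtain ⟨m, n, rfl⟩ := AddSubgroup.mem_closure_pair.1 hu
    have h4 := h.four_mul_norm m n
    have hle := hle v hv hv0
    rcases h.quadratic_bound (hpar m n) (hne m n hu0) with ⟨h1, h2⟩ | h1
    · have e1 : m + n = 1 ∨ m + n = -1 := sq_eq_sq_iff_eq_or_eq_neg.1 (by rw [h1]; rfl)
      have e2 : m - n = 1 ∨ m - n = -1 := sq_eq_sq_iff_eq_or_eq_neg.1 (by rw [h2]; rfl)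
      rcases e1 with e1 | e1 <;> rcases e2 with e2 | e2
      · obtain ⟨rfl, rfl⟩ : m = 1 ∧ n = 0 := by omega
        simp
      · obtain ⟨rfl, rfl⟩ : m = 0 ∧ n = 1 := by omega
        simp
      · obtain ⟨rfl, rfl⟩ : m = 0 ∧ n = -1 := by omega
        simp
      · obtain ⟨rfl, rfl⟩ : m = -1 ∧ n = 0 := by omega
        simp
    · exfalso; nlinarith
  · rintro (rfl | rfl | rfl | rfl)
    · exact ⟨hv, hv0, hmin⟩
    · exact ⟨neg_mem hv, neg_ne_zero.2 hv0, by rw [Zsqrtd.norm_neg]; exact hmin⟩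
    · exact ⟨hw, hw0, fun u hu h0 => by have := hmin u hu h0; omega⟩
    · exact ⟨neg_mem hw, neg_ne_zero.2 hw0, fun u hu h0 => by
        have := hmin u hu h0; rw [Zsqrtd.norm_neg]; omega⟩

lemma add_eq (h : IsReducedRhombus v w y p q) : v + w = p * y := by
  have h1 := h.two_mul_left
  have h2 := h.two_mul_right
  rw [Zsqrtd.ext_iff] at h1 h2 ⊢
  simp at h1 h2 ⊢
  exact ⟨by linarith, by linarith⟩

lemma sub_eq (h : IsReducedRhombus v w y p q) : v - w = q * (⟨0, 1⟩ * y) := by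
  have h1 := h.two_mul_left
  have h2 := h.two_mul_right
  rw [Zsqrtd.ext_iff] at h1 h2 ⊢
  simp at h1 h2 ⊢
  exact ⟨by linarith, by linarith⟩

/-- Two reduced rhombi that generate the same lattice have proportional diagonals. -/
lemma diagonals_of_closure_eq {v' w' y' : GaussianInt} {p' q' : ℕ}
    (h : IsReducedRhombus v w y p q) (h' : IsReducedRhombus v' w' y' p' q')
    (he : AddSubgroup.closure {v', w'} = AddSubgroup.closure {v, w}) :
    (((p' : GaussianInt) * y' = p * y ∨ (p' : GaussianInt) * y' = -(p * y)) ∧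
      ((q' : GaussianInt) * y' = q * y ∨ (q' : GaussianInt) * y' = -(q * y))) ∨
    (((p' : GaussianInt) * y' = q * (⟨0, 1⟩ * y) ∨ (p' : GaussianInt) * y' = -(q * (⟨0, 1⟩ * y))) ∧
      ((q' : GaussianInt) * (⟨0, 1⟩ * y') = p * y ∨
        (q' : GaussianInt) * (⟨0, 1⟩ * y') = -(p * y))) := by
  have hmin := h.minimalGaussian_closure
  rw [← he, h'.minimalGaussian_closure] at hmin
  have hv : v' ∈ ({v, -v, w, -w} : Set GaussianInt) := by rw [← hmin]; simp
  have hw : w' ∈ ({v, -v, w, -w} : Set GaussianInt) := by rw [← hmin]; simp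
  have hc := h'.cross_ne_zero
  have hself : ∀ x : GaussianInt, cross x x = 0 := fun x => by simp [cross]; ring
  have hneg : ∀ x y : GaussianInt, cross x (-y) = -cross x y := fun x y => by simp [cross]; ring
  have hneg' : ∀ x y : GaussianInt, cross (-x) y = -cross x y := fun x y => by simp [cross]; ring
  have ha := h.add_eq
  have hs := h.sub_eq
  have ha' := h'.add_eq
  have hs' := h'.sub_eq
  have hcancel : ∀ a b : GaussianInt, (⟨0, 1⟩ : GaussianInt) * a = ⟨0, 1⟩ * b → a = b :=
    fun a b hab => mul_left_cancel₀ (by decide) hab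
  rw [← ha, ← hs, ← ha', ← hs']
  have e1 : ∀ x : GaussianInt, (q' : GaussianInt) * y' = x ↔ v' - w' = ⟨0, 1⟩ * x := by
    intro x
    rw [hs']
    constructor
    · rintro rfl; ring
    · intro hx; apply hcancel; rw [← hx]; ring
  rw [e1, e1]
  have e2 : (⟨0, 1⟩ : GaussianInt) * (q * y) = v - w := by rw [hs]; ring
  have e3 : (⟨0, 1⟩ : GaussianInt) * -(q * y) = -(v - w) := by rw [hs]; ring
  rw [e2, e3]
  simp only [Set.mem_insert_iff, Set.mem_singleton_iff] at hv hw
  -- Of the sixteen choices, the eight in which `v'` and `w'` are proportional contradict the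
  -- non-zero determinant. In the others the two diagonals agree up to signs and a possible
  -- exchange.
  rcases hv with rfl | rfl | rfl | rfl <;> rcases hw with rfl | rfl | rfl | rfl <;>
    first
    | (exfalso; apply hc; simp [hself, hneg, hneg']; done)
    | (left; constructor <;> [left; left] <;> abel1)
    | (left; constructor <;> [left; right] <;> abel1)
    | (left; constructor <;> [right; left] <;> abel1)
    | (left; constructor <;> [right; right] <;> abel1)
    | (right; constructor <;> [left; left] <;> abel1)
    | (right; constructor <;> [left; right] <;> abel1)
    | (right; constructor <;> [right; left] <;> abel1)
    | (right; constructor <;> [right; right] <;> abel1)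

end IsReducedRhombus

/-- The parameters of the well-rounded sublattices of index `n`. -/
def rhombicData (n : ℕ) : Set (GaussianInt × ℕ × ℕ) :=
  {x | (0 < x.1.re ∧ 0 ≤ x.1.im) ∧ (0 < x.2.1 ∧ 0 < x.2.2 ∧ x.2.1 ^ 2 < 3 * x.2.2 ^ 2 ∧
    x.2.2 ^ 2 < 3 * x.2.1 ^ 2 ∧ x.2.1.Coprime x.2.2) ∧
    x.1.norm * rhombusWeight x.2.1 x.2.2 = n}

lemma isReducedRhombus_of_data {z : GaussianInt} {p q : ℕ} (hz : z ≠ 0) (hp : 0 < p) (hq : 0 < q)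
    (hpq : p ^ 2 < 3 * q ^ 2) (hqp : q ^ 2 < 3 * p ^ 2) :
    IsReducedRhombus (rhombusSide p q * z) (rhombusSide' p q * z) (diagonalFactor p q * z) p q where
  left_pos := hp
  right_pos := hq
  left_lt := hpq
  right_lt := hqp
  ne_zero := mul_ne_zero (diagonalFactor_ne_zero p q) hz
  two_mul_left := by rw [← mul_assoc, two_mul_rhombusSide, mul_assoc]
  two_mul_right := by rw [← mul_assoc, two_mul_rhombusSide', mul_assoc]

/-- The sublattice with given parameters. -/
def rhombicLattice (x : GaussianInt × ℕ × ℕ) : AddSubgroup GaussianInt :=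
  AddSubgroup.closure {rhombusSide x.2.1 x.2.2 * x.1, rhombusSide' x.2.1 x.2.2 * x.1}

lemma rhombicLattice_mem {n : ℕ} {x : GaussianInt × ℕ × ℕ} (hx : x ∈ rhombicData n) :
    rhombicLattice x ∈ wellRoundedGaussian n := by
  obtain ⟨z, p, q⟩ := x
  obtain ⟨⟨hz, -⟩, ⟨hp, hq, hpq, hqp, -⟩, hn⟩ := hx
  dsimp only at *
  have hz0 : z ≠ 0 := by rintro rfl; simp at hz
  have h := isReducedRhombus_of_data hz0 hp hq hpq hqp
  refine ⟨⟨_, ?_, _, ?_, h.cross_ne_zero⟩, ?_⟩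
  · rw [rhombicLattice, h.minimalGaussian_closure]; simp
  · rw [rhombicLattice, h.minimalGaussian_closure]; simp
  · rw [rhombicLattice, index_closure_pair h.cross_ne_zero]
    have h1 := h.two_mul_cross
    rw [Zsqrtd.norm_mul, ← mul_assoc, norm_diagonalFactor] at h1
    have h2 : cross (rhombusSide p q * z) (rhombusSide' p q * z) = -(n : ℤ) := by
      rw [← hn]; linarith
    rw [h2]; simp

lemma eq_of_coprime_of_mul_eq {a b c d : ℕ} (hab : a.Coprime b) (hcd : c.Coprime d)
    (h : a * d = b * c) : a = c ∧ b = d := by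
  have h1 : a ∣ c := hab.dvd_of_dvd_mul_left ⟨d, h.symm⟩
  have h2 : c ∣ a := hcd.dvd_of_dvd_mul_right ⟨b, by rw [h]; ring⟩
  have h3 : b ∣ d := hab.symm.dvd_of_dvd_mul_left ⟨c, h⟩
  have h4 : d ∣ b := hcd.symm.dvd_of_dvd_mul_right ⟨a, by rw [← h]; ring⟩
  exact ⟨Nat.dvd_antisymm h1 h2, Nat.dvd_antisymm h3 h4⟩

lemma norm_natCast_mul (p : ℕ) (y : GaussianInt) :
    ((p : GaussianInt) * y).norm = (p : ℤ) ^ 2 * y.norm := by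
  rw [Zsqrtd.norm_mul, Zsqrtd.norm_natCast]; ring

lemma norm_I_mul (y : GaussianInt) : ((⟨0, 1⟩ : GaussianInt) * y).norm = y.norm := by
  rw [Zsqrtd.norm_mul, gaussianInt_norm_eq]; simp

/-- Comparing norms of proportional diagonals determines the coprime pair up to exchange. Without
exchange the `z`-parameters differ by a sign, and the quadrant condition leaves only equality. With
exchange they differ by ± i, which the quadrant excludes. -/
lemma rhombicLattice_injOn (n : ℕ) : Set.InjOn rhombicLattice (rhombicData n) := by
  rintro ⟨z, p, q⟩ ⟨⟨hz, hz'⟩, ⟨hp, hq, hpq, hqp, hc⟩, -⟩ ⟨z₁, p₁, q₁⟩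
    ⟨⟨hz₁, hz₁'⟩, ⟨hp₁, hq₁, hpq₁, hqp₁, hc₁⟩, -⟩ he
  dsimp only at *
  have hz0 : z ≠ 0 := by rintro rfl; simp at hz
  have hz0₁ : z₁ ≠ 0 := by rintro rfl; simp at hz₁
  have h := isReducedRhombus_of_data hz0 hp hq hpq hqp
  have h₁ := isReducedRhombus_of_data hz0₁ hp₁ hq₁ hpq₁ hqp₁
  have hN := GaussianInt.norm_pos.2 h.ne_zero
  have hN₁ := GaussianInt.norm_pos.2 h₁.ne_zero
  have sq : ∀ a b c d : ℕ, ∀ N M : ℤ, 0 < N → 0 < M → (a : ℤ) ^ 2 * N = (b : ℤ) ^ 2 * M →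
      (c : ℤ) ^ 2 * N = (d : ℤ) ^ 2 * M → a * d = c * b := by
    intro a b c d N M hN hM h1 h2
    have h3 : ((a : ℤ) * d) ^ 2 = ((c : ℤ) * b) ^ 2 := by
      have : ((a : ℤ) * d) ^ 2 * (N * M) = ((c : ℤ) * b) ^ 2 * (N * M) := by
        linear_combination (d : ℤ) ^ 2 * M * h1 - (b : ℤ) ^ 2 * M * h2
      exact mul_right_cancel₀ (by positivity) this
    have := (sq_eq_sq₀ (by positivity) (by positivity)).1 h3
    exact_mod_cast this
  have hnorm : ∀ a b : GaussianInt, a = b ∨ a = -b → a.norm = b.norm := by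
    rintro a b (rfl | rfl)
    · rfl
    · exact Zsqrtd.norm_neg b
  rcases h₁.diagonals_of_closure_eq h he with ⟨h1, h2⟩ | ⟨h1, h2⟩
  · have n1 := hnorm _ _ h1
    have n2 := hnorm _ _ h2
    rw [norm_natCast_mul, norm_natCast_mul] at n1 n2
    obtain ⟨rfl, rfl⟩ := eq_of_coprime_of_mul_eq hc hc₁ (sq _ _ _ _ _ _ hN hN₁ n1 n2)
    have hp0 : (p : GaussianInt) ≠ 0 := by exact_mod_cast hp.ne'
    have hd := diagonalFactor_ne_zero p q
    have : z = z₁ := by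
      rcases h1 with h1 | h1
      · exact mul_left_cancel₀ hd (mul_left_cancel₀ hp0 h1)
      · rw [← mul_neg, ← mul_neg] at h1
        have := mul_left_cancel₀ hd (mul_left_cancel₀ hp0 h1)
        rw [this] at hz
        simp at hz
        omega
    rw [this]
  · exfalso
    have n1 := hnorm _ _ h1
    have n2 := hnorm _ _ h2
    rw [norm_natCast_mul, norm_natCast_mul, norm_I_mul] at n1 n2
    obtain ⟨rfl, rfl⟩ := eq_of_coprime_of_mul_eq hc hc₁.symm (sq _ _ _ _ _ _ hN hN₁ n1 n2)
    have hp0 : (p : GaussianInt) ≠ 0 := by exact_mod_cast hp.ne'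
    have hd := diagonalFactor_ne_zero p q
    rw [diagonalFactor_comm q p] at h1
    have e : (p : GaussianInt) * (⟨0, 1⟩ * (diagonalFactor p q * z₁)) =
      p * (diagonalFactor p q * (⟨0, 1⟩ * z₁)) := by ring
    rw [e] at h1
    rcases h1 with h1 | h1
    · have := mul_left_cancel₀ hd (mul_left_cancel₀ hp0 h1)
      rw [this] at hz
      simp at hz; omega
    · rw [← mul_neg, ← mul_neg] at h1
      have := mul_left_cancel₀ hd (mul_left_cancel₀ hp0 h1)
      rw [this] at hz'
      simp at hz'; omega


/-! ### Reduction to a rhombus: every well-rounded sublattice occurs -/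

/-- Two independent minimal vectors generate. -/
lemma eq_closure_of_minimal {M : AddSubgroup GaussianInt} {v w : GaussianInt}
    (hv : v ∈ minimalGaussian M) (hw : w ∈ minimalGaussian M) (hc : cross v w ≠ 0)
    (hk : |2 * (v.re * w.re + v.im * w.im)| ≤ v.norm) : M = AddSubgroup.closure {v, w} := by
  have hnorm : v.norm = w.norm :=
    le_antisymm (hv.2.2 w hw.1 hw.2.1) (hw.2.2 v hv.1 hv.2.1)
  apply le_antisymm
  · intro u hu
    -- Rounding the coordinates of `u` in the basis `v, w`, which are quotients by `cross v w` by
    -- Cramer's rule: the remainders `r` and `s` are at most half the determinant in size.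
    have hround : ∀ X : ℤ, ∃ a r : ℤ, X = cross v w * a + r ∧ 4 * r ^ 2 ≤ cross v w ^ 2 := by
      intro X
      set D := cross v w
      refine ⟨round ((X : ℚ) / D), X - D * round ((X : ℚ) / D), by ring, ?_⟩
      have h := abs_sub_round ((X : ℚ) / D)
      have hD : (D : ℚ) ≠ 0 := by exact_mod_cast hc
      have h2 := sq_le_sq' (neg_le_of_abs_le h) (le_of_abs_le h)
      have h3 : ((X : ℚ) - D * round ((X : ℚ) / D)) = D * ((X : ℚ) / D - round ((X : ℚ) / D)) := by
        field_simp
      have h4 : 4 * ((X : ℚ) - D * round ((X : ℚ) / D)) ^ 2 ≤ (D : ℚ) ^ 2 := by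
        rw [h3]
        nlinarith [sq_nonneg (D : ℚ)]
      exact_mod_cast h4
    obtain ⟨a, r, hX, hr⟩ := hround (cross u w)
    obtain ⟨b, s, hY, hs⟩ := hround (cross v u)
    have hmem : a • v + b • w ∈ M := add_mem (zsmul_mem hv.1 a) (zsmul_mem hw.1 b)
    have hu' : u - (a • v + b • w) ∈ M := sub_mem hu hmem
    by_cases h0 : u - (a • v + b • w) = 0
    · rw [sub_eq_zero.1 h0]
      exact AddSubgroup.mem_closure_pair.2 ⟨a, b, rfl⟩
    · exfalso
      have hle := hv.2.2 _ hu' h0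
      have hre : cross v w * (u - (a • v + b • w)).re = r * v.re + s * w.re := by
        have h1 : r = cross u w - cross v w * a := by linarith
        have h2 : s = cross v u - cross v w * b := by linarith
        rw [h1, h2]
        simp [cross]; ring
      have him : cross v w * (u - (a • v + b • w)).im = r * v.im + s * w.im := by
        have h1 : r = cross u w - cross v w * a := by linarith
        have h2 : s = cross v u - cross v w * b := by linarith
        rw [h1, h2]
        simp [cross]; ring
      have h5 : cross v w ^ 2 * (u - (a • v + b • w)).norm = r ^ 2 * v.norm + s ^ 2 * w.norm
          + r * s * (2 * (v.re * w.re + v.im * w.im)) := by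
        rw [gaussianInt_norm_eq, gaussianInt_norm_eq, gaussianInt_norm_eq, mul_add, ← mul_pow,
          ← mul_pow, hre, him]
        ring
      rw [← hnorm] at h5
      have hpos := GaussianInt.norm_pos.2 hv.2.1
      have hrs : r * s * (2 * (v.re * w.re + v.im * w.im)) ≤ |r * s| * v.norm := by
        calc _ ≤ |r * s * (2 * (v.re * w.re + v.im * w.im))| := le_abs_self _
          _ = |r * s| * |2 * (v.re * w.re + v.im * w.im)| := abs_mul _ _
          _ ≤ _ := mul_le_mul_of_nonneg_left hk (abs_nonneg _)
      -- The difference `u - (a • v + b • w)` then has norm at most (r² + s² + |rs|)/D² ≤ 3/4 times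
      -- the norm of `v`, where D is the determinant, contradicting minimality unless it is zero.
      have hrs2 : 4 * |r * s| ≤ cross v w ^ 2 := by
        have : 2 * |r * s| ≤ r ^ 2 + s ^ 2 := by
          rw [abs_mul, ← sq_abs r, ← sq_abs s]
          nlinarith [sq_nonneg (|r| - |s|)]
        linarith
      have hD : 0 < cross v w ^ 2 := by positivity
      nlinarith
  · rw [AddSubgroup.closure_le]
    rintro x (rfl | rfl)
    · exact hv.1
    · exact hw.1

/-- Irrationality of √3 excludes the 60 degree angle: the square lattice has no hexagonal
sublattice, and the cone conditions are strict. -/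
lemma sq_ne_three_mul_sq {a b : ℕ} (hb : 0 < b) : a ^ 2 ≠ 3 * b ^ 2 := by
  intro h
  have h3 : Irrational √(3 : ℕ) := Nat.Prime.irrational_sqrt Nat.prime_three
  apply h3
  refine ⟨(a : ℚ) / b, ?_⟩
  have hb' : (0 : ℝ) < b := by exact_mod_cast hb
  push_cast
  rw [eq_comm, Real.sqrt_eq_iff_mul_self_eq (by norm_num) (by positivity)]
  field_simp
  exact_mod_cast h.symm

lemma exists_isReducedRhombus {M : AddSubgroup GaussianInt}
    (hM : ∃ v ∈ minimalGaussian M, ∃ w ∈ minimalGaussian M, cross v w ≠ 0) :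
    ∃ v w y p q, p.Coprime q ∧ IsReducedRhombus v w y p q ∧ M = AddSubgroup.closure {v, w} := by
  -- The orientation is chosen so that v + w, v - w is a positive pair, since their determinant is
  -- -2 `cross v w`.
  obtain ⟨v, hv, w, hw, hc, hneg⟩ : ∃ v ∈ minimalGaussian M, ∃ w ∈ minimalGaussian M,
      cross v w ≠ 0 ∧ cross v w < 0 := by
    obtain ⟨v, hv, w, hw, hc⟩ := hM
    rcases lt_or_gt_of_ne hc with h | h
    · exact ⟨v, hv, w, hw, hc, h⟩
    · have : cross w v = - cross v w := by simp [cross]; ring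
      exact ⟨w, hw, v, hv, by omega, by omega⟩
  have hnorm : v.norm = w.norm :=
    le_antisymm (hv.2.2 w hw.1 hw.2.1) (hw.2.2 v hv.1 hv.2.1)
  have hadd0 : v + w ≠ 0 := by
    intro h0
    rw [eq_neg_of_add_eq_zero_left h0] at hc
    apply hc; simp [cross]; ring
  have hsub0 : v - w ≠ 0 := by
    intro h0
    rw [sub_eq_zero.1 h0] at hc
    apply hc; simp [cross]; ring
  have hadd := hv.2.2 _ (add_mem hv.1 hw.1) hadd0
  have hsub := hv.2.2 _ (sub_mem hv.1 hw.1) hsub0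
  set k := 2 * (v.re * w.re + v.im * w.im) with hk
  have eadd : (v + w).norm = 2 * v.norm + k := by
    have : (v + w).norm = v.norm + w.norm + k := by
      rw [gaussianInt_norm_eq, gaussianInt_norm_eq, gaussianInt_norm_eq, hk]; simp; ring
    rw [this, ← hnorm]; ring
  have esub : (v - w).norm = 2 * v.norm - k := by
    have : (v - w).norm = v.norm + w.norm - k := by
      rw [gaussianInt_norm_eq, gaussianInt_norm_eq, gaussianInt_norm_eq, hk]; simp; ring
    rw [this, ← hnorm]; ring
  have hkle : |k| ≤ v.norm := abs_le.2 ⟨by linarith, by linarith⟩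
  have hclosure := eq_closure_of_minimal hv hw hc hkle
  set a := v + w with ha
  set b := v - w with hb
  have hA := GaussianInt.norm_pos.2 hadd0
  have hT : 0 < cross a b := by
    have : cross a b = -2 * cross v w := by rw [ha, hb]; simp [cross]; ring
    omega
  obtain ⟨A, hA'⟩ := Int.eq_ofNat_of_zero_le hA.le
  obtain ⟨T, hT'⟩ := Int.eq_ofNat_of_zero_le hT.le
  have hA0 : 0 < A := by omega
  have hT0 : 0 < T := by omega
  have horth : a.re * b.re + a.im * b.im = 0 := by
    have : a.re * b.re + a.im * b.im = v.norm - w.norm := by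
      rw [gaussianInt_norm_eq, gaussianInt_norm_eq, ha, hb]; simp; ring
    rw [this, hnorm, sub_self]
  -- As `b` is orthogonal to `a`, it is a real multiple of `i a`, with factor det(a, b)/N(a) = T/A.
  -- Reducing this fraction produces `p` and `q`.
  have key : (A : GaussianInt) * b = T * (⟨0, 1⟩ * a) := by
    have h1 : ((A : ℤ) : GaussianInt) * b = ((T : ℤ) : GaussianInt) * (⟨0, 1⟩ * a) := by
      have hA'' : (A : ℤ) = a.norm := hA'.symm
      have hT'' : (T : ℤ) = cross a b := hT'.symm
      rw [hA'', hT'', gaussianInt_norm_eq, Zsqrtd.ext_iff]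
      simp only [Zsqrtd.re_mul, Zsqrtd.im_mul, Zsqrtd.re_intCast, Zsqrtd.im_intCast, cross]
      constructor
      · linear_combination a.re * horth
      · linear_combination a.im * horth
    exact_mod_cast h1
  obtain ⟨d, p, q, hd, hcop, rfl, rfl⟩ := Nat.exists_coprime' (m := A) (n := T)
    (Nat.gcd_pos_of_pos_left _ hA0)
  have hp : 0 < p := Nat.pos_of_mul_pos_right hA0
  have hq : 0 < q := Nat.pos_of_mul_pos_right hT0
  have hd0 : (d : GaussianInt) ≠ 0 := by exact_mod_cast hd.ne'
  have key2 : (p : GaussianInt) * b = q * (⟨0, 1⟩ * a) := by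
    apply mul_left_cancel₀ hd0
    push_cast at key
    linear_combination key
  have hp0 : (p : GaussianInt) ≠ 0 := by exact_mod_cast hp.ne'
  have hdvd : (p : GaussianInt) ∣ a := by
    have h1 : IsCoprime (p : GaussianInt) (q : GaussianInt) := hcop.cast
    have h2 : (p : GaussianInt) ∣ ⟨0, 1⟩ * a := h1.dvd_of_dvd_mul_left ⟨b, key2.symm⟩
    obtain ⟨e, he⟩ := h2
    refine ⟨⟨0, -1⟩ * e, ?_⟩
    have : (⟨0, -1⟩ : GaussianInt) * ⟨0, 1⟩ = 1 := by decide
    linear_combination (⟨0, -1⟩ : GaussianInt) * he - a * this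
  obtain ⟨y, hy⟩ := hdvd
  have hby : b = q * (⟨0, 1⟩ * y) := by
    apply mul_left_cancel₀ hp0
    rw [key2, hy]; ring
  have hy0 : y ≠ 0 := by rintro rfl; apply hadd0; rw [hy, mul_zero]
  have hN := GaussianInt.norm_pos.2 hy0
  have nA : a.norm = (p : ℤ) ^ 2 * y.norm := by rw [hy, norm_natCast_mul]
  have nB : b.norm = (q : ℤ) ^ 2 * y.norm := by rw [hby, norm_natCast_mul, norm_I_mul]
  obtain ⟨hk1, hk2⟩ := abs_le.1 hkle
  have le1 : p ^ 2 ≤ 3 * q ^ 2 := by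
    have : (p : ℤ) ^ 2 * y.norm ≤ (3 * q ^ 2) * y.norm := by
      rw [← nA, mul_assoc, ← nB, eadd, esub]; linarith
    exact_mod_cast le_of_mul_le_mul_right this hN
  have le2 : q ^ 2 ≤ 3 * p ^ 2 := by
    have : (q : ℤ) ^ 2 * y.norm ≤ (3 * p ^ 2) * y.norm := by
      rw [← nB, mul_assoc, ← nA, eadd, esub]; linarith
    exact_mod_cast le_of_mul_le_mul_right this hN
  refine ⟨v, w, y, p, q, hcop, ⟨hp, hq, lt_of_le_of_ne le1 (sq_ne_three_mul_sq hq),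
    lt_of_le_of_ne le2 (sq_ne_three_mul_sq hp), hy0, ?_, ?_⟩, hclosure⟩
  · have : 2 * v = a + b := by rw [ha, hb]; ring
    rw [this, hy, hby]
    ext <;> simp
  · have : 2 * w = a - b := by rw [ha, hb]; ring
    rw [this, hy, hby]
    ext <;> simp <;> ring

lemma closure_pair_neg_left (v w : GaussianInt) :
    AddSubgroup.closure {v, -w} = AddSubgroup.closure {v, w} := by
  apply le_antisymm
  · rw [AddSubgroup.closure_le]
    rintro x (rfl | rfl)
    · exact AddSubgroup.subset_closure (by simp)
    · exact neg_mem (AddSubgroup.subset_closure (by simp))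
  · rw [AddSubgroup.closure_le]
    rintro x (rfl | rfl)
    · exact AddSubgroup.subset_closure (by simp)
    · rw [← neg_neg x]
      exact neg_mem (AddSubgroup.subset_closure (by simp))

lemma closure_pair_neg_right (v w : GaussianInt) :
    AddSubgroup.closure {-v, w} = AddSubgroup.closure {v, w} := by
  rw [Set.pair_comm, closure_pair_neg_left, Set.pair_comm]

lemma exists_quadrant {z : GaussianInt} (hz : z ≠ 0) : ∃ z₀ : GaussianInt,
    (0 < z₀.re ∧ 0 ≤ z₀.im) ∧ (z = z₀ ∨ z = -z₀ ∨ z = ⟨0, 1⟩ * z₀ ∨ z = -(⟨0, 1⟩ * z₀)) := by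
  have hne : z.re ≠ 0 ∨ z.im ≠ 0 := by
    by_contra! h
    exact hz (Zsqrtd.ext h.1 h.2)
  have e1 : ∀ z : GaussianInt, (⟨0, 1⟩ : GaussianInt) * z = ⟨-z.im, z.re⟩ := fun z => by
    ext <;> simp
  simp only [e1]
  by_cases h1 : 0 < z.re ∧ 0 ≤ z.im
  · exact ⟨z, h1, Or.inl rfl⟩
  by_cases h2 : z.re < 0 ∧ z.im ≤ 0
  · exact ⟨-z, ⟨by simp; omega, by simp; omega⟩, Or.inr (Or.inl (by simp))⟩
  by_cases h3 : 0 < z.im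
  · exact ⟨⟨z.im, -z.re⟩, ⟨h3, by simp; omega⟩,
      Or.inr (Or.inr (Or.inl (by ext <;> simp)))⟩
  · exact ⟨⟨-z.im, z.re⟩, ⟨by simp; omega, by simp; omega⟩,
      Or.inr (Or.inr (Or.inr (by ext <;> simp)))⟩

lemma rhombicLattice_surj {n : ℕ} {M : AddSubgroup GaussianInt}
    (hM : M ∈ wellRoundedGaussian n) : ∃ x ∈ rhombicData n, rhombicLattice x = M := by
  obtain ⟨hM, hn⟩ := hM
  obtain ⟨v, w, y, p, q, hcop, h, rfl⟩ := exists_isReducedRhombus hM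
  obtain ⟨z, rfl⟩ := diagonalFactor_dvd hcop h.two_mul_left
  have h20 : (2 : GaussianInt) ≠ 0 := by decide
  have hv : v = rhombusSide p q * z := by
    apply mul_left_cancel₀ h20
    rw [h.two_mul_left, ← mul_assoc, ← mul_assoc, two_mul_rhombusSide]
  have hw : w = rhombusSide' p q * z := by
    apply mul_left_cancel₀ h20
    rw [h.two_mul_right, ← mul_assoc, ← mul_assoc, two_mul_rhombusSide']
  have hz0 : z ≠ 0 := by rintro rfl; exact h.ne_zero (mul_zero _)
  have hidx : z.norm * rhombusWeight p q = n := by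
    rw [index_closure_pair h.cross_ne_zero] at hn
    have h1 := h.two_mul_cross
    rw [Zsqrtd.norm_mul, ← mul_assoc, norm_diagonalFactor] at h1
    have h2 : cross v w = -(z.norm * rhombusWeight p q) := by linarith
    have h3 := GaussianInt.norm_nonneg z
    rw [h2, Int.natAbs_neg] at hn
    rw [← hn]
    exact (Int.natAbs_of_nonneg (by positivity)).symm
  obtain ⟨z₀, hquad, hz⟩ := exists_quadrant hz0
  have hwcomm : rhombusWeight q p = rhombusWeight p q := by
    unfold rhombusWeight; simp only [and_comm, mul_comm]
  -- Since (p + iq) i = -(q - ip), multiplying `z` by i amounts to exchanging `p` and `q`. Thus the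
  -- quadrant for `z` can always be attained.
  have hs1 : rhombusSide p q * ⟨0, 1⟩ = -rhombusSide' q p := by
    apply mul_left_cancel₀ h20
    rw [mul_neg, two_mul_rhombusSide', ← mul_assoc, two_mul_rhombusSide, diagonalFactor_comm q p,
      mul_right_comm, ← neg_mul]
    congr 1
    ext <;> simp
  have hs2 : rhombusSide' p q * ⟨0, 1⟩ = rhombusSide q p := by
    apply mul_left_cancel₀ h20
    rw [two_mul_rhombusSide, ← mul_assoc, two_mul_rhombusSide', diagonalFactor_comm q p,
      mul_right_comm]
    congr 1
    ext <;> simp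
  have data1 : z₀.norm * rhombusWeight p q = n → (z₀, p, q) ∈ rhombicData n := fun hn =>
    ⟨hquad, ⟨h.left_pos, h.right_pos, h.left_lt, h.right_lt, hcop⟩, hn⟩
  have data2 : z₀.norm * rhombusWeight p q = n → (z₀, q, p) ∈ rhombicData n := fun hn =>
    ⟨hquad, ⟨h.right_pos, h.left_pos, h.right_lt, h.left_lt, hcop.symm⟩,
      by dsimp only; rw [hwcomm]; exact hn⟩
  rcases hz with rfl | rfl | rfl | rfl
  · exact ⟨_, data1 hidx, by rw [rhombicLattice, hv, hw]⟩
  · rw [Zsqrtd.norm_neg] at hidx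
    refine ⟨_, data1 hidx, ?_⟩
    rw [rhombicLattice, hv, hw, mul_neg, mul_neg, closure_pair_neg_left, closure_pair_neg_right]
  · rw [norm_I_mul] at hidx
    refine ⟨_, data2 hidx, ?_⟩
    rw [rhombicLattice, hv, hw, ← mul_assoc, ← mul_assoc, hs1, hs2, neg_mul,
      closure_pair_neg_right, Set.pair_comm]
  · rw [Zsqrtd.norm_neg, norm_I_mul] at hidx
    refine ⟨_, data2 hidx, ?_⟩
    rw [rhombicLattice, hv, hw, mul_neg, mul_neg, ← mul_assoc, ← mul_assoc, hs1, hs2, neg_mul,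
      neg_neg, closure_pair_neg_left, Set.pair_comm]

/-! ### The count as a Dirichlet convolution -/

/-- The coprime pairs `(p, q)` with `1 / √3 < q / p < √3` and weight `m`. -/
def shapeFiber (m : ℕ) : Set (ℕ × ℕ) :=
  {x | (0 < x.1 ∧ 0 < x.2 ∧ x.1 ^ 2 < 3 * x.2 ^ 2 ∧ x.2 ^ 2 < 3 * x.1 ^ 2 ∧ x.1.Coprime x.2) ∧
    rhombusWeight x.1 x.2 = m}

lemma mul_le_rhombusWeight (p q : ℕ) : p * q ≤ rhombusWeight p q := by
  unfold rhombusWeight; split_ifs <;> omega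

lemma finite_shapeFiber (m : ℕ) : (shapeFiber m).Finite := by
  refine ((Set.finite_Iic m).prod (Set.finite_Iic m)).subset ?_
  rintro ⟨p, q⟩ ⟨⟨hp, hq, -⟩, rfl⟩
  have := mul_le_rhombusWeight p q
  exact ⟨le_trans (Nat.le_mul_of_pos_right p hq) this, le_trans (Nat.le_mul_of_pos_left q hp) this⟩

/-- The number of shapes of weight `m`. -/
noncomputable def shapeCount (m : ℕ) : ℕ := (shapeFiber m).ncard

/-- The well-rounded sublattices are counted by a Dirichlet convolution. -/
theorem aSquare_eq_sum {n : ℕ} (hn : n ≠ 0) :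
    (aSquare n : ℤ) = ∑ x ∈ n.divisorsAntidiagonal, chiSum x.1 * shapeCount x.2 := by
  classical
  have h1 : aSquare n = (rhombicData n).ncard := by
    rw [aSquare_eq_ncard]
    symm
    apply Set.ncard_congr (fun x _ => rhombicLattice x)
    · exact fun x hx => rhombicLattice_mem hx
    · exact fun x y hx hy h => rhombicLattice_injOn n hx hy h
    · exact fun M hM => by
        obtain ⟨x, hx, h⟩ := rhombicLattice_surj hM
        exact ⟨x, hx, h⟩
  have h2 : rhombicData n = ⋃ x ∈ n.divisorsAntidiagonal,
      quadrantFiber x.1 ×ˢ shapeFiber x.2 := by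
    ext ⟨z, p, q⟩
    simp only [rhombicData, quadrantFiber, shapeFiber, Set.mem_iUnion, Set.mem_prod,
      Set.mem_ofPred_eq, Nat.mem_divisorsAntidiagonal, exists_prop, Prod.exists]
    constructor
    · rintro ⟨hz, hpq, h⟩
      obtain ⟨N, hN⟩ := Int.eq_ofNat_of_zero_le (GaussianInt.norm_nonneg z)
      rw [hN] at h ⊢
      exact ⟨N, rhombusWeight p q, ⟨by exact_mod_cast h, hn⟩, ⟨rfl, hz⟩, hpq, rfl⟩
    · rintro ⟨a, b, ⟨rfl, -⟩, ⟨hz, hz'⟩, hpq, rfl⟩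
      exact ⟨hz', hpq, by rw [hz]; push_cast; rfl⟩
  have h3 : rhombicData n = ((n.divisorsAntidiagonal.biUnion fun x =>
      (finite_quadrantFiber x.1).toFinset ×ˢ (finite_shapeFiber x.2).toFinset :
        Finset (GaussianInt × ℕ × ℕ)) : Set (GaussianInt × ℕ × ℕ)) := by
    rw [h2]; simp
  rw [h1, h3, Set.ncard_coe_finset, Finset.card_biUnion]
  · push_cast
    refine Finset.sum_congr rfl fun x hx => ?_
    rw [Finset.card_product, ← ncard_quadrantFiber x.1 (by
      rintro h0
      rw [Nat.mem_divisorsAntidiagonal, h0, zero_mul] at hx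
      exact hx.2 hx.1.symm)]
    rw [Set.ncard_eq_toFinset_card _ (finite_quadrantFiber x.1), shapeCount,
      Set.ncard_eq_toFinset_card _ (finite_shapeFiber x.2)]
    push_cast; rfl
  · rintro x hx y hy hxy
    rw [Function.onFun, Finset.disjoint_left]
    rintro ⟨z, s⟩ h h'
    simp only [Finset.mem_product, Set.Finite.mem_toFinset] at h h'
    apply hxy
    have e1 : (x.1 : ℤ) = y.1 := h.1.1.symm.trans h'.1.1
    have e2 : x.2 = y.2 := h.2.2.symm.trans h'.2.2
    exact Prod.ext (by exact_mod_cast e1) e2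


/-! ### Discrepancy of the multiples of √3 -/

/-- The discrepancy sum of an arithmetic progression modulo one. -/
noncomputable def sawtoothSum (α x : ℝ) (n : ℕ) : ℝ :=
  ∑ j ∈ Finset.range n, (Int.fract (x + j * α) - 1 / 2)

lemma sawtoothSum_add_nat (α x : ℝ) (k n : ℕ) :
    sawtoothSum (α + k) x n = sawtoothSum α x n := by
  refine Finset.sum_congr rfl fun j _ => ?_
  have : x + j * (α + k) = x + j * α + ((j * k : ℕ) : ℝ) := by push_cast; ring
  rw [this, Int.fract_add_natCast]

lemma sawtoothSum_fract (α x : ℝ) (n : ℕ) :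
    sawtoothSum α (Int.fract x) n = sawtoothSum α x n := by
  refine Finset.sum_congr rfl fun j _ => ?_
  have : Int.fract x + j * α = x + j * α - (⌊x⌋ : ℤ) := by
    rw [← Int.self_sub_floor]; ring
  rw [this, Int.fract_sub_intCast]

lemma abs_sawtoothSum_le (α x : ℝ) (n : ℕ) : |sawtoothSum α x n| ≤ n / 2 := by
  calc _ ≤ ∑ j ∈ Finset.range n, |Int.fract (x + j * α) - 1 / 2| := Finset.abs_sum_le_sum_abs _ _
    _ ≤ ∑ j ∈ Finset.range n, (1 / 2 : ℝ) := by
      refine Finset.sum_le_sum fun j _ => abs_le.2 ⟨?_, ?_⟩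
      · linarith [Int.fract_nonneg (x + j * α)]
      · linarith [Int.fract_lt_one (x + j * α)]
    _ = _ := by simp; ring

/-- Counting the lattice points below a line of slope `α` by columns or by rows: exchanging the axes
replaces `α` by `1 / α`. -/
lemma sum_floor_reciprocity {α x : ℝ} (h0 : 0 < α) (h1 : α < 1) (hx0 : 0 ≤ x) (hx1 : x < 1)
    (n : ℕ) : ∃ m : ℕ, (m : ℝ) ≤ x + n * α ∧ x + n * α < m + 1 ∧
      (∑ j ∈ Finset.range (n + 1), ⌊x + j * α⌋ : ℤ)
        = (n + 1) * m + ∑ y ∈ Finset.range m, ⌊(x - (y + 1)) / α⌋ := by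
  induction n with
  | zero => exact ⟨0, by simpa using hx0, by simpa using hx1, by simp [Int.floor_eq_zero_iff, hx0, hx1]⟩
  | succ n ih =>
    obtain ⟨m, hm1, hm2, hm⟩ := ih
    rw [Finset.sum_range_succ, hm]
    push_cast
    -- As `α < 1`, the floor grows by at most one. When it does, the new row enters with the floor
    -- -(n + 1).
    by_cases hc : x + (n + 1) * α < m + 1
    · refine ⟨m, by nlinarith, hc, ?_⟩
      have : ⌊x + (n + 1) * α⌋ = m := by
        rw [Int.floor_eq_iff]; push_cast; exact ⟨by nlinarith, hc⟩
      rw [this]; ring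
    · push Not at hc
      refine ⟨m + 1, by push_cast; exact hc, by push_cast; nlinarith, ?_⟩
      have e1 : ⌊x + (n + 1) * α⌋ = m + 1 := by
        rw [Int.floor_eq_iff]; push_cast; exact ⟨hc, by nlinarith⟩
      have e2 : ⌊(x - (m + 1)) / α⌋ = -(n + 1) := by
        rw [Int.floor_eq_iff]; push_cast
        exact ⟨by rw [le_div_iff₀ h0]; linarith, by rw [div_lt_iff₀ h0]; linarith⟩
      rw [e1, Finset.sum_range_succ, e2]
      push_cast; ring

/-- Reciprocity for discrepancy sums. -/
lemma sawtoothSum_reciprocity {α x : ℝ} (h0 : 0 < α) (h1 : α < 1) (hx0 : 0 ≤ x) (hx1 : x < 1)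
    (n : ℕ) : ∃ (m : ℕ) (x' : ℝ), (m : ℝ) ≤ α * n + 1 ∧
      |sawtoothSum α x n| ≤ (1 + α) ^ 2 / (8 * α) + |sawtoothSum (1 / α) x' m| := by
  rcases n with _ | n
  · exact ⟨0, 0, by simp, by simp [sawtoothSum]; positivity⟩
  obtain ⟨m, hm1, hm2, hm⟩ := sum_floor_reciprocity h0 h1 hx0 hx1 n
  refine ⟨m, (x - m) / α, by push_cast; nlinarith, ?_⟩
  have hsum : ∀ k : ℕ, ∑ j ∈ Finset.range k, (j : ℝ) = k * (k - 1) / 2 := by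
    intro k
    induction k with
    | zero => simp
    | succ k ih => rw [Finset.sum_range_succ, ih]; push_cast; ring
  have e1 : ∀ (a y : ℝ) (k : ℕ), sawtoothSum a y k
      = k * (y - 1 / 2) + a * (k * (k - 1) / 2) - ((∑ j ∈ Finset.range k, ⌊y + j * a⌋ : ℤ) : ℝ) := by
    intro a y k
    unfold sawtoothSum
    push_cast
    rw [← hsum k, Finset.mul_sum, ← Finset.card_range k, ← nsmul_eq_mul, ← Finset.sum_const,
      Finset.card_range, ← Finset.sum_add_distrib, ← Finset.sum_sub_distrib]
    refine Finset.sum_congr rfl fun j _ => ?_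
    rw [← Int.self_sub_floor]; ring
  have e2 : ∑ y ∈ Finset.range m, ⌊(x - (y + 1)) / α⌋
      = ∑ j ∈ Finset.range m, ⌊(x - m) / α + j * (1 / α)⌋ := by
    rw [← Finset.sum_range_reflect]
    refine Finset.sum_congr rfl fun j hj => ?_
    rw [Finset.mem_range] at hj
    have : ((m - 1 - j : ℕ) : ℝ) = m - 1 - j := by
      rw [Nat.cast_sub (by omega), Nat.cast_sub (by omega)]; simp
    rw [this]
    congr 1
    field_simp; ring
  rw [e2] at hm
  have hmR : ((∑ j ∈ Finset.range (n + 1), ⌊x + j * α⌋ : ℤ) : ℝ)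
      = (n + 1) * m + ((∑ j ∈ Finset.range m, ⌊(x - m) / α + j * (1 / α)⌋ : ℤ) : ℝ) := by
    rw [hm]; push_cast; rfl
  have e3 := e1 α x (n + 1)
  have e4 := e1 (1 / α) ((x - m) / α) m
  rw [hmR] at e3
  set φ := x + (n + 1) * α - m with hφ
  have key : sawtoothSum α x (n + 1) = sawtoothSum (1 / α) ((x - m) / α) m
      + ((φ ^ 2 - (1 + α) * φ) - (x ^ 2 - (1 + α) * x)) / (2 * α) := by
    rw [e3, e4, hφ]
    push_cast
    field_simp
    ring
  -- The boundary terms are values of y² - (1 + α) y on [0, 1 + α], where its range has length (1 +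
  -- α)²/4; division by 2α gives the constant of the lemma.
  have hb : ∀ y : ℝ, 0 ≤ y → y ≤ 1 + α → -((1 + α) ^ 2 / 4) ≤ y ^ 2 - (1 + α) * y ∧
      y ^ 2 - (1 + α) * y ≤ 0 := fun y h0 h1 =>
    ⟨by nlinarith [sq_nonneg (y - (1 + α) / 2)], by nlinarith⟩
  obtain ⟨b1, b2⟩ := hb φ (by rw [hφ]; nlinarith) (by rw [hφ]; nlinarith)
  obtain ⟨b3, b4⟩ := hb x hx0 (by linarith)
  rw [key]
  refine (abs_add_le _ _).trans ?_
  rw [add_comm]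
  gcongr
  rw [abs_div, abs_of_pos (by positivity : 0 < 2 * α), div_le_div_iff₀ (by positivity) (by positivity)]
  have : |φ ^ 2 - (1 + α) * φ - (x ^ 2 - (1 + α) * x)| ≤ (1 + α) ^ 2 / 4 :=
    abs_le.2 ⟨by linarith, by linarith⟩
  nlinarith

lemma sqrt_three_bounds : 1.7320508 < √3 ∧ √3 < 1.7320509 :=
  ⟨by rw [Real.lt_sqrt] <;> norm_num, by rw [Real.sqrt_lt'] <;> norm_num⟩

/-- Two reciprocity steps go once around the period 1, 2 of the continued fraction of √3: √3 - 1 →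
(√3 - 1)/2 → √3 - 1 modulo one. The length shrinks by (√3 - 1)²/2 = 2 - √3 < 0.268, at the cost
0.5124 + 0.6375 < 1.15; the constant 1.3661 bounds (√3 - 1)/2 + 1. -/
lemma sawtoothSum_sqrt_three_step (x : ℝ) (n : ℕ) : ∃ (m : ℕ) (y : ℝ),
    (m : ℝ) ≤ 0.268 * n + 1.3661 ∧
      |sawtoothSum (√3 - 1) x n| ≤ 1.15 + |sawtoothSum (√3 - 1) y m| := by
  obtain ⟨hl, hu⟩ := sqrt_three_bounds
  have hsq : √3 * √3 = 3 := Real.mul_self_sqrt (by norm_num)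
  obtain ⟨m, x', hm, h⟩ := sawtoothSum_reciprocity (α := √3 - 1) (by linarith) (by linarith)
    (Int.fract_nonneg x) (Int.fract_lt_one x) n
  simp only [sawtoothSum_fract] at h
  have e1 : 1 / (√3 - 1) = (√3 - 1) / 2 + (1 : ℕ) := by
    have : √3 - 1 ≠ 0 := by linarith
    field_simp; push_cast; nlinarith
  rw [e1, sawtoothSum_add_nat] at h
  obtain ⟨k, y, hk, h'⟩ := sawtoothSum_reciprocity (α := (√3 - 1) / 2) (by linarith) (by linarith)
    (Int.fract_nonneg x') (Int.fract_lt_one x') m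
  have e2 : 1 / ((√3 - 1) / 2) = (√3 - 1) + (2 : ℕ) := by
    have : √3 - 1 ≠ 0 := by linarith
    field_simp; push_cast; nlinarith
  rw [e2, sawtoothSum_add_nat, sawtoothSum_fract] at h'
  refine ⟨k, y, ?_, ?_⟩
  · have : (√3 - 1) / 2 * m ≤ (√3 - 1) / 2 * ((√3 - 1) * n + 1) :=
      mul_le_mul_of_nonneg_left hm (by linarith)
    have hn : (0 : ℝ) ≤ n := Nat.cast_nonneg n
    have h2 : (2 - √3) * n ≤ 0.268 * n := mul_le_mul_of_nonneg_right (by linarith) hn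
    have h3 : (√3 - 1) / 2 * ((√3 - 1) * n + 1)
        = (2 - √3) * n + (√3 - 1) / 2 + (√3 * √3 - 3) * n / 2 := by ring
    rw [hsq] at h3
    linarith
  · have b1 : (1 + (√3 - 1)) ^ 2 / (8 * (√3 - 1)) ≤ 0.5124 := by
      rw [div_le_iff₀ (by linarith)]; nlinarith
    have b2 : (1 + (√3 - 1) / 2) ^ 2 / (8 * ((√3 - 1) / 2)) ≤ 0.6375 := by
      rw [div_le_iff₀ (by linarith)]; nlinarith
    linarith

/-- Iterating `k` periods and then applying the trivial bound n/2. The constant 0.9332 bounds the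
sum of the geometric series of the shifts, 1.3661/2 divided by 1 - 0.268. -/
lemma abs_sawtoothSum_sqrt_three_le (k : ℕ) (x : ℝ) (n : ℕ) :
    |sawtoothSum (√3 - 1) x n| ≤ 1.15 * k + 0.9332 * (1 - 0.268 ^ k) + 0.268 ^ k * n / 2 := by
  induction k generalizing x n with
  | zero => have := abs_sawtoothSum_le (√3 - 1) x n; norm_num; linarith
  | succ k ih =>
    obtain ⟨m, y, hm, h⟩ := sawtoothSum_sqrt_three_step x n
    have h2 := ih y m
    have hpos : (0 : ℝ) < 0.268 ^ k := by positivity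
    have h3 : (0.268 : ℝ) ^ k * m ≤ 0.268 ^ k * (0.268 * n + 1.3661) :=
      mul_le_mul_of_nonneg_left hm hpos.le
    rw [pow_succ]
    push_cast
    nlinarith

lemma abs_sawtoothSum_sqrt_three_le' (x : ℝ) (n : ℕ) :
    |sawtoothSum (√3 - 1) x n| ≤ 9 + n / 20000 := by
  -- Seven periods: 7 · 1.15 + 0.9332 < 9, and 0.268⁷/2 < 1/20000.
  have h := abs_sawtoothSum_sqrt_three_le 7 x n
  have hn : (0 : ℝ) ≤ n := Nat.cast_nonneg n
  norm_num at h ⊢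
  linarith

/-- Summation by parts against a decreasing weight. -/
lemma abs_sum_mul_le_of_antitone {e w : ℕ → ℝ} {A η : ℝ} (hw : Antitone w) (hw0 : ∀ n, 0 ≤ w n)
    (h : ∀ n, |∑ j ∈ Finset.range n, e j| ≤ A + η * n) (m : ℕ) :
    |∑ j ∈ Finset.range m, e j * w j| ≤ A * w 0 + η * ∑ j ∈ Finset.range m, w j := by
  -- Abel summation; the boundary term is subtracted so that the induction has non-negative weight
  -- differences.
  have h1 : ∀ m, |∑ j ∈ Finset.range m, e j * w j - (∑ j ∈ Finset.range m, e j) * w m|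
      ≤ A * (w 0 - w m) + η * (∑ j ∈ Finset.range m, w j - m * w m) := by
    intro m
    induction m with
    | zero => simp
    | succ m ih =>
      have e1 : ∑ j ∈ Finset.range (m + 1), e j * w j - (∑ j ∈ Finset.range (m + 1), e j) * w (m + 1)
        = (∑ j ∈ Finset.range m, e j * w j - (∑ j ∈ Finset.range m, e j) * w m)
          + (∑ j ∈ Finset.range (m + 1), e j) * (w m - w (m + 1)) := by
        rw [Finset.sum_range_succ, Finset.sum_range_succ]; ring
      have h2 : 0 ≤ w m - w (m + 1) := sub_nonneg.2 (hw (Nat.le_succ m))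
      have h3 : |(∑ j ∈ Finset.range (m + 1), e j) * (w m - w (m + 1))|
          ≤ (A + η * (m + 1)) * (w m - w (m + 1)) := by
        rw [abs_mul, abs_of_nonneg h2]
        exact mul_le_mul_of_nonneg_right (by exact_mod_cast h (m + 1)) h2
      rw [e1]
      refine (abs_add_le _ _).trans ?_
      rw [Finset.sum_range_succ w m]
      push_cast
      linarith
  have h2 : |(∑ j ∈ Finset.range m, e j) * w m| ≤ (A + η * m) * w m := by
    rw [abs_mul, abs_of_nonneg (hw0 m)]
    exact mul_le_mul_of_nonneg_right (h m) (hw0 m)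
  have h3 : ∑ j ∈ Finset.range m, e j * w j = (∑ j ∈ Finset.range m, e j * w j -
    (∑ j ∈ Finset.range m, e j) * w m) + (∑ j ∈ Finset.range m, e j) * w m := by ring
  rw [h3]
  refine (abs_add_le _ _).trans ?_
  linarith [h1 m]


/-! ### The midpoint rule with a telescoping error -/

lemma nonneg_of_hasDerivAt_nonneg {g g' : ℝ → ℝ} {b : ℝ}
    (hg : ∀ t ∈ Set.Icc 0 b, HasDerivAt g (g' t) t) (hg' : ∀ t ∈ Set.Icc 0 b, 0 ≤ g' t)
    (h0 : 0 ≤ g 0) : ∀ t ∈ Set.Icc 0 b, 0 ≤ g t := by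
  intro t ht
  have hmono : MonotoneOn g (Set.Icc 0 b) := by
    apply monotoneOn_of_deriv_nonneg (convex_Icc 0 b)
    · exact fun t ht => (hg t ht).continuousAt.continuousWithinAt
    · rw [interior_Icc]
      exact fun t ht => (hg t ⟨ht.1.le, ht.2.le⟩).differentiableAt.differentiableWithinAt
    · rw [interior_Icc]
      intro t ht
      rw [(hg t ⟨ht.1.le, ht.2.le⟩).deriv]
      exact hg' t ⟨ht.1.le, ht.2.le⟩
  exact h0.trans (hmono ⟨le_rfl, ht.1.trans ht.2⟩ ht ht.1)

/-- The midpoint rule for a convex function. -/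
lemma midpoint_bounds {F f f' : ℝ → ℝ} {x : ℝ}
    (hF : ∀ t ∈ Set.Icc (x - 1 / 2) (x + 1 / 2), HasDerivAt F (f t) t)
    (hf : ∀ t ∈ Set.Icc (x - 1 / 2) (x + 1 / 2), HasDerivAt f (f' t) t)
    (hm : MonotoneOn f' (Set.Icc (x - 1 / 2) (x + 1 / 2))) :
    f x ≤ F (x + 1 / 2) - F (x - 1 / 2) ∧
      F (x + 1 / 2) - F (x - 1 / 2) ≤ f x + (f' (x + 1 / 2) - f' (x - 1 / 2)) / 8 := by
  set M := f' (x + 1 / 2) - f' (x - 1 / 2)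
  have hplus : ∀ t ∈ Set.Icc (0 : ℝ) (1 / 2), x + t ∈ Set.Icc (x - 1 / 2) (x + 1 / 2) :=
    fun t ht => ⟨by linarith [ht.1], by linarith [ht.2]⟩
  have hminus : ∀ t ∈ Set.Icc (0 : ℝ) (1 / 2), x - t ∈ Set.Icc (x - 1 / 2) (x + 1 / 2) :=
    fun t ht => ⟨by linarith [ht.2], by linarith [ht.1]⟩
  have hend : x + 1 / 2 ∈ Set.Icc (x - 1 / 2) (x + 1 / 2) := ⟨by linarith, le_rfl⟩
  have hend' : x - 1 / 2 ∈ Set.Icc (x - 1 / 2) (x + 1 / 2) := ⟨le_rfl, by linarith⟩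
  -- The second difference f(x+t) + f(x-t) - 2f(x) has derivative between 0 and `M`. Integrating
  -- twice bounds the midpoint error between 0 and M t²/2, which is M/8 at t = 1/2.
  have d1 : ∀ t ∈ Set.Icc (0 : ℝ) (1 / 2),
      HasDerivAt (fun t => f (x + t) + f (x - t) - 2 * f x) (f' (x + t) - f' (x - t)) t := by
    intro t ht
    have h1 := (hf _ (hplus t ht)).comp_const_add x t
    have h2 := (hf _ (hminus t ht)).comp_const_sub x t
    exact ((h1.add h2).sub_const _).congr_deriv (by ring)
  have d0 : ∀ t ∈ Set.Icc (0 : ℝ) (1 / 2),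
      HasDerivAt (fun t => F (x + t) - F (x - t) - 2 * f x * t)
        (f (x + t) + f (x - t) - 2 * f x) t := by
    intro t ht
    have h1 := (hF _ (hplus t ht)).comp_const_add x t
    have h2 := (hF _ (hminus t ht)).comp_const_sub x t
    exact ((h1.sub h2).sub ((hasDerivAt_id t).const_mul (2 * f x))).congr_deriv (by ring)
  have b1 := nonneg_of_hasDerivAt_nonneg d1
    (fun t ht => sub_nonneg.2 (hm (hminus t ht) (hplus t ht) (by linarith [ht.1]))) (by simp; linarith)
  have b2 := nonneg_of_hasDerivAt_nonneg (b := 1 / 2)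
    (g := fun t => M * t - (f (x + t) + f (x - t) - 2 * f x))
    (g' := fun t => M - (f' (x + t) - f' (x - t)))
    (fun t ht => (((hasDerivAt_id t).const_mul M).sub (d1 t ht)).congr_deriv (by ring))
    (fun t ht => by
      have h1 := hm (hplus t ht) hend (by linarith [ht.2])
      have h2 := hm hend' (hminus t ht) (by linarith [ht.2])
      simp only [M]; linarith) (by simp; linarith)
  have c1 := nonneg_of_hasDerivAt_nonneg d0 b1 (by simp) (1 / 2) ⟨by norm_num, le_rfl⟩
  have c2 := nonneg_of_hasDerivAt_nonneg (b := 1 / 2)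
    (g := fun t => M * t ^ 2 / 2 - (F (x + t) - F (x - t) - 2 * f x * t))
    (g' := fun t => M * t - (f (x + t) + f (x - t) - 2 * f x))
    (fun t ht => (((((hasDerivAt_id t).pow 2).const_mul M).div_const 2).sub (d0 t ht)).congr_deriv
      (by simp; ring)) b2 (by simp) (1 / 2) ⟨by norm_num, le_rfl⟩
  constructor
  · linarith
  · linarith

/-- The single errors are bounded by increments of `f' / 8`, so they telescope and only the end
slopes remain. -/
lemma sum_midpoint_bounds {F f f' : ℝ → ℝ} {a : ℝ}
    (hF : ∀ t ∈ Set.Ici a, HasDerivAt F (f t) t)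
    (hf : ∀ t ∈ Set.Ici a, HasDerivAt f (f' t) t)
    (hm : MonotoneOn f' (Set.Ici a)) (n : ℕ) :
    ∑ j ∈ Finset.range n, f (a + 1 / 2 + j) ≤ F (a + n) - F a ∧
      F (a + n) - F a ≤ ∑ j ∈ Finset.range n, f (a + 1 / 2 + j) + (f' (a + n) - f' a) / 8 := by
  induction n with
  | zero => simp
  | succ n ih =>
    have hsub : Set.Icc (a + 1 / 2 + n - 1 / 2) (a + 1 / 2 + n + 1 / 2) ⊆ Set.Ici a := by
      intro t ht
      have : (0 : ℝ) ≤ n := Nat.cast_nonneg n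
      exact le_trans (by linarith) ht.1
    have h := midpoint_bounds (x := a + 1 / 2 + n) (fun t ht => hF t (hsub ht))
      (fun t ht => hf t (hsub ht)) (hm.mono hsub)
    have e1 : a + 1 / 2 + n - 1 / 2 = a + n := by ring
    have e2 : a + 1 / 2 + n + 1 / 2 = a + (n + 1 : ℕ) := by push_cast; ring
    rw [e1, e2] at h
    rw [Finset.sum_range_succ]
    exact ⟨by linarith, by linarith⟩

/-! ### The regularised cone sums and their tails -/

/-- The regularised summand of the sum over the cone `p < q < p √3`, where `p` and `q` are congruent
modulo one. -/
noncomputable def coneTerm (p : ℝ) : ℝ :=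
  1 / p * (Real.log 3 / 2 - ∑ j ∈ Finset.range ⌊(√3 - 1) * p⌋₊, 1 / (p + j + 1))

/-- The midpoint rule for 1/t on unit intervals centred at p + j + 1, which start at p + 1/2. -/
lemma sum_inv_bounds {p : ℝ} (hp : 0 < p) (n : ℕ) :
    ∑ j ∈ Finset.range n, 1 / (p + j + 1) ≤ Real.log ((p + 1 / 2 + n) / (p + 1 / 2)) ∧
    Real.log ((p + 1 / 2 + n) / (p + 1 / 2)) ≤ ∑ j ∈ Finset.range n, 1 / (p + j + 1)
      + 1 / (8 * p ^ 2) := by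
  have hpos : ∀ t ∈ Set.Ici (p + 1 / 2), 0 < t := fun t ht => lt_of_lt_of_le (by linarith) ht
  have hn : (0 : ℝ) ≤ n := Nat.cast_nonneg n
  have h := sum_midpoint_bounds (F := Real.log) (f := fun t => t⁻¹) (f' := fun t => -(t ^ 2)⁻¹)
    (a := p + 1 / 2) (fun t ht => Real.hasDerivAt_log (hpos t ht).ne')
    (fun t ht => by simpa using hasDerivAt_inv (hpos t ht).ne') (fun s hs t ht hst => by
      have := hpos s hs
      simp only [neg_le_neg_iff]
      gcongr) n
  rw [Real.log_div (by positivity) (by positivity)]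
  have e : ∀ j : ℕ, (p + 1 / 2 + 1 / 2 + (j : ℝ))⁻¹ = 1 / (p + j + 1) := fun j => by
    rw [one_div]; ring
  simp only [e] at h
  refine ⟨h.1, h.2.trans ?_⟩
  have h1 : 0 ≤ ((p + 1 / 2 + n) ^ 2)⁻¹ := by positivity
  have h2 : ((p + 1 / 2) ^ 2)⁻¹ ≤ (p ^ 2)⁻¹ := by gcongr; linarith
  have h3 : 1 / (8 * p ^ 2) = (p ^ 2)⁻¹ / 8 := by field_simp
  linarith

lemma log_one_add_bounds {x : ℝ} (hx : -0.29 ≤ x) :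
    x - 1.41 * x ^ 2 ≤ Real.log (1 + x) ∧ Real.log (1 + x) ≤ x := by
  have h0 : 0 < 1 + x := by linarith
  constructor
  · refine le_trans ?_ (Real.one_sub_inv_le_log_of_pos h0)
    have : 1 - (1 + x)⁻¹ = x - x ^ 2 / (1 + x) := by field_simp; ring
    rw [this]
    have : x ^ 2 / (1 + x) ≤ 1.41 * x ^ 2 := by
      rw [div_le_iff₀ h0]; nlinarith [sq_nonneg x]
    linarith
  · linarith [Real.log_le_sub_one_of_pos h0]

lemma log_one_add_ge_of_nonneg {x : ℝ} (hx : 0 ≤ x) : x - x ^ 2 ≤ Real.log (1 + x) := by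
  have h0 : 0 < 1 + x := by linarith
  refine le_trans ?_ (Real.one_sub_inv_le_log_of_pos h0)
  have : 1 - (1 + x)⁻¹ = x - x ^ 2 / (1 + x) := by field_simp; ring
  rw [this]
  have : x ^ 2 / (1 + x) ≤ x ^ 2 := div_le_self (sq_nonneg x) (by linarith)
  linarith

/-- The window ends at p√3 - f with f the fractional part, so the midpoint rule gives log((p + 1/2 +
J)/(p + 1/2)) = log 3/2 + log(1 + x) - log(1 + y) with x = (1/2 - f)/(√3 p) and y = 1/(2p). To first
order the bracket of `coneTerm` is y - x. -/
lemma coneTerm_estimate {p : ℝ} (hp : 1 ≤ p) :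
    |coneTerm p - (1 / (2 * p ^ 2) + (Int.fract ((√3 - 1) * p) - 1 / 2) / √3 * (1 / p ^ 2))|
      ≤ 1 / (4 * p ^ 3) := by
  have hp0 : 0 < p := by linarith
  obtain ⟨hl, hu⟩ := sqrt_three_bounds
  have hsq : √3 * √3 = 3 := Real.mul_self_sqrt (by norm_num)
  set f := Int.fract ((√3 - 1) * p) with hf
  have hf0 : 0 ≤ f := Int.fract_nonneg _
  have hf1 : f < 1 := Int.fract_lt_one _
  have hJ : ((⌊(√3 - 1) * p⌋₊ : ℕ) : ℝ) = (√3 - 1) * p - f := by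
    rw [natCast_floor_eq_intCast_floor (by nlinarith), ← Int.self_sub_fract]
  obtain ⟨h1, h2⟩ := sum_inv_bounds hp0 ⌊(√3 - 1) * p⌋₊
  set T := ∑ j ∈ Finset.range ⌊(√3 - 1) * p⌋₊, 1 / (p + j + 1) with hT
  set x := (1 / 2 - f) / (√3 * p) with hx
  set y := 1 / (2 * p) with hy
  have hlog : Real.log ((p + 1 / 2 + (⌊(√3 - 1) * p⌋₊ : ℕ)) / (p + 1 / 2))
      = Real.log 3 / 2 + Real.log (1 + x) - Real.log (1 + y) := by
    have hx1 : 0 < 1 + x := by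
      have : 1 + x = (√3 * p + (1 / 2 - f)) / (√3 * p) := by rw [hx]; field_simp
      rw [this]
      apply div_pos <;> nlinarith
    rw [← Real.log_sqrt (by norm_num), ← Real.log_mul (by positivity) hx1.ne',
      ← Real.log_div (by positivity) (by positivity), hJ]
    congr 1
    rw [hx, hy]
    field_simp
    ring
  rw [hlog] at h1 h2
  have hx2 : x ^ 2 ≤ 1 / (12 * p ^ 2) := by
    rw [hx, div_pow, div_le_div_iff₀ (by positivity) (by positivity)]
    have : (√3 * p) ^ 2 = 3 * p ^ 2 := by rw [mul_pow, sq √3, hsq]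
    rw [this]
    have : (1 / 2 - f) ^ 2 ≤ 1 / 4 := by nlinarith
    nlinarith [sq_nonneg p]
  have hxl : -0.29 ≤ x := by
    rw [hx, le_div_iff₀ (by positivity)]
    nlinarith
  obtain ⟨a1, a2⟩ := log_one_add_bounds hxl
  have hy0 : 0 ≤ y := by positivity
  have a3 := log_one_add_ge_of_nonneg hy0
  have a4 : Real.log (1 + y) ≤ y := by linarith [Real.log_le_sub_one_of_pos (by linarith : 0 < 1 + y)]
  have hy2 : y ^ 2 = 1 / (4 * p ^ 2) := by rw [hy]; field_simp; norm_num
  set w := 1 / p ^ 2 with hw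
  have hw0 : 0 < w := by positivity
  have e12 : 1 / (12 * p ^ 2) = w / 12 := by rw [hw]; field_simp
  have e4 : 1 / (4 * p ^ 2) = w / 4 := by rw [hw]; field_simp
  have e8 : 1 / (8 * p ^ 2) = w / 8 := by rw [hw]; field_simp
  rw [e12] at hx2
  rw [e4] at hy2
  rw [e8] at h2
  -- In units of `w` = 1/p², the error is at most 1/8 + 1.41/12 from above and 1/4 from below. The
  -- factor 1.41 is valid because x ≥ -1/(2√3) > -0.29.
  have hmain : |Real.log 3 / 2 - T - (y - x)| ≤ w / 4 := abs_le.2 ⟨by linarith, by linarith⟩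
  have e : coneTerm p - (1 / (2 * p ^ 2) + (f - 1 / 2) / √3 * w)
      = 1 / p * (Real.log 3 / 2 - T - (y - x)) := by
    rw [coneTerm, ← hT, hy, hx, hw]
    field_simp
    ring
  rw [e, abs_mul, abs_of_pos (by positivity : 0 < 1 / p)]
  calc 1 / p * |Real.log 3 / 2 - T - (y - x)| ≤ 1 / p * (w / 4) := by gcongr
    _ = _ := by rw [hw]; field_simp

lemma abs_coneTerm_le {p : ℝ} (hp : 1 ≤ p) : |coneTerm p| ≤ 2 / p ^ 2 := by
  have h := coneTerm_estimate hp
  have hp0 : 0 < p := by linarith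
  obtain ⟨hl, hu⟩ := sqrt_three_bounds
  set f := Int.fract ((√3 - 1) * p) with hf
  have hf0 : 0 ≤ f := Int.fract_nonneg _
  have hf1 : f < 1 := Int.fract_lt_one _
  have h1 : 1 / (4 * p ^ 3) ≤ 1 / p ^ 2 / 4 := by
    rw [div_div, div_le_div_iff₀ (by positivity) (by positivity)]
    nlinarith [sq_nonneg p]
  have h2 : |(f - 1 / 2) / √3| ≤ 1 / 2 := by
    rw [abs_div, abs_of_pos (by linarith : 0 < √3), div_le_iff₀ (by linarith)]
    have : |f - 1 / 2| ≤ 1 / 2 := abs_le.2 ⟨by linarith, by linarith⟩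
    linarith
  obtain ⟨h3, h4⟩ := abs_le.1 h2
  have hw0 : 0 < 1 / p ^ 2 := by positivity
  have e : 1 / (2 * p ^ 2) = 1 / p ^ 2 / 2 := by field_simp
  rw [e] at h
  have e2 : 2 / p ^ 2 = 2 * (1 / p ^ 2) := by ring
  rw [e2]
  obtain ⟨h5, h6⟩ := abs_le.1 h
  rw [abs_le]
  constructor <;> nlinarith

lemma summable_coneTerm {τ : ℝ} (hτ : 0 < τ) : Summable fun k : ℕ => coneTerm (k + τ) := by
  rw [← summable_nat_add_iff 1]
  have h : Summable fun k : ℕ => 2 / ((k : ℝ) + 1) ^ 2 := by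
    have := (Real.summable_one_div_nat_add_rpow 1 2).2 (by norm_num)
    refine (this.mul_left 2).congr fun k => ?_
    have : (0 : ℝ) ≤ k := Nat.cast_nonneg k
    rw [abs_of_pos (by positivity)]
    norm_cast
    field_simp
  refine Summable.of_norm_bounded h fun k => ?_
  have hk : (0 : ℝ) ≤ k := Nat.cast_nonneg k
  push_cast
  refine (abs_coneTerm_le (by linarith)).trans ?_
  gcongr 2 / ?_ ^ 2
  linarith

lemma sqrt_three_mul_ne_intCast {P : ℕ} (hP : 0 < P) (m : ℤ) : (√3 - 1) * (P / 2 : ℝ) ≠ m := by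
  intro h
  have h3 : Irrational √3 := by
    have := Nat.Prime.irrational_sqrt Nat.prime_three; exact_mod_cast this
  have hP' : (0 : ℝ) < P := by exact_mod_cast hP
  apply h3
  refine ⟨(2 * m + P) / P, ?_⟩
  push_cast
  rw [div_eq_iff hP'.ne']
  linarith

/-- The upper end of a window is irrational, so its ceiling is one more than its floor and the open
interval contains exactly floor-many points. -/
lemma ceil_eq_add_floor_add_one {x : ℝ} {p P : ℕ} (hP : 0 < P)
    (hx : x = p + (√3 - 1) * (P / 2 : ℝ)) :
    ⌈x⌉₊ = p + ⌊(√3 - 1) * (P / 2 : ℝ)⌋₊ + 1 := by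
  obtain ⟨hl, hu⟩ := sqrt_three_bounds
  have h0 : 0 ≤ (√3 - 1) * (P / 2 : ℝ) := mul_nonneg (by linarith) (by positivity)
  rw [Nat.ceil_eq_iff (by omega), hx]
  have h1 := Nat.floor_le h0
  have h2 := Nat.lt_floor_add_one ((√3 - 1) * (P / 2 : ℝ))
  have h3 := sqrt_three_mul_ne_intCast hP (⌊(√3 - 1) * (P / 2 : ℝ)⌋₊ : ℕ)
  have h4 : ((⌊(√3 - 1) * (P / 2 : ℝ)⌋₊ : ℕ) : ℝ) < (√3 - 1) * (P / 2 : ℝ) :=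
    lt_of_le_of_ne h1 (by exact_mod_cast h3.symm)
  rw [Nat.add_sub_cancel]
  push_cast
  exact ⟨by linarith, by linarith⟩

lemma sum_Ioo_eq_sum_range (f : ℕ → ℝ) (p J : ℕ) :
    ∑ q ∈ Finset.Ioo p (p + J + 1), f q = ∑ j ∈ Finset.range J, f (p + j + 1) := by
  rw [← Finset.sum_image (g := fun j => p + j + 1) (fun a _ b _ h => by simpa using h)]
  congr 1
  ext q
  simp only [Finset.mem_Ioo, Finset.mem_image, Finset.mem_range]
  exact ⟨fun h => ⟨q - p - 1, by omega, by omega⟩, fun ⟨j, hj, h⟩ => by omega⟩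

lemma seriesTermOne_eq (k : ℕ) : seriesTermOne (k + 1) = coneTerm (k + 1) := by
  have hc := ceil_eq_add_floor_add_one (x := ((k + 1 : ℕ) : ℝ) * √3) (p := k + 1)
    (P := 2 * (k + 1)) (by omega) (by push_cast; ring)
  rw [seriesTermOne, hc, sum_Ioo_eq_sum_range, coneTerm]
  have : (((2 * (k + 1) : ℕ) : ℝ) / 2) = k + 1 := by push_cast; ring
  rw [this]
  push_cast
  congr 2

/-- Writing 2k + 1 = 2(k + 1/2) takes a factor 1/2 out of the outer and inner quotients; hence the
1/4. -/
lemma seriesTermTwo_eq (k : ℕ) : seriesTermTwo k = coneTerm (k + 1 / 2) / 4 := by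
  have hc := ceil_eq_add_floor_add_one (x := (k : ℝ) * √3 + (√3 - 1) / 2) (p := k)
    (P := 2 * k + 1) (by omega) (by push_cast; ring)
  rw [seriesTermTwo, hc, sum_Ioo_eq_sum_range, coneTerm]
  have : (((2 * k + 1 : ℕ) : ℝ) / 2) = k + 1 / 2 := by push_cast; ring
  rw [this]
  have hk : (0 : ℝ) ≤ k := Nat.cast_nonneg k
  have e : ∀ j : ℕ, 1 / (2 * ((k + j + 1 : ℕ) : ℝ) + 1) = 1 / 2 * (1 / (k + 1 / 2 + j + 1)) := by
    intro j
    have hj : (0 : ℝ) ≤ j := Nat.cast_nonneg j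
    push_cast
    field_simp
    ring
  simp only [e]
  rw [← Finset.mul_sum]
  field_simp
  ring


/-- The tail of the regularised sum over the cone. -/
lemma abs_tsum_coneTerm_sub_le {a : ℝ} (ha : 1 / 2 ≤ a) :
    |∑' k : ℕ, coneTerm (k + (a + 1 / 2)) - 1 / (2 * a)|
      ≤ 0.5774 * (9 / a ^ 2 + 1 / (20000 * a)) + 1 / (8 * a ^ 2) + 1 / (8 * a ^ 3) := by
  have ha0 : 0 < a := by linarith
  obtain ⟨hl, hu⟩ := sqrt_three_bounds
  have hsq : √3 * √3 = 3 := Real.mul_self_sqrt (by norm_num)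
  have hsum := (summable_coneTerm (τ := a + 1 / 2) (by linarith)).hasSum.tendsto_sum_nat
  have hpos : ∀ t ∈ Set.Ici a, 0 < t := fun t ht => lt_of_lt_of_le ha0 ht
  -- Termwise the estimate of `coneTerm` splits the sum into `A2 / 2`, which the midpoint rule
  -- compares with an integral, the sawtooth part `B / √3`, bounded by summation by parts, and an
  -- error at most `A3 / 4`. The constant 0.5774 exceeds 1/√3, and `a` lies half a step before the
  -- first term.
  have bound : ∀ m : ℕ, |∑ k ∈ Finset.range m, coneTerm (k + (a + 1 / 2))
      - (1 / a - 1 / (a + m)) / 2|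
      ≤ 0.5774 * (9 / a ^ 2 + 1 / (20000 * a)) + 1 / (8 * a ^ 2) + 1 / (8 * a ^ 3) := by
    intro m
    have hm0 : (0 : ℝ) ≤ m := Nat.cast_nonneg m
    have hp : ∀ k : ℕ, 0 < (k : ℝ) + (a + 1 / 2) := fun k => by positivity
    have q2 := sum_midpoint_bounds (F := fun t => -t⁻¹) (f := fun t => (t ^ 2)⁻¹)
      (f' := fun t => -(2 / t ^ 3)) (a := a)
      (fun t ht => (hasDerivAt_inv (hpos t ht).ne').fun_neg.congr_deriv (by simp))
      (fun t ht => by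
        have := ((hasDerivAt_id t).pow 2).inv (pow_ne_zero 2 (hpos t ht).ne')
        refine this.congr_deriv ?_
        have := (hpos t ht).ne'
        simp; field_simp)
      (fun s hs t ht hst => by
        have := hpos s hs
        simp only [neg_le_neg_iff]
        gcongr) m
    have q3 := (sum_midpoint_bounds (F := fun t => -(t ^ 2)⁻¹ / 2) (f := fun t => (t ^ 3)⁻¹)
      (f' := fun t => -(3 / t ^ 4)) (a := a)
      (fun t ht => by
        have := (((hasDerivAt_id t).pow 2).inv (pow_ne_zero 2 (hpos t ht).ne')).neg.div_const 2
        refine this.congr_deriv ?_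
        have := (hpos t ht).ne'
        simp; field_simp)
      (fun t ht => by
        have := ((hasDerivAt_id t).pow 3).inv (pow_ne_zero 3 (hpos t ht).ne')
        refine this.congr_deriv ?_
        have := (hpos t ht).ne'
        simp; field_simp)
      (fun s hs t ht hst => by
        have := hpos s hs
        simp only [neg_le_neg_iff]
        gcongr) m).1
    have ecomm : ∀ j : ℕ, a + 1 / 2 + (j : ℝ) = j + (a + 1 / 2) := fun j => by ring
    simp only [ecomm] at q2 q3
    set A2 := ∑ k ∈ Finset.range m, (((k : ℝ) + (a + 1 / 2)) ^ 2)⁻¹ with hA2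
    set A3 := ∑ k ∈ Finset.range m, (((k : ℝ) + (a + 1 / 2)) ^ 3)⁻¹ with hA3
    set B := ∑ k ∈ Finset.range m,
      (Int.fract ((√3 - 1) * (a + 1 / 2) + k * (√3 - 1)) - 1 / 2) * (((k : ℝ) + (a + 1 / 2)) ^ 2)⁻¹
      with hB
    have hBle : |B| ≤ 9 / a ^ 2 + 1 / (20000 * a) := by
      have h := abs_sum_mul_le_of_antitone
        (e := fun k => Int.fract ((√3 - 1) * (a + 1 / 2) + k * (√3 - 1)) - 1 / 2)
        (w := fun k => (((k : ℝ) + (a + 1 / 2)) ^ 2)⁻¹) (A := 9) (η := 1 / 20000)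
        (fun i j hij => by
          have := hp i
          dsimp only
          gcongr) (fun n => by positivity)
        (fun n => by
          have := abs_sawtoothSum_sqrt_three_le' ((√3 - 1) * (a + 1 / 2)) n
          rw [sawtoothSum] at this
          linarith) m
      refine h.trans ?_
      have h1 : ((((0 : ℕ) : ℝ) + (a + 1 / 2)) ^ 2)⁻¹ ≤ (a ^ 2)⁻¹ := by
        gcongr; push_cast; linarith
      have h2 : A2 ≤ a⁻¹ := by
        have : 0 ≤ (a + m)⁻¹ := by positivity
        linarith [q2.1]
      have e1 : 9 / a ^ 2 = 9 * (a ^ 2)⁻¹ := by ring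
      have e2 : 1 / (20000 * a) = 1 / 20000 * a⁻¹ := by field_simp
      rw [e1, e2]
      gcongr
    have hmain : |∑ k ∈ Finset.range m, coneTerm (k + (a + 1 / 2)) - (A2 / 2 + B / √3)| ≤ A3 / 4 := by
      rw [hA2, hB, hA3, Finset.sum_div, Finset.sum_div, Finset.sum_div, ← Finset.sum_add_distrib,
        ← Finset.sum_sub_distrib]
      refine (Finset.abs_sum_le_sum_abs _ _).trans (Finset.sum_le_sum fun k _ => ?_)
      have hk : (0 : ℝ) ≤ k := Nat.cast_nonneg k
      have h := coneTerm_estimate (p := k + (a + 1 / 2)) (by linarith)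
      have e1 : (√3 - 1) * (k + (a + 1 / 2)) = (√3 - 1) * (a + 1 / 2) + k * (√3 - 1) := by ring
      rw [e1] at h
      have e2 : (((k : ℝ) + (a + 1 / 2)) ^ 3)⁻¹ / 4 = 1 / (4 * (k + (a + 1 / 2)) ^ 3) := by
        have := hp k
        field_simp
      have e3 : (((k : ℝ) + (a + 1 / 2)) ^ 2)⁻¹ / 2 +
          (Int.fract ((√3 - 1) * (a + 1 / 2) + k * (√3 - 1)) - 1 / 2)
            * (((k : ℝ) + (a + 1 / 2)) ^ 2)⁻¹ / √3 = 1 / (2 * (k + (a + 1 / 2)) ^ 2) +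
          (Int.fract ((√3 - 1) * (a + 1 / 2) + k * (√3 - 1)) - 1 / 2) / √3 *
            (1 / (k + (a + 1 / 2)) ^ 2) := by
        have := hp k
        field_simp
      rw [e2, e3]
      exact h
    have hA3' : A3 ≤ (a ^ 2)⁻¹ / 2 := by
      have : 0 ≤ ((a + m) ^ 2)⁻¹ := by positivity
      linarith
    have hB3 : |B / √3| ≤ 0.5774 * (9 / a ^ 2 + 1 / (20000 * a)) := by
      rw [abs_div, abs_of_pos (by linarith : 0 < √3), div_le_iff₀ (by linarith)]
      have : 0 ≤ 9 / a ^ 2 + 1 / (20000 * a) := by positivity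
      nlinarith
    have hA2' : |A2 / 2 - (1 / a - 1 / (a + m)) / 2| ≤ 1 / (8 * a ^ 3) := by
      have e1 : 1 / (8 * a ^ 3) = (2 / a ^ 3) / 8 / 2 := by field_simp
      have : 0 ≤ 2 / (a + m) ^ 3 := by positivity
      rw [e1, one_div, one_div]
      have : 0 ≤ 2 / a ^ 3 / 8 := by positivity
      exact abs_le.2 ⟨by linarith [q2.2], by linarith [q2.1]⟩
    have e4 : 1 / (8 * a ^ 2) = (a ^ 2)⁻¹ / 2 / 4 := by field_simp; norm_num
    rw [e4]
    obtain ⟨c1, c2⟩ := abs_le.1 hmain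
    obtain ⟨c3, c4⟩ := abs_le.1 hB3
    obtain ⟨c5, c6⟩ := abs_le.1 hA2'
    exact abs_le.2 ⟨by linarith, by linarith⟩
  have hlim : Tendsto (fun m : ℕ => (1 / a - 1 / (a + m)) / 2) atTop (𝓝 (1 / (2 * a))) := by
    have h1 : Tendsto (fun m : ℕ => a + (m : ℝ)) atTop atTop :=
      tendsto_atTop_add_const_left _ _ tendsto_natCast_atTop_atTop
    have h2 : Tendsto (fun m : ℕ => 1 / (a + (m : ℝ))) atTop (𝓝 0) := by
      exact (tendsto_inv_atTop_zero.comp h1).congr fun m => by simp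
    have h3 := (h2.const_sub (1 / a)).div_const 2
    rw [sub_zero, div_div, mul_comm a 2] at h3
    exact h3
  exact le_of_tendsto ((hsum.sub hlim).abs) (Eventually.of_forall bound)

/-! ### Fixed-point evaluation of the cone sums -/

/-- Evaluate the first argument before passing it on. -/
noncomputable def force {α : Type} (x : ℕ) (k : ℕ → α) : α :=
  Nat.rec (k 0) (fun n _ => k (Nat.succ n)) x

lemma force_eq {α : Type} (x : ℕ) (k : ℕ → α) : force x k = k x := by cases x <;> rfl

/-- The `2 ^ k`-th iterate, where `app` is a version of function application. -/
noncomputable def doubleIterate {σ : Type} (app : (σ → σ) → σ → σ) (f : σ → σ) (k : ℕ) : σ → σ :=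
  Nat.rec f (fun _ ih s => app ih (ih s)) k

lemma doubleIterate_eq {σ : Type} {app : (σ → σ) → σ → σ} (happ : ∀ g s, app g s = g s)
    (f : σ → σ) (k : ℕ) (s : σ) : doubleIterate app f k s = f^[2 ^ k] s := by
  induction k generalizing s with
  | zero => rfl
  | succ k ih =>
    rw [pow_succ, mul_two, Function.iterate_add_apply, ← ih, ← ih]; exact happ _ _

/-- The state of the fixed point evaluation of the sum over the cone. -/
structure ConeState where
  P : ℕ
  t : ℕ
  D : ℕ
  H : ℕ
  U : ℕ

/-- Apply a function to an evaluated state. -/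
noncomputable def ConeState.app {α : Type} (g : ConeState → α) (s : ConeState) : α :=
  ConeState.rec (fun P t D H U => g (ConeState.mk P t D H U)) s

/-- One step of the fixed point evaluation with denominator `S`. -/
noncomputable def coneStep (S : ℕ) (s : ConeState) : ConeState :=
  ConeState.rec (fun P t D H U =>
    force (Nat.add P 2) fun P' =>
    force (Nat.div S P') fun f =>
    force (Nat.add t 2) fun a =>
    force (Nat.add t 4) fun b =>
    Bool.rec
      (force (Nat.sub (Nat.add D (Nat.div S a)) f) fun D' =>
       force (Nat.add H f) fun H' =>
       force (Nat.add U (Nat.div D' P')) fun U' => ConeState.mk P' a D' H' U')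
      (force (Nat.sub (Nat.add (Nat.add D (Nat.div S a)) (Nat.div S b)) f) fun D' =>
       force (Nat.add H f) fun H' =>
       force (Nat.add U (Nat.div D' P')) fun U' => ConeState.mk P' b D' H' U')
      (Nat.blt (Nat.mul b b) (Nat.mul 3 (Nat.mul P' P')))) s

/-- The number of `q ≡ P` modulo two with `P < q < P √3`. -/
noncomputable def windowSize (P : ℕ) : ℕ := ⌊(√3 - 1) * (P / 2 : ℝ)⌋₊

/-- Fixed point version of `∑ 1 / q` over the window. -/
noncomputable def windowSum (S P : ℕ) : ℕ := ∑ j ∈ Finset.range (windowSize P), S / (P + 2 * j + 2)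

/-- The state after `n` steps. -/
noncomputable def coneState (S P₀ n : ℕ) : ConeState where
  P := P₀ + 2 * n
  t := P₀ + 2 * n + 2 * windowSize (P₀ + 2 * n)
  D := windowSum S (P₀ + 2 * n)
  H := ∑ k ∈ Finset.range (n + 1), S / (P₀ + 2 * k)
  U := ∑ k ∈ Finset.range (n + 1), windowSum S (P₀ + 2 * k) / (P₀ + 2 * k)

lemma windowSize_bounds (P : ℕ) : (P + 2 * windowSize P : ℝ) ≤ √3 * P ∧
    √3 * P < P + 2 * windowSize P + 2 := by
  obtain ⟨hl, hu⟩ := sqrt_three_bounds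
  have h0 : 0 ≤ (√3 - 1) * (P / 2 : ℝ) := mul_nonneg (by linarith) (by positivity)
  have h1 := Nat.floor_le h0
  have h2 := Nat.lt_floor_add_one ((√3 - 1) * (P / 2 : ℝ))
  unfold windowSize
  exact ⟨by linarith, by linarith⟩

lemma windowSize_eq {P J : ℕ} (h1 : (P + 2 * J : ℝ) ≤ √3 * P) (h2 : √3 * P < P + 2 * J + 2) :
    windowSize P = J := by
  obtain ⟨hl, hu⟩ := sqrt_three_bounds
  have h0 : 0 ≤ (√3 - 1) * (P / 2 : ℝ) := mul_nonneg (by linarith) (by positivity)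
  rw [windowSize, Nat.floor_eq_iff h0]
  exact ⟨by linarith, by linarith⟩

lemma sq_lt_three_mul_sq_iff (b P : ℕ) : b * b < 3 * (P * P) ↔ (b : ℝ) < √3 * P := by
  have h3 : (√3 * P) ^ 2 = 3 * (P * P) := by
    rw [mul_pow, Real.sq_sqrt (by norm_num)]; ring
  have h := sq_lt_sq₀ (a := (b : ℝ)) (b := √3 * P) (by positivity) (by positivity)
  rw [← h, h3, sq]
  exact_mod_cast Iff.rfl

/-- Going from P to P + 2 removes q = P + 2 from the window and moves its end by 2√3, which lies
between 2 and 4. So the next q = t + 2 always enters and t + 4 enters exactly if (t + 4)² < 3(P +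
2)². Equality cannot occur, again by irrationality. -/
lemma coneStep_coneState (S P₀ n : ℕ) (hP : 0 < P₀) :
    coneStep S (coneState S P₀ n) = coneState S P₀ (n + 1) := by
  obtain ⟨hl, hu⟩ := sqrt_three_bounds
  set P := P₀ + 2 * n with hPdef
  have hP' : P₀ + 2 * (n + 1) = P + 2 := by omega
  obtain ⟨w1, w2⟩ := windowSize_bounds P
  set J := windowSize P with hJ
  have hshift : windowSum S P + S / (P + 2 * J + 2)
      = S / (P + 2) + ∑ j ∈ Finset.range J, S / (P + 2 + 2 * j + 2) := by
    rw [windowSum, ← hJ, ← Finset.sum_range_succ, Finset.sum_range_succ']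
    rw [add_comm]
    congr 1
    exact Finset.sum_congr rfl fun j _ => by congr 1; ring
  have hH : ∑ k ∈ Finset.range (n + 1 + 1), S / (P₀ + 2 * k)
      = ∑ k ∈ Finset.range (n + 1), S / (P₀ + 2 * k) + S / (P + 2) := by
    rw [Finset.sum_range_succ, hP']
  have hU : ∑ k ∈ Finset.range (n + 1 + 1), windowSum S (P₀ + 2 * k) / (P₀ + 2 * k)
      = ∑ k ∈ Finset.range (n + 1), windowSum S (P₀ + 2 * k) / (P₀ + 2 * k)
        + windowSum S (P + 2) / (P + 2) := by
    rw [Finset.sum_range_succ, hP']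
  have hdiv : ∀ a b, Nat.div a b = a / b := fun _ _ => rfl
  simp only [coneStep, coneState, force_eq, Nat.add_eq, hdiv, Nat.sub_eq, Nat.mul_eq,
    hP', ← hPdef, ← hJ, hH, hU]
  by_cases hc : (P + 2 * J + 4) * (P + 2 * J + 4) < 3 * ((P + 2) * (P + 2))
  · have hb : Nat.blt ((P + 2 * J + 4) * (P + 2 * J + 4)) (3 * ((P + 2) * (P + 2))) = true := by
      simpa [Nat.blt] using hc
    have hJ' : windowSize (P + 2) = J + 1 := by
      rw [sq_lt_three_mul_sq_iff] at hc
      push_cast at hc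
      apply windowSize_eq <;> push_cast <;> linarith
    have hD : windowSum S P + S / (P + 2 * J + 2) + S / (P + 2 * J + 4) - S / (P + 2)
        = windowSum S (P + 2) := by
      rw [hshift, windowSum, hJ', Finset.sum_range_succ]
      have : P + 2 + 2 * J + 2 = P + 2 * J + 4 := by ring
      rw [this, add_assoc, Nat.add_sub_cancel_left]
    rw [hb]
    simp only [hD, hJ']
    congr 1
    ring
  · have hb : Nat.blt ((P + 2 * J + 4) * (P + 2 * J + 4)) (3 * ((P + 2) * (P + 2))) = false := by
      rw [← Bool.not_eq_true]
      simpa [Nat.blt] using hc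
    have hJ' : windowSize (P + 2) = J := by
      have hne : (P + 2 * J + 4) * (P + 2 * J + 4) ≠ 3 * ((P + 2) * (P + 2)) := by
        have := sq_ne_three_mul_sq (a := P + 2 * J + 4) (b := P + 2) (by omega)
        rwa [sq, sq] at this
      rw [sq_lt_three_mul_sq_iff] at hc
      push_cast at hc
      apply windowSize_eq
      · push_cast; linarith
      · have h1 : √3 * ((P + 2 : ℕ) : ℝ) ≠ (P + 2 * J + 4 : ℕ) := by
          intro h
          apply hne
          have h3 : (√3 * ((P + 2 : ℕ) : ℝ)) ^ 2 = 3 * (((P + 2 : ℕ) : ℝ) * ((P + 2 : ℕ) : ℝ)) := by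
            rw [mul_pow, Real.sq_sqrt (by norm_num)]; ring
          rw [h, sq] at h3
          exact_mod_cast h3
        push_cast at h1 ⊢
        have := lt_of_le_of_ne (not_lt.1 hc) h1
        linarith
    have hD : windowSum S P + S / (P + 2 * J + 2) - S / (P + 2) = windowSum S (P + 2) := by
      rw [hshift, windowSum, hJ', Nat.add_sub_cancel_left]
    rw [hb]
    simp only [hD, hJ']
    congr 1
    ring

lemma coneState_eq_iterate (S P₀ n : ℕ) (hP : 0 < P₀) :
    coneState S P₀ n = (coneStep S)^[n] (coneState S P₀ 0) := by
  induction n with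
  | zero => rfl
  | succ n ih => rw [Function.iterate_succ_apply', ← ih, coneStep_coneState S P₀ n hP]


lemma windowSize_le (P : ℕ) : windowSize P ≤ P := by
  obtain ⟨hl, hu⟩ := sqrt_three_bounds
  have h := (windowSize_bounds P).1
  have hP : (0 : ℝ) ≤ P := Nat.cast_nonneg P
  have : (windowSize P : ℝ) ≤ P := by nlinarith
  exact_mod_cast this

lemma natCast_div_bounds (a b : ℕ) (hb : 0 < b) :
    ((a / b : ℕ) : ℝ) ≤ a / b ∧ (a : ℝ) / b ≤ ((a / b : ℕ) : ℝ) + 1 := by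
  refine ⟨Nat.cast_div_le, ?_⟩
  have hb' : (0 : ℝ) < b := by exact_mod_cast hb
  rw [div_le_iff₀ hb']
  have h := Nat.lt_div_mul_add (a := a) hb
  have h' : (a : ℝ) < (a / b : ℕ) * b + b := by exact_mod_cast h
  linarith

lemma natCast_div_sandwich {a b : ℕ} {x e : ℝ} (hb : 0 < b) (h : (a : ℝ) ≤ x ∧ x ≤ a + e) :
    ((a / b : ℕ) : ℝ) ≤ x / b ∧ x / b ≤ ((a / b : ℕ) : ℝ) + (e / b + 1) := by
  obtain ⟨h1, h2⟩ := natCast_div_bounds a b hb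
  have hb' : (0 : ℝ) < b := by exact_mod_cast hb
  have h3 : (a : ℝ) / b ≤ x / b := by gcongr; exact h.1
  have h4 : x / b ≤ (a + e) / b := by gcongr; exact h.2
  rw [add_div] at h4
  exact ⟨by linarith, by linarith⟩

lemma sum_sandwich {f : ℕ → ℕ} {x e : ℕ → ℝ} (n : ℕ)
    (h : ∀ k < n, (f k : ℝ) ≤ x k ∧ x k ≤ f k + e k) :
    ((∑ k ∈ Finset.range n, f k : ℕ) : ℝ) ≤ ∑ k ∈ Finset.range n, x k ∧
      ∑ k ∈ Finset.range n, x k ≤ ((∑ k ∈ Finset.range n, f k : ℕ) : ℝ)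
        + ∑ k ∈ Finset.range n, e k := by
  push_cast
  rw [← Finset.sum_add_distrib]
  exact ⟨Finset.sum_le_sum fun k hk => (h k (Finset.mem_range.1 hk)).1,
    Finset.sum_le_sum fun k hk => (h k (Finset.mem_range.1 hk)).2⟩

/-- The sum `∑ 1 / q` over the window. -/
noncomputable def windowSumReal (P : ℕ) : ℝ :=
  ∑ j ∈ Finset.range (windowSize P), 1 / (P + 2 * j + 2 : ℝ)

lemma windowSum_sandwich (S P : ℕ) : (windowSum S P : ℝ) ≤ S * windowSumReal P ∧
    S * windowSumReal P ≤ windowSum S P + P := by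
  have h := sum_sandwich (f := fun j => S / (P + 2 * j + 2))
    (x := fun j => S * (1 / (P + 2 * j + 2 : ℝ))) (e := fun _ => 1) (windowSize P) (fun j _ => by
      have := natCast_div_bounds S (P + 2 * j + 2) (by omega)
      push_cast at this
      rw [mul_one_div]
      exact this)
  rw [← Finset.mul_sum] at h
  refine ⟨h.1, h.2.trans ?_⟩
  have : (windowSize P : ℝ) ≤ P := by exact_mod_cast windowSize_le P
  simp only [Finset.sum_const, Finset.card_range, nsmul_eq_mul, mul_one, windowSum]
  linarith

lemma coneTerm_half (P : ℕ) (hP : 0 < P) :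
    coneTerm (P / 2 : ℝ) = Real.log 3 * (1 / P) - 4 * (windowSumReal P / P) := by
  have hP' : (0 : ℝ) < P := by exact_mod_cast hP
  rw [coneTerm, windowSumReal]
  have e : ∀ j : ℕ, 1 / ((P : ℝ) / 2 + j + 1) = 2 * (1 / (P + 2 * j + 2 : ℝ)) := by
    intro j
    have : (0 : ℝ) ≤ j := Nat.cast_nonneg j
    field_simp
  simp only [e]
  rw [← Finset.mul_sum, ← windowSize]
  field_simp
  ring

/-- Every division rounds down by less than one. A window sum loses at most its length, hence at
most P, which becomes at most 1 after division by P; that division loses another 1. This gives error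
2 per step in `U` and 1 in `H`. -/
lemma coneState_sandwich (S P₀ n : ℕ) (hP : 0 < P₀) :
    (((coneState S P₀ n).H : ℝ) ≤ S * ∑ k ∈ Finset.range (n + 1), 1 / ((P₀ + 2 * k : ℕ) : ℝ) ∧
      S * ∑ k ∈ Finset.range (n + 1), 1 / ((P₀ + 2 * k : ℕ) : ℝ)
        ≤ (coneState S P₀ n).H + (n + 1)) ∧
    (((coneState S P₀ n).U : ℝ) ≤ S * ∑ k ∈ Finset.range (n + 1),
        windowSumReal (P₀ + 2 * k) / ((P₀ + 2 * k : ℕ) : ℝ) ∧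
      S * ∑ k ∈ Finset.range (n + 1), windowSumReal (P₀ + 2 * k) / ((P₀ + 2 * k : ℕ) : ℝ)
        ≤ (coneState S P₀ n).U + 2 * (n + 1)) := by
  constructor
  · have h := sum_sandwich (f := fun k => S / (P₀ + 2 * k))
      (x := fun k => S * (1 / ((P₀ + 2 * k : ℕ) : ℝ))) (e := fun _ => 1) (n + 1) (fun k _ => by
        rw [mul_one_div]
        exact natCast_div_bounds S (P₀ + 2 * k) (by omega))
    rw [← Finset.mul_sum] at h
    simpa [coneState] using h
  · have h := sum_sandwich (f := fun k => windowSum S (P₀ + 2 * k) / (P₀ + 2 * k))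
      (x := fun k => S * (windowSumReal (P₀ + 2 * k) / ((P₀ + 2 * k : ℕ) : ℝ)))
      (e := fun _ => 2) (n + 1) (fun k _ => by
        have h := natCast_div_sandwich (b := P₀ + 2 * k) (by omega) (windowSum_sandwich S (P₀ + 2 * k))
        have h0 : (0 : ℝ) < ((P₀ + 2 * k : ℕ) : ℝ) := by exact_mod_cast (by omega : 0 < P₀ + 2 * k)
        rw [div_self h0.ne'] at h
        rw [← mul_div_assoc]
        exact ⟨h.1, h.2.trans (by linarith)⟩)
    rw [← Finset.mul_sum] at h
    refine ⟨by simpa [coneState] using h.1, h.2.trans ?_⟩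
    simp [coneState]; linarith

/-- With p = P/2, the progression of step 2 from `P₀` covers the integers for `P₀ = 2` and the
half-integers for `P₀ = 1`; the remaining tail is in the form of the tail estimate. -/
lemma tsum_coneTerm_eq (P₀ n : ℕ) (hP : 0 < P₀) :
    ∑' k : ℕ, coneTerm (k + P₀ / 2) =
      Real.log 3 * ∑ k ∈ Finset.range (n + 1), 1 / ((P₀ + 2 * k : ℕ) : ℝ)
      - 4 * ∑ k ∈ Finset.range (n + 1), windowSumReal (P₀ + 2 * k) / ((P₀ + 2 * k : ℕ) : ℝ)
      + ∑' k : ℕ, coneTerm (k + ((n + 1 / 2 + P₀ / 2 : ℝ) + 1 / 2)) := by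
  have hP' : (0 : ℝ) < P₀ := by exact_mod_cast hP
  rw [← (summable_coneTerm (τ := (P₀ : ℝ) / 2) (by positivity)).sum_add_tsum_nat_add (n + 1)]
  congr 1
  · rw [Finset.mul_sum, Finset.mul_sum, ← Finset.sum_sub_distrib]
    refine Finset.sum_congr rfl fun k _ => ?_
    rw [← coneTerm_half _ (by omega)]
    congr 1
    push_cast
    ring
  · refine tsum_congr fun k => ?_
    congr 1
    push_cast
    ring

/-- Test the output of the evaluation. -/
noncomputable def coneCheck (H U : ℕ) (s : ConeState) : Bool :=
  ConeState.rec (fun _ _ _ H' U' => and (Nat.beq H' H) (Nat.beq U' U)) s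

lemma coneState_of_check {S P₀ i H U : ℕ} {t : ℕ} (hP : 0 < P₀)
    (h0 : coneState S P₀ 0 = ⟨P₀, t, 0, S / P₀, 0⟩)
    (h : coneCheck H U (doubleIterate ConeState.app (coneStep S) i ⟨P₀, t, 0, S / P₀, 0⟩) = true) :
    (coneState S P₀ (2 ^ i)).H = H ∧ (coneState S P₀ (2 ^ i)).U = U := by
  rw [doubleIterate_eq (app := ConeState.app) (fun _ _ => rfl), ← h0, ← coneState_eq_iterate S P₀ _ hP, coneCheck, Bool.and_eq_true] at h
  exact ⟨Nat.eq_of_beq_eq_true h.1, Nat.eq_of_beq_eq_true h.2⟩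

lemma coneState_zero (S P₀ : ℕ) (h : windowSize P₀ = 0) :
    coneState S P₀ 0 = ⟨P₀, P₀, 0, S / P₀, 0⟩ := by
  simp [coneState, windowSum, h]

lemma windowSize_one : windowSize 1 = 0 := by
  obtain ⟨hl, hu⟩ := sqrt_three_bounds
  apply windowSize_eq <;> push_cast <;> linarith

lemma windowSize_two : windowSize 2 = 0 := by
  obtain ⟨hl, hu⟩ := sqrt_three_bounds
  apply windowSize_eq <;> push_cast <;> linarith

/-- The scale is 10²⁰ and P runs up to 2¹⁶ + 2, so the accumulated rounding is below 10⁻¹⁵ and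
negligible against the tail. -/
lemma coneState_two : (coneState (100000000000000000000) 2 (2 ^ 15)).H = 548723457432949765519 ∧
    (coneState (100000000000000000000) 2 (2 ^ 15)).U = 129592529467303097836 :=
  coneState_of_check two_pos (coneState_zero _ _ windowSize_two) (by decide +kernel)

lemma coneState_one : (coneState (100000000000000000000) 1 (2 ^ 14)).H = 583381579365476988530 ∧
    (coneState (100000000000000000000) 1 (2 ^ 14)).U = 123833710851145086908 :=
  coneState_of_check one_pos (coneState_zero _ _ windowSize_one) (by decide +kernel)

lemma log_three_le_two : Real.log 3 ≤ 2 := by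
  linarith [Real.log_le_sub_one_of_pos (by norm_num : (0 : ℝ) < 3)]

lemma log_three_nonneg : 0 ≤ Real.log 3 := Real.log_nonneg (by norm_num)

lemma harmonic_sum_two : |∑ k ∈ Finset.range (2 ^ 15 + 1), 1 / ((2 + 2 * k : ℕ) : ℝ)
    - 5.48723457432949| ≤ 1 / 10 ^ 13 := by
  obtain ⟨⟨h1, h2⟩, -⟩ := coneState_sandwich 100000000000000000000 2 (2 ^ 15) two_pos
  rw [coneState_two.1] at h1 h2
  set A := ∑ k ∈ Finset.range (2 ^ 15 + 1), 1 / ((2 + 2 * k : ℕ) : ℝ)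
  clear_value A
  norm_num at h1 h2
  rw [abs_le]
  constructor <;> norm_num <;> linarith

lemma tsum_coneTerm_one : |∑' k : ℕ, coneTerm (k + 1)
    - (5.48723457432949 * Real.log 3 - 4 * 1.29592529467303 + 1 / 65539)| ≤ 6 / 10 ^ 9 := by
  have h0 := tsum_coneTerm_eq 2 (2 ^ 15) two_pos
  obtain ⟨-, h3, h4⟩ := coneState_sandwich (100000000000000000000) 2 (2 ^ 15) two_pos
  have hH := harmonic_sum_two
  rw [coneState_two.2] at h3 h4
  -- Here a = 2¹⁵ + 3/2, so the leading tail term 1/(2a) is 1/65539. Almost all of the error 6·10⁻⁹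
  -- is the discrepancy term 0.5774 · 9/a².
  have ht := abs_tsum_coneTerm_sub_le (a := ((2 ^ 15 : ℕ) + 1 / 2 + (2 : ℕ) / 2 : ℝ))
    (by push_cast; norm_num)
  have hl := log_three_le_two
  have hl0 := log_three_nonneg
  have e : ∑' k : ℕ, coneTerm (k + 1) = ∑' k : ℕ, coneTerm (k + (2 : ℕ) / 2) := by norm_num
  rw [e, h0]
  set A := ∑ k ∈ Finset.range (2 ^ 15 + 1), 1 / ((2 + 2 * k : ℕ) : ℝ)
  set B := ∑ k ∈ Finset.range (2 ^ 15 + 1), windowSumReal (2 + 2 * k) / ((2 + 2 * k : ℕ) : ℝ)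
  set T := ∑' k : ℕ, coneTerm (k + (((2 ^ 15 : ℕ) + 1 / 2 + (2 : ℕ) / 2 : ℝ) + 1 / 2))
  clear_value A B T
  obtain ⟨a1, a2⟩ := abs_le.1 hH
  have b1 : |Real.log 3 * (A - 5.48723457432949)| ≤ 2 * (1 / 10 ^ 13) := by
    rw [abs_mul, abs_of_nonneg hl0]
    exact mul_le_mul hl hH (abs_nonneg _) (by norm_num)
  obtain ⟨b2, b3⟩ := abs_le.1 b1
  obtain ⟨c1, c2⟩ := abs_le.1 ht
  rw [mul_sub] at b2 b3
  norm_num at h3 h4 c1 c2 b2 b3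
  rw [abs_le]
  constructor <;> norm_num <;> linarith

/-- This sum enters the constant with weight 1/3, so a larger tail error is tolerable. Here a = 2¹⁴
+ 1. -/
lemma tsum_coneTerm_half : |∑' k : ℕ, coneTerm (k + 1 / 2)
    - (5.83381579365476 * Real.log 3 - 4 * 1.23833710851145 + 1 / 32770)| ≤ 22 / 10 ^ 9 := by
  have h0 := tsum_coneTerm_eq 1 (2 ^ 14) one_pos
  obtain ⟨⟨h1, h2⟩, h3, h4⟩ := coneState_sandwich (100000000000000000000) 1 (2 ^ 14) one_pos
  rw [coneState_one.1] at h1 h2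
  rw [coneState_one.2] at h3 h4
  have ht := abs_tsum_coneTerm_sub_le (a := ((2 ^ 14 : ℕ) + 1 / 2 + (1 : ℕ) / 2 : ℝ))
    (by push_cast; norm_num)
  have hl := log_three_le_two
  have hl0 := log_three_nonneg
  have e : ∑' k : ℕ, coneTerm (k + 1 / 2) = ∑' k : ℕ, coneTerm (k + (1 : ℕ) / 2) := by norm_num
  rw [e, h0]
  set A := ∑ k ∈ Finset.range (2 ^ 14 + 1), 1 / ((1 + 2 * k : ℕ) : ℝ)
  set B := ∑ k ∈ Finset.range (2 ^ 14 + 1), windowSumReal (1 + 2 * k) / ((1 + 2 * k : ℕ) : ℝ)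
  set T := ∑' k : ℕ, coneTerm (k + (((2 ^ 14 : ℕ) + 1 / 2 + (1 : ℕ) / 2 : ℝ) + 1 / 2))
  clear_value A B T
  norm_num at h1 h2 h3 h4
  have hA : |A - 5.83381579365476| ≤ 1 / 10 ^ 13 := by
    rw [abs_le]; constructor <;> norm_num <;> linarith
  have b1 : |Real.log 3 * (A - 5.83381579365476)| ≤ 2 * (1 / 10 ^ 13) := by
    rw [abs_mul, abs_of_nonneg hl0]
    exact mul_le_mul hl hA (abs_nonneg _) (by norm_num)
  obtain ⟨b2, b3⟩ := abs_le.1 b1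
  obtain ⟨c1, c2⟩ := abs_le.1 ht
  rw [mul_sub] at b2 b3
  norm_num at c1 c2 b2 b3
  rw [abs_le]
  constructor <;> norm_num <;> linarith


/-! ### Fixed-point evaluation of logarithms and logarithmic sums -/

/-- The odd series for log((1 + y)/(1 - y)) at y = 1/(2a + 1) ≤ 1/3. Its remainder is dominated by a
geometric series of ratio 1/9, whose sum 9/4 · y^(2K+1) is below the stated bound. -/
lemma log_one_add_inv_sandwich {a : ℝ} (ha : 1 ≤ a) (K : ℕ) :
    ∑ k ∈ Finset.range K, 2 * (1 / (2 * k + 1)) * (1 / (2 * a + 1)) ^ (2 * k + 1)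
        ≤ Real.log (1 + a⁻¹) ∧
      Real.log (1 + a⁻¹) ≤ ∑ k ∈ Finset.range K,
        2 * (1 / (2 * k + 1)) * (1 / (2 * a + 1)) ^ (2 * k + 1)
        + 3 * (1 / (2 * a + 1)) ^ (2 * K + 1) := by
  have hs := Real.hasSum_log_one_add_inv (a := a) (by linarith)
  set y := 1 / (2 * a + 1)
  have hy0 : 0 < y := by positivity
  have hy : y ≤ 1 / 3 := by
    apply one_div_le_one_div_of_le (by norm_num); linarith
  have hy2 : y ^ 2 ≤ 1 / 9 := by nlinarith
  rw [← hs.tsum_eq, ← hs.summable.sum_add_tsum_nat_add K]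
  have hg : HasSum (fun k : ℕ => 2 * y ^ (2 * K + 1) * (1 / 9 : ℝ) ^ k)
      (2 * y ^ (2 * K + 1) * (1 - 1 / 9)⁻¹) :=
    (hasSum_geometric_of_lt_one (by norm_num) (by norm_num)).mul_left _
  have hle : ∀ k : ℕ, 2 * (1 / (2 * ((k + K : ℕ) : ℝ) + 1)) * y ^ (2 * (k + K) + 1)
      ≤ 2 * y ^ (2 * K + 1) * (1 / 9 : ℝ) ^ k := by
    intro k
    have e : y ^ (2 * (k + K) + 1) = y ^ (2 * K + 1) * (y ^ 2) ^ k := by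
      rw [← pow_mul, ← pow_add]; congr 1; ring
    have h1 : 1 / (2 * ((k + K : ℕ) : ℝ) + 1) ≤ 1 := by
      rw [div_le_one (by positivity)]
      have : (0 : ℝ) ≤ ((k + K : ℕ) : ℝ) := Nat.cast_nonneg _
      linarith
    rw [e]
    calc 2 * (1 / (2 * ((k + K : ℕ) : ℝ) + 1)) * (y ^ (2 * K + 1) * (y ^ 2) ^ k)
        ≤ 2 * 1 * (y ^ (2 * K + 1) * (1 / 9) ^ k) := by gcongr
      _ = _ := by ring
  constructor
  · have : 0 ≤ ∑' k : ℕ, 2 * (1 / (2 * ((k + K : ℕ) : ℝ) + 1)) * y ^ (2 * (k + K) + 1) :=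
      tsum_nonneg fun k => by positivity
    linarith
  · have h2 := ((summable_nat_add_iff K).2 hs.summable).tsum_le_of_sum_le (fun s =>
      (Finset.sum_le_sum fun k _ => hle k).trans
        (hg.summable.sum_le_tsum s fun k _ => by positivity))
    rw [hg.tsum_eq] at h2
    have h3 : 0 < y ^ (2 * K + 1) := by positivity
    norm_num at h2 ⊢
    linarith

/-- Fixed point version of the logarithm of `(y + 1) / (y - 1)`. -/
noncomputable def logInc (S y : ℕ) (K : ℕ) : ℕ :=
  Nat.rec 0 (fun i acc => Nat.add acc
    (Nat.div (Nat.div (Nat.mul 2 S) (Nat.pow y (Nat.succ (Nat.mul 2 i)))) (Nat.succ (Nat.mul 2 i)))) K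

lemma logInc_eq (S y K : ℕ) :
    logInc S y K = ∑ i ∈ Finset.range K, 2 * S / y ^ (2 * i + 1) / (2 * i + 1) := by
  induction K with
  | zero => rfl
  | succ K ih => rw [Finset.sum_range_succ, ← ih]; rfl

/-- Sixteen terms with two roundings each give 32, and the truncation error is at most 3 · 3⁻³³ <
10⁻¹⁵. -/
lemma logInc_sandwich (S n : ℕ) (hn : 1 ≤ n) :
    (logInc S (2 * n + 1) 16 : ℝ) ≤ S * Real.log (1 + (n : ℝ)⁻¹) ∧
      S * Real.log (1 + (n : ℝ)⁻¹) ≤ logInc S (2 * n + 1) 16 + (32 + S / 10 ^ 15) := by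
  obtain ⟨l1, l2⟩ := log_one_add_inv_sandwich (a := n) (by exact_mod_cast hn) 16
  have hS : (0 : ℝ) ≤ S := Nat.cast_nonneg S
  have h := sum_sandwich (f := fun i => 2 * S / (2 * n + 1) ^ (2 * i + 1) / (2 * i + 1))
    (x := fun i : ℕ => S * (2 * (1 / (2 * i + 1)) * (1 / (2 * n + 1)) ^ (2 * i + 1) : ℝ))
    (e := fun _ => 2) 16 (fun i _ => by
      have h := natCast_div_sandwich (b := 2 * i + 1) (by omega)
        (natCast_div_bounds (2 * S) ((2 * n + 1) ^ (2 * i + 1)) (by positivity))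
      have e : ((2 * S : ℕ) : ℝ) / (((2 * n + 1) ^ (2 * i + 1) : ℕ) : ℝ) / ((2 * i + 1 : ℕ) : ℝ)
          = S * (2 * (1 / (2 * i + 1)) * (1 / (2 * n + 1)) ^ (2 * i + 1) : ℝ) := by
        push_cast
        rw [one_div_pow]
        ring
      rw [e] at h
      refine ⟨h.1, h.2.trans ?_⟩
      have : (1 : ℝ) / ((2 * i + 1 : ℕ) : ℝ) ≤ 1 := by
        rw [div_le_one (by positivity)]; exact_mod_cast (by omega : 1 ≤ 2 * i + 1)
      linarith)
  rw [← Finset.mul_sum, ← logInc_eq] at h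
  have h3 : 3 * (1 / (2 * (n : ℝ) + 1)) ^ (2 * 16 + 1) ≤ 1 / 10 ^ 15 := by
    have hy : 1 / (2 * (n : ℝ) + 1) ≤ 1 / 3 := by
      apply one_div_le_one_div_of_le (by norm_num)
      have : (1 : ℝ) ≤ n := by exact_mod_cast hn
      linarith
    calc 3 * (1 / (2 * (n : ℝ) + 1)) ^ (2 * 16 + 1) ≤ 3 * (1 / 3) ^ (2 * 16 + 1) := by gcongr
      _ ≤ _ := by norm_num
  constructor
  · exact h.1.trans (mul_le_mul_of_nonneg_left l1 hS)
  · refine (mul_le_mul_of_nonneg_left (l2.trans (add_le_add_right h3 _)) hS).trans ?_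
    have h4 := h.2
    simp only [Finset.sum_const, Finset.card_range, nsmul_eq_mul] at h4
    push_cast at h4
    rw [mul_add, mul_one_div]
    linarith

/-- The state of the fixed point evaluation of sums of logarithms. -/
structure LogState where
  n : ℕ
  L : ℕ
  Z : ℕ
  A : ℕ
  B : ℕ

/-- Apply a function to an evaluated state. -/
noncomputable def LogState.app {α : Type} (g : LogState → α) (s : LogState) : α :=
  LogState.rec (fun n L Z A B => g (LogState.mk n L Z A B)) s

/-- The summand with index `n` for a residue class modulo four. -/
noncomputable def residueTerm (n r v : ℕ) : ℕ :=
  Bool.rec 0 (Nat.div v n) (Nat.beq (Nat.mod n 4) r)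

/-- One step of the fixed point evaluation with denominator `S`. -/
noncomputable def logStep (S : ℕ) (s : LogState) : LogState :=
  LogState.rec (fun n L Z A B =>
    force (Nat.add L (logInc S (Nat.succ (Nat.mul 2 n)) 16)) fun L' =>
    force (Nat.succ n) fun n' =>
    force (Nat.add Z (Nat.div L' (Nat.mul n' n'))) fun Z' =>
    force (Nat.add A (residueTerm n' 1 L')) fun A' =>
    force (Nat.add B (residueTerm n' 3 L')) fun B' => LogState.mk n' L' Z' A' B') s

/-- The sum of `log m / m` over a residue class modulo four. -/
noncomputable def residueSum (r n : ℕ) : ℝ :=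
  ∑ m ∈ Finset.range (n + 1), if m % 4 = r then Real.log m / m else 0

/-- The state approximates the sums up to a bounded error per step. -/
structure LogState.Sound (S : ℕ) (e : ℝ) (s : LogState) : Prop where
  one_le : 1 ≤ s.n
  log : (s.L : ℝ) ≤ S * Real.log s.n ∧ S * Real.log s.n ≤ s.L + e * s.n
  sq : (s.Z : ℝ) ≤ S * ∑ m ∈ Finset.range (s.n + 1), Real.log m / m ^ 2 ∧
    S * ∑ m ∈ Finset.range (s.n + 1), Real.log m / m ^ 2 ≤ s.Z + (e + 1) * s.n
  one : (s.A : ℝ) ≤ S * residueSum 1 s.n ∧ S * residueSum 1 s.n ≤ s.A + (e + 1) * s.n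
  three : (s.B : ℝ) ≤ S * residueSum 3 s.n ∧ S * residueSum 3 s.n ≤ s.B + (e + 1) * s.n

lemma residueTerm_eq (n r v : ℕ) : residueTerm n r v = if n % 4 = r then v / n else 0 := by
  unfold residueTerm
  have hdm : Nat.mod n 4 = n % 4 := rfl
  by_cases h : n % 4 = r
  · have : Nat.beq (Nat.mod n 4) r = true := by rw [hdm]; simpa using h
    rw [this, if_pos h]; rfl
  · have : Nat.beq (Nat.mod n 4) r = false := by
      rw [← Bool.not_eq_true, Nat.beq_eq]; exact h
    rw [this, if_neg h]

lemma residueTerm_sandwich {S n r v : ℕ} {e : ℝ} (hn : 1 ≤ n) (he : 0 ≤ e)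
    (h : (v : ℝ) ≤ S * Real.log n ∧ S * Real.log n ≤ v + e * n) :
    (residueTerm n r v : ℝ) ≤ S * (if n % 4 = r then Real.log n / n else 0) ∧
      S * (if n % 4 = r then Real.log n / n else 0) ≤ residueTerm n r v + (e + 1) := by
  rw [residueTerm_eq]
  split_ifs
  · have h1 := natCast_div_sandwich (b := n) hn h
    have hn' : (n : ℝ) ≠ 0 := by positivity
    rw [mul_div_cancel_right₀ e hn'] at h1
    rwa [← mul_div_assoc]
  · simp; linarith

/-- The logarithm error grows linearly, at most e n. Dividing by n or n² leaves at most e for each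
added summand, and rounding adds at most one more. -/
lemma LogState.Sound.step {S : ℕ} {e : ℝ} (he : 32 + (S : ℝ) / 10 ^ 15 ≤ e) {s : LogState}
    (hs : s.Sound S e) : (logStep S s).Sound S e := by
  obtain ⟨n, L, Z, A, B⟩ := s
  obtain ⟨h1, h2, h3, h4, h5⟩ := hs
  dsimp only at h1 h2 h3 h4 h5
  have he0 : 0 ≤ e := le_trans (by positivity) he
  have hn' : (1 : ℝ) ≤ n := by exact_mod_cast h1
  set L' := L + logInc S (2 * n + 1) 16 with hL'
  have hstep : logStep S ⟨n, L, Z, A, B⟩ = ⟨n + 1, L', Z + L' / ((n + 1) * (n + 1)),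
      A + residueTerm (n + 1) 1 L', B + residueTerm (n + 1) 3 L'⟩ := by
    simp only [logStep, force_eq]; rfl
  have hlog : (L' : ℝ) ≤ S * Real.log ((n + 1 : ℕ) : ℝ) ∧
      S * Real.log ((n + 1 : ℕ) : ℝ) ≤ L' + e * ((n + 1 : ℕ) : ℝ) := by
    have hl : Real.log ((n + 1 : ℕ) : ℝ) = Real.log n + Real.log (1 + (n : ℝ)⁻¹) := by
      rw [← Real.log_mul (by positivity) (by positivity)]
      congr 1
      push_cast
      field_simp
    obtain ⟨c1, c2⟩ := logInc_sandwich S n h1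
    rw [hl, hL']
    push_cast
    constructor
    · linarith [h2.1]
    · linarith [h2.2]
  rw [hstep]
  refine ⟨by simp, hlog, ?_, ?_, ?_⟩
  · dsimp only
    rw [Finset.sum_range_succ, mul_add (S : ℝ)]
    have c := natCast_div_sandwich (b := (n + 1) * (n + 1)) (by positivity) hlog
    have e1 : S * Real.log ((n + 1 : ℕ) : ℝ) / (((n + 1) * (n + 1) : ℕ) : ℝ)
        = S * (Real.log ((n + 1 : ℕ) : ℝ) / ((n + 1 : ℕ) : ℝ) ^ 2) := by
      push_cast; ring
    have e2 : e * ((n + 1 : ℕ) : ℝ) / (((n + 1) * (n + 1) : ℕ) : ℝ) ≤ e := by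
      push_cast
      rw [div_le_iff₀ (by positivity)]
      nlinarith [mul_nonneg he0 (by linarith : (0 : ℝ) ≤ n)]
    rw [e1] at c
    push_cast at c e2 h3 ⊢
    exact ⟨by linarith [h3.1, c.1], by linarith [h3.2, c.2]⟩
  · have c := residueTerm_sandwich (r := 1) (by omega) he0 hlog
    dsimp only
    rw [residueSum, Finset.sum_range_succ, ← residueSum, mul_add]
    push_cast at c ⊢
    exact ⟨by linarith [h4.1, c.1], by linarith [h4.2, c.2]⟩
  · have c := residueTerm_sandwich (r := 3) (by omega) he0 hlog
    dsimp only
    rw [residueSum, Finset.sum_range_succ, ← residueSum, mul_add]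
    push_cast at c ⊢
    exact ⟨by linarith [h5.1, c.1], by linarith [h5.2, c.2]⟩

lemma LogState.Sound.init (S : ℕ) {e : ℝ} (he : 0 ≤ e) : (LogState.mk 1 0 0 0 0).Sound S e := by
  refine ⟨le_rfl, ?_, ?_, ?_, ?_⟩ <;> simp [residueSum, Finset.sum_range_succ] <;> linarith

/-- Test the output of the evaluation. -/
noncomputable def logCheck (n L Z A B : ℕ) (s : LogState) : Bool :=
  LogState.rec (fun n' L' Z' A' B' => and (Nat.beq n' n) (and (Nat.beq L' L) (and (Nat.beq Z' Z)
    (and (Nat.beq A' A) (Nat.beq B' B))))) s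

lemma sound_of_logCheck {S i n L Z A B : ℕ} {e : ℝ} (he : 32 + (S : ℝ) / 10 ^ 15 ≤ e)
    (h : logCheck n L Z A B (doubleIterate LogState.app (logStep S) i ⟨1, 0, 0, 0, 0⟩) = true) :
    (LogState.mk n L Z A B).Sound S e := by
  rw [doubleIterate_eq (app := LogState.app) (fun _ _ => rfl)] at h
  have hs : ∀ k, ((logStep S)^[k] ⟨1, 0, 0, 0, 0⟩).Sound S e := by
    intro k
    induction k with
    | zero => exact LogState.Sound.init S (le_trans (by positivity) he)
    | succ k ih => rw [Function.iterate_succ_apply']; exact ih.step he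
  have h' := hs (2 ^ i)
  generalize (logStep S)^[2 ^ i] ⟨1, 0, 0, 0, 0⟩ = s at h h'
  obtain ⟨n', L', Z', A', B'⟩ := s
  simp only [logCheck, Bool.and_eq_true, Nat.beq_eq] at h
  obtain ⟨rfl, rfl, rfl, rfl, rfl⟩ := h
  exact h'

/-- Starting from n = 1, 2¹¹ steps reach 2049 = 4 · 512 + 1. The error 200000 per step covers 32 +
10²⁰/10¹⁵ and is 2·10⁻¹⁵ after scaling. -/
lemma logState_sound : (LogState.mk 2049 762510714823889970943 93333973955683737157
    711502069594315677401 730606211185847733984).Sound 100000000000000000000 200000 :=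
  sound_of_logCheck (i := 11) (by norm_num) (by decide +kernel)

lemma logState_sound_two : (LogState.mk 2 69314718055994529717 17328679513998632429 0 0).Sound
    100000000000000000000 200000 :=
  sound_of_logCheck (i := 0) (by norm_num) (by decide +kernel)

lemma logState_sound_three : (LogState.mk 3 109861228866810967908 29535482721422073307 0
    36620409622270322636).Sound 100000000000000000000 200000 :=
  sound_of_logCheck (i := 1) (by norm_num) (by decide +kernel)


/-! ### Numerical values of the logarithms, ζ'(2), L'(1, χ₋₄) and γ -/

lemma log_two_approx : |Real.log 2 - 0.693147180559945| ≤ 1 / 10 ^ 14 := by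
  have h := logState_sound_two.log
  norm_num at h
  rw [abs_le]
  constructor <;> norm_num <;> linarith

lemma log_three_approx : |Real.log 3 - 1.098612288668109| ≤ 1 / 10 ^ 14 := by
  have h := logState_sound_three.log
  norm_num at h
  rw [abs_le]
  constructor <;> norm_num <;> linarith

lemma log_2049_approx : |Real.log 2049 - 7.6251071482389| ≤ 5 / 10 ^ 12 := by
  have h := logState_sound.log
  norm_num at h
  rw [abs_le]
  constructor <;> norm_num <;> linarith

lemma log_one_add_inv_crude {a : ℝ} (ha : 1 ≤ a) : 2 / (2 * a + 1) ≤ Real.log (1 + a⁻¹) ∧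
    Real.log (1 + a⁻¹) ≤ 2 / (2 * a + 1) + 3 / (2 * a + 1) ^ 3 := by
  have h := log_one_add_inv_sandwich ha 1
  simpa [div_eq_mul_inv] using h

/-- The tail of a series of values of a convex function tending to zero. -/
lemma tsum_midpoint_bounds {F f f' : ℝ → ℝ} {a : ℝ}
    (hF : ∀ t ∈ Set.Ici a, HasDerivAt F (f t) t)
    (hf : ∀ t ∈ Set.Ici a, HasDerivAt f (f' t) t)
    (hm : MonotoneOn f' (Set.Ici a)) (h0 : ∀ t ∈ Set.Ici a, f' t ≤ 0)
    (hF0 : Tendsto F atTop (𝓝 0))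
    (hs : Summable fun j : ℕ => f (a + 1 / 2 + j)) :
    ∑' j : ℕ, f (a + 1 / 2 + j) ≤ -F a ∧
      -F a ≤ ∑' j : ℕ, f (a + 1 / 2 + j) + (-f' a) / 8 := by
  have h := sum_midpoint_bounds hF hf hm
  have hlim : Tendsto (fun n : ℕ => F (a + n) - F a) atTop (𝓝 (0 - F a)) :=
    (hF0.comp (tendsto_atTop_add_const_left _ _ tendsto_natCast_atTop_atTop)).sub_const _
  rw [zero_sub] at hlim
  have ht := hs.hasSum.tendsto_sum_nat
  refine ⟨le_of_tendsto_of_tendsto' ht hlim fun n => (h n).1, ?_⟩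
  refine le_of_tendsto_of_tendsto' hlim (ht.add_const _) fun n => (h n).2.trans ?_
  have := h0 (a + n) (by simp)
  linarith

lemma summable_log_div_sq : Summable fun n : ℕ => Real.log n / (n : ℝ) ^ 2 := by
  have h1 : Summable fun n : ℕ => 2 * ((n : ℝ) ^ (3 / 2 : ℝ))⁻¹ :=
    (Real.summable_nat_rpow_inv.2 (by norm_num)).mul_left 2
  refine h1.of_nonneg_of_le (fun n => div_nonneg (Real.log_natCast_nonneg n) (by positivity))
    fun n => ?_
  rcases Nat.eq_zero_or_pos n with rfl | hn
  · simp
  have hn' : (0 : ℝ) < n := by exact_mod_cast hn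
  have h2 := Real.log_natCast_le_rpow_div n (ε := 1 / 2) (by norm_num)
  have h3 : (n : ℝ) ^ (3 / 2 : ℝ) * (n : ℝ) ^ (1 / 2 : ℝ) = (n : ℝ) ^ 2 := by
    rw [← Real.rpow_add hn', ← Real.rpow_natCast]; norm_num
  rw [← h3, div_le_iff₀ (by positivity), ← mul_assoc, mul_assoc 2, inv_mul_cancel₀ (by positivity)]
  linarith

/-- The terms up to 2049 are evaluated; the rest is the midpoint rule from 2049.5 with primitive
-(log t + 1)/t. The logarithm there comes from 2049.5/2049 = 1 + 1/4098. -/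
lemma tsum_log_div_sq_approx :
    |∑' n : ℕ, Real.log n / (n : ℝ) ^ 2 - 0.9375482543| ≤ 4 / 10 ^ 10 := by
  have hder : ∀ t ∈ Set.Ici (2049.5 : ℝ),
      HasDerivAt (fun t => -((Real.log t + 1) / t)) (Real.log t / t ^ 2) t ∧
      HasDerivAt (fun t => Real.log t / t ^ 2) ((1 - 2 * Real.log t) / t ^ 3) t ∧
      HasDerivAt (fun t => (1 - 2 * Real.log t) / t ^ 3) ((6 * Real.log t - 5) / t ^ 4) t ∧
      1 ≤ Real.log t := by
    intro t ht
    have ht' : (2049.5 : ℝ) ≤ t := ht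
    have h0 : 0 < t := by linarith
    have hl := Real.hasDerivAt_log h0.ne'
    refine ⟨?_, ?_, ?_, ?_⟩
    · refine (((hl.add_const 1).div (hasDerivAt_id t) h0.ne').fun_neg).congr_deriv ?_
      simp only [id]; field_simp; ring
    · refine (hl.div (hasDerivAt_pow 2 t) (by positivity)).congr_deriv ?_
      field_simp; push_cast; ring
    · refine (((hl.const_mul 2).const_sub 1).div (hasDerivAt_pow 3 t) (by positivity)).congr_deriv ?_
      field_simp; push_cast; ring
    · rw [Real.le_log_iff_exp_le h0]
      linarith [Real.exp_one_lt_d9]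
  have hlog1 : (1 : ℝ) ≤ Real.log 2049.5 := (hder _ (by simp)).2.2.2
  have hs := (summable_nat_add_iff 2050).2 summable_log_div_sq
  have e : ∀ j : ℕ, (((j + 2050 : ℕ) : ℝ)) = 2049.5 + 1 / 2 + j := by
    intro j; push_cast; norm_num; ring
  simp only [e] at hs
  have ht := tsum_midpoint_bounds (a := 2049.5) (fun t ht => (hder t ht).1)
    (fun t ht => (hder t ht).2.1) (by
      apply monotoneOn_of_hasDerivWithinAt_nonneg (convex_Ici _)
        (fun t ht => (hder t ht).2.2.1.continuousAt.continuousWithinAt)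
        (fun t ht => (hder t (interior_subset ht)).2.2.1.hasDerivWithinAt)
      intro t ht
      have h := hder t (interior_subset ht)
      exact div_nonneg (by linarith [h.2.2.2]) (by positivity))
    (fun t ht => by
      have h : (0 : ℝ) < t := lt_of_lt_of_le (by norm_num) ht
      exact div_nonpos_of_nonpos_of_nonneg (by linarith [(hder t ht).2.2.2]) (by positivity))
    (by
      have h1 : Tendsto (fun t : ℝ => Real.log t / t) atTop (𝓝 0) :=
        Real.isLittleO_log_id_atTop.tendsto_div_nhds_zero
      have h2 := (h1.add tendsto_inv_atTop_zero).neg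
      simp only [add_zero, neg_zero] at h2
      refine h2.congr fun t => ?_
      simp only [add_div, one_div]) hs
  rw [← summable_log_div_sq.sum_add_tsum_nat_add 2050]
  simp only [e]
  have hz := logState_sound.sq
  dsimp only at hz
  set A := ∑ m ∈ Finset.range (2049 + 1), Real.log m / (m : ℝ) ^ 2
  set T := ∑' j : ℕ, Real.log (2049.5 + 1 / 2 + j : ℝ) / (2049.5 + 1 / 2 + j : ℝ) ^ 2
  have hl2 : Real.log 2049.5 = Real.log 2049 + Real.log (1 + (4098 : ℝ)⁻¹) := by
    rw [← Real.log_mul (by norm_num) (by norm_num)]; norm_num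
  obtain ⟨c1, c2⟩ := log_one_add_inv_crude (a := 4098) (by norm_num)
  obtain ⟨d1, d2⟩ := abs_le.1 log_2049_approx
  have l1 : 7.625351139 ≤ Real.log 2049.5 := by rw [hl2]; norm_num at c1 d1 ⊢; linarith
  have l2 : Real.log 2049.5 ≤ 7.6253511405 := by rw [hl2]; norm_num at c2 d2 ⊢; linarith
  obtain ⟨t1, t2⟩ := ht
  clear_value A T
  rw [neg_neg] at t1 t2
  have b1 : (Real.log 2049.5 + 1) / 2049.5 ≤ 8.6253511405 / 2049.5 := by gcongr; linarith
  have b2 : 8.625351139 / 2049.5 ≤ (Real.log 2049.5 + 1) / 2049.5 := by gcongr; linarith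
  have b3 : -((1 - 2 * Real.log 2049.5) / 2049.5 ^ 3) ≤ 15 / 2049.5 ^ 3 := by
    rw [← neg_div]; gcongr; linarith
  obtain ⟨z1, z2⟩ := hz
  generalize -((1 - 2 * Real.log 2049.5) / 2049.5 ^ 3) = X at *
  generalize (Real.log 2049.5 + 1) / 2049.5 = Y at *
  norm_num at z1 z2 b1 b2 b3
  rw [abs_le]
  constructor <;> norm_num <;> linarith


/-- The summand of the series for `L'(1, χ₋₄)`. -/
noncomputable def pairedLogTerm (x : ℕ) : ℝ :=
  Real.log (4 * x + 3) / (4 * x + 3) - Real.log (4 * x + 5) / (4 * x + 5)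

lemma log_div_antitone {x y : ℝ} (hx : 3 ≤ x) (hxy : x ≤ y) :
    Real.log y / y ≤ Real.log x / x :=
  Real.log_div_self_antitoneOn (show Real.exp 1 ≤ _ by linarith [Real.exp_one_lt_d9])
    (show Real.exp 1 ≤ _ by linarith [Real.exp_one_lt_d9]) hxy

/-- Pairing neighbours turns the alternating series into a series of non-negative terms, since log t
/ t decreases beyond e. Its partial sums are bounded by the first term of the alternating series. -/
lemma summable_pairedLogTerm : Summable pairedLogTerm := by
  refine summable_of_sum_range_le (c := Real.log 3 / 3) (fun x => ?_) fun n => ?_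
  · have : (0 : ℝ) ≤ x := Nat.cast_nonneg x
    exact sub_nonneg.2 (log_div_antitone (by linarith) (by linarith))
  · have h : ∑ x ∈ Finset.range n, pairedLogTerm x
        ≤ Real.log 3 / 3 - Real.log (4 * n + 3) / (4 * n + 3) := by
      induction n with
      | zero => simp
      | succ n ih =>
        rw [Finset.sum_range_succ, pairedLogTerm]
        have : (0 : ℝ) ≤ n := Nat.cast_nonneg n
        have h := log_div_antitone (x := 4 * n + 5) (y := 4 * n + 7) (by linarith) (by linarith)
        have e : (4 * ((n + 1 : ℕ) : ℝ) + 3) = 4 * n + 7 := by push_cast; ring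
        rw [e]
        linarith
    have : 0 ≤ Real.log (4 * n + 3) / (4 * n + 3) := by
      have : (0 : ℝ) ≤ n := Nat.cast_nonneg n
      exact div_nonneg (Real.log_nonneg (by linarith)) (by linarith)
    linarith

lemma sum_pairedLogTerm (n : ℕ) : ∑ x ∈ Finset.range n, pairedLogTerm x
    = residueSum 3 (4 * n + 1) - residueSum 1 (4 * n + 1) := by
  induction n with
  | zero => simp [residueSum, Finset.sum_range_succ]
  | succ n ih =>
    have e : 4 * (n + 1) + 1 + 1 = 4 * n + 1 + 1 + 1 + 1 + 1 + 1 := by ring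
    have m1 : (4 * n + 1 + 1) % 4 = 2 := by omega
    have m2 : (4 * n + 1 + 1 + 1) % 4 = 3 := by omega
    have m3 : (4 * n + 1 + 1 + 1 + 1) % 4 = 0 := by omega
    have m4 : (4 * n + 1 + 1 + 1 + 1 + 1) % 4 = 1 := by omega
    rw [Finset.sum_range_succ, ih, residueSum, residueSum, residueSum, residueSum, e]
    simp only [Finset.sum_range_succ _ (4 * n + 1 + 1), Finset.sum_range_succ _ (4 * n + 1 + 1 + 1),
      Finset.sum_range_succ _ (4 * n + 1 + 1 + 1 + 1),
      Finset.sum_range_succ _ (4 * n + 1 + 1 + 1 + 1 + 1), m1, m2, m3, m4, pairedLogTerm]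
    norm_num
    have e1 : (4 * (n : ℝ) + 1 + 1 + 1) = 4 * n + 3 := by ring
    have e2 : (4 * (n : ℝ) + 3 + 1 + 1) = 4 * n + 5 := by ring
    rw [e1, e2]
    ring

lemma hasDerivAt_sq_log_half {c t : ℝ} (ht : 0 < 4 * t + c) :
    HasDerivAt (fun t => Real.log (4 * t + c) ^ 2 / 8) (Real.log (4 * t + c) / (4 * t + c)) t := by
  have hl : HasDerivAt (fun t : ℝ => 4 * t + c) 4 t := by
    simpa using ((hasDerivAt_id t).const_mul 4).add_const c
  refine (((hl.log ht.ne').pow 2).div_const 8).congr_deriv ?_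
  field_simp; norm_num

lemma hasDerivAt_log_div {c t : ℝ} (ht : 0 < 4 * t + c) :
    HasDerivAt (fun t => Real.log (4 * t + c) / (4 * t + c))
      (4 * ((1 - Real.log (4 * t + c)) / (4 * t + c) ^ 2)) t := by
  have hl : HasDerivAt (fun t : ℝ => 4 * t + c) 4 t := by
    simpa using ((hasDerivAt_id t).const_mul 4).add_const c
  refine ((hl.log ht.ne').div hl ht.ne').congr_deriv ?_
  field_simp

lemma hasDerivAt_log_div_deriv {c t : ℝ} (ht : 0 < 4 * t + c) :
    HasDerivAt (fun t => 4 * ((1 - Real.log (4 * t + c)) / (4 * t + c) ^ 2))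
      (16 * ((2 * Real.log (4 * t + c) - 3) / (4 * t + c) ^ 3)) t := by
  have hl : HasDerivAt (fun t : ℝ => 4 * t + c) 4 t := by
    simpa using ((hasDerivAt_id t).const_mul 4).add_const c
  refine ((((hl.log ht.ne').const_sub 1).div (hl.fun_pow 2) (pow_pos ht 2).ne').const_mul 4).congr_deriv ?_
  field_simp; ring

/-- The derivative has the sign of 11 - 6 log t, negative from e^(11/6) < 8 onwards. Up to a
positive constant this is the second derivative of log t / t, so the antitonicity makes the
difference of two shifts convex, as the midpoint rule requires. -/
lemma two_log_sub_three_div_cube_antitone {x y : ℝ} (hx : 8 ≤ x) (hxy : x ≤ y) :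
    (2 * Real.log y - 3) / y ^ 3 ≤ (2 * Real.log x - 3) / x ^ 3 := by
  have h := antitoneOn_of_hasDerivWithinAt_nonpos (D := Set.Ici (8 : ℝ)) (convex_Ici _)
    (f := fun y => (2 * Real.log y - 3) / y ^ 3) (f' := fun y => (11 - 6 * Real.log y) / y ^ 4)
  have hd : ∀ t ∈ Set.Ici (8 : ℝ), HasDerivAt (fun y => (2 * Real.log y - 3) / y ^ 3)
      ((11 - 6 * Real.log t) / t ^ 4) t := by
    intro t ht
    have h0 : 0 < t := lt_of_lt_of_le (by norm_num) ht
    refine ((((Real.hasDerivAt_log h0.ne').const_mul 2).sub_const 3).div (hasDerivAt_pow 3 t)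
      (by positivity)).congr_deriv ?_
    field_simp; push_cast; ring
  refine h (fun t ht => (hd t ht).continuousAt.continuousWithinAt)
    (fun t ht => (hd t (interior_subset ht)).hasDerivWithinAt) (fun t ht => ?_)
    hx (hx.trans hxy) hxy
  have h8 : (8 : ℝ) ≤ t := interior_subset ht
  have : Real.log 8 ≤ Real.log t := Real.log_le_log (by norm_num) h8
  have e : Real.log 8 = 3 * Real.log 2 := by
    rw [← Real.log_rpow (by norm_num)]; norm_num
  exact div_nonpos_of_nonpos_of_nonneg (by linarith [Real.log_two_gt_d9]) (by positivity)

lemma one_sub_log_div_sq_mono {x y : ℝ} (hx : 8 ≤ x) (hxy : x ≤ y) :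
    (1 - Real.log x) / x ^ 2 ≤ (1 - Real.log y) / y ^ 2 ∧
    (1 - Real.log y) / y ^ 2 - (1 - Real.log x) / x ^ 2
      ≤ (2 * Real.log x - 3) / x ^ 3 * (y - x) := by
  have hd : ∀ t ∈ Set.Ici (x : ℝ), HasDerivAt (fun y => (1 - Real.log y) / y ^ 2)
      ((2 * Real.log t - 3) / t ^ 3) t := by
    intro t ht
    have h0 : 0 < t := lt_of_lt_of_le (by linarith) ht
    refine (((Real.hasDerivAt_log h0.ne').const_sub 1).div (hasDerivAt_pow 2 t)
      (by positivity)).congr_deriv ?_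
    field_simp; push_cast; ring
  have hpos : ∀ t ∈ Set.Ici x, 0 ≤ (2 * Real.log t - 3) / t ^ 3 := by
    intro t ht
    have h8 : (8 : ℝ) ≤ t := hx.trans ht
    have : Real.log 8 ≤ Real.log t := Real.log_le_log (by norm_num) h8
    have e : Real.log 8 = 3 * Real.log 2 := by
      rw [← Real.log_rpow (by norm_num)]; norm_num
    exact div_nonneg (by linarith [Real.log_two_gt_d9]) (by positivity)
  constructor
  · exact monotoneOn_of_hasDerivWithinAt_nonneg (D := Set.Ici x) (convex_Ici _)
      (f := fun y => (1 - Real.log y) / y ^ 2)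
      (fun t ht => (hd t ht).continuousAt.continuousWithinAt)
      (fun t ht => (hd t (interior_subset ht)).hasDerivWithinAt)
      (fun t ht => hpos t (interior_subset ht)) Set.self_mem_Ici hxy hxy
  · have h := Convex.image_sub_le_mul_sub_of_deriv_le (convex_Ici x)
      (f := fun y => (1 - Real.log y) / y ^ 2) (C := (2 * Real.log x - 3) / x ^ 3)
      (fun t ht => (hd t ht).continuousAt.continuousWithinAt)
      (fun t ht => (hd t (interior_subset ht)).differentiableAt.differentiableWithinAt)
      (fun t ht => by
        rw [(hd t (interior_subset ht)).deriv]
        exact two_log_sub_three_div_cube_antitone hx (interior_subset ht))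
    exact h x Set.self_mem_Ici y hxy hxy

/-- Midpoint rule from t = 511.5 with primitive (log²(4t + 3) - log²(4t + 5))/8, which tends to 0 at
infinity; the end slope is a small difference, bounded by the mean value inequality. -/
lemma tsum_pairedLogTerm_tail :
    |∑' x : ℕ, pairedLogTerm (x + 512)
      - (Real.log (4 * 511.5 + 5) ^ 2 / 8 - Real.log (4 * 511.5 + 3) ^ 2 / 8)| ≤ 2 / 10 ^ 9 := by
  have hpos : ∀ t ∈ Set.Ici (511.5 : ℝ), 8 ≤ 4 * t + 3 := fun t ht => by
    have : (511.5 : ℝ) ≤ t := ht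
    linarith
  have hs := (summable_nat_add_iff 512).2 summable_pairedLogTerm
  have e : ∀ j : ℕ, pairedLogTerm (j + 512) = Real.log (4 * (511.5 + 1 / 2 + j) + 3) /
      (4 * (511.5 + 1 / 2 + j) + 3) - Real.log (4 * (511.5 + 1 / 2 + j) + 5) /
      (4 * (511.5 + 1 / 2 + j) + 5) := by
    intro j
    rw [pairedLogTerm]
    push_cast
    congr 2 <;> norm_num <;> ring_nf
  simp only [e] at hs ⊢
  have hlim : Tendsto (fun t : ℝ => Real.log (4 * t + 3) ^ 2 / 8 - Real.log (4 * t + 5) ^ 2 / 8)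
      atTop (𝓝 0) := by
    have h3 : Tendsto (fun t : ℝ => 4 * t + 5) atTop atTop :=
      tendsto_atTop_add_const_right _ _ (tendsto_id.const_mul_atTop (by norm_num))
    have h1 : Tendsto (fun t : ℝ => Real.log (4 * t + 5) / (4 * t + 5)) atTop (𝓝 0) :=
      (Real.isLittleO_log_id_atTop.tendsto_div_nhds_zero).comp h3
    have h2 : Tendsto (fun t : ℝ => -(2 * (Real.log (4 * t + 5) / (4 * t + 5)))) atTop (𝓝 0) := by
      simpa using (h1.const_mul 2).neg
    refine tendsto_of_tendsto_of_tendsto_of_le_of_le' h2 tendsto_const_nhds ?_ ?_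
    · filter_upwards [eventually_ge_atTop 1] with t ht
      have hl : Real.log (4 * t + 5) - Real.log (4 * t + 3) ≤ 4 / (4 * t + 5) := by
        have := Real.one_sub_inv_le_log_of_pos (x := (4 * t + 3) / (4 * t + 5)) (by positivity)
        rw [Real.log_div (by positivity) (by positivity), inv_div] at this
        have h6 : (4 * t + 5) / (4 * t + 3) - 1 ≤ 4 / (4 * t + 5) := by
          rw [div_sub_one (by positivity), div_le_div_iff₀ (by positivity) (by positivity)]
          nlinarith
        linarith
      have hl0 : 0 ≤ Real.log (4 * t + 3) := Real.log_nonneg (by linarith)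
      have hl1 : Real.log (4 * t + 3) ≤ Real.log (4 * t + 5) :=
        Real.log_le_log (by linarith) (by linarith)
      have h7 : (Real.log (4 * t + 5) - Real.log (4 * t + 3)) *
          (Real.log (4 * t + 5) + Real.log (4 * t + 3)) ≤
          4 / (4 * t + 5) * (2 * Real.log (4 * t + 5)) := by
        apply mul_le_mul hl (by linarith) (by linarith) (by positivity)
      have e : 4 / (4 * t + 5) * (2 * Real.log (4 * t + 5))
        = 8 * (Real.log (4 * t + 5) / (4 * t + 5)) := by ring
      have h8 : 0 ≤ Real.log (4 * t + 5) / (4 * t + 5) := by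
        apply div_nonneg <;> linarith
      nlinarith
    · filter_upwards [eventually_ge_atTop 1] with t ht
      have hl0 : 0 ≤ Real.log (4 * t + 3) := Real.log_nonneg (by linarith)
      have hl1 : Real.log (4 * t + 3) ≤ Real.log (4 * t + 5) :=
        Real.log_le_log (by linarith) (by linarith)
      have := pow_le_pow_left₀ hl0 hl1 2
      linarith
  obtain ⟨t1, t2⟩ := tsum_midpoint_bounds (a := 511.5)
    (F := fun t => Real.log (4 * t + 3) ^ 2 / 8 - Real.log (4 * t + 5) ^ 2 / 8)
    (f := fun t => Real.log (4 * t + 3) / (4 * t + 3) - Real.log (4 * t + 5) / (4 * t + 5))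
    (f' := fun t => 4 * ((1 - Real.log (4 * t + 3)) / (4 * t + 3) ^ 2)
      - 4 * ((1 - Real.log (4 * t + 5)) / (4 * t + 5) ^ 2))
    (fun t ht => (hasDerivAt_sq_log_half (by linarith [hpos t ht])).sub
      (hasDerivAt_sq_log_half (by linarith [hpos t ht])))
    (fun t ht => (hasDerivAt_log_div (by linarith [hpos t ht])).sub
      (hasDerivAt_log_div (by linarith [hpos t ht])))
    (by
      have hd := fun t (ht : t ∈ Set.Ici (511.5 : ℝ)) =>
        (hasDerivAt_log_div_deriv (c := 3) (by linarith [hpos t ht])).sub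
          (hasDerivAt_log_div_deriv (c := 5) (by linarith [hpos t ht]))
      apply monotoneOn_of_hasDerivWithinAt_nonneg (convex_Ici _)
        (fun t ht => (hd t ht).continuousAt.continuousWithinAt)
        (fun t ht => (hd t (interior_subset ht)).hasDerivWithinAt)
      intro t ht
      have := two_log_sub_three_div_cube_antitone (hpos t (interior_subset ht))
        (y := 4 * t + 5) (by linarith)
      linarith)
    (fun t ht => by
      have := (one_sub_log_div_sq_mono (hpos t ht) (y := 4 * t + 5) (by linarith)).1
      linarith)
    hlim hs
  have h9 := (one_sub_log_div_sq_mono (x := 4 * 511.5 + 3) (y := 4 * 511.5 + 5)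
    (by norm_num) (by norm_num)).2
  have h10 : (2 * Real.log (4 * 511.5 + 3) - 3) / (4 * 511.5 + 3) ^ 3 * (4 * 511.5 + 5 - (4 * 511.5 + 3))
      ≤ 3 / 10 ^ 9 := by
    have e : (4 * 511.5 + 3 : ℝ) = 2049 := by norm_num
    rw [e, div_mul_eq_mul_div, div_le_iff₀ (by norm_num)]
    have := (abs_le.1 log_2049_approx).2
    norm_num at this ⊢
    linarith
  rw [abs_le]
  constructor <;> linarith

lemma tsum_pairedLogTerm_approx : |∑' x : ℕ, pairedLogTerm x - 0.1929013169| ≤ 4 / 10 ^ 9 := by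
  have ht := tsum_pairedLogTerm_tail
  have h3 := logState_sound.three
  have h1 := logState_sound.one
  dsimp only at h1 h3
  have hsum := sum_pairedLogTerm 512
  rw [← summable_pairedLogTerm.sum_add_tsum_nat_add 512, hsum]
  generalize ∑' x : ℕ, pairedLogTerm (x + 512) = T at *
  -- 2051 = 2049 (1 + 1/1024.5), so the difference of squared logarithms expands around log 2049.
  have hl : Real.log (4 * 511.5 + 5) = Real.log 2049 + Real.log (1 + (1024.5 : ℝ)⁻¹) := by
    rw [← Real.log_mul (by norm_num) (by norm_num)]; norm_num
  have e2 : (4 * 511.5 + 3 : ℝ) = 2049 := by norm_num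
  have ee : 4 * 512 + 1 = 2049 := rfl
  rw [hl, e2] at ht
  rw [ee]
  have hx := log_one_add_inv_crude (a := 1024.5) (by norm_num)
  have hy := log_2049_approx
  generalize Real.log (1 + (1024.5 : ℝ)⁻¹) = d at *
  generalize Real.log 2049 = l at *
  generalize residueSum 3 2049 = B at *
  generalize residueSum 1 2049 = A at *
  norm_num at h1 h3 hx ht hy
  obtain ⟨x1, x2⟩ := hx
  obtain ⟨y1, y2⟩ := abs_le.1 hy
  obtain ⟨t1, t2⟩ := abs_le.1 ht
  norm_num at y1 y2 t1 t2
  have e3 : (l + d) ^ 2 / 8 - l ^ 2 / 8 = l * d / 4 + d * d / 8 := by ring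
  have b1 : l * d ≤ 7.62510714825 * 0.0009756101105 := by
    apply mul_le_mul <;> norm_num <;> linarith
  have b2 : 7.6251071482 * 0.000975609756 ≤ l * d := by
    apply mul_le_mul <;> norm_num <;> linarith
  have b3 : d * d ≤ 0.0009756101105 * 0.0009756101105 := by
    apply mul_le_mul <;> norm_num <;> linarith
  have b4 : 0.000975609756 * 0.000975609756 ≤ d * d := by
    apply mul_le_mul <;> norm_num <;> linarith
  norm_num at b1 b2 b3 b4
  rw [abs_le]
  constructor <;> norm_num <;> linarith

/-- Comparing with log(N + 1/2) instead of log N is the midpoint rule for 1/t, and gains a factor N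
in accuracy. -/
lemma eulerMascheroni_bounds (N : ℕ) (hN : 0 < N) :
    harmonic N - Real.log (N + 1 / 2) - 1 / (8 * (N : ℝ) ^ 2) ≤ Real.eulerMascheroniConstant ∧
      Real.eulerMascheroniConstant ≤ harmonic N - Real.log (N + 1 / 2) := by
  have hN' : (0 : ℝ) < N := by exact_mod_cast hN
  have hlim : Tendsto (fun n : ℕ => (harmonic (n + N) : ℝ) - Real.log ((n + N : ℕ) : ℝ)) atTop
      (𝓝 Real.eulerMascheroniConstant) :=
    (tendsto_add_atTop_iff_nat N).2 Real.tendsto_harmonic_sub_log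
  have hsum : ∀ n : ℕ, (harmonic (n + N) : ℝ)
      = harmonic N + ∑ j ∈ Finset.range n, 1 / ((N : ℝ) + j + 1) := by
    intro n
    induction n with
    | zero => simp
    | succ n ih =>
      rw [Finset.sum_range_succ, ← add_assoc, ← ih, show n + 1 + N = n + N + 1 by ring,
        harmonic_succ]
      push_cast
      rw [one_div]
      ring
  have hlim2 : Tendsto (fun n : ℕ => Real.log ((N + 1 / 2 + n) / (N + 1 / 2))
      - Real.log ((n + N : ℕ) : ℝ)) atTop (𝓝 (-Real.log (N + 1 / 2))) := by
    have h1 : Tendsto (fun n : ℕ => ((n + N : ℕ) : ℝ)) atTop atTop :=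
      tendsto_natCast_atTop_atTop.comp (tendsto_add_atTop_nat N)
    have h2 : Tendsto (fun n : ℕ => Real.log (1 + 1 / 2 * (((n + N : ℕ) : ℝ))⁻¹)) atTop (𝓝 0) := by
      have h3 := ((tendsto_inv_atTop_zero.comp h1).const_mul (1 / 2 : ℝ)).const_add 1
      rw [mul_zero, add_zero] at h3
      have h4 := (Real.continuousAt_log one_ne_zero).tendsto.comp h3
      rw [Real.log_one] at h4
      exact h4
    have h5 := h2.sub_const (Real.log (N + 1 / 2))
    rw [zero_sub] at h5
    refine h5.congr fun n => ?_
    have h6 : (0 : ℝ) < ((n + N : ℕ) : ℝ) := by positivity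
    have h7 : 1 + 1 / 2 * (((n + N : ℕ) : ℝ))⁻¹ = (N + 1 / 2 + n) / ((n + N : ℕ) : ℝ) := by
      field_simp; push_cast; ring
    rw [h7, Real.log_div (by positivity) (by positivity), Real.log_div (by positivity) (by positivity)]
    ring
  have hb := fun n => sum_inv_bounds hN' n
  have hlim3 := hlim2.const_add (harmonic N : ℝ)
  rw [← sub_eq_add_neg] at hlim3
  constructor
  · refine le_of_tendsto_of_tendsto'
      (hlim3.sub_const (1 / (8 * (N : ℝ) ^ 2))) hlim fun n => ?_
    rw [hsum]
    linarith [(hb n).2]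
  · refine le_of_tendsto_of_tendsto' hlim hlim3 fun n => ?_
    rw [hsum]
    linarith [(hb n).1]

lemma eulerMascheroni_approx : |Real.eulerMascheroniConstant - 0.5772156649| ≤ 2 / 10 ^ 9 := by
  obtain ⟨h1, h2⟩ := eulerMascheroni_bounds (2 ^ 15 + 1) (by positivity)
  -- The harmonic number is twice the reciprocal sum already evaluated for the cone.
  have hH : (harmonic (2 ^ 15 + 1) : ℝ)
      = 2 * ∑ k ∈ Finset.range (2 ^ 15 + 1), 1 / ((2 + 2 * k : ℕ) : ℝ) := by
    rw [harmonic, Finset.mul_sum]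
    generalize 2 ^ 15 + 1 = M
    push_cast
    refine Finset.sum_congr rfl fun k _ => ?_
    field_simp
    ring
  have hl : Real.log (((2 ^ 15 + 1 : ℕ) : ℝ) + 1 / 2)
      = 15 * Real.log 2 + Real.log (1 + (65536 / 3 : ℝ)⁻¹) := by
    have : 15 * Real.log 2 = Real.log (2 ^ 15) := by rw [Real.log_pow]; norm_num
    rw [this, ← Real.log_mul (by norm_num) (by norm_num)]; norm_num
  have hh := harmonic_sum_two
  rw [hH, hl] at h1 h2
  have hx := log_one_add_inv_crude (a := 65536 / 3) (by norm_num)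
  have hy := log_two_approx
  generalize ∑ k ∈ Finset.range (2 ^ 15 + 1), 1 / ((2 + 2 * k : ℕ) : ℝ) = A at *
  generalize Real.log (1 + (65536 / 3 : ℝ)⁻¹) = d at *
  generalize Real.log 2 = l at *
  obtain ⟨x1, x2⟩ := hx
  obtain ⟨y1, y2⟩ := abs_le.1 hy
  obtain ⟨z1, z2⟩ := abs_le.1 hh
  norm_num at x1 x2 y1 y2 z1 z2 h1 h2
  rw [abs_le]
  constructor <;> norm_num <;> linarith


/-! ### Numerical value of the constant -/

/-- Real form of the bracket in the formula for the constant. -/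
noncomputable def constantBracket : ℝ :=
  Real.pi ^ 2 / 6 + Real.log 3 / 3 * ((∑' x, pairedLogTerm x) / (Real.pi / 4)
      + Real.eulerMascheroniConstant
      + 2 * ((∑' n : ℕ, Real.log n / (n : ℝ) ^ 2) / (Real.pi ^ 2 / 6)))
    + Real.log 3 / 3 * (2 * Real.eulerMascheroniConstant - Real.log 3 / 4 - Real.log 2 / 6)
    - ∑' k : ℕ, coneTerm (k + 1) - 1 / 3 * ∑' k : ℕ, coneTerm (k + 1 / 2)

lemma mul_mem_bounds {a b c d x y : ℝ} (ha : 0 ≤ a) (hc : 0 ≤ c) (hx : a ≤ x ∧ x ≤ b)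
    (hy : c ≤ y ∧ y ≤ d) : a * c ≤ x * y ∧ x * y ≤ b * d :=
  ⟨mul_le_mul hx.1 hy.1 hc (ha.trans hx.1),
    mul_le_mul hx.2 hy.2 (hc.trans hy.1) (ha.trans (hx.1.trans hx.2))⟩

lemma constantBracket_approx :
    |(Real.pi / 4) / (Real.pi ^ 2 / 6) * constantBracket - 0.6272237| < 5 / 10 ^ 8 := by
  have hp1 := Real.pi_gt_d20
  have hp2 := Real.pi_lt_d20
  have hl3 := abs_le.1 log_three_approx
  have hl2 := abs_le.1 log_two_approx
  have hP := abs_le.1 tsum_pairedLogTerm_approx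
  have hZ := abs_le.1 tsum_log_div_sq_approx
  have hg := abs_le.1 eulerMascheroni_approx
  have hT := abs_le.1 tsum_coneTerm_one
  have hU := abs_le.1 tsum_coneTerm_half
  rw [constantBracket]
  generalize ∑' k : ℕ, coneTerm (k + 1) = T at *
  generalize ∑' k : ℕ, coneTerm (k + 1 / 2) = U at *
  generalize ∑' x, pairedLogTerm x = P at *
  generalize ∑' n : ℕ, Real.log n / (n : ℝ) ^ 2 = Z at *
  generalize Real.eulerMascheroniConstant = g at *
  generalize Real.log 3 = l at *
  generalize Real.log 2 = m at *
  generalize Real.pi = p at *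
  have hp0 : 0 < p := by linarith
  -- All quotients are rewritten through 1/π, so that interval arithmetic needs only products of
  -- positive quantities.
  have e1 : P / (p / 4) = 4 * (P * p⁻¹) := by field_simp
  have e2 : Z / (p ^ 2 / 6) = 6 * (Z * (p⁻¹ * p⁻¹)) := by field_simp
  have e3 : p / 4 / (p ^ 2 / 6) = 3 / 2 * p⁻¹ := by field_simp; norm_num
  rw [e1, e2, e3]
  have i1 : 0.3183098861837 ≤ p⁻¹ := by
    rw [← one_div, le_div_iff₀ hp0]; linarith
  have i2 : p⁻¹ ≤ 0.3183098861838 := by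
    rw [← one_div, div_le_iff₀ hp0]; linarith
  have s1 : 9.869604401089 ≤ p ^ 2 := by nlinarith
  have s2 : p ^ 2 ≤ 9.869604401090 := by nlinarith
  generalize p⁻¹ = i at *
  generalize p ^ 2 = s at *
  norm_num at hl3 hl2 hP hZ hg hT hU
  obtain ⟨hl3a, hl3b⟩ := hl3
  obtain ⟨hl2a, hl2b⟩ := hl2
  obtain ⟨hPa, hPb⟩ := hP
  obtain ⟨hZa, hZb⟩ := hZ
  obtain ⟨hga, hgb⟩ := hg
  obtain ⟨hTa, hTb⟩ := hT
  obtain ⟨hUa, hUb⟩ := hU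
  have hi := And.intro i1 i2
  obtain ⟨a1, a2⟩ := mul_mem_bounds (a := 0.1929013129) (b := 0.1929013209) (x := P) (by norm_num)
    (by norm_num) (by constructor <;> linarith) hi
  obtain ⟨c1, c2⟩ := mul_mem_bounds (a := 0.9375482539) (b := 0.9375482547) (x := Z) (by norm_num)
    (by norm_num) (by constructor <;> linarith)
    (mul_mem_bounds (by norm_num) (by norm_num) hi hi)
  norm_num at a1 a2 c1 c2
  have hQ : s / 6 + l / 3 * (4 * (P * i) + g + 2 * (6 * (Z * (i * i)))) + l / 3 * (2 * g - l / 4 - m / 6)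
      = s / 6 + l * (4 * (P * i) + g + 2 * (6 * (Z * (i * i))) + (2 * g - l / 4 - m / 6)) / 3 := by
    ring
  have q1 : 2.72700095 ≤ 4 * (P * i) + g + 2 * (6 * (Z * (i * i))) + (2 * g - l / 4 - m / 6) := by
    norm_num; linarith
  have q2 : 4 * (P * i) + g + 2 * (6 * (Z * (i * i))) + (2 * g - l / 4 - m / 6) ≤ 2.727000976 := by
    norm_num; linarith
  rw [hQ]
  generalize 4 * (P * i) + g + 2 * (6 * (Z * (i * i))) + (2 * g - l / 4 - m / 6) = Q at *
  obtain ⟨d1, d2⟩ := mul_mem_bounds (a := 1.0986122886680) (b := 1.0986122886682) (x := l)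
    (by norm_num) (by norm_num) (by constructor <;> linarith) ⟨q1, q2⟩
  norm_num at d1 d2 s1 s2
  set R := s / 6 + l * Q / 3 - T - 1 / 3 * U with hR
  have r1 : 1.31365428 ≤ R := by rw [hR]; norm_num; linarith
  have r2 : R ≤ 1.31365433 := by rw [hR]; norm_num; linarith
  obtain ⟨f1, f2⟩ := mul_mem_bounds (by norm_num) (by norm_num) hi ⟨r1, r2⟩
  norm_num at f1 f2
  rw [mul_assoc, abs_lt]
  constructor <;> norm_num <;> linarith


/-! ### Values and derivatives of L(s, χ₋₄) and ζ(s) as real series -/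

/-- The sum of two consecutive non-zero terms of the series for `L(s, χ₋₄)`, up to sign. -/
noncomputable def pairedTerm (x : ℕ) (s : ℂ) : ℂ :=
  ((4 * x + 3 : ℕ) : ℂ) ^ (-s) - ((4 * x + 5 : ℕ) : ℂ) ^ (-s)

/-- Mean value inequality over a step of length 2: the derivative of t^(-s) has norm at most 2
t^(-3/2) on the disc, because |s| ≤ 2 and Re s ≥ 1/2. Pairing thus gives convergence beyond Re s >
1. -/
lemma norm_pairedTerm_le {s : ℂ} (hs : s ∈ Metric.ball (1 : ℂ) (1 / 2)) (x : ℕ) :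
    ‖pairedTerm x s‖ ≤ 4 * ((x + 1 : ℕ) : ℝ) ^ (-(3 / 2) : ℝ) := by
  rw [Metric.mem_ball, dist_eq_norm] at hs
  have hn : ‖s‖ ≤ 2 := by
    have := norm_add_le (s - 1) 1
    rw [sub_add_cancel, norm_one] at this
    linarith
  have hre : 1 / 2 ≤ s.re := by
    have := Complex.abs_re_le_norm (s - 1)
    rw [Complex.sub_re, Complex.one_re] at this
    linarith [(abs_le.1 this).1]
  have hd : ∀ t ∈ Set.Ici ((x + 1 : ℕ) : ℝ), HasDerivWithinAt (fun t : ℝ => (t : ℂ) ^ (-s))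
      (-s * (t : ℂ) ^ (-s - 1)) (Set.Ici ((x + 1 : ℕ) : ℝ)) t := by
    intro t ht
    have ht0 : 0 < t := lt_of_lt_of_le (by positivity) ht
    have := ((hasDerivAt_id (t : ℂ)).cpow_const (c := -s) (by simp [Complex.slitPlane, ht0])).comp_ofReal
    simpa using this.hasDerivWithinAt
  have hb : ∀ t ∈ Set.Ici ((x + 1 : ℕ) : ℝ),
      ‖-s * (t : ℂ) ^ (-s - 1)‖ ≤ 2 * ((x + 1 : ℕ) : ℝ) ^ (-(3 / 2) : ℝ) := by
    intro t ht
    have hx : (1 : ℝ) ≤ ((x + 1 : ℕ) : ℝ) := by exact_mod_cast Nat.le_add_left 1 x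
    have ht1 : 1 ≤ t := hx.trans ht
    rw [norm_mul, norm_neg, Complex.norm_cpow_eq_rpow_re_of_pos (by linarith)]
    have h1 : t ^ (-s - 1).re ≤ t ^ (-(3 / 2) : ℝ) := by
      apply Real.rpow_le_rpow_of_exponent_le ht1
      simp only [Complex.sub_re, Complex.neg_re, Complex.one_re]
      linarith
    have h2 : t ^ (-(3 / 2) : ℝ) ≤ ((x + 1 : ℕ) : ℝ) ^ (-(3 / 2) : ℝ) :=
      Real.rpow_le_rpow_of_nonpos (by linarith) ht (by norm_num)
    exact mul_le_mul hn (h1.trans h2) (by positivity) (by norm_num)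
  have h := Convex.norm_image_sub_le_of_norm_hasDerivWithin_le hd hb (convex_Ici _)
    (x := ((4 * x + 5 : ℕ) : ℝ)) (y := ((4 * x + 3 : ℕ) : ℝ))
    (by simp only [Set.mem_Ici]; exact_mod_cast (by omega))
    (by simp only [Set.mem_Ici]; exact_mod_cast (by omega))
  have e : ‖((4 * x + 3 : ℕ) : ℝ) - ((4 * x + 5 : ℕ) : ℝ)‖ = 2 := by
    push_cast
    rw [show (4 * (x : ℝ) + 3 - (4 * x + 5)) = -2 by ring]
    norm_num
  rw [e] at h
  simp only [Complex.ofReal_natCast] at h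
  rw [pairedTerm]
  linarith

lemma differentiable_pairedTerm (x : ℕ) : Differentiable ℂ (pairedTerm x) := by
  have h : ∀ n : ℕ, n ≠ 0 → Differentiable ℂ fun s : ℂ => (n : ℂ) ^ (-s) := fun n hn =>
    differentiable_neg.const_cpow (Or.inl (by exact_mod_cast hn))
  exact (h _ (by omega)).sub (h _ (by omega))

lemma deriv_pairedTerm_one (x : ℕ) : deriv (pairedTerm x) 1 = -(pairedLogTerm x : ℂ) := by
  have h : ∀ n : ℕ, n ≠ 0 →
      HasDerivAt (fun s : ℂ => (n : ℂ) ^ (-s)) (-((Real.log n / n : ℝ) : ℂ)) 1 := by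
    intro n hn
    refine ((hasDerivAt_neg (1 : ℂ)).const_cpow (c := (n : ℂ))
      (Or.inl (by exact_mod_cast hn))).congr_deriv ?_
    rw [Complex.cpow_neg_one, Complex.ofReal_div, ← Complex.natCast_log, Complex.ofReal_natCast]
    ring
  refine ((h (4 * x + 3) (by omega)).sub (h (4 * x + 5) (by omega))).deriv.trans ?_
  rw [pairedLogTerm]
  push_cast
  ring

lemma summable_pairedBound : Summable fun x : ℕ => 4 * ((x + 1 : ℕ) : ℝ) ^ (-(3 / 2) : ℝ) :=
  ((summable_nat_add_iff 1).2 (Real.summable_nat_rpow.2 (by norm_num))).mul_left 4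

lemma chiNegFour_ne_one : chiNegFour ≠ 1 := by
  intro h
  have h1 : chiNegFour (3 : ZMod 4) = 1 := by
    rw [h]; exact MulChar.one_apply (by decide)
  have h2 : chiNegFour (3 : ZMod 4) = -1 := by
    simp only [chiNegFour, MulChar.ringHomComp_apply]
    rw [show ZMod.χ₄ (3 : ZMod 4) = -1 by decide]; simp
  rw [h2] at h1
  norm_num at h1

/-- Splitting by residue classes modulo 4; the term n = 1 is set aside so that 4x + 3 pairs with 4x
+ 5. -/
lemma LFunction_chiNegFour_of_one_lt {s : ℂ} (hs : 1 < s.re) (hsb : s ∈ Metric.ball (1 : ℂ) (1 / 2)) :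
    chiNegFour.LFunction s = 1 - ∑' x, pairedTerm x s := by
  have hsum : LSeriesSummable (fun n => chiNegFour (n : ZMod 4)) s :=
    ZMod.LSeriesSummable_of_one_lt_re _ hs
  have hs0 : s ≠ 0 := by rintro rfl; norm_num at hs
  have hval : chiNegFour (0 : ZMod 4) = 0 ∧ chiNegFour (1 : ZMod 4) = 1 ∧
      chiNegFour (2 : ZMod 4) = 0 ∧ chiNegFour (3 : ZMod 4) = -1 := by
    simp only [chiNegFour, MulChar.ringHomComp_apply]
    rw [show ZMod.χ₄ (3 : ZMod 4) = -1 by decide, show ZMod.χ₄ (0 : ZMod 4) = 0 by decide,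
      show ZMod.χ₄ (1 : ZMod 4) = 1 by decide, show ZMod.χ₄ (2 : ZMod 4) = 0 by decide]
    simp
  obtain ⟨v0, v1, v2, v3⟩ := hval
  have hcast : ∀ j m : ℕ, ((j + 4 * m : ℕ) : ZMod 4) = (j : ZMod 4) := by
    intro j m
    push_cast
    rw [show (4 : ZMod 4) = 0 by decide]; simp
  have hterm : ∀ j m : ℕ, LSeries.term (fun n => chiNegFour (n : ZMod 4)) s (j + 4 * m)
      = chiNegFour (j : ZMod 4) * ((j + 4 * m : ℕ) : ℂ) ^ (-s) := by
    intro j m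
    rcases Nat.eq_zero_or_pos (j + 4 * m) with h | h
    · rw [h, LSeries.term_zero, Nat.cast_zero, Complex.zero_cpow (neg_ne_zero.2 hs0), mul_zero]
    · rw [LSeries.term_of_ne_zero (by omega), hcast, Complex.cpow_neg, div_eq_mul_inv]
  have hr : ∀ m : ℕ, Summable fun x : ℕ => ((m + 1 + 4 * x : ℕ) : ℂ) ^ (-s) := by
    intro m
    have h1 := (LSeriesSummable_one_iff.2 hs)
    have h2 := h1.comp_injective (i := fun x : ℕ => m + 1 + 4 * x) (fun a b h => by
      simp only at h; omega)
    refine h2.congr fun x => ?_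
    simp only [Function.comp]
    rw [LSeries.term_of_ne_zero (by omega), Complex.cpow_neg]
    simp
  rw [DirichletCharacter.LFunction_eq_LSeries _ hs, LSeries, Nat.sumByResidueClasses hsum 4]
  have huniv : (Finset.univ : Finset (ZMod 4)) = {0, 1, 2, 3} := by decide
  rw [huniv]
  rw [Finset.sum_insert (by decide), Finset.sum_insert (by decide), Finset.sum_insert (by decide),
    Finset.sum_singleton]
  have w0 : (0 : ZMod 4).val = 0 := rfl
  have w1 : (1 : ZMod 4).val = 1 := rfl
  have w2 : (2 : ZMod 4).val = 2 := rfl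
  have w3 : (3 : ZMod 4).val = 3 := rfl
  simp only [w0, w1, w2, w3, hterm]
  push_cast
  rw [v0, v1, v2, v3]
  simp only [zero_mul, tsum_zero, one_mul, neg_mul, tsum_neg, zero_add]
  have e1 : ∑' m : ℕ, (1 + 4 * (m : ℂ)) ^ (-s) = 1 + ∑' m : ℕ, ((4 * m + 5 : ℕ) : ℂ) ^ (-s) := by
    have := (hr 0).tsum_eq_zero_add
    push_cast at this
    simp only [Complex.one_cpow] at this
    rw [this]
    congr 1
    refine tsum_congr fun m => ?_
    congr 1
    push_cast
    ring
  have e3 : ∑' m : ℕ, (3 + 4 * (m : ℂ)) ^ (-s) = ∑' m : ℕ, ((4 * m + 3 : ℕ) : ℂ) ^ (-s) := by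
    refine tsum_congr fun m => ?_
    congr 1
    push_cast
    ring
  have s5 : Summable fun m : ℕ => ((4 * m + 5 : ℕ) : ℂ) ^ (-s) :=
    (hr 4).congr fun m => by congr 2; ring
  have s3 : Summable fun m : ℕ => ((4 * m + 3 : ℕ) : ℂ) ^ (-s) :=
    (hr 2).congr fun m => by congr 2; ring
  rw [e1, e3]
  simp only [pairedTerm]
  rw [s3.tsum_sub s5]
  ring

/-- Both sides are holomorphic on the disc and agree near 5/4, where the Dirichlet series converges
absolutely; the identity theorem does the rest. -/
lemma LFunction_chiNegFour_eqOn : Set.EqOn chiNegFour.LFunction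
    (fun s => 1 - ∑' x, pairedTerm x s) (Metric.ball (1 : ℂ) (1 / 2)) := by
  have hd : DifferentiableOn ℂ (fun s => 1 - ∑' x, pairedTerm x s) (Metric.ball (1 : ℂ) (1 / 2)) :=
    (Complex.differentiableOn_tsum_of_summable_norm summable_pairedBound
      (fun x => (differentiable_pairedTerm x).differentiableOn) Metric.isOpen_ball
      (fun x s hs => norm_pairedTerm_le hs x)).const_sub 1
  refine AnalyticOnNhd.eqOn_of_preconnected_of_eventuallyEq (𝕜 := ℂ) (z₀ := 5 / 4)
    ((DirichletCharacter.differentiable_LFunction chiNegFour_ne_one).differentiableOn.analyticOnNhd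
      Metric.isOpen_ball) (hd.analyticOnNhd Metric.isOpen_ball)
    (convex_ball _ _).isPreconnected ?_ ?_
  · rw [Metric.mem_ball, dist_eq_norm]; norm_num
  · have h1 : ∀ᶠ s : ℂ in 𝓝 (5 / 4), 1 < s.re :=
      (isOpen_lt continuous_const Complex.continuous_re).mem_nhds (by norm_num)
    have h2 : ∀ᶠ s : ℂ in 𝓝 (5 / 4), s ∈ Metric.ball (1 : ℂ) (1 / 2) :=
      Metric.isOpen_ball.mem_nhds (by rw [Metric.mem_ball, dist_eq_norm]; norm_num)
    filter_upwards [h1, h2] with s a b using LFunction_chiNegFour_of_one_lt a b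

lemma LDerivOne_eq : LDerivOne = ((∑' x, pairedLogTerm x : ℝ) : ℂ) := by
  have hm : (1 : ℂ) ∈ Metric.ball (1 : ℂ) (1 / 2) := Metric.mem_ball_self (by norm_num)
  have h := Complex.hasSum_deriv_of_summable_norm summable_pairedBound
      (fun x => (differentiable_pairedTerm x).differentiableOn) Metric.isOpen_ball
      (fun x s hs => norm_pairedTerm_le hs x) hm
  simp only [deriv_pairedTerm_one] at h
  rw [LDerivOne, (LFunction_chiNegFour_eqOn.eventuallyEq_of_mem
    (Metric.isOpen_ball.mem_nhds hm)).deriv_eq, deriv_const_sub, ← h.tsum_eq, tsum_neg, neg_neg,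
    Complex.ofReal_tsum]

/-- At s = 1 the paired series is Leibniz's series for π/4, taken along odd partial sums. -/
lemma LOne_eq : LOne = ((Real.pi / 4 : ℝ) : ℂ) := by
  have hm : (1 : ℂ) ∈ Metric.ball (1 : ℂ) (1 / 2) := Metric.mem_ball_self (by norm_num)
  have hs : Summable fun x => pairedTerm x 1 :=
    summable_pairedBound.of_norm_bounded fun x => norm_pairedTerm_le hm x
  have hval : ∀ x : ℕ, pairedTerm x 1 = ((1 / (4 * x + 3) - 1 / (4 * x + 5) : ℝ) : ℂ) := by
    intro x
    rw [pairedTerm, Complex.cpow_neg_one, Complex.cpow_neg_one]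
    push_cast
    ring
  have h1 : Tendsto (fun n : ℕ => 1 - ∑ x ∈ Finset.range n,
      ((1 / (4 * x + 3) - 1 / (4 * x + 5) : ℝ))) atTop (𝓝 (Real.pi / 4)) := by
    have h2 : Tendsto (fun n : ℕ => 2 * n + 1) atTop atTop :=
      tendsto_atTop_mono (fun n => show n ≤ 2 * n + 1 by omega) tendsto_id
    refine (Real.tendsto_sum_pi_div_four.comp h2).congr fun n => ?_
    simp only [Function.comp]
    induction n with
    | zero => simp
    | succ n ih =>
      rw [show 2 * (n + 1) + 1 = 2 * n + 1 + 1 + 1 by ring, Finset.sum_range_succ,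
        Finset.sum_range_succ, ih, Finset.sum_range_succ]
      have p1 : (-1 : ℝ) ^ (2 * n + 1) = -1 := Odd.neg_one_pow ⟨n, rfl⟩
      have p2 : (-1 : ℝ) ^ (2 * n + 1 + 1) = 1 := Even.neg_one_pow ⟨n + 1, by ring⟩
      rw [p1, p2]
      push_cast
      ring
  have h3 := hs.hasSum.tendsto_sum_nat.const_sub 1
  have h4 := (Complex.continuous_ofReal.tendsto _).comp h1
  rw [LOne, LFunction_chiNegFour_eqOn hm]
  refine tendsto_nhds_unique h3 (h4.congr fun n => ?_)
  simp only [Function.comp, hval]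
  push_cast
  rfl

lemma deriv_riemannZeta_two :
    deriv riemannZeta 2 = -((∑' n : ℕ, Real.log n / (n : ℝ) ^ 2 : ℝ) : ℂ) := by
  have h1 : ∀ᶠ s : ℂ in 𝓝 2, riemannZeta s = LSeries 1 s := by
    filter_upwards [(isOpen_lt continuous_const Complex.continuous_re).mem_nhds
      (by norm_num : (1 : ℝ) < (2 : ℂ).re)] with s hs
    exact (LSeries_one_eq_riemannZeta hs).symm
  have h2 : LSeries.abscissaOfAbsConv 1 < ((2 : ℂ).re : EReal) := by
    rw [LSeries.abscissaOfAbsConv_one]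
    norm_num
    exact_mod_cast (by norm_num : (1 : ℝ) < 2)
  rw [EventuallyEq.deriv_eq h1, LSeries_deriv h2, LSeries, Complex.ofReal_tsum]
  congr 1
  refine tsum_congr fun n => ?_
  rcases Nat.eq_zero_or_pos n with rfl | hn
  · simp
  · rw [LSeries.term_of_ne_zero hn.ne', LSeries.logMul, ← Complex.natCast_log]
    norm_num

lemma cSquareFormula_eq : cSquareFormula
    = (((Real.pi / 4) / (Real.pi ^ 2 / 6) * constantBracket : ℝ) : ℂ) := by
  have t1 : ∑' p : ℕ, seriesTermOne (p + 1) = ∑' k : ℕ, coneTerm (k + 1) :=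
    tsum_congr seriesTermOne_eq
  have t2 : ∑' k : ℕ, seriesTermTwo k = (∑' k : ℕ, coneTerm (k + 1 / 2)) / 4 := by
    rw [← tsum_div_const]; exact tsum_congr seriesTermTwo_eq
  rw [cSquareFormula, LOne_eq, LDerivOne_eq, deriv_riemannZeta_two, riemannZeta_two, t1, t2,
    constantBracket]
  push_cast
  ring


/-! ### Mean values and the hyperbola method -/

/-- The summatory function of `f`. -/
noncomputable def summatory (f : ℕ → ℝ) (x : ℝ) : ℝ := ∑ n ∈ Finset.Icc 1 ⌊x⌋₊, f n

/-- `f` has mean value `α` with error `O(x ^ θ * log x)`. -/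
def HasMeanValue (f : ℕ → ℝ) (α θ : ℝ) : Prop :=
  ∃ C, ∀ x, 1 ≤ x → |summatory f x - α * x| ≤ C * (x ^ θ * (1 + Real.log x))

lemma summatory_natCast (f : ℕ → ℝ) (n : ℕ) : summatory f n = ∑ k ∈ Finset.Icc 1 n, f k := by
  rw [summatory, Nat.floor_natCast]

lemma one_le_one_add_log {x : ℝ} (hx : 1 ≤ x) : 1 ≤ 1 + Real.log x := by
  linarith [Real.log_nonneg hx]

lemma one_le_floor {x : ℝ} (hx : 1 ≤ x) : 1 ≤ ⌊x⌋₊ := by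
  rwa [Nat.one_le_floor_iff]

/-- A primitive of `- t ^ (θ - 2) * (1 + log t)` up to a constant factor. -/
noncomputable def tailWeight (θ t : ℝ) : ℝ := t ^ (θ - 1) * (1 + (1 - θ)⁻¹ + Real.log t)

lemma hasDerivAt_tailWeight {θ t : ℝ} (hθ : θ < 1) (ht : 0 < t) :
    HasDerivAt (tailWeight θ) (-((1 - θ) * (t ^ (θ - 2) * (1 + Real.log t)))) t := by
  have h := (Real.hasDerivAt_rpow_const (p := θ - 1) (Or.inl ht.ne')).mul
    ((Real.hasDerivAt_log ht.ne').const_add (1 + (1 - θ)⁻¹))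
  refine h.congr_deriv ?_
  have e : t ^ (θ - 1) = t ^ (θ - 2) * t := by
    rw [← Real.rpow_add_one ht.ne']; congr 1; ring
  rw [show θ - 1 - 1 = θ - 2 by ring, e]
  have : 1 - θ ≠ 0 := by linarith
  field_simp
  ring

/-- A discrete form of the derivative formula, by the mean value inequality: t^(θ-2) is bounded
below at the right end and the logarithm at the left end. -/
lemma tailWeight_sub_le {θ : ℝ} (hθ : θ < 1) {n : ℝ} (hn : 1 ≤ n) :
    (1 - θ) * ((n + 1) ^ (θ - 2) * (1 + Real.log n)) ≤ tailWeight θ n - tailWeight θ (n + 1) := by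
  have hd : ∀ t ∈ Set.Icc n (n + 1), HasDerivAt (fun t => -tailWeight θ t)
      ((1 - θ) * (t ^ (θ - 2) * (1 + Real.log t))) t := fun t ht => by
    simpa using (hasDerivAt_tailWeight hθ (lt_of_lt_of_le (by linarith) ht.1)).fun_neg
  have h := Convex.mul_sub_le_image_sub_of_le_deriv (convex_Icc n (n + 1))
    (f := fun t => -tailWeight θ t) (C := (1 - θ) * ((n + 1) ^ (θ - 2) * (1 + Real.log n)))
    (fun t ht => (hd t ht).continuousAt.continuousWithinAt)
    (fun t ht => (hd t (interior_subset ht)).differentiableAt.differentiableWithinAt)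
    (fun t ht => by
      have ht' := interior_subset ht
      rw [(hd t ht').deriv]
      have h0 : 0 < t := by linarith [ht'.1]
      have h1 : (n + 1) ^ (θ - 2) ≤ t ^ (θ - 2) :=
        Real.rpow_le_rpow_of_nonpos h0 ht'.2 (by linarith)
      have h2 : Real.log n ≤ Real.log t := Real.log_le_log (by linarith) ht'.1
      have h3 := one_le_one_add_log hn
      have h4 : (0 : ℝ) ≤ t ^ (θ - 2) := by positivity
      have : 0 ≤ 1 - θ := by linarith
      gcongr)
  have := h n ⟨le_rfl, by linarith⟩ (n + 1) ⟨by linarith, le_rfl⟩ (by linarith)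
  linarith

lemma tailWeight_nonneg {θ : ℝ} (hθ : θ < 1) {t : ℝ} (ht : 1 ≤ t) : 0 ≤ tailWeight θ t := by
  have h1 := Real.log_nonneg ht
  have h2 : 0 < (1 - θ)⁻¹ := inv_pos.2 (by linarith)
  exact mul_nonneg (by positivity) (by linarith)

/-- Comparison of a sequence with the decrements of a nonnegative sequence. -/
lemma exists_limit_of_abs_le_sub {b w : ℕ → ℝ} (hw : ∀ n, 0 ≤ w n)
    (h : ∀ n, |b n| ≤ w n - w (n + 1)) :
    ∃ l, ∀ n, |∑ i ∈ Finset.range n, b i - l| ≤ w n := by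
  have hs : ∀ n, ∑ i ∈ Finset.range n, |b i| ≤ w 0 - w n := by
    intro n
    induction n with
    | zero => simp
    | succ n ih => rw [Finset.sum_range_succ]; linarith [h n]
  have hsum : Summable b :=
    (summable_of_sum_range_le (fun n => abs_nonneg (b n))
      (fun n => (hs n).trans (by linarith [hw n]) : ∀ n, _ ≤ w 0)).of_abs
  refine ⟨∑' i, b i, fun n => ?_⟩
  have hb : ∀ m, |∑ i ∈ Finset.range n, b i - ∑ i ∈ Finset.range (m + n), b i| ≤ w n := by
    have : ∀ m, |∑ i ∈ Finset.range n, b i - ∑ i ∈ Finset.range (m + n), b i|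
        ≤ w n - w (m + n) := by
      intro m
      induction m with
      | zero => simp
      | succ m ih =>
        rw [show m + 1 + n = m + n + 1 by ring, Finset.sum_range_succ, ← sub_sub]
        refine (abs_sub _ _).trans ?_
        linarith [h (m + n)]
    exact fun m => (this m).trans (by linarith [hw (m + n)])
  exact le_of_tendsto ((tendsto_const_nhds.sub
    ((tendsto_add_atTop_iff_nat n).2 hsum.hasSum.tendsto_sum_nat)).abs)
    (Eventually.of_forall hb)

lemma abs_harmonic_sub_log_le {n : ℕ} (hn : 1 ≤ n) :
    |(harmonic n : ℝ) - Real.log n - Real.eulerMascheroniConstant| ≤ 1 / n := by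
  have hn' : (0 : ℝ) < n := by exact_mod_cast hn
  have h1 := Real.eulerMascheroniSeq_lt_eulerMascheroniConstant n
  have h2 := Real.eulerMascheroniConstant_lt_eulerMascheroniSeq' n
  rw [Real.eulerMascheroniSeq] at h1
  rw [Real.eulerMascheroniSeq', if_neg (by omega)] at h2
  have h3 : Real.log (n + 1) - Real.log n ≤ 1 / n := by
    rw [← Real.log_div (by positivity) (by positivity)]
    have := Real.log_le_sub_one_of_pos (x := ((n : ℝ) + 1) / n) (by positivity)
    have e : ((n : ℝ) + 1) / n - 1 = 1 / n := by field_simp; ring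
    linarith
  rw [abs_le]
  have : (0 : ℝ) < 1 / n := by positivity
  constructor <;> linarith

lemma rpow_floor_le {θ x : ℝ} (h0 : 0 ≤ θ) (hθ : θ < 1) (hx : 1 ≤ x) :
    ((⌊x⌋₊ : ℕ) : ℝ) ^ (θ - 1) ≤ 2 * x ^ (θ - 1) := by
  have h1 := Nat.lt_floor_add_one x
  have h2 : (1 : ℝ) ≤ ⌊x⌋₊ := by exact_mod_cast one_le_floor hx
  have h3 : x / 2 ≤ ⌊x⌋₊ := by linarith
  calc ((⌊x⌋₊ : ℕ) : ℝ) ^ (θ - 1) ≤ (x / 2) ^ (θ - 1) :=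
        Real.rpow_le_rpow_of_nonpos (by linarith) h3 (by linarith)
    _ = (2 : ℝ) ^ (1 - θ) * x ^ (θ - 1) := by
        rw [Real.div_rpow (by linarith) (by norm_num), div_eq_mul_inv,
          ← Real.rpow_neg (by norm_num), mul_comm]
        congr 2
        ring
    _ ≤ 2 * x ^ (θ - 1) := by
        gcongr
        calc (2 : ℝ) ^ (1 - θ) ≤ 2 ^ (1 : ℝ) :=
              Real.rpow_le_rpow_of_exponent_le (by norm_num) (by linarith)
          _ = 2 := Real.rpow_one 2

lemma inv_le_rpow {θ x : ℝ} (h0 : 0 ≤ θ) (hx : 1 ≤ x) : x⁻¹ ≤ x ^ (θ - 1) := by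
  rw [← Real.rpow_neg_one]
  exact Real.rpow_le_rpow_of_exponent_le hx (by linarith)

/-- The logarithmic mean of a function with a mean value. -/
lemma HasMeanValue.sum_div {f : ℕ → ℝ} {α θ : ℝ} (hf : HasMeanValue f α θ) (h0 : 0 ≤ θ)
    (hθ : θ < 1) : ∃ κ C, ∀ x, 1 ≤ x →
      |∑ n ∈ Finset.Icc 1 ⌊x⌋₊, f n / n - α * Real.log x - κ|
        ≤ C * (x ^ (θ - 1) * (1 + Real.log x)) := by
  obtain ⟨C, hC⟩ := hf
  have hC0 : 0 ≤ C := by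
    have h := (abs_nonneg _).trans (hC 1 le_rfl)
    simpa using h
  set e : ℕ → ℝ := fun n => summatory f n - α * n with he
  have heb : ∀ n : ℕ, 1 ≤ n → |e n| ≤ C * ((n : ℝ) ^ θ * (1 + Real.log n)) := fun n hn =>
    hC n (by exact_mod_cast hn)
  set b : ℕ → ℝ := fun i => e (i + 1) / (((i + 1 : ℕ) : ℝ) * ((i + 2 : ℕ) : ℝ)) with hb
  -- Partial summation. The main term α n of the summatory function contributes the harmonic number,
  -- and the error contributes the absolutely convergent series with terms `b`.
  have hsum : ∀ M : ℕ, ∑ n ∈ Finset.Icc 1 (M + 1), f n / n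
      = α * harmonic (M + 1) + e (M + 1) / ((M + 1 : ℕ) : ℝ) + ∑ i ∈ Finset.range M, b i := by
    intro M
    induction M with
    | zero => simp [he, summatory]
    | succ M ih =>
      rw [Finset.sum_Icc_succ_top (by omega), ih, harmonic_succ (M + 1), Finset.sum_range_succ]
      have h1 : e (M + 1 + 1) = e (M + 1) + f (M + 1 + 1) - α := by
        simp only [he, summatory_natCast]
        rw [Finset.sum_Icc_succ_top (by omega)]
        push_cast
        ring
      rw [h1]
      simp only [hb]
      generalize ∑ i ∈ Finset.range M, e (i + 1) / (((i + 1 : ℕ) : ℝ) * ((i + 2 : ℕ) : ℝ)) = T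
      generalize harmonic (M + 1) = H
      push_cast
      have : (0 : ℝ) ≤ M := Nat.cast_nonneg M
      field_simp
      ring
  -- Chosen such that |b n| is at most the decrement of D · `tailWeight`; the factor 2 pays for
  -- t^(θ-1) ≤ 2 (t + 1)^(θ-1).
  set D := 2 * C / (1 - θ) with hD
  have h1θ : 0 < 1 - θ := by linarith
  have hD0 : 0 ≤ D := by positivity
  obtain ⟨l, hl⟩ := exists_limit_of_abs_le_sub (b := b)
    (w := fun n => D * tailWeight θ ((n + 1 : ℕ) : ℝ))
    (fun n => mul_nonneg hD0 (tailWeight_nonneg hθ (by exact_mod_cast (by omega)))) (fun n => by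
      have hn : (1 : ℝ) ≤ ((n + 1 : ℕ) : ℝ) := by exact_mod_cast (by omega)
      have hw := tailWeight_sub_le hθ hn
      have e2 : (((n + 1 + 1 : ℕ)) : ℝ) = ((n + 1 : ℕ) : ℝ) + 1 := by push_cast; ring
      simp only [hb]
      rw [abs_div, e2, ← mul_sub]
      have heb' := heb (n + 1) (by omega)
      generalize (((n + 1 : ℕ)) : ℝ) = t at *
      have ht0 : 0 < t := by linarith
      have hl0 := one_le_one_add_log hn
      rw [abs_of_pos (by positivity : 0 < t * (t + 1)), div_le_iff₀ (by positivity)]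
      refine heb'.trans ?_
      have h3 : t ^ θ ≤ 2 * ((t + 1) ^ (θ - 2) * (t * (t + 1))) := by
        have a1 : t ^ θ = t ^ (θ - 1) * t := by
          rw [← Real.rpow_add_one ht0.ne']; congr 1; ring
        have a2 : (t + 1) ^ (θ - 1) = (t + 1) ^ (θ - 2) * (t + 1) := by
          rw [← Real.rpow_add_one (by positivity)]; congr 1; ring
        have a3 : t ^ (θ - 1) ≤ 2 * (t + 1) ^ (θ - 1) := by
          have : t ^ (θ - 1) = 2 ^ (1 - θ) * (2 * t) ^ (θ - 1) := by
            rw [Real.mul_rpow (by norm_num) ht0.le, ← mul_assoc, ← Real.rpow_add (by norm_num)]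
            simp
          rw [this]
          have b1 : (2 : ℝ) ^ (1 - θ) ≤ 2 := by
            calc (2 : ℝ) ^ (1 - θ) ≤ 2 ^ (1 : ℝ) :=
              Real.rpow_le_rpow_of_exponent_le (by norm_num) (by linarith)
            _ = 2 := Real.rpow_one 2
          have b2 : (2 * t) ^ (θ - 1) ≤ (t + 1) ^ (θ - 1) :=
            Real.rpow_le_rpow_of_nonpos (by linarith) (by linarith) (by linarith)
          gcongr
        calc t ^ θ = t ^ (θ - 1) * t := a1
          _ ≤ 2 * (t + 1) ^ (θ - 1) * t := by gcongr
          _ = _ := by rw [a2]; ring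
      calc C * (t ^ θ * (1 + Real.log t))
          ≤ C * (2 * ((t + 1) ^ (θ - 2) * (t * (t + 1))) * (1 + Real.log t)) := by gcongr
        _ = D * ((1 - θ) * ((t + 1) ^ (θ - 2) * (1 + Real.log t))) * (t * (t + 1)) := by
            rw [hD]; field_simp
        _ ≤ _ := by gcongr)
  refine ⟨α * Real.eulerMascheroniConstant + l,
    4 * |α| + 2 * C + D * (2 * (2 + (1 - θ)⁻¹)), fun x hx => ?_⟩
  obtain ⟨M, hM⟩ : ∃ M, ⌊x⌋₊ = M + 1 := ⟨⌊x⌋₊ - 1, by have := one_le_floor hx; omega⟩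
  rw [hM, hsum]
  have hN : (1 : ℝ) ≤ ((M + 1 : ℕ) : ℝ) := by exact_mod_cast (by omega)
  have hNx : ((M + 1 : ℕ) : ℝ) ≤ x := hM ▸ Nat.floor_le (by linarith)
  have hxN : x < ((M + 1 : ℕ) : ℝ) + 1 := hM ▸ Nat.lt_floor_add_one x
  have hH := abs_harmonic_sub_log_le (n := M + 1) (by omega)
  have hpow := rpow_floor_le h0 hθ hx
  rw [hM] at hpow
  have heN := heb (M + 1) (by omega)
  have hlM := hl M
  have hinv := inv_le_rpow h0 hx
  set N := ((M + 1 : ℕ) : ℝ) with hNdef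
  have hlogN : Real.log N ≤ Real.log x := Real.log_le_log (by linarith) hNx
  have hlogN0 : 0 ≤ Real.log N := Real.log_nonneg hN
  have hl1 := one_le_one_add_log hx
  have hx0 : 0 < x ^ (θ - 1) := by positivity
  have hNinv : 1 / N ≤ 2 * x ^ (θ - 1) := by
    have : 1 / N ≤ 2 * x⁻¹ := by
      rw [← div_eq_mul_inv, div_le_div_iff₀ (by linarith) (by linarith)]; linarith
    linarith
  have hlogd : Real.log x - Real.log N ≤ 1 / N := by
    rw [← Real.log_div (by linarith) (by linarith)]
    have h5 := Real.log_le_sub_one_of_pos (x := x / N) (by positivity)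
    have h6 : x / N - 1 ≤ 1 / N := by
      rw [div_sub_one (by linarith)]; gcongr; linarith
    linarith
  have t1 : |α * (harmonic (M + 1) - Real.log x - Real.eulerMascheroniConstant)|
      ≤ |α| * (2 * (1 / N)) := by
    rw [abs_mul]
    gcongr
    have := abs_le.1 hH
    rw [abs_le]
    constructor <;> linarith
  have t2 : |e (M + 1) / N| ≤ C * (2 * x ^ (θ - 1) * (1 + Real.log x)) := by
    rw [abs_div, abs_of_pos (by linarith : 0 < N), div_le_iff₀ (by linarith)]
    refine heN.trans ?_
    have : N ^ θ = N ^ (θ - 1) * N := by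
      rw [← Real.rpow_add_one (by linarith)]; congr 1; ring
    rw [this]
    calc C * (N ^ (θ - 1) * N * (1 + Real.log N))
        ≤ C * ((2 * x ^ (θ - 1)) * N * (1 + Real.log x)) := by gcongr
      _ = _ := by ring
  have t3 : |∑ i ∈ Finset.range M, b i - l|
      ≤ D * (2 * x ^ (θ - 1) * ((2 + (1 - θ)⁻¹) * (1 + Real.log x))) := by
    refine hlM.trans ?_
    rw [tailWeight]
    have hi : 0 < (1 - θ)⁻¹ := inv_pos.2 h1θ
    gcongr
    nlinarith
  have key : α * (harmonic (M + 1) : ℝ) + e (M + 1) / N + ∑ i ∈ Finset.range M, b i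
      - α * Real.log x - (α * Real.eulerMascheroniConstant + l)
      = α * (harmonic (M + 1) - Real.log x - Real.eulerMascheroniConstant) + e (M + 1) / N
        + (∑ i ∈ Finset.range M, b i - l) := by ring
  rw [key]
  refine (abs_add_three _ _ _).trans ?_
  have t1' : |α| * (2 * (1 / N)) ≤ |α| * (4 * (x ^ (θ - 1) * (1 + Real.log x))) := by
    apply mul_le_mul_of_nonneg_left _ (abs_nonneg α)
    nlinarith
  have e3 : (4 * |α| + 2 * C + D * (2 * (2 + (1 - θ)⁻¹))) * (x ^ (θ - 1) * (1 + Real.log x))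
      = |α| * (4 * (x ^ (θ - 1) * (1 + Real.log x))) + C * (2 * x ^ (θ - 1) * (1 + Real.log x))
        + D * (2 * x ^ (θ - 1) * ((2 + (1 - θ)⁻¹) * (1 + Real.log x))) := by ring
  rw [e3]
  linarith


lemma mem_Icc_floor {x : ℝ} {n : ℕ} : n ∈ Finset.Icc 1 ⌊x⌋₊ ↔ 1 ≤ n ∧ (n : ℝ) ≤ x := by
  rw [Finset.mem_Icc]
  constructor
  · rintro ⟨h1, h2⟩
    exact ⟨h1, (Nat.le_floor_iff' (by omega)).1 h2⟩
  · rintro ⟨h1, h2⟩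
    exact ⟨h1, (Nat.le_floor_iff' (by omega)).2 h2⟩

lemma summatory_div (g : ℕ → ℝ) (x : ℝ) {a N : ℕ} (ha : 1 ≤ a) (hN : ⌊x⌋₊ = N) :
    summatory g (x / a) = ∑ b ∈ Finset.Icc 1 N, if (a * b : ℝ) ≤ x then g b else 0 := by
  rw [summatory, ← Finset.sum_filter]
  have ha' : (0 : ℝ) < a := by exact_mod_cast ha
  refine Finset.sum_congr ?_ fun _ _ => rfl
  ext b
  rw [Finset.mem_filter, mem_Icc_floor, ← hN, mem_Icc_floor, le_div_iff₀ ha', mul_comm (b : ℝ)]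
  constructor
  · rintro ⟨h1, h2⟩
    refine ⟨⟨h1, le_trans ?_ h2⟩, h2⟩
    have : (1 : ℝ) ≤ a := by exact_mod_cast ha
    nlinarith [(Nat.cast_nonneg b : (0 : ℝ) ≤ b)]
  · rintro ⟨⟨h1, -⟩, h2⟩
    exact ⟨h1, h2⟩

/-- The hyperbola method. -/
lemma summatory_mul (f g : ArithmeticFunction ℝ) {x : ℝ} (hx : 1 ≤ x) :
    summatory (f * g : ArithmeticFunction ℝ) x = ∑ n ∈ Finset.Icc 1 ⌊√x⌋₊, f n * summatory g (x / n)
      + ∑ n ∈ Finset.Icc 1 ⌊√x⌋₊, g n * summatory f (x / n)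
      - summatory f √x * summatory g √x := by
  set N := ⌊x⌋₊ with hN
  have hx0 : 0 ≤ x := by linarith
  have hsx : √x ≤ x := by
    rw [Real.sqrt_le_left hx0]; nlinarith
  have hIcc : Finset.Icc 1 N = Finset.Ioc 0 N := rfl
  have hsub : Finset.Icc 1 ⌊√x⌋₊ = (Finset.Icc 1 N).filter fun n : ℕ => (n : ℝ) ≤ √x := by
    ext n
    rw [Finset.mem_filter, mem_Icc_floor, hN, mem_Icc_floor]
    constructor
    · rintro ⟨h1, h2⟩; exact ⟨⟨h1, h2.trans hsx⟩, h2⟩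
    · rintro ⟨⟨h1, -⟩, h2⟩; exact ⟨h1, h2⟩
  have hle : ∀ a b : ℕ, a * b ≤ N ↔ (a * b : ℝ) ≤ x := by
    intro a b
    rw [hN, Nat.le_floor_iff hx0]
    push_cast
    rfl
  rw [summatory, ← hN, hIcc, ArithmeticFunction.sum_Ioc_mul_eq_sum_prod_filter, ← hIcc,
    Finset.sum_filter, Finset.sum_product]
  have h1 : ∑ n ∈ Finset.Icc 1 ⌊√x⌋₊, f n * summatory g (x / n)
      = ∑ a ∈ Finset.Icc 1 N, ∑ b ∈ Finset.Icc 1 N,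
        if (a : ℝ) ≤ √x ∧ (a * b : ℝ) ≤ x then f a * g b else 0 := by
    rw [hsub, Finset.sum_filter]
    refine Finset.sum_congr rfl fun a ha => ?_
    rw [summatory_div g x (Finset.mem_Icc.1 ha).1 hN.symm, Finset.mul_sum]
    split_ifs with h <;> simp [h]
  have h2 : ∑ n ∈ Finset.Icc 1 ⌊√x⌋₊, g n * summatory f (x / n)
      = ∑ a ∈ Finset.Icc 1 N, ∑ b ∈ Finset.Icc 1 N,
        if (b : ℝ) ≤ √x ∧ (a * b : ℝ) ≤ x then f a * g b else 0 := by
    rw [hsub, Finset.sum_filter, Finset.sum_comm]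
    refine Finset.sum_congr rfl fun a ha => ?_
    rw [summatory_div f x (Finset.mem_Icc.1 ha).1 hN.symm, Finset.mul_sum]
    split_ifs with h <;> simp [h, mul_comm]
  have h3 : summatory f √x * summatory g √x
      = ∑ a ∈ Finset.Icc 1 N, ∑ b ∈ Finset.Icc 1 N,
        if (a : ℝ) ≤ √x ∧ (b : ℝ) ≤ √x then f a * g b else 0 := by
    rw [summatory, summatory, hsub, Finset.sum_filter, Finset.sum_filter, Finset.sum_mul_sum]
    refine Finset.sum_congr rfl fun a _ => Finset.sum_congr rfl fun b _ => ?_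
    split_ifs <;> simp_all
  rw [h1, h2, h3, ← Finset.sum_add_distrib, ← Finset.sum_sub_distrib]
  refine Finset.sum_congr rfl fun a _ => ?_
  rw [← Finset.sum_add_distrib, ← Finset.sum_sub_distrib]
  refine Finset.sum_congr rfl fun b _ => ?_
  simp only [hle]
  have hss : √x * √x = x := Real.mul_self_sqrt hx0
  have hs0 := Real.sqrt_nonneg x
  have ha0 : (0 : ℝ) ≤ a := Nat.cast_nonneg a
  have hb0 : (0 : ℝ) ≤ b := Nat.cast_nonneg b
  -- Pointwise inclusion-exclusion: if a b ≤ x, then a ≤ √x or b ≤ √x, and both of these imply a b ≤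
  -- x.
  by_cases ha : (a : ℝ) ≤ √x <;> by_cases hb : (b : ℝ) ≤ √x
  · have : (a * b : ℝ) ≤ x := by nlinarith
    simp [ha, hb, this]
  · simp [ha, hb]
  · simp [ha, hb]
  · have : ¬ (a * b : ℝ) ≤ x := by nlinarith
    simp [ha, hb, this]

/-- Comparison of weighted sums from partial sums. -/
lemma sum_mul_le_of_sum_le {a w : ℕ → ℝ} {K : ℝ} (hw : Antitone w) (hw0 : ∀ n, 0 ≤ w n)
    (h : ∀ n, ∑ i ∈ Finset.range n, a i ≤ K * n) (n : ℕ) :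
    ∑ i ∈ Finset.range n, a i * w i ≤ K * ∑ i ∈ Finset.range n, w i := by
  have key : ∀ n, w n * (∑ i ∈ Finset.range n, (K - a i))
      ≤ ∑ i ∈ Finset.range n, (K - a i) * w i := by
    intro n
    have hD : ∀ n, 0 ≤ ∑ i ∈ Finset.range n, (K - a i) := by
      intro n
      rw [Finset.sum_sub_distrib]
      simp only [Finset.sum_const, Finset.card_range, nsmul_eq_mul]
      linarith [h n]
    induction n with
    | zero => simp
    | succ n ih =>
      rw [Finset.sum_range_succ (fun i => (K - a i) * w i)]
      have h1 : w (n + 1) * ∑ i ∈ Finset.range (n + 1), (K - a i)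
          ≤ w n * ∑ i ∈ Finset.range (n + 1), (K - a i) :=
        mul_le_mul_of_nonneg_right (hw (Nat.le_succ n)) (hD _)
      rw [Finset.sum_range_succ, mul_add, mul_add] at h1
      rw [Finset.sum_range_succ, mul_add]
      linarith
  have hD : 0 ≤ ∑ i ∈ Finset.range n, (K - a i) := by
    rw [Finset.sum_sub_distrib]
    simp only [Finset.sum_const, Finset.card_range, nsmul_eq_mul]
    linarith [h n]
  have h2 := (mul_nonneg (hw0 n) hD).trans (key n)
  simp only [sub_mul, Finset.sum_sub_distrib] at h2
  rw [← Finset.mul_sum] at h2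
  linarith

/-- Bernoulli's inequality bounds each term by the increment of n^(1-θ)/(1-θ), so the sum
telescopes. -/
lemma sum_rpow_neg_le {θ : ℝ} (h0 : 0 ≤ θ) (hθ : θ < 1) (n : ℕ) :
    ∑ i ∈ Finset.range n, ((i + 1 : ℕ) : ℝ) ^ (-θ) ≤ (n : ℝ) ^ (1 - θ) / (1 - θ) := by
  have h1 : 0 < 1 - θ := by linarith
  induction n with
  | zero => simp [Real.zero_rpow h1.ne']
  | succ n ih =>
    rw [Finset.sum_range_succ]
    have hn : (0 : ℝ) < ((n + 1 : ℕ) : ℝ) := by positivity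
    have hb := rpow_one_add_le_one_add_mul_self (s := -1 / ((n + 1 : ℕ) : ℝ)) (p := 1 - θ)
      (by rw [le_div_iff₀ hn]; push_cast; linarith [(Nat.cast_nonneg n : (0 : ℝ) ≤ n)])
      h1.le (by linarith)
    have e1 : (n : ℝ) = ((n + 1 : ℕ) : ℝ) * (1 + -1 / ((n + 1 : ℕ) : ℝ)) := by
      field_simp; push_cast; ring
    have e2 : (0 : ℝ) ≤ 1 + -1 / ((n + 1 : ℕ) : ℝ) := by
      rw [← mul_nonneg_iff_of_pos_left hn, ← e1]; positivity
    have e3 : (n : ℝ) ^ (1 - θ) ≤ ((n + 1 : ℕ) : ℝ) ^ (1 - θ)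
        - (1 - θ) * ((n + 1 : ℕ) : ℝ) ^ (-θ) := by
      have e4 : ((n + 1 : ℕ) : ℝ) ^ (1 - θ) = ((n + 1 : ℕ) : ℝ) * ((n + 1 : ℕ) : ℝ) ^ (-θ) := by
        rw [mul_comm, ← Real.rpow_add_one hn.ne']; congr 1; ring
      rw [e1, Real.mul_rpow hn.le e2]
      calc ((n + 1 : ℕ) : ℝ) ^ (1 - θ) * (1 + -1 / ((n + 1 : ℕ) : ℝ)) ^ (1 - θ)
          ≤ ((n + 1 : ℕ) : ℝ) ^ (1 - θ) * (1 + (1 - θ) * (-1 / ((n + 1 : ℕ) : ℝ))) := by gcongr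
        _ = _ := by rw [e4]; field_simp; ring
    calc _ ≤ (n : ℝ) ^ (1 - θ) / (1 - θ) + ((n + 1 : ℕ) : ℝ) ^ (-θ) := by gcongr
      _ ≤ (((n + 1 : ℕ) : ℝ) ^ (1 - θ) - (1 - θ) * ((n + 1 : ℕ) : ℝ) ^ (-θ)) / (1 - θ)
          + ((n + 1 : ℕ) : ℝ) ^ (-θ) := by gcongr
      _ = _ := by field_simp; ring

/-- A weighted sum of a nonnegative function with bounded means. -/
lemma sum_mul_rpow_neg_le {f : ℕ → ℝ} {K θ y : ℝ} (h0 : 0 ≤ θ) (hθ : θ < 1) (hy : 1 ≤ y)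
    (hK : ∀ x, 1 ≤ x → summatory (fun n => |f n|) x ≤ K * x) :
    ∑ n ∈ Finset.Icc 1 ⌊y⌋₊, |f n| * (n : ℝ) ^ (-θ) ≤ K / (1 - θ) * y ^ (1 - θ) := by
  have h1 : 0 < 1 - θ := by linarith
  have hK0 : 0 ≤ K := by
    have := hK 1 le_rfl
    rw [mul_one] at this
    exact le_trans (Finset.sum_nonneg fun _ _ => abs_nonneg _) this
  have hshift : ∀ (F : ℕ → ℝ) (n : ℕ), ∑ k ∈ Finset.Icc 1 n, F k
      = ∑ i ∈ Finset.range n, F (i + 1) := by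
    intro F n
    induction n with
    | zero => simp
    | succ n ih => rw [Finset.sum_Icc_succ_top (by omega), ih, Finset.sum_range_succ]
  have h := sum_mul_le_of_sum_le (a := fun i => |f (i + 1)|)
    (w := fun i => ((i + 1 : ℕ) : ℝ) ^ (-θ)) (K := K) (fun i j hij => by
      apply Real.rpow_le_rpow_of_nonpos (by positivity) _ (by linarith)
      exact_mod_cast Nat.succ_le_succ hij) (fun n => by positivity) (fun n => by
      rcases Nat.eq_zero_or_pos n with rfl | hn
      · simp
      · have := hK n (by exact_mod_cast hn)
        rw [summatory_natCast, hshift] at this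
        exact this) ⌊y⌋₊
  rw [hshift]
  refine h.trans ?_
  calc K * ∑ i ∈ Finset.range ⌊y⌋₊, ((i + 1 : ℕ) : ℝ) ^ (-θ)
      ≤ K * ((⌊y⌋₊ : ℝ) ^ (1 - θ) / (1 - θ)) := by gcongr; exact sum_rpow_neg_le h0 hθ _
    _ ≤ K * (y ^ (1 - θ) / (1 - θ)) := by
        gcongr; exact Nat.floor_le (by linarith)
    _ = _ := by ring

/-- The mean of `|f|` is bounded. -/
def HasBoundedMean (f : ℕ → ℝ) : Prop :=
  ∃ K, ∀ x, 1 ≤ x → summatory (fun n => |f n|) x ≤ K * x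

lemma rpow_mul_one_add_log_le {θ x : ℝ} (h1 : θ < 1) (hx : 1 ≤ x) :
    x ^ θ * (1 + Real.log x) ≤ (1 + (1 - θ)⁻¹) * x := by
  have hx0 : 0 < x := by linarith
  have h2 : 0 < 1 - θ := by linarith
  have h3 := Real.log_le_rpow_div hx0.le h2
  have h4 : 1 ≤ x ^ (1 - θ) := Real.one_le_rpow hx h2.le
  have h5 : x = x ^ θ * x ^ (1 - θ) := by rw [← Real.rpow_add hx0]; simp
  have h6 : 1 + Real.log x ≤ (1 + (1 - θ)⁻¹) * x ^ (1 - θ) := by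
    rw [add_mul, one_mul, inv_mul_eq_div]; linarith
  calc x ^ θ * (1 + Real.log x) ≤ x ^ θ * ((1 + (1 - θ)⁻¹) * x ^ (1 - θ)) := by gcongr
    _ = (1 + (1 - θ)⁻¹) * x := by conv_rhs => rw [h5]
                                  ring

lemma HasMeanValue.abs_le {f : ℕ → ℝ} {α θ : ℝ} (hf : HasMeanValue f α θ) (h1 : θ < 1) :
    ∃ K, ∀ x, 1 ≤ x → |summatory f x| ≤ K * x := by
  obtain ⟨C, hC⟩ := hf
  have hC0 : 0 ≤ C := by
    have h := (abs_nonneg _).trans (hC 1 le_rfl)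
    simpa using h
  refine ⟨C * (1 + (1 - θ)⁻¹) + |α|, fun x hx => ?_⟩
  have h := hC x hx
  have h2 := mul_le_mul_of_nonneg_left (rpow_mul_one_add_log_le h1 hx) hC0
  have h3 : |α * x| = |α| * x := by rw [abs_mul, abs_of_pos (by linarith : 0 < x)]
  have h4 := abs_sub_abs_le_abs_sub (summatory f x) (α * x)
  linarith

lemma HasMeanValue.hasBoundedMean {f : ℕ → ℝ} {α θ : ℝ} (hf : HasMeanValue f α θ) (h1 : θ < 1)
    (hpos : ∀ n, 0 ≤ f n) : HasBoundedMean f := by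
  obtain ⟨K, hK⟩ := hf.abs_le h1
  refine ⟨K, fun x hx => ?_⟩
  simp only [abs_of_nonneg (hpos _)]
  exact (le_abs_self _).trans (hK x hx)

/-- One half of the hyperbola method. -/
lemma HasMeanValue.sum_mul_summatory {f g : ℕ → ℝ} {α β θ : ℝ} (hf : HasMeanValue f α θ)
    (hg : HasMeanValue g β θ) (hfb : HasBoundedMean f) (h0 : 0 ≤ θ) (hθ : θ < 1) :
    ∃ κ C, ∀ x, 1 ≤ x →
      |∑ n ∈ Finset.Icc 1 ⌊√x⌋₊, f n * summatory g (x / n)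
        - (α * β / 2 * (x * Real.log x) + κ * x)| ≤ C * (x ^ ((1 + θ) / 2) * (1 + Real.log x)) := by
  obtain ⟨κ, C₁, h1⟩ := hf.sum_div h0 hθ
  obtain ⟨C₂, h2⟩ := hg
  obtain ⟨K, hK⟩ := hfb
  have hC₂0 : 0 ≤ C₂ := by
    have h := (abs_nonneg _).trans (h2 1 le_rfl)
    simpa using h
  have hC₁0 : 0 ≤ C₁ := by
    have h := (abs_nonneg _).trans (h1 1 le_rfl)
    simpa using h
  refine ⟨β * κ, |β| * C₁ + C₂ * (K / (1 - θ)), fun x hx => ?_⟩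
  have hx0 : 0 < x := by linarith
  have hs1 : 1 ≤ √x := Real.one_le_sqrt.2 hx
  have hl := one_le_one_add_log hx
  have hlog : Real.log √x = Real.log x / 2 := Real.log_sqrt hx0.le
  have hsq : √x = x ^ (1 / 2 : ℝ) := Real.sqrt_eq_rpow x
  -- Inserting the main term of the inner summatory function leaves the logarithmic mean of `f` up
  -- to √x, whose logarithm halves the coefficient, and an error of order x^θ ∑ |f n| n^(-θ). The
  -- bounded mean of `f` makes the latter x^θ (√x)^(1-θ) = x^((1+θ)/2).
  have e1 : ∑ n ∈ Finset.Icc 1 ⌊√x⌋₊, f n * summatory g (x / n)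
      = β * x * ∑ n ∈ Finset.Icc 1 ⌊√x⌋₊, f n / n
        + ∑ n ∈ Finset.Icc 1 ⌊√x⌋₊, f n * (summatory g (x / n) - β * (x / n)) := by
    rw [Finset.mul_sum, ← Finset.sum_add_distrib]
    exact Finset.sum_congr rfl fun n _ => by ring
  have b1 := h1 √x hs1
  have b2 : |∑ n ∈ Finset.Icc 1 ⌊√x⌋₊, f n * (summatory g (x / n) - β * (x / n))|
      ≤ C₂ * (K / (1 - θ)) * (x ^ ((1 + θ) / 2) * (1 + Real.log x)) := by
    have hstep : ∀ n ∈ Finset.Icc 1 ⌊√x⌋₊, |f n * (summatory g (x / n) - β * (x / n))|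
        ≤ C₂ * (1 + Real.log x) * x ^ θ * (|f n| * (n : ℝ) ^ (-θ)) := by
      intro n hn
      obtain ⟨hn1, hn2⟩ := mem_Icc_floor.1 hn
      have hn0 : (1 : ℝ) ≤ n := by exact_mod_cast hn1
      have hnx : 1 ≤ x / n := by
        rw [le_div_iff₀ (by linarith), one_mul]
        have : √x ≤ x := by rw [Real.sqrt_le_left hx0.le]; nlinarith
        linarith
      have h3 := h2 _ hnx
      have hlogn : Real.log (x / n) ≤ Real.log x :=
        Real.log_le_log (by positivity) (div_le_self hx0.le hn0)
      have hpow : (x / n) ^ θ = x ^ θ * (n : ℝ) ^ (-θ) := by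
        rw [Real.div_rpow hx0.le (by linarith), Real.rpow_neg (by linarith), div_eq_mul_inv]
      rw [abs_mul]
      calc |f n| * |summatory g (x / n) - β * (x / n)|
          ≤ |f n| * (C₂ * ((x / n) ^ θ * (1 + Real.log x))) := by
            gcongr
            exact h3.trans (by gcongr)
        _ = _ := by rw [hpow]; ring
    refine (Finset.abs_sum_le_sum_abs _ _).trans ((Finset.sum_le_sum hstep).trans ?_)
    rw [← Finset.mul_sum]
    have h4 := sum_mul_rpow_neg_le h0 hθ hs1 hK
    have hp : x ^ θ * √x ^ (1 - θ) = x ^ ((1 + θ) / 2) := by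
      rw [hsq, ← Real.rpow_mul hx0.le, ← Real.rpow_add hx0]; congr 1; ring
    calc C₂ * (1 + Real.log x) * x ^ θ * ∑ n ∈ Finset.Icc 1 ⌊√x⌋₊, |f n| * (n : ℝ) ^ (-θ)
        ≤ C₂ * (1 + Real.log x) * x ^ θ * (K / (1 - θ) * √x ^ (1 - θ)) := by gcongr
      _ = C₂ * (K / (1 - θ)) * (x ^ θ * √x ^ (1 - θ) * (1 + Real.log x)) := by ring
      _ = _ := by rw [hp]
  rw [hlog] at b1
  have b3 : |β * x * (∑ n ∈ Finset.Icc 1 ⌊√x⌋₊, f n / n - α * (Real.log x / 2) - κ)|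
      ≤ |β| * C₁ * (x ^ ((1 + θ) / 2) * (1 + Real.log x)) := by
    have hp : x * √x ^ (θ - 1) = x ^ ((1 + θ) / 2) := by
      nth_rewrite 1 [← Real.rpow_one x]
      rw [hsq, ← Real.rpow_mul hx0.le, ← Real.rpow_add hx0]; congr 1; ring
    rw [abs_mul, abs_mul, abs_of_pos hx0]
    have hlx : Real.log x / 2 ≤ Real.log x := by linarith
    have h5 : 0 ≤ √x ^ (θ - 1) := by positivity
    calc |β| * x * |∑ n ∈ Finset.Icc 1 ⌊√x⌋₊, f n / n - α * (Real.log x / 2) - κ|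
        ≤ |β| * x * (C₁ * (√x ^ (θ - 1) * (1 + Real.log x))) := by
          gcongr
          exact b1.trans (by gcongr)
      _ = |β| * C₁ * (x * √x ^ (θ - 1) * (1 + Real.log x)) := by ring
      _ = _ := by rw [hp]
  have key : ∑ n ∈ Finset.Icc 1 ⌊√x⌋₊, f n * summatory g (x / n)
        - (α * β / 2 * (x * Real.log x) + β * κ * x)
      = β * x * (∑ n ∈ Finset.Icc 1 ⌊√x⌋₊, f n / n - α * (Real.log x / 2) - κ)
        + ∑ n ∈ Finset.Icc 1 ⌊√x⌋₊, f n * (summatory g (x / n) - β * (x / n)) := by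
    rw [e1]; ring
  rw [key, add_mul]
  exact (abs_add_le _ _).trans (add_le_add b3 b2)

/-- The summatory function of a Dirichlet convolution. -/
lemma HasMeanValue.summatory_mul {f g : ArithmeticFunction ℝ} {α β θ : ℝ}
    (hf : HasMeanValue f α θ) (hg : HasMeanValue g β θ) (hfb : HasBoundedMean f)
    (hgb : HasBoundedMean g) (h0 : 0 ≤ θ) (hθ : θ < 1) :
    ∃ κ C, ∀ x, 1 ≤ x →
      |summatory (f * g : ArithmeticFunction ℝ) x - (α * β * (x * Real.log x) + κ * x)|
        ≤ C * (x ^ ((1 + θ) / 2) * (1 + Real.log x)) := by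
  obtain ⟨κ₁, C₁, h1⟩ := hf.sum_mul_summatory hg hfb h0 hθ
  obtain ⟨κ₂, C₂, h2⟩ := hg.sum_mul_summatory hf hgb h0 hθ
  obtain ⟨K, hK⟩ := hg.abs_le hθ
  obtain ⟨C₃, h3⟩ := hf
  obtain ⟨C₄, h4⟩ := hg
  have hC₃0 : 0 ≤ C₃ := by
    have h := (abs_nonneg _).trans (h3 1 le_rfl)
    simpa using h
  have hC₄0 : 0 ≤ C₄ := by
    have h := (abs_nonneg _).trans (h4 1 le_rfl)
    simpa using h
  refine ⟨κ₁ + κ₂ - α * β, C₁ + C₂ + C₃ * K + |α| * C₄, fun x hx => ?_⟩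
  have hx0 : 0 < x := by linarith
  have hs1 : 1 ≤ √x := Real.one_le_sqrt.2 hx
  have hl := one_le_one_add_log hx
  have hss : √x * √x = x := Real.mul_self_sqrt hx0.le
  have hlog : Real.log √x ≤ Real.log x := by
    rw [Real.log_sqrt hx0.le]; linarith
  have hp : √x ^ θ * √x = x ^ ((1 + θ) / 2) := by
    rw [← Real.rpow_add_one (by positivity), Real.sqrt_eq_rpow, ← Real.rpow_mul hx0.le]
    congr 1; ring
  have hK0 : 0 ≤ K := by
    have := (abs_nonneg _).trans (hK 1 le_rfl)
    simpa using this
  have b3 : |(summatory f √x - α * √x) * summatory g √x|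
      ≤ C₃ * K * (x ^ ((1 + θ) / 2) * (1 + Real.log x)) := by
    rw [abs_mul]
    calc |summatory f √x - α * √x| * |summatory g √x|
        ≤ (C₃ * (√x ^ θ * (1 + Real.log x))) * (K * √x) := by
          gcongr
          · exact (h3 _ hs1).trans (by gcongr)
          · exact hK _ hs1
      _ = C₃ * K * ((√x ^ θ * √x) * (1 + Real.log x)) := by ring
      _ = _ := by rw [hp]
  have b4 : |α * √x * (summatory g √x - β * √x)|
      ≤ |α| * C₄ * (x ^ ((1 + θ) / 2) * (1 + Real.log x)) := by
    rw [abs_mul, abs_mul, abs_of_nonneg (Real.sqrt_nonneg x)]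
    calc |α| * √x * |summatory g √x - β * √x|
        ≤ |α| * √x * (C₄ * (√x ^ θ * (1 + Real.log x))) := by
          gcongr
          exact (h4 _ hs1).trans (by gcongr)
      _ = |α| * C₄ * ((√x ^ θ * √x) * (1 + Real.log x)) := by ring
      _ = _ := by rw [hp]
  have b1 := h1 x hx
  have b2 := h2 x hx
  rw [WellRounded.summatory_mul f g hx]
  -- The two halves supply the full coefficient of x log x, while the main term of the correction at
  -- √x is α β x and is absorbed into the linear term.
  have key : ∀ A B F G : ℝ, A + B - F * G - (α * β * (x * Real.log x) + (κ₁ + κ₂ - α * β) * x)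
      = (A - (α * β / 2 * (x * Real.log x) + κ₁ * x)) + (B - (β * α / 2 * (x * Real.log x) + κ₂ * x))
        + (-((F - α * √x) * G) + -(α * √x * (G - β * √x))) := by
    intro A B F G
    have : α * √x * (β * √x) = α * β * x := by
      calc α * √x * (β * √x) = α * β * (√x * √x) := by ring
        _ = _ := by rw [hss]
    linear_combination (-1 : ℝ) * this
  rw [key]
  refine (abs_add_three _ _ _).trans ?_
  have b5 := abs_add_le (-((summatory f √x - α * √x) * summatory g √x))
    (-(α * √x * (summatory g √x - β * √x)))
  rw [abs_neg, abs_neg] at b5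
  rw [add_mul, add_mul, add_mul]
  linarith


/-! ### Mean value of χ₋₄ * 1 -/

/-- The character `χ₋₄` as a real arithmetic function. -/
noncomputable def chiArith : ArithmeticFunction ℝ := ⟨fun n => (ZMod.χ₄ (n : ZMod 4) : ℝ), by simp⟩

lemma chiArith_apply (n : ℕ) : chiArith n = (ZMod.χ₄ (n : ZMod 4) : ℝ) := rfl

/-- The function `chiSum` as a real arithmetic function. -/
noncomputable def chiSumArith : ArithmeticFunction ℝ := chiArith * ArithmeticFunction.zeta

lemma chiSumArith_apply (n : ℕ) : chiSumArith n = (chiSum n : ℝ) := by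
  rw [chiSumArith, ArithmeticFunction.coe_mul_zeta_apply, chiSum]
  push_cast
  rfl

lemma abs_chi_le (n : ℕ) : |chiArith n| ≤ 1 := by
  rw [chiArith_apply]
  generalize (n : ZMod 4) = a
  fin_cases a <;> simp [ZMod.χ₄]

lemma sum_chi (n : ℕ) : ∑ k ∈ Finset.Icc 1 n, chiArith k = if n % 4 = 1 ∨ n % 4 = 2 then 1 else 0 := by
  induction n with
  | zero => simp
  | succ n ih =>
    rw [Finset.sum_Icc_succ_top (by omega), ih, chiArith_apply]
    have h : n % 4 = 0 ∨ n % 4 = 1 ∨ n % 4 = 2 ∨ n % 4 = 3 := by omega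
    have hc : (((n + 1 : ℕ)) : ZMod 4) = (((n % 4 + 1 : ℕ)) : ZMod 4) := by
      rw [ZMod.natCast_eq_natCast_iff']; omega
    rw [hc]
    rcases h with h | h | h | h
    · have : (n + 1) % 4 = 1 := by omega
      rw [h, this]
      have : ZMod.χ₄ ((0 + 1 : ℕ) : ZMod 4) = 1 := by decide
      rw [this]; norm_num
    · have : (n + 1) % 4 = 2 := by omega
      rw [h, this]
      have : ZMod.χ₄ ((1 + 1 : ℕ) : ZMod 4) = 0 := by decide
      rw [this]; norm_num
    · have : (n + 1) % 4 = 3 := by omega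
      rw [h, this]
      have : ZMod.χ₄ ((2 + 1 : ℕ) : ZMod 4) = -1 := by decide
      rw [this]; norm_num
    · have : (n + 1) % 4 = 0 := by omega
      rw [h, this]
      have : ZMod.χ₄ ((3 + 1 : ℕ) : ZMod 4) = 0 := by decide
      rw [this]; norm_num

lemma hasMeanValue_chi : HasMeanValue chiArith 0 0 := by
  refine ⟨1, fun x hx => ?_⟩
  rw [summatory, sum_chi, zero_mul, sub_zero, Real.rpow_zero, one_mul, one_mul]
  have := one_le_one_add_log hx
  split_ifs <;> simp <;> linarith

lemma summatory_one (x : ℝ) : summatory (fun _ => 1) x = ⌊x⌋₊ := by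
  simp [summatory]

lemma hasBoundedMean_chi : HasBoundedMean chiArith := by
  refine ⟨1, fun x hx => ?_⟩
  calc summatory (fun n => |chiArith n|) x ≤ summatory (fun _ => 1) x :=
        Finset.sum_le_sum fun n _ => abs_chi_le n
    _ ≤ 1 * x := by rw [summatory_one, one_mul]; exact Nat.floor_le (by linarith)

lemma summatory_zeta (x : ℝ) :
    summatory ((ArithmeticFunction.zeta : ArithmeticFunction ℝ)) x = ⌊x⌋₊ := by
  rw [← summatory_one]
  refine Finset.sum_congr rfl fun n hn => ?_
  have : n ≠ 0 := by have := (Finset.mem_Icc.1 hn).1; omega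
  simp [ArithmeticFunction.natCoe_apply, this]

lemma hasMeanValue_zeta : HasMeanValue ((ArithmeticFunction.zeta : ArithmeticFunction ℝ)) 1 0 := by
  refine ⟨1, fun x hx => ?_⟩
  rw [summatory_zeta, Real.rpow_zero, one_mul, one_mul, one_mul]
  have h1 := Nat.floor_le (by linarith : 0 ≤ x)
  have h2 := Nat.lt_floor_add_one x
  have := one_le_one_add_log hx
  rw [abs_le]
  constructor <;> linarith

/-- Here θ = 0 for both factors, so the hyperbola method gives exponent 1/2. The mean value of χ₋₄
is 0, so no term x log x appears. -/
lemma hasMeanValue_chiSum : ∃ κ, HasMeanValue chiSumArith κ (1 / 2) := by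
  obtain ⟨κ, C, h⟩ := hasMeanValue_chi.summatory_mul hasMeanValue_zeta hasBoundedMean_chi
    (hasMeanValue_zeta.hasBoundedMean (by norm_num) fun n => by
      simp [ArithmeticFunction.natCoe_apply]; positivity) le_rfl (by norm_num)
  refine ⟨κ, C, fun x hx => ?_⟩
  have := h x hx
  rwa [zero_mul, zero_mul, zero_add, add_zero] at this

lemma chiSum_nonneg {n : ℕ} (hn : n ≠ 0) : 0 ≤ chiSum n := by
  rw [← ncard_quadrantFiber n hn]; positivity


/-! ### Lattice points of the cone under a hyperbola -/

/-- The number of points `q ≡ p` modulo one in the cone with `p * q ≤ y`. -/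
noncomputable def coneColumn (y p : ℝ) : ℕ := ⌊min ((√3 - 1) * p) (y / p - p)⌋₊

lemma sum_range_add (τ : ℝ) (n : ℕ) :
    ∑ k ∈ Finset.range n, ((k : ℝ) + τ) = (n + τ - 1 / 2) ^ 2 / 2 - (τ - 1 / 2) ^ 2 / 2 := by
  induction n with
  | zero => simp
  | succ n ih => rw [Finset.sum_range_succ, ih]; push_cast; ring

lemma abs_log_one_add_le {t : ℝ} (ht : |t| ≤ 1 / 4) : |Real.log (1 + t)| ≤ 2 * |t| := by
  obtain ⟨h1, h2⟩ := abs_le.1 ht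
  obtain ⟨h3, h4⟩ := log_one_add_bounds (x := t) (by linarith)
  rw [abs_le]
  have h5 : t ^ 2 ≤ |t| * (1 / 4) := by
    rw [← sq_abs, sq]; exact mul_le_mul_of_nonneg_left ht (abs_nonneg t)
  constructor
  · nlinarith [neg_abs_le t, abs_nonneg t]
  · linarith [le_abs_self t, abs_nonneg t]

lemma abs_log_sub_log_le {a b : ℝ} (hb : 2 ≤ b) (h : |a - b| ≤ 1 / 2) :
    |Real.log a - Real.log b| ≤ 1 / b := by
  have hb0 : 0 < b := by linarith
  obtain ⟨h1, h2⟩ := abs_le.1 h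
  have e : Real.log a - Real.log b = Real.log (1 + (a - b) / b) := by
    rw [← Real.log_div (by linarith) (by linarith)]
    congr 1
    field_simp
    ring
  have h3 : |(a - b) / b| ≤ (1 / 2) / b := by
    rw [abs_div, abs_of_pos hb0]; gcongr
  have h4 : (1 / 2) / b ≤ 1 / 4 := by
    rw [div_le_iff₀ hb0]; linarith
  rw [e]
  refine (abs_log_one_add_le (h3.trans h4)).trans ?_
  calc 2 * |(a - b) / b| ≤ 2 * ((1 / 2) / b) := by gcongr
    _ = 1 / b := by ring

-- The main term is the area of the region p < q < √3 p, p q ≤ y, namely (y/2) log √3. Columns are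
-- linear in p up to `p₀` = √(y/√3), where the ray meets the hyperbola, and equal y/p - p from there
-- to √y. Rounding costs at most one per column, hence O(√y).
set_option maxHeartbeats 800000 in
lemma sum_coneColumn_estimate {τ y : ℝ} (hτ : 0 < τ) (hτ1 : τ ≤ 1) (hy : 16 ≤ y) {n : ℕ}
    (hn : √y ≤ n) :
    |(∑ k ∈ Finset.range n, (coneColumn y (k + τ) : ℝ)) - Real.log 3 / 4 * y| ≤ 20 * √y := by
  obtain ⟨hl3, hu3⟩ := sqrt_three_bounds
  set Y := √y with hYdef
  have hY4 : 4 ≤ Y := by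
    rw [hYdef]; apply Real.le_sqrt_of_sq_le; linarith
  have hYY : Y * Y = y := Real.mul_self_sqrt (by linarith)
  set p₀ := √(y / √3) with hp₀
  have hs3 : √3 * √3 = 3 := Real.mul_self_sqrt (by norm_num)
  have hpp : p₀ * p₀ = y / √3 := Real.mul_self_sqrt (by positivity)
  have hpp' : √3 * (p₀ * p₀) = y := by rw [hpp]; field_simp
  have hp₀0 : 0 ≤ p₀ := Real.sqrt_nonneg _
  have hp₀Y : p₀ ≤ Y := by
    apply Real.sqrt_le_sqrt
    exact div_le_self (by linarith) (by linarith)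
  have hp₀3 : 3 ≤ p₀ := by
    apply Real.le_sqrt_of_sq_le
    rw [le_div_iff₀ (by linarith)]
    linarith
  have hp₀half : Y ≤ 2 * p₀ := by
    rw [mul_self_le_mul_self_iff (by linarith) (by linarith), hYY, ← hpp']
    have := mul_le_mul_of_nonneg_right (by linarith : √3 ≤ 4) (mul_self_nonneg p₀)
    linarith
  -- `K` and `M` count the columns at positions k + τ up to `p₀` and up to √y.
  have hfl : ∀ z : ℝ, 3 ≤ z → ∃ K : ℕ, K + τ - 1 ≤ z ∧ z < K + τ := by
    intro z hz
    refine ⟨⌊z - τ⌋₊ + 1, ?_, ?_⟩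
    · have := Nat.floor_le (a := z - τ) (by linarith)
      push_cast; linarith
    · have := Nat.lt_floor_add_one (z - τ)
      push_cast; linarith
  obtain ⟨K, hK1, hK2⟩ := hfl p₀ hp₀3
  obtain ⟨M, hM1, hM2⟩ := hfl Y (by linarith)
  have hK1' : 1 ≤ K := by
    by_contra hK0
    have : K = 0 := by omega
    rw [this] at hK2
    push_cast at hK2
    linarith
  have hKM : K ≤ M := by
    have : (K : ℝ) < M + 1 := by linarith
    have h2 : K < M + 1 := by exact_mod_cast this
    omega
  have hMn : M ≤ n := by
    have : (M : ℝ) < n + 1 := by linarith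
    have h2 : M < n + 1 := by exact_mod_cast this
    omega
  set φ : ℝ → ℝ := fun p => min ((√3 - 1) * p) (y / p - p) with hφ
  -- the columns beyond `√ y` are empty
  have hzero : ∑ k ∈ Finset.range n, (coneColumn y (k + τ) : ℝ)
      = ∑ k ∈ Finset.range M, (coneColumn y (k + τ) : ℝ) := by
    rw [← Finset.sum_range_add_sum_Ico _ hMn, add_eq_left]
    refine Finset.sum_eq_zero fun k hk => ?_
    have hk1 : (M : ℝ) ≤ k := by exact_mod_cast (Finset.mem_Ico.1 hk).1
    have hp : Y < k + τ := by linarith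
    have h1 : y / (k + τ) - (k + τ) < 0 := by
      rw [sub_neg, div_lt_iff₀ (by linarith), ← hYY]
      exact mul_self_lt_mul_self (by linarith) hp
    rw [coneColumn, Nat.floor_of_nonpos ((min_le_right _ _).trans h1.le), Nat.cast_zero]
  have hfloor : |∑ k ∈ Finset.range M, (coneColumn y (k + τ) : ℝ)
      - ∑ k ∈ Finset.range M, φ (k + τ)| ≤ M := by
    rw [← Finset.sum_sub_distrib]
    refine (Finset.abs_sum_le_sum_abs _ _).trans ?_
    have : ∀ k ∈ Finset.range M, |(coneColumn y (k + τ) : ℝ) - φ (k + τ)| ≤ 1 := by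
      intro k hk
      have hk0 : (0 : ℝ) ≤ k := Nat.cast_nonneg k
      have hkM : (k : ℝ) + 1 ≤ M := by exact_mod_cast Finset.mem_range.1 hk
      have hp : 0 < (k : ℝ) + τ := by linarith
      have h0 : 0 ≤ φ (k + τ) := by
        apply le_min
        · exact mul_nonneg (by linarith) hp.le
        · rw [sub_nonneg, le_div_iff₀ hp, ← hYY]
          exact mul_self_le_mul_self hp.le (by linarith)
      have h1 := Nat.floor_le h0
      have h2 := Nat.lt_floor_add_one (φ (k + τ))
      rw [abs_le]
      constructor
      · simp only [coneColumn]; simp only [hφ] at h2 ⊢; linarith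
      · simp only [coneColumn]; simp only [hφ] at h1 ⊢; linarith
    simpa using Finset.sum_le_sum this
  have hφ1 : ∀ k ∈ Finset.range K, φ (k + τ) = (√3 - 1) * (k + τ) := by
    intro k hk
    have hk0 : (0 : ℝ) ≤ k := Nat.cast_nonneg k
    have hkM : (k : ℝ) + 1 ≤ K := by exact_mod_cast Finset.mem_range.1 hk
    have hp : 0 < (k : ℝ) + τ := by linarith
    apply min_eq_left
    have : √3 * (k + τ) ≤ y / (k + τ) := by
      rw [le_div_iff₀ hp, ← hpp']
      rw [mul_assoc]
      exact mul_le_mul_of_nonneg_left (mul_self_le_mul_self hp.le (by linarith)) (by linarith)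
    linarith
  have hφ2 : ∀ k ∈ Finset.Ico K M, φ (k + τ) = y / (k + τ) - (k + τ) := by
    intro k hk
    have hkM : (K : ℝ) ≤ k := by exact_mod_cast (Finset.mem_Ico.1 hk).1
    have hp : p₀ < (k : ℝ) + τ := by linarith
    apply min_eq_right
    have : y / (k + τ) ≤ √3 * (k + τ) := by
      rw [div_le_iff₀ (by linarith), ← hpp']
      rw [mul_assoc]
      exact mul_le_mul_of_nonneg_left (mul_self_le_mul_self hp₀0 hp.le) (by linarith)
    linarith
  set R := ∑ j ∈ Finset.range (M - K), 1 / (((K : ℝ) - 1 + τ) + j + 1) with hR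
  have hsumφ : ∑ k ∈ Finset.range M, φ (k + τ)
      = √3 * (∑ k ∈ Finset.range K, ((k : ℝ) + τ)) - ∑ k ∈ Finset.range M, ((k : ℝ) + τ)
        + y * R := by
    rw [← Finset.sum_range_add_sum_Ico _ hKM, Finset.sum_congr rfl hφ1, Finset.sum_congr rfl hφ2,
      ← Finset.sum_range_add_sum_Ico (fun k : ℕ => (k : ℝ) + τ) hKM, Finset.sum_sub_distrib,
      ← Finset.mul_sum]
    have : ∑ k ∈ Finset.Ico K M, y / ((k : ℝ) + τ) = y * R := by
      rw [Finset.sum_Ico_eq_sum_range, hR, Finset.mul_sum]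
      refine Finset.sum_congr rfl fun j _ => ?_
      rw [mul_one_div]
      congr 1
      push_cast
      ring
    rw [this]
    ring
  rw [sum_range_add, sum_range_add] at hsumφ
  have hq0 : 2 ≤ (K : ℝ) - 1 + τ := by linarith
  obtain ⟨r1, r2⟩ := sum_inv_bounds (p := (K : ℝ) - 1 + τ) (by linarith) (M - K)
  rw [← hR] at r1 r2
  have e1 : (K : ℝ) - 1 + τ + 1 / 2 + ((M - K : ℕ) : ℝ) = M + τ - 1 / 2 := by
    rw [Nat.cast_sub hKM]; ring
  have e2 : (K : ℝ) - 1 + τ + 1 / 2 = K + τ - 1 / 2 := by ring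
  rw [e1, e2, Real.log_div (by linarith) (by linarith)] at r1 r2
  have l1 := abs_log_sub_log_le (a := M + τ - 1 / 2) (b := Y) (by linarith)
    (by rw [abs_le]; constructor <;> linarith)
  have l2 := abs_log_sub_log_le (a := K + τ - 1 / 2) (b := p₀) (by linarith)
    (by rw [abs_le]; constructor <;> linarith)
  have hlogY : Real.log Y - Real.log p₀ = Real.log 3 / 4 := by
    rw [hYdef, hp₀, Real.log_sqrt (by linarith), Real.log_sqrt (by positivity),
      Real.log_div (by linarith) (by positivity), Real.log_sqrt (by norm_num)]
    ring
  have hyY : y * (1 / Y) = Y := by rw [← hYY]; field_simp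
  have hyp : y * (1 / p₀) ≤ 2 * Y := by
    rw [mul_one_div, div_le_iff₀ (by linarith), ← hYY]
    have := mul_le_mul_of_nonneg_left hp₀half (by linarith : 0 ≤ Y)
    linarith
  have hyq : y * (1 / (8 * ((K : ℝ) - 1 + τ) ^ 2)) ≤ Y := by
    rw [mul_one_div, div_le_iff₀ (by positivity), ← hYY]
    have h1 : Y ≤ 4 * ((K : ℝ) - 1 + τ) := by linarith
    have h2 : Y * Y ≤ Y * (4 * ((K : ℝ) - 1 + τ)) := by gcongr
    have h3 : (4 * ((K : ℝ) - 1 + τ)) ≤ 8 * ((K : ℝ) - 1 + τ) ^ 2 := by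
      have := mul_le_mul_of_nonneg_right hq0 (by linarith : 0 ≤ (K : ℝ) - 1 + τ)
      linarith
    exact h2.trans (mul_le_mul_of_nonneg_left h3 (by linarith))
  have hyR : |y * R - Real.log 3 / 4 * y| ≤ 4 * Y := by
    have hy0 : 0 ≤ y := by linarith
    have m1 := mul_le_mul_of_nonneg_left r1 hy0
    have m2 := mul_le_mul_of_nonneg_left r2 hy0
    have m3 := mul_le_mul_of_nonneg_left l1 hy0
    have m4 := mul_le_mul_of_nonneg_left l2 hy0
    have m5 := mul_le_mul_of_nonneg_left (neg_le_of_abs_le l1) hy0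
    have m6 := mul_le_mul_of_nonneg_left (le_of_abs_le l1) hy0
    have m7 := mul_le_mul_of_nonneg_left (neg_le_of_abs_le l2) hy0
    have m8 := mul_le_mul_of_nonneg_left (le_of_abs_le l2) hy0
    have m9 : y * (Real.log Y - Real.log p₀) = Real.log 3 / 4 * y := by rw [hlogY]; ring
    rw [abs_le]
    constructor <;> linarith
  -- Since √3 p₀² = y, the quadratic sums up to `p₀` and up to √y cancel to within O(√y); only y
  -- log(√y/p₀) = y log 3/4 survives.
  have d1 : |√3 * (((K : ℝ) + τ - 1 / 2) ^ 2 / 2) - √3 * (p₀ * p₀) / 2| ≤ 2 * Y := by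
    have h1 : √3 * (((K : ℝ) + τ - 1 / 2) ^ 2 / 2) - √3 * (p₀ * p₀) / 2
        = √3 / 2 * (((K : ℝ) + τ - 1 / 2 - p₀) * ((K : ℝ) + τ - 1 / 2 + p₀)) := by ring
    rw [h1, abs_mul, abs_mul, abs_of_pos (by linarith : 0 < √3 / 2)]
    have h2 : |(K : ℝ) + τ - 1 / 2 - p₀| ≤ 1 / 2 := by rw [abs_le]; constructor <;> linarith
    have h3 : |(K : ℝ) + τ - 1 / 2 + p₀| ≤ 2 * Y + 1 / 2 := by
      rw [abs_le]; constructor <;> linarith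
    calc √3 / 2 * (|(K : ℝ) + τ - 1 / 2 - p₀| * |(K : ℝ) + τ - 1 / 2 + p₀|)
        ≤ 1 * (1 / 2 * (2 * Y + 1 / 2)) := by gcongr; linarith
      _ ≤ 2 * Y := by linarith
  have d2 : |((M : ℝ) + τ - 1 / 2) ^ 2 / 2 - Y * Y / 2| ≤ Y := by
    have h1 : ((M : ℝ) + τ - 1 / 2) ^ 2 / 2 - Y * Y / 2
        = 1 / 2 * (((M : ℝ) + τ - 1 / 2 - Y) * ((M : ℝ) + τ - 1 / 2 + Y)) := by ring
    rw [h1, abs_mul, abs_mul, abs_of_pos (by norm_num : (0 : ℝ) < 1 / 2)]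
    have h2 : |(M : ℝ) + τ - 1 / 2 - Y| ≤ 1 / 2 := by rw [abs_le]; constructor <;> linarith
    have h3 : |(M : ℝ) + τ - 1 / 2 + Y| ≤ 2 * Y + 1 / 2 := by
      rw [abs_le]; constructor <;> linarith
    calc 1 / 2 * (|(M : ℝ) + τ - 1 / 2 - Y| * |(M : ℝ) + τ - 1 / 2 + Y|)
        ≤ 1 / 2 * (1 / 2 * (2 * Y + 1 / 2)) := by gcongr
      _ ≤ Y := by linarith
  have d3 : |(√3 - 1) * ((τ - 1 / 2) ^ 2 / 2)| ≤ 1 := by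
    have h1 : (τ - 1 / 2) ^ 2 ≤ 1 := by
      rw [sq_le_one_iff_abs_le_one, abs_le]; constructor <;> linarith
    rw [abs_of_nonneg (mul_nonneg (by linarith) (by positivity))]
    have := mul_le_mul (by linarith : √3 - 1 ≤ 1) h1 (by positivity) zero_le_one
    linarith
  have hMY : (M : ℝ) ≤ 2 * Y := by linarith
  rw [hpp'] at d1
  rw [hYY] at d2
  rw [hzero]
  obtain ⟨f1, f2⟩ := abs_le.1 hfloor
  obtain ⟨g1, g2⟩ := abs_le.1 hyR
  obtain ⟨a1, a2⟩ := abs_le.1 d1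
  obtain ⟨b1, b2⟩ := abs_le.1 d2
  obtain ⟨c1, c2⟩ := abs_le.1 d3
  rw [hsumφ] at f1 f2
  rw [abs_le]
  constructor <;> linarith


/-! ### Coprime pairs by Möbius inversion over squares -/

open Classical in
/-- The number of factorizations `n = p * q` with `R p q`. -/
noncomputable def fiberCount (R : ℕ → ℕ → Prop) : ArithmeticFunction ℝ :=
  ⟨fun n => ((n.divisorsAntidiagonal.filter fun x => R x.1 x.2).card : ℝ), by simp⟩

open Classical in
lemma fiberCount_apply (R : ℕ → ℕ → Prop) (n : ℕ) :
    fiberCount R n = ∑ x ∈ n.divisorsAntidiagonal, if R x.1 x.2 then (1 : ℝ) else 0 := by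
  simp [fiberCount]

lemma fiberCount_nonneg (R : ℕ → ℕ → Prop) (n : ℕ) : 0 ≤ fiberCount R n := by
  classical
  rw [fiberCount_apply]
  exact Finset.sum_nonneg fun x _ => by split_ifs <;> norm_num

open Classical in
/-- The function supported on squares with value `μ d` at `d ^ 2` if `E d`. -/
noncomputable def squareMoebius (E : ℕ → Prop) : ArithmeticFunction ℝ :=
  ⟨fun n => if Nat.sqrt n ^ 2 = n ∧ E (Nat.sqrt n) then
    (ArithmeticFunction.moebius (Nat.sqrt n) : ℝ) else 0, by simp⟩

open Classical in
lemma squareMoebius_sq (E : ℕ → Prop) (d : ℕ) :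
    squareMoebius E (d ^ 2) = if E d then (ArithmeticFunction.moebius d : ℝ) else 0 := by
  simp [squareMoebius, Nat.sqrt_eq']

lemma squareMoebius_of_not_sq (E : ℕ → Prop) {n : ℕ} (h : ∀ d, d ^ 2 ≠ n) :
    squareMoebius E n = 0 := by
  simp [squareMoebius, h]

lemma abs_squareMoebius_sq_le (E : ℕ → Prop) (d : ℕ) : |squareMoebius E (d ^ 2)| ≤ 1 := by
  classical
  rw [squareMoebius_sq]
  split_ifs
  · exact_mod_cast ArithmeticFunction.abs_moebius_le_one
  · simp

/-- Sums against a function supported on squares. -/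
lemma sum_squareMoebius_mul (E : ℕ → Prop) (G : ℕ → ℝ) {s t : Finset ℕ}
    (h : ∀ d, 0 < d → (d ∈ t ↔ d ^ 2 ∈ s)) (h0 : 0 ∉ s) (ht : 0 ∉ t) :
    ∑ m ∈ s, squareMoebius E m * G m = ∑ d ∈ t, squareMoebius E (d ^ 2) * G (d ^ 2) := by
  have hinj : Set.InjOn (fun d : ℕ => d ^ 2) t := fun a _ b _ hab =>
    Nat.pow_left_injective (n := 2) (by norm_num) hab
  rw [← Finset.sum_image (f := fun m => squareMoebius E m * G m) hinj]
  symm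
  apply Finset.sum_subset
  · intro m hm
    obtain ⟨d, hd, rfl⟩ := Finset.mem_image.1 hm
    exact (h d (Nat.pos_of_ne_zero fun h => ht (h ▸ hd))).1 hd
  · intro m hm hm2
    rw [squareMoebius_of_not_sq, zero_mul]
    rintro d rfl
    apply hm2
    have hd : 0 < d := Nat.pos_of_ne_zero fun h => h0 (by rw [h] at hm; simpa using hm)
    exact Finset.mem_image.2 ⟨d, (h d hd).2 hm, rfl⟩

lemma sum_moebius_of_dvd (g N : ℕ) (hg : g ≠ 0) (hN : g ≤ N) :
    ∑ d ∈ Finset.Icc 1 N, (if d ∣ g then (ArithmeticFunction.moebius d : ℝ) else 0)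
      = if g = 1 then 1 else 0 := by
  have h : (Finset.Icc 1 N).filter (· ∣ g) = g.divisors := by
    ext d
    rw [Finset.mem_filter, Finset.mem_Icc, Nat.mem_divisors]
    constructor
    · rintro ⟨-, h⟩; exact ⟨h, hg⟩
    · rintro ⟨h, -⟩
      exact ⟨⟨Nat.pos_of_dvd_of_pos h (Nat.pos_of_ne_zero hg),
        (Nat.le_of_dvd (Nat.pos_of_ne_zero hg) h).trans hN⟩, h⟩
  rw [← Finset.sum_filter, h]
  have h2 := congrArg (fun f : ArithmeticFunction ℤ => f g) ArithmeticFunction.moebius_mul_coe_zeta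
  simp only [ArithmeticFunction.coe_mul_zeta_apply, ArithmeticFunction.one_apply] at h2
  exact_mod_cast h2

open Classical in
/-- Möbius inversion for coprime pairs. -/
lemma fiberCount_coprime {R : ℕ → ℕ → Prop} {E : ℕ → Prop}
    (hR : ∀ d p q, 0 < d → (R (d * p) (d * q) ↔ E d ∧ R p q)) :
    fiberCount (fun p q => R p q ∧ p.Coprime q) = squareMoebius E * fiberCount R := by
  ext n
  rcases Nat.eq_zero_or_pos n with rfl | hn
  · simp
  have h1 : (squareMoebius E * fiberCount R) n
      = ∑ d ∈ Finset.Icc 1 n, if d ^ 2 ∣ n then squareMoebius E (d ^ 2) * fiberCount R (n / d ^ 2)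
        else 0 := by
    rw [ArithmeticFunction.mul_apply, Nat.sum_divisorsAntidiagonal (fun a b =>
      squareMoebius E a * fiberCount R b), ← Finset.sum_filter]
    apply sum_squareMoebius_mul E (fun m => fiberCount R (n / m))
    · intro d hd
      rw [Finset.mem_filter, Finset.mem_Icc, Nat.mem_divisors]
      constructor
      · rintro ⟨-, h⟩; exact ⟨h, hn.ne'⟩
      · rintro ⟨h, -⟩
        refine ⟨⟨hd, ?_⟩, h⟩
        exact le_trans (Nat.le_self_pow (by norm_num) d) (Nat.le_of_dvd hn h)
    · simp
    · simp
  -- Dividing both entries by `d` identifies the pairs with product n divisible by `d` and the pairs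
  -- with product n/d². Summing over `d` afterwards, μ over the divisors of the gcd detects
  -- coprimality.
  have h2 : ∀ d ∈ Finset.Icc 1 n,
      (if d ^ 2 ∣ n then squareMoebius E (d ^ 2) * fiberCount R (n / d ^ 2) else 0)
      = ∑ x ∈ n.divisorsAntidiagonal, if R x.1 x.2 then
          (if d ∣ x.1.gcd x.2 then (ArithmeticFunction.moebius d : ℝ) else 0) else 0 := by
    intro d hd
    have hd0 : 0 < d := (Finset.mem_Icc.1 hd).1
    have hrw : ∀ x : ℕ × ℕ, (if R x.1 x.2 then
        (if d ∣ x.1.gcd x.2 then (ArithmeticFunction.moebius d : ℝ) else 0) else 0)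
        = if (d ∣ x.1 ∧ d ∣ x.2) ∧ R x.1 x.2 then (ArithmeticFunction.moebius d : ℝ) else 0 := by
      intro x
      by_cases h : R x.1 x.2 <;> by_cases h' : d ∣ x.1.gcd x.2 <;>
        simp [h, h', ← Nat.dvd_gcd_iff]
    simp only [hrw]
    rw [← Finset.sum_filter]
    split_ifs with hdn
    · obtain ⟨m, rfl⟩ := hdn
      have hm : m ≠ 0 := by rintro rfl; simp at hn
      have hd2 : 0 < d ^ 2 := by positivity
      rw [Nat.mul_div_cancel_left m hd2, squareMoebius_sq]
      by_cases hE : E d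
      · rw [if_pos hE, fiberCount_apply, ← Finset.sum_filter, Finset.mul_sum]
        refine Finset.sum_bij' (fun x _ => (d * x.1, d * x.2)) (fun y _ => (y.1 / d, y.2 / d))
          ?_ ?_ ?_ ?_ ?_
        · rintro ⟨p, q⟩ hx
          simp only [Finset.mem_filter, Nat.mem_divisorsAntidiagonal] at hx ⊢
          obtain ⟨⟨rfl, -⟩, hx⟩ := hx
          exact ⟨⟨by ring, hn.ne'⟩, ⟨Dvd.intro _ rfl, Dvd.intro _ rfl⟩, (hR d p q hd0).2 ⟨hE, hx⟩⟩
        · rintro ⟨P, Q⟩ hy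
          simp only [Finset.mem_filter, Nat.mem_divisorsAntidiagonal] at hy ⊢
          obtain ⟨⟨h, -⟩, ⟨⟨p, rfl⟩, ⟨q, rfl⟩⟩, hy⟩ := hy
          rw [Nat.mul_div_cancel_left _ hd0, Nat.mul_div_cancel_left _ hd0]
          refine ⟨⟨?_, hm⟩, ((hR d p q hd0).1 hy).2⟩
          have : d ^ 2 * (p * q) = d ^ 2 * m := by rw [← h]; ring
          exact Nat.eq_of_mul_eq_mul_left hd2 this
        · rintro ⟨p, q⟩ -
          simp [Nat.mul_div_cancel_left _ hd0]
        · rintro ⟨P, Q⟩ hy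
          simp only [Finset.mem_filter] at hy
          rw [Nat.mul_div_cancel' hy.2.1.1, Nat.mul_div_cancel' hy.2.1.2]
        · rintro ⟨p, q⟩ hx
          rw [mul_one]
      · rw [if_neg hE, zero_mul, Finset.sum_eq_zero]
        rintro ⟨P, Q⟩ hy
        simp only [Finset.mem_filter] at hy
        obtain ⟨-, ⟨⟨p, rfl⟩, ⟨q, rfl⟩⟩, hy⟩ := hy
        exact absurd ((hR d p q hd0).1 hy).1 hE
    · rw [Finset.sum_eq_zero]
      rintro ⟨P, Q⟩ hy
      simp only [Finset.mem_filter, Nat.mem_divisorsAntidiagonal] at hy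
      obtain ⟨⟨rfl, -⟩, ⟨h1, h2⟩, -⟩ := hy
      exact absurd (by rw [sq]; exact mul_dvd_mul h1 h2) hdn
  rw [h1, Finset.sum_congr rfl h2, Finset.sum_comm, fiberCount_apply]
  refine Finset.sum_congr rfl fun x hx => ?_
  obtain ⟨hxn, -⟩ := Nat.mem_divisorsAntidiagonal.1 hx
  have hx1 : x.1 ≠ 0 := by intro h; rw [h] at hxn; simp at hxn; omega
  by_cases hr : R x.1 x.2
  · simp only [hr, if_true, true_and]
    rw [sum_moebius_of_dvd _ _ (Nat.gcd_ne_zero_left hx1)]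
    · refine (Nat.gcd_le_left _ (Nat.pos_of_ne_zero hx1)).trans ?_
      exact Nat.le_of_dvd hn (Dvd.intro _ hxn)
  · simp [hr]

/-- Summation over squares preserves square-root error terms, up to a logarithm. -/
lemma hasMeanValue_squareMoebius_mul (E : ℕ → Prop) {F : ArithmeticFunction ℝ} {ν C : ℝ}
    (hF : ∀ x, 1 ≤ x → |summatory F x - ν * x| ≤ C * √x) :
    ∃ α, HasMeanValue (squareMoebius E * F : ArithmeticFunction ℝ) α (1 / 2) := by
  have hC0 : 0 ≤ C := by
    have h := (abs_nonneg _).trans (hF 1 le_rfl)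
    simpa using h
  -- The weight 2/(i+1) works because its decrement 2/((i+1)(i+2)) is at least 1/(i+1)².
  obtain ⟨l, hl⟩ := exists_limit_of_abs_le_sub
    (b := fun i => squareMoebius E ((i + 1) ^ 2) / ((i + 1 : ℕ) : ℝ) ^ 2)
    (w := fun i => 2 / ((i + 1 : ℕ) : ℝ)) (fun n => by positivity) (fun n => by
      rw [abs_div, abs_of_pos (by positivity : (0 : ℝ) < ((n + 1 : ℕ) : ℝ) ^ 2)]
      have h1 : |squareMoebius E ((n + 1) ^ 2)| / ((n + 1 : ℕ) : ℝ) ^ 2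
          ≤ 1 / ((n + 1 : ℕ) : ℝ) ^ 2 := by
        gcongr; exact abs_squareMoebius_sq_le E _
      refine h1.trans ?_
      push_cast
      rw [div_sub_div _ _ (by positivity) (by positivity),
        div_le_div_iff₀ (by positivity) (by positivity)]
      nlinarith [(Nat.cast_nonneg n : (0 : ℝ) ≤ n)])
  refine ⟨ν * l, 4 * |ν| + C, fun x hx => ?_⟩
  have hx0 : 0 < x := by linarith
  have hs1 : 1 ≤ √x := Real.one_le_sqrt.2 hx
  have hss : √x * √x = x := Real.mul_self_sqrt hx0.le
  have hlog := one_le_one_add_log hx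
  have hS : summatory (squareMoebius E * F : ArithmeticFunction ℝ) x
      = ∑ d ∈ Finset.Icc 1 ⌊√x⌋₊, squareMoebius E (d ^ 2) * summatory F (x / d ^ 2) := by
    have hIcc : Finset.Icc 1 ⌊x⌋₊ = Finset.Ioc 0 ⌊x⌋₊ := rfl
    rw [summatory, hIcc, ArithmeticFunction.sum_Ioc_mul_eq_sum_sum, ← hIcc]
    have h1 := sum_squareMoebius_mul E (fun m => ∑ k ∈ Finset.Ioc 0 (⌊x⌋₊ / m), F k)
      (s := Finset.Icc 1 ⌊x⌋₊) (t := Finset.Icc 1 ⌊√x⌋₊) (fun d hd => by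
        rw [mem_Icc_floor, mem_Icc_floor, Real.le_sqrt (by positivity) hx0.le]
        push_cast
        constructor
        · rintro ⟨h1, h2⟩; exact ⟨Nat.one_le_pow _ _ hd, h2⟩
        · rintro ⟨h1, h2⟩; exact ⟨hd, h2⟩) (by simp) (by simp)
    rw [h1]
    refine Finset.sum_congr rfl fun d _ => ?_
    congr 1
    rw [summatory]
    have : ⌊x / (d : ℝ) ^ 2⌋₊ = ⌊x⌋₊ / d ^ 2 := by
      rw [← Nat.cast_pow, Nat.floor_div_natCast]
    rw [this]
    rfl
  have hshift : ∀ (G : ℕ → ℝ) (n : ℕ), ∑ k ∈ Finset.Icc 1 n, G k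
      = ∑ i ∈ Finset.range n, G (i + 1) := by
    intro G n
    induction n with
    | zero => simp
    | succ n ih => rw [Finset.sum_Icc_succ_top (by omega), ih, Finset.sum_range_succ]
  have hmain : |∑ d ∈ Finset.Icc 1 ⌊√x⌋₊, squareMoebius E (d ^ 2) / (d : ℝ) ^ 2 - l| ≤ 2 / √x := by
    rw [hshift]
    refine (hl ⌊√x⌋₊).trans ?_
    have := Nat.lt_floor_add_one √x
    push_cast
    gcongr
  -- The errors √(x/d²) sum to √x times a harmonic number, which is the source of the logarithm.
  have herr : |∑ d ∈ Finset.Icc 1 ⌊√x⌋₊, squareMoebius E (d ^ 2)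
      * (summatory F (x / d ^ 2) - ν * (x / d ^ 2))| ≤ C * √x * (1 + Real.log x) := by
    have h1 : ∀ d ∈ Finset.Icc 1 ⌊√x⌋₊, |squareMoebius E (d ^ 2)
        * (summatory F (x / d ^ 2) - ν * (x / d ^ 2))| ≤ C * √x * (1 / d) := by
      intro d hd
      obtain ⟨hd1, hd2⟩ := mem_Icc_floor.1 hd
      have hd0 : (0 : ℝ) < d := by exact_mod_cast hd1
      have hxd : 1 ≤ x / (d : ℝ) ^ 2 := by
        rw [le_div_iff₀ (by positivity), one_mul]
        exact (Real.le_sqrt hd0.le hx0.le).1 hd2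
      rw [abs_mul]
      calc _ ≤ 1 * (C * √(x / (d : ℝ) ^ 2)) :=
            mul_le_mul (abs_squareMoebius_sq_le E d) (hF _ hxd) (abs_nonneg _) zero_le_one
        _ = C * √x * (1 / d) := by
            rw [Real.sqrt_div hx0.le, Real.sqrt_sq hd0.le]; ring
    refine (Finset.abs_sum_le_sum_abs _ _).trans ((Finset.sum_le_sum h1).trans ?_)
    rw [← Finset.mul_sum]
    gcongr
    have h2 : ∑ d ∈ Finset.Icc 1 ⌊√x⌋₊, 1 / (d : ℝ) = harmonic ⌊√x⌋₊ := by
      rw [harmonic_eq_sum_Icc]; push_cast; simp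
    rw [h2]
    refine (harmonic_floor_le_one_add_log √x hs1).trans ?_
    rw [Real.log_sqrt hx0.le]
    linarith
  have hdec : ∑ d ∈ Finset.Icc 1 ⌊√x⌋₊, squareMoebius E (d ^ 2) * summatory F (x / d ^ 2)
      - ν * l * x = ν * x * (∑ d ∈ Finset.Icc 1 ⌊√x⌋₊, squareMoebius E (d ^ 2) / (d : ℝ) ^ 2 - l)
      + ∑ d ∈ Finset.Icc 1 ⌊√x⌋₊, squareMoebius E (d ^ 2)
      * (summatory F (x / d ^ 2) - ν * (x / d ^ 2)) := by
    have : ∑ d ∈ Finset.Icc 1 ⌊√x⌋₊, squareMoebius E (d ^ 2) * summatory F (x / d ^ 2)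
        = ν * x * ∑ d ∈ Finset.Icc 1 ⌊√x⌋₊, squareMoebius E (d ^ 2) / (d : ℝ) ^ 2
        + ∑ d ∈ Finset.Icc 1 ⌊√x⌋₊, squareMoebius E (d ^ 2)
          * (summatory F (x / d ^ 2) - ν * (x / d ^ 2)) := by
      rw [Finset.mul_sum, ← Finset.sum_add_distrib]
      exact Finset.sum_congr rfl fun d _ => by ring
    rw [this]; ring
  rw [hS, hdec, ← Real.sqrt_eq_rpow]
  refine (abs_add_le _ _).trans ?_
  have h5 : |ν * x * (∑ d ∈ Finset.Icc 1 ⌊√x⌋₊, squareMoebius E (d ^ 2) / (d : ℝ) ^ 2 - l)|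
      ≤ 4 * |ν| * (√x * (1 + Real.log x)) := by
    rw [abs_mul, abs_mul, abs_of_pos hx0]
    calc |ν| * x * |∑ d ∈ Finset.Icc 1 ⌊√x⌋₊, squareMoebius E (d ^ 2) / (d : ℝ) ^ 2 - l|
        ≤ |ν| * x * (2 / √x) := by gcongr
      _ = 2 * |ν| * (√x * 1) := by
          nth_rewrite 1 [← hss]; field_simp
      _ ≤ 4 * |ν| * (√x * (1 + Real.log x)) := by gcongr; norm_num
  rw [add_mul]
  linarith


/-! ### Cone points in a residue class -/

/-- The points `(p, q) ≡ (1, 1)` modulo `c` of the open cone between the diagonal and the line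
of slope `√3`. -/
def IsConePoint (c p q : ℕ) : Prop :=
  0 < p ∧ p < q ∧ q ^ 2 < 3 * p ^ 2 ∧ p % c = 1 % c ∧ q % c = 1 % c

lemma lt_sqrt_three_sub_one_mul_iff {c k j : ℕ} (hc : 0 < c) :
    (c * k + 1 + c * (j + 1)) ^ 2 < 3 * (c * k + 1) ^ 2 ↔
      ((j + 1 : ℕ) : ℝ) < (√3 - 1) * (k + 1 / c) := by
  have hc' : (0 : ℝ) < c := by exact_mod_cast hc
  rw [sq, sq, sq_lt_three_mul_sq_iff]
  have e : (√3 - 1) * ((k : ℝ) + 1 / c) = (√3 - 1) * (c * k + 1) / c := by field_simp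
  rw [e, lt_div_iff₀ hc']
  push_cast
  constructor <;> intro h <;> linarith

lemma sqrt_three_sub_one_mul_ne {c k : ℕ} (hc : 0 < c) (m : ℕ) :
    (m : ℝ) ≠ (√3 - 1) * (k + 1 / c) := by
  intro h
  have hc' : (0 : ℝ) < c := by exact_mod_cast hc
  refine sqrt_three_mul_ne_intCast (P := 2 * (c * k + 1)) (by omega) (c * m) ?_
  push_cast
  rw [h]
  field_simp

lemma le_floor_sqrt_three_iff {c k j : ℕ} (hc : 0 < c) :
    j < ⌊(√3 - 1) * ((k : ℝ) + 1 / c)⌋₊ ↔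
      (c * k + 1 + c * (j + 1)) ^ 2 < 3 * (c * k + 1) ^ 2 := by
  rw [lt_sqrt_three_sub_one_mul_iff hc, ← Nat.succ_le_iff, Nat.le_floor_iff' (by omega)]
  exact ⟨fun h => lt_of_le_of_ne h (sqrt_three_sub_one_mul_ne hc _), le_of_lt⟩

lemma lt_coneColumn_iff {c k j : ℕ} (hc : 0 < c) (x : ℝ) :
    j < coneColumn (x / c ^ 2) (k + 1 / c) ↔
      (c * k + 1 + c * (j + 1)) ^ 2 < 3 * (c * k + 1) ^ 2 ∧
        (((c * k + 1) * (c * k + 1 + c * (j + 1)) : ℕ) : ℝ) ≤ x := by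
  have hc' : (0 : ℝ) < c := by exact_mod_cast hc
  rw [← le_floor_sqrt_three_iff hc, coneColumn, ← Nat.succ_le_iff, Nat.le_floor_iff' (by omega),
    le_min_iff, ← Nat.succ_le_iff, Nat.le_floor_iff' (by omega)]
  refine and_congr_right fun _ => ?_
  have e : x / (c : ℝ) ^ 2 / (k + 1 / c) - (k + 1 / c) = (x / (c * k + 1) - (c * k + 1)) / c := by
    have : (0 : ℝ) < c * k + 1 := by positivity
    field_simp
  rw [e, le_div_iff₀ hc', le_sub_iff_add_le, le_div_iff₀ (by positivity)]
  push_cast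
  rw [show (c : ℝ) * (k : ℝ) + 1 + (c : ℝ) * ((j : ℝ) + 1) = ((j : ℝ) + 1) * c + (c * k + 1) by ring,
    mul_comm]

lemma isConePoint_iff {c p q : ℕ} (hc : 0 < c) :
    IsConePoint c p q ↔ ∃ k j : ℕ, p = c * k + 1 ∧ q = c * k + 1 + c * (j + 1) ∧
      j < ⌊(√3 - 1) * ((k : ℝ) + 1 / c)⌋₊ := by
  constructor
  · rintro ⟨h1, h2, h3, h4, h5⟩
    have e1 : c ∣ p - 1 := (Nat.modEq_iff_dvd' h1).1 h4.symm
    have e2 : c ∣ q - p := (Nat.modEq_iff_dvd' h2.le).1 (h4.trans h5.symm)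
    obtain ⟨k, hk⟩ := e1
    obtain ⟨j, hj⟩ := e2
    have hj0 : j ≠ 0 := by rintro rfl; omega
    obtain ⟨i, rfl⟩ := Nat.exists_eq_succ_of_ne_zero hj0
    have hp : p = c * k + 1 := by omega
    have hq : q = c * k + 1 + c * (i + 1) := by rw [← hp]; simp only [Nat.succ_eq_add_one] at hj; omega
    refine ⟨k, i, hp, hq, (le_floor_sqrt_three_iff hc).2 ?_⟩
    rw [← hp] at hq ⊢
    rw [← hq]; exact h3
  · rintro ⟨k, j, rfl, rfl, h⟩
    refine ⟨by omega, ?_, (le_floor_sqrt_three_iff hc).1 h, ?_, ?_⟩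
    · have := Nat.mul_pos hc (Nat.succ_pos j)
      simp only [Nat.succ_eq_add_one] at this; omega
    · simp [Nat.add_mod]
    · simp [Nat.add_mod]

/-- Writing p = ck + 1 and q = p + c(j + 1) and scaling by 1/c turns cone points into columns at k +
1/c under the hyperbola x/c². The range of k suffices since k < p ≤ p q ≤ x. -/
lemma summatory_fiberCount_isConePoint {c : ℕ} (hc : 0 < c) (x : ℝ) :
    summatory (fiberCount (IsConePoint c)) x
      = ∑ k ∈ Finset.range ⌊x⌋₊, (coneColumn (x / c ^ 2) (k + 1 / c) : ℝ) := by
  classical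
  have h : ∑ n ∈ Finset.Icc 1 ⌊x⌋₊, (n.divisorsAntidiagonal.filter
      fun x => IsConePoint c x.1 x.2).card
      = ∑ k ∈ Finset.range ⌊x⌋₊, (Finset.range (coneColumn (x / c ^ 2) (k + 1 / c))).card := by
    rw [← Finset.card_sigma, ← Finset.card_sigma]
    refine (Finset.card_bij (fun y _ => ⟨(c * y.1 + 1) * (c * y.1 + 1 + c * (y.2 + 1)),
      c * y.1 + 1, c * y.1 + 1 + c * (y.2 + 1)⟩) ?_ ?_ ?_).symm
    · rintro ⟨k, j⟩ h
      simp only [Finset.mem_sigma, Finset.mem_range] at h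
      obtain ⟨h1, h2⟩ := (lt_coneColumn_iff hc x).1 h.2
      rw [← le_floor_sqrt_three_iff hc] at h1
      simp only [Finset.mem_sigma, mem_Icc_floor, Finset.mem_filter,
        Nat.mem_divisorsAntidiagonal]
      exact ⟨⟨Nat.mul_pos (by omega) (by omega), h2⟩, ⟨trivial, by positivity⟩,
        (isConePoint_iff hc).2 ⟨k, j, rfl, rfl, h1⟩⟩
    · rintro ⟨k, j⟩ - ⟨k', j'⟩ - h
      simp only [Sigma.mk.injEq, heq_eq_eq, Prod.mk.injEq] at h
      obtain ⟨-, h1, h2⟩ := h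
      have : k = k' := Nat.eq_of_mul_eq_mul_left hc (by omega)
      subst this
      have : j + 1 = j' + 1 := Nat.eq_of_mul_eq_mul_left hc (by omega)
      simpa using this
    · rintro ⟨n, p, q⟩ h
      simp only [Finset.mem_sigma, mem_Icc_floor, Finset.mem_filter,
        Nat.mem_divisorsAntidiagonal] at h
      obtain ⟨⟨h1, h2⟩, ⟨h3, -⟩, h4⟩ := h
      obtain ⟨k, j, rfl, rfl, h5⟩ := (isConePoint_iff hc).1 h4
      subst h3
      refine ⟨⟨k, j⟩, ?_, rfl⟩
      simp only [Finset.mem_sigma, Finset.mem_range]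
      refine ⟨?_, (lt_coneColumn_iff hc x).2 ⟨(le_floor_sqrt_three_iff hc).1 h5, h2⟩⟩
      have := Nat.le_floor h2
      refine lt_of_lt_of_le ?_ this
      have h6 : k + 1 ≤ c * k + 1 := by
        have := Nat.le_mul_of_pos_left k hc; omega
      exact lt_of_lt_of_le (by omega : k < c * k + 1) (Nat.le_mul_of_pos_right _ (by omega))
  have h' := congrArg (fun n : ℕ => (n : ℝ)) h
  simp only [Finset.card_range, Nat.cast_sum] at h'
  exact h'

lemma summatory_mono {f : ℕ → ℝ} (hf : ∀ n, 0 ≤ f n) {x y : ℝ} (h : x ≤ y) :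
    summatory f x ≤ summatory f y :=
  Finset.sum_le_sum_of_subset_of_nonneg
    (Finset.Icc_subset_Icc le_rfl (Nat.floor_mono h)) fun n _ _ => hf n

/-- The column estimate requires x/c² ≥ 16; below that, monotonicity of the summatory function gives
a constant bound. -/
lemma exists_abs_summatory_isConePoint_le {c : ℕ} (hc : 0 < c) :
    ∃ C, ∀ x, 1 ≤ x →
      |summatory (fiberCount (IsConePoint c)) x - Real.log 3 / 4 / c ^ 2 * x| ≤ C * √x := by
  have hc' : (1 : ℝ) ≤ c := by exact_mod_cast hc
  set ν := Real.log 3 / 4 / (c : ℝ) ^ 2 with hν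
  have hν0 : 0 ≤ ν := by positivity
  set S := summatory (fiberCount (IsConePoint c)) with hS
  have hS0 : ∀ x, 0 ≤ S x := fun x => Finset.sum_nonneg fun n _ => fiberCount_nonneg _ n
  refine ⟨20 + S (16 * c ^ 2) + ν * (16 * c ^ 2), fun x hx => ?_⟩
  have hs1 : 1 ≤ √x := Real.one_le_sqrt.2 hx
  have h0 := hS0 (16 * (c : ℝ) ^ 2)
  rcases le_or_gt (16 * (c : ℝ) ^ 2) x with h | h
  · have hxc : 16 ≤ x / (c : ℝ) ^ 2 := by rw [le_div_iff₀ (by positivity)]; exact h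
    have hle : √(x / (c : ℝ) ^ 2) ≤ √x :=
      Real.sqrt_le_sqrt (div_le_self (by linarith) (one_le_pow₀ hc'))
    have hn : √(x / (c : ℝ) ^ 2) ≤ ⌊x⌋₊ := by
      rw [Real.sqrt_div (by linarith), Real.sqrt_sq (by linarith)]
      have h4 : 4 ≤ √x := by
        apply Real.le_sqrt_of_sq_le
        have := one_le_pow₀ (n := 2) hc'
        linarith
      have h5 := Nat.lt_floor_add_one x
      have h6 : √x * √x = x := Real.mul_self_sqrt (by linarith)
      have h7 : 4 * √x ≤ √x * √x := by gcongr
      have h8 : √x / c ≤ √x := div_le_self (by linarith) hc'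
      linarith
    have := sum_coneColumn_estimate (τ := 1 / c) (by positivity)
      ((div_le_one (by linarith)).2 hc') hxc hn
    rw [← summatory_fiberCount_isConePoint hc, ← hS] at this
    rw [show ν * x = Real.log 3 / 4 * (x / c ^ 2) by rw [hν]; ring]
    refine this.trans ?_
    have h9 : 0 ≤ ν * (16 * (c : ℝ) ^ 2) := by positivity
    exact mul_le_mul (by linarith) hle (Real.sqrt_nonneg _) (by linarith)
  · have h1 : S x ≤ S (16 * (c : ℝ) ^ 2) := summatory_mono (fiberCount_nonneg _) h.le
    have h2 : ν * x ≤ ν * (16 * (c : ℝ) ^ 2) := by gcongr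
    have h3 := hS0 x
    have h4 : 0 ≤ ν * x := by positivity
    have h5 : |S x - ν * x| ≤ 20 + S (16 * (c : ℝ) ^ 2) + ν * (16 * (c : ℝ) ^ 2) := by
      rw [abs_le]; constructor <;> linarith
    exact h5.trans (le_mul_of_one_le_right (by linarith) hs1)


/-! ### The arithmetic function of shapes -/

lemma fiberCount_eq_sum (R : ℕ → ℕ → Prop) [∀ x : ℕ × ℕ, Decidable (R x.1 x.2)] (n : ℕ) :
    fiberCount R n = ∑ x ∈ n.divisorsAntidiagonal, if R x.1 x.2 then (1 : ℝ) else 0 :=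
  (fiberCount_apply R n).trans (Finset.sum_congr rfl fun x _ => by congr)

lemma fiberCount_eq_card (R : ℕ → ℕ → Prop) [∀ x : ℕ × ℕ, Decidable (R x.1 x.2)] (n : ℕ) :
    fiberCount R n = (n.divisorsAntidiagonal.filter fun x => R x.1 x.2).card := by
  rw [fiberCount_eq_sum, Finset.card_filter]
  push_cast
  rfl

lemma fiberCount_congr {R R' : ℕ → ℕ → Prop} (h : ∀ p q, R p q ↔ R' p q) :
    fiberCount R = fiberCount R' := by
  have : R = R' := by ext p q; exact h p q
  rw [this]

lemma fiberCount_split (R Q : ℕ → ℕ → Prop) :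
    fiberCount R = fiberCount (fun p q => R p q ∧ Q p q)
      + fiberCount (fun p q => R p q ∧ ¬ Q p q) := by
  classical
  ext n
  simp only [ArithmeticFunction.add_apply, fiberCount_apply, ← Finset.sum_add_distrib]
  refine Finset.sum_congr rfl fun x _ => ?_
  by_cases h1 : R x.1 x.2 <;> by_cases h2 : Q x.1 x.2 <;> simp [h1, h2]

lemma fiberCount_swap (R : ℕ → ℕ → Prop) : fiberCount (fun p q => R q p) = fiberCount R := by
  classical
  ext n
  rw [fiberCount_apply, fiberCount_apply]
  conv_lhs => rw [← Nat.map_swap_divisorsAntidiagonal, Finset.sum_map]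
  rfl

lemma fiberCount_of_symm {R : ℕ → ℕ → Prop} (hR : ∀ p q, R p q → R q p) :
    fiberCount R = fiberCount (fun p q => R p q ∧ p = q)
      + 2 * fiberCount (fun p q => R p q ∧ p < q) := by
  rw [fiberCount_split R (fun p q => p = q),
    fiberCount_split (fun p q => R p q ∧ ¬ p = q) (fun p q => p < q),
    fiberCount_congr (R := fun p q => (R p q ∧ ¬ p = q) ∧ p < q)
      (R' := fun p q => R p q ∧ p < q) (fun p q => ⟨fun h => ⟨h.1.1, h.2⟩,
        fun h => ⟨⟨h.1, h.2.ne⟩, h.2⟩⟩),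
    fiberCount_congr (R := fun p q => (R p q ∧ ¬ p = q) ∧ ¬ p < q)
      (R' := fun p q => R q p ∧ q < p) (fun p q => ⟨fun h => ⟨hR _ _ h.1.1, by omega⟩,
        fun h => ⟨⟨hR _ _ h.1, by omega⟩, by omega⟩⟩),
    fiberCount_swap (fun p q => R p q ∧ p < q), two_mul]

/-- The number of coprime pairs `(p, q)` with `IsConePoint c p q` and `p * q = n`, if `c ≤ 2`. -/
noncomputable def primitiveConeCount (c : ℕ) : ArithmeticFunction ℝ :=
  squareMoebius (fun d => d % c = 1 % c) * fiberCount (IsConePoint c)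

lemma primitiveConeCount_one :
    primitiveConeCount 1 = fiberCount (fun p q => IsConePoint 1 p q ∧ p.Coprime q) := by
  refine (fiberCount_coprime fun d p q hd => ?_).symm
  simp only [IsConePoint, Nat.mod_one, true_and, and_true, Nat.mul_pos_iff_of_pos_left hd,
    Nat.mul_lt_mul_left hd, mul_pow, mul_left_comm 3 (d ^ 2),
    Nat.mul_lt_mul_left (pow_pos hd 2)]

/-- A product is odd exactly if both factors are, so only odd common divisors occur; this is the
condition on `d` in `primitiveConeCount`. -/
lemma primitiveConeCount_two :
    primitiveConeCount 2 = fiberCount (fun p q => IsConePoint 2 p q ∧ p.Coprime q) := by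
  refine (fiberCount_coprime fun d p q hd => ?_).symm
  simp only [IsConePoint, Nat.mul_pos_iff_of_pos_left hd,
    Nat.mul_lt_mul_left hd, mul_pow, mul_left_comm 3 (d ^ 2),
    Nat.mul_lt_mul_left (pow_pos hd 2), ← Nat.odd_iff, Nat.odd_mul, Nat.mod_eq_of_lt one_lt_two]
  tauto

/-- Ratios of diagonals of rhombic fundamental cells of well-rounded lattices. -/
def IsShape (p q : ℕ) : Prop :=
  0 < p ∧ 0 < q ∧ p ^ 2 < 3 * q ^ 2 ∧ q ^ 2 < 3 * p ^ 2 ∧ p.Coprime q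

lemma IsShape.symm {p q : ℕ} (h : IsShape p q) : IsShape q p :=
  ⟨h.2.1, h.1, h.2.2.2.1, h.2.2.1, h.2.2.2.2.symm⟩

lemma isShape_and_lt_iff {p q : ℕ} :
    IsShape p q ∧ p < q ↔ IsConePoint 1 p q ∧ p.Coprime q := by
  simp only [IsShape, IsConePoint, Nat.mod_one, and_true]
  constructor
  · rintro ⟨⟨h1, h2, h3, h4, h5⟩, h6⟩
    exact ⟨⟨h1, h6, h4⟩, h5⟩
  · rintro ⟨⟨h1, h6, h4⟩, h5⟩
    refine ⟨⟨h1, by omega, ?_, h4, h5⟩, h6⟩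
    have : p ^ 2 < q ^ 2 := Nat.pow_lt_pow_left h6 (by norm_num)
    omega

/-- The diagonal contributes only p = q = 1, by coprimality, which gives the summand 1; the two
sides of the diagonal are exchanged by symmetry. -/
lemma fiberCount_isShape_odd :
    fiberCount (fun p q => IsShape p q ∧ Odd p ∧ Odd q) = 1 + 2 * primitiveConeCount 2 := by
  rw [fiberCount_of_symm (fun p q h => ⟨h.1.symm, h.2.symm⟩), primitiveConeCount_two]
  congr 1
  · classical
    ext n
    rw [ArithmeticFunction.one_apply]
    have : ∀ x ∈ n.divisorsAntidiagonal,
        (if (IsShape x.1 x.2 ∧ Odd x.1 ∧ Odd x.2) ∧ x.1 = x.2 then (1 : ℝ) else 0)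
        = if x = (1, 1) then 1 else 0 := by
      rintro ⟨p, q⟩ -
      congr 1
      rw [Prod.mk.injEq, eq_iff_iff]
      constructor
      · rintro ⟨⟨⟨-, -, -, -, h⟩, -⟩, h2 : p = q⟩
        subst h2
        have := (Nat.coprime_self p).1 h
        exact ⟨this, this⟩
      · rintro ⟨rfl, rfl⟩
        exact ⟨⟨⟨by norm_num, by norm_num, by norm_num, by norm_num, by norm_num⟩, by decide⟩, rfl⟩
    rw [fiberCount_eq_sum, Finset.sum_congr rfl this, Finset.sum_ite_eq']
    congr 1
    rw [Nat.mem_divisorsAntidiagonal, eq_iff_iff]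
    constructor
    · rintro ⟨h, -⟩; omega
    · rintro rfl; simp
  · congr 1
    refine fiberCount_congr fun p q => ?_
    have h := isShape_and_lt_iff (p := p) (q := q)
    simp only [IsConePoint, Nat.mod_one, Nat.odd_iff, Nat.mod_eq_of_lt one_lt_two] at h ⊢
    tauto

/-- The diagonal pair (1, 1) is odd, so nothing is left on the diagonal. Above it, pairs with an
even entry are all primitive cone points minus the odd ones. -/
lemma fiberCount_isShape_even :
    fiberCount (fun p q => IsShape p q ∧ ¬ (Odd p ∧ Odd q))
      = 2 * (primitiveConeCount 1 - primitiveConeCount 2) := by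
  rw [fiberCount_of_symm (fun p q h => ⟨h.1.symm, fun h2 => h.2 h2.symm⟩), primitiveConeCount_two,
    primitiveConeCount_one, fiberCount_split (fun p q => IsConePoint 1 p q ∧ p.Coprime q)
      (fun p q => Odd p ∧ Odd q)]
  have h0 : fiberCount (fun p q => (IsShape p q ∧ ¬ (Odd p ∧ Odd q)) ∧ p = q) = 0 := by
    ext n
    classical
    rw [fiberCount_apply, ArithmeticFunction.zero_apply]
    refine Finset.sum_eq_zero fun x _ => if_neg ?_
    rintro ⟨⟨⟨-, -, -, -, h⟩, h1⟩, h2⟩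
    rw [h2] at h h1
    rw [(Nat.coprime_self _).1 h] at h1
    exact h1 (by decide)
  rw [h0, zero_add, fiberCount_congr (R := fun p q => IsConePoint 2 p q ∧ p.Coprime q)
    (R' := fun p q => (IsConePoint 1 p q ∧ p.Coprime q) ∧ Odd p ∧ Odd q),
    fiberCount_congr (R := fun p q => (IsShape p q ∧ ¬ (Odd p ∧ Odd q)) ∧ p < q)
    (R' := fun p q => (IsConePoint 1 p q ∧ p.Coprime q) ∧ ¬ (Odd p ∧ Odd q))]
  · ring
  · intro p q
    have h := isShape_and_lt_iff (p := p) (q := q)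
    tauto
  · intro p q
    simp only [IsConePoint, Nat.mod_one, Nat.odd_iff, Nat.mod_eq_of_lt one_lt_two]
    tauto

/-- The indicator function of `2`. -/
noncomputable def indicatorTwo : ArithmeticFunction ℝ := ⟨fun n => if n = 2 then 1 else 0, by simp⟩

lemma indicatorTwo_mul_two_mul (f : ArithmeticFunction ℝ) {m : ℕ} (hm : m ≠ 0) :
    (indicatorTwo * f) (2 * m) = f m := by
  rw [ArithmeticFunction.mul_apply, Finset.sum_eq_single (2, m)]
  · simp [indicatorTwo]
  · rintro ⟨a, b⟩ h h2
    obtain ⟨h, -⟩ := Nat.mem_divisorsAntidiagonal.1 h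
    have : a ≠ 2 := by
      rintro rfl
      apply h2
      simp only [Prod.mk.injEq, true_and]
      simp only at h
      omega
    simp [indicatorTwo, this]
  · intro h
    simp [hm] at h

lemma indicatorTwo_mul_of_not_dvd (f : ArithmeticFunction ℝ) {n : ℕ} (hn : ¬ 2 ∣ n) :
    (indicatorTwo * f) n = 0 := by
  rw [ArithmeticFunction.mul_apply]
  refine Finset.sum_eq_zero ?_
  rintro ⟨a, b⟩ h
  obtain ⟨h, -⟩ := Nat.mem_divisorsAntidiagonal.1 h
  have : a ≠ 2 := by rintro rfl; exact hn (Dvd.intro _ h)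
  simp [indicatorTwo, this]

lemma summatory_indicatorTwo_mul (f : ArithmeticFunction ℝ) (x : ℝ) :
    summatory (indicatorTwo * f : ArithmeticFunction ℝ) x = summatory f (x / 2) := by
  rw [summatory, summatory]
  rw [← Finset.sum_subset (s₁ := (Finset.Icc 1 ⌊x / 2⌋₊).image (fun m => 2 * m))
    (s₂ := Finset.Icc 1 ⌊x⌋₊)]
  · rw [Finset.sum_image (fun a _ b _ h => by simpa using h)]
    refine Finset.sum_congr rfl fun m hm => (indicatorTwo_mul_two_mul f ?_)
    have := (Finset.mem_Icc.1 hm).1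
    omega
  · intro n hn
    obtain ⟨m, hm, rfl⟩ := Finset.mem_image.1 hn
    rw [mem_Icc_floor] at hm ⊢
    refine ⟨by omega, ?_⟩
    push_cast
    linarith
  · intro n hn hn2
    rw [mem_Icc_floor] at hn
    apply indicatorTwo_mul_of_not_dvd
    rintro ⟨m, rfl⟩
    apply hn2
    refine Finset.mem_image.2 ⟨m, mem_Icc_floor.2 ⟨by omega, ?_⟩, rfl⟩
    have := hn.2
    push_cast at this
    linarith

/-- The arithmetic function counting shapes. -/
noncomputable def shapeArith : ArithmeticFunction ℝ :=
  1 + 2 * primitiveConeCount 2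
    + indicatorTwo * (2 * (primitiveConeCount 1 - primitiveConeCount 2))

lemma shapeArith_apply (n : ℕ) : shapeArith n = (shapeCount n : ℝ) := by
  classical
  rcases Nat.eq_zero_or_pos n with rfl | hn
  · rw [ArithmeticFunction.map_zero, shapeCount]
    have : shapeFiber 0 = ∅ := by
      ext ⟨p, q⟩
      simp only [shapeFiber, Set.mem_ofPred_eq, Set.mem_empty_iff_false, iff_false]
      rintro ⟨⟨h1, h2, -⟩, h⟩
      have := mul_le_rhombusWeight p q
      have := Nat.mul_pos h1 h2
      omega
    rw [this]
    simp
  set A := n.divisorsAntidiagonal.filter fun x => IsShape x.1 x.2 ∧ Odd x.1 ∧ Odd x.2 with hA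
  set B := (if 2 ∣ n then (n / 2).divisorsAntidiagonal else ∅).filter
    fun x => IsShape x.1 x.2 ∧ ¬ (Odd x.1 ∧ Odd x.2) with hB
  have hset : shapeFiber n = ((A ∪ B : Finset (ℕ × ℕ)) : Set (ℕ × ℕ)) := by
    ext ⟨p, q⟩
    simp only [shapeFiber, rhombusWeight, hA, hB, Finset.coe_union, Set.mem_union, Finset.mem_coe,
      Finset.mem_filter, Set.mem_ofPred_eq, Nat.mem_divisorsAntidiagonal]
    by_cases ho : Odd p ∧ Odd q
    · simp only [ho, and_self, if_true, not_true, and_false, or_false, and_true]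
      exact ⟨fun h => ⟨⟨h.2, hn.ne'⟩, h.1⟩, fun h => ⟨h.2, h.1.1⟩⟩
    · simp only [ho, if_false, and_false, false_or, not_false_eq_true, and_true]
      constructor
      · rintro ⟨h, rfl⟩
        rw [if_pos (Dvd.intro _ rfl), Nat.mul_div_cancel_left _ two_pos,
          Nat.mem_divisorsAntidiagonal]
        exact ⟨⟨rfl, by rintro h'; rw [h'] at hn; simp at hn⟩, h⟩
      · rintro ⟨h1, h⟩
        split_ifs at h1 with h2
        · rw [Nat.mem_divisorsAntidiagonal] at h1
          exact ⟨h, by rw [h1.1]; omega⟩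
        · simp at h1
  have hdisj : Disjoint A B := by
    rw [Finset.disjoint_left]
    intro x h1 h2
    exact (Finset.mem_filter.1 h2).2.2 (Finset.mem_filter.1 h1).2.2
  rw [shapeCount, hset, Set.ncard_coe_finset, Finset.card_union_of_disjoint hdisj, shapeArith,
    ← fiberCount_isShape_odd, ← fiberCount_isShape_even, ArithmeticFunction.add_apply,
    Nat.cast_add]
  have hodd : fiberCount (fun p q => IsShape p q ∧ Odd p ∧ Odd q) n = A.card :=
    fiberCount_eq_card _ n
  rw [hodd, add_right_inj]
  by_cases h2 : 2 ∣ n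
  · obtain ⟨m, rfl⟩ := h2
    rw [indicatorTwo_mul_two_mul _ (by omega), hB, if_pos (Dvd.intro _ rfl),
      Nat.mul_div_cancel_left _ two_pos]
    exact fiberCount_eq_card _ m
  · rw [indicatorTwo_mul_of_not_dvd _ h2, hB, if_neg h2]
    simp

lemma HasMeanValue.add {f g : ℕ → ℝ} {α β θ : ℝ} (hf : HasMeanValue f α θ)
    (hg : HasMeanValue g β θ) : HasMeanValue (fun n => f n + g n) (α + β) θ := by
  obtain ⟨C, hC⟩ := hf
  obtain ⟨D, hD⟩ := hg
  refine ⟨C + D, fun x hx => ?_⟩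
  have : summatory (fun n => f n + g n) x - (α + β) * x
      = (summatory f x - α * x) + (summatory g x - β * x) := by
    rw [summatory, Finset.sum_add_distrib, summatory, summatory]; ring
  rw [this, add_mul]
  exact (abs_add_le _ _).trans (add_le_add (hC x hx) (hD x hx))

lemma HasMeanValue.const_mul {f : ℕ → ℝ} {α θ : ℝ} (c : ℝ) (hf : HasMeanValue f α θ) :
    HasMeanValue (fun n => c * f n) (c * α) θ := by
  obtain ⟨C, hC⟩ := hf
  refine ⟨|c| * C, fun x hx => ?_⟩
  have : summatory (fun n => c * f n) x - c * α * x = c * (summatory f x - α * x) := by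
    rw [summatory, ← Finset.mul_sum, summatory]; ring
  rw [this, abs_mul, mul_assoc]
  exact mul_le_mul_of_nonneg_left (hC x hx) (abs_nonneg c)

lemma HasMeanValue.indicatorTwo_mul {f : ArithmeticFunction ℝ} {α θ : ℝ} (h0 : 0 ≤ θ)
    (hf : HasMeanValue f α θ) :
    HasMeanValue (indicatorTwo * f : ArithmeticFunction ℝ) (α / 2) θ := by
  obtain ⟨C, hC⟩ := hf
  have hC0 : 0 ≤ C := by
    have h := (abs_nonneg _).trans (hC 1 le_rfl)
    simpa using h
  refine ⟨C + |α|, fun x hx => ?_⟩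
  have hxp : 1 ≤ x ^ θ := Real.one_le_rpow hx h0
  have hlog := one_le_one_add_log hx
  rw [summatory_indicatorTwo_mul, show α / 2 * x = α * (x / 2) by ring]
  rcases le_or_gt 2 x with h | h
  · refine (hC (x / 2) (by linarith)).trans ?_
    have h1 : (x / 2) ^ θ ≤ x ^ θ := Real.rpow_le_rpow (by linarith) (by linarith) h0
    have h2 : Real.log (x / 2) ≤ Real.log x := Real.log_le_log (by linarith) (by linarith)
    have h3 := one_le_one_add_log (x := x / 2) (by linarith)
    have h4 := abs_nonneg α
    gcongr
    linarith
  · have : ⌊x / 2⌋₊ = 0 := Nat.floor_eq_zero.2 (by linarith)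
    rw [summatory, this]
    simp only [Finset.Icc_eq_empty_of_lt, zero_lt_one, Finset.sum_empty, zero_sub, abs_neg,
      abs_mul]
    rw [abs_of_pos (by linarith : 0 < x / 2)]
    have h5 : 1 ≤ x ^ θ * (1 + Real.log x) := one_le_mul_of_one_le_of_one_le hxp hlog
    calc |α| * (x / 2) ≤ |α| * 1 := by gcongr; linarith
      _ ≤ (C + |α|) * (x ^ θ * (1 + Real.log x)) := by
        gcongr
        linarith

lemma hasMeanValue_one_arith :
    HasMeanValue (1 : ArithmeticFunction ℝ) 0 (1 / 2) := by
  refine ⟨1, fun x hx => ?_⟩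
  have h : summatory (1 : ArithmeticFunction ℝ) x = 1 := by
    rw [summatory, Finset.sum_eq_single_of_mem 1 (Finset.mem_Icc.2 ⟨le_rfl, one_le_floor hx⟩)]
    · simp
    · intro b _ hb
      simp [hb]
  rw [h]
  simpa using one_le_mul_of_one_le_of_one_le
    (Real.one_le_rpow hx (by norm_num : (0 : ℝ) ≤ 1 / 2)) (one_le_one_add_log hx)

/-- Mere existence of the mean value suffices, since the leading constant is recovered later from
the Dirichlet series. -/
lemma hasMeanValue_shapeArith : ∃ β, HasMeanValue shapeArith β (1 / 2) := by
  obtain ⟨C₁, h1⟩ := exists_abs_summatory_isConePoint_le one_pos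
  obtain ⟨C₂, h2⟩ := exists_abs_summatory_isConePoint_le two_pos
  obtain ⟨α, hα⟩ := hasMeanValue_squareMoebius_mul (fun d => d % 1 = 1 % 1) h1
  obtain ⟨β, hβ⟩ := hasMeanValue_squareMoebius_mul (fun d => d % 2 = 1 % 2) h2
  change HasMeanValue (primitiveConeCount 1) _ _ at hα
  change HasMeanValue (primitiveConeCount 2) _ _ at hβ
  have h3 : HasMeanValue (2 * (primitiveConeCount 1 - primitiveConeCount 2) :
      ArithmeticFunction ℝ) (2 * (α + -1 * β)) (1 / 2) := by
    convert (hα.add (hβ.const_mul (-1))).const_mul 2 using 2 with n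
    rw [two_mul, ArithmeticFunction.add_apply, sub_eq_add_neg,
      ArithmeticFunction.add_apply, ArithmeticFunction.neg_apply]
    ring
  have h4 := (hasMeanValue_one_arith.add (hβ.const_mul 2)).add
    (h3.indicatorTwo_mul (by norm_num))
  refine ⟨0 + 2 * β + 2 * (α + -1 * β) / 2, ?_⟩
  convert h4 using 2 with n
  rw [shapeArith, two_mul, ArithmeticFunction.add_apply, ArithmeticFunction.add_apply,
    ArithmeticFunction.add_apply]
  ring

lemma aSquare_eq_convolution {n : ℕ} (hn : n ≠ 0) :
    (aSquare n : ℝ) = (chiSumArith * shapeArith) n := by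
  have h := congrArg (fun z : ℤ => (z : ℝ)) (aSquare_eq_sum hn)
  simp only [Int.cast_natCast, Int.cast_sum, Int.cast_mul] at h
  rw [h, ArithmeticFunction.mul_apply]
  simp only [chiSumArith_apply, shapeArith_apply]

lemma ASquare_eq_summatory (x : ℝ) :
    ASquare x = summatory (chiSumArith * shapeArith : ArithmeticFunction ℝ) x :=
  Finset.sum_congr rfl fun n hn => aSquare_eq_convolution (by
    have := (Finset.mem_Icc.1 hn).1; omega)


/-! ### From the summatory function to the principal part -/

open MeasureTheory Set

lemma rpow_mul_one_add_log_isBigO {θ η : ℝ} (h : θ < η) :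
    (fun x : ℝ => x ^ θ * (1 + Real.log x)) =O[atTop] fun x => x ^ η := by
  have h1 : (fun x : ℝ => 1 + Real.log x) =O[atTop] fun x => x ^ (η - θ) := by
    refine IsBigO.add ?_ (isLittleO_log_rpow_atTop (sub_pos.2 h)).isBigO
    refine IsBigO.of_bound 1 ?_
    filter_upwards [eventually_ge_atTop 1] with x hx
    rw [norm_one, one_mul, Real.norm_of_nonneg (by positivity)]
    exact Real.one_le_rpow hx (sub_pos.2 h).le
  refine ((isBigO_refl (fun x : ℝ => x ^ θ) atTop).mul h1).trans_eventuallyEq ?_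
  filter_upwards [eventually_gt_atTop 0] with x hx
  rw [← Real.rpow_add hx]
  congr 1
  ring

lemma indicator_Ioi_isBigO (f : ℝ → ℂ) (b : ℝ) :
    (indicator (Ioi 1) f) =O[𝓝[>] 0] fun t : ℝ => t ^ (-b) := by
  refine IsBigO.of_bound 0 ?_
  have : Iio (1 : ℝ) ∈ 𝓝[>] (0 : ℝ) := mem_nhdsWithin_of_mem_nhds (Iio_mem_nhds one_pos)
  filter_upwards [this] with t ht
  rw [indicator_of_notMem (by simpa using (mem_Iio.1 ht).le)]
  simp

lemma mellin_indicator_Ioi (f : ℝ → ℂ) (z : ℂ) :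
    mellin (indicator (Ioi 1) f) z = ∫ t in Ioi (1 : ℝ), (t : ℂ) ^ (z - 1) * f t := by
  rw [mellin]
  have : ∀ t : ℝ, (t : ℂ) ^ (z - 1) • indicator (Ioi 1) f t
      = indicator (Ioi 1) (fun t : ℝ => (t : ℂ) ^ (z - 1) * f t) t := by
    intro t
    by_cases ht : t ∈ Ioi (1 : ℝ)
    · rw [indicator_of_mem ht, indicator_of_mem ht, smul_eq_mul]
    · rw [indicator_of_notMem ht, indicator_of_notMem ht, smul_zero]
  simp only [this]
  rw [setIntegral_indicator measurableSet_Ioi, Ioi_inter_Ioi, max_eq_right zero_le_one]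

lemma mellinConvergent_indicator_Ioi {f : ℝ → ℂ} {z : ℂ} :
    MellinConvergent (indicator (Ioi 1) f) z ↔
      IntegrableOn (fun t : ℝ => (t : ℂ) ^ (z - 1) * f t) (Ioi 1) := by
  rw [MellinConvergent]
  have : (fun t : ℝ => (t : ℂ) ^ (z - 1) • indicator (Ioi 1) f t)
      = indicator (Ioi 1) (fun t : ℝ => (t : ℂ) ^ (z - 1) * f t) := by
    ext t
    by_cases ht : t ∈ Ioi (1 : ℝ)
    · rw [indicator_of_mem ht, indicator_of_mem ht, smul_eq_mul]
    · rw [indicator_of_notMem ht, indicator_of_notMem ht, smul_zero]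
  rw [this, integrableOn_indicator_iff measurableSet_Ioi, Ioi_inter_Ioi, max_eq_left zero_le_one]

lemma integral_Ioi_cpow_neg {s : ℂ} (hs : 1 < s.re) :
    IntegrableOn (fun t : ℝ => (t : ℂ) ^ (-s)) (Ioi 1) ∧
      ∫ t in Ioi (1 : ℝ), (t : ℂ) ^ (-s) = 1 / (s - 1) := by
  have h : (-s).re < -1 := by simpa using hs
  refine ⟨integrableOn_Ioi_cpow_of_lt h one_pos, ?_⟩
  rw [integral_Ioi_cpow_of_lt h one_pos, Complex.ofReal_one, Complex.one_cpow,
    ← neg_div_neg_eq, neg_neg]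
  congr 1
  ring

/-- The Mellin transform of the indicator of (1, ∞) is -1/z for Re z < 0. Differentiating under the
integral at z = 1 - s brings in the logarithm. -/
lemma integral_Ioi_cpow_neg_mul_log {s : ℂ} (hs : 1 < s.re) :
    IntegrableOn (fun t : ℝ => (t : ℂ) ^ (-s) * (Real.log t : ℂ)) (Ioi 1) ∧
      ∫ t in Ioi (1 : ℝ), (t : ℂ) ^ (-s) * (Real.log t : ℂ) = 1 / (s - 1) ^ 2 := by
  have hloc : LocallyIntegrableOn (indicator (Ioi (1 : ℝ)) (fun _ => (1 : ℂ))) (Ioi 0) :=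
    ((locallyIntegrable_const (1 : ℂ)).indicator measurableSet_Ioi).locallyIntegrableOn _
  have htop : (indicator (Ioi (1 : ℝ)) (fun _ => (1 : ℂ))) =O[atTop] fun t : ℝ => t ^ (-(0 : ℝ)) := by
    refine IsBigO.of_bound 1 (Eventually.of_forall fun t => ?_)
    rw [neg_zero, Real.rpow_zero, norm_one, mul_one]
    by_cases ht : t ∈ Ioi (1 : ℝ)
    · rw [indicator_of_mem ht, norm_one]
    · rw [indicator_of_notMem ht, norm_zero]; exact zero_le_one
  have hz : (1 - s).re < 0 := by simpa using hs
  obtain ⟨h1, h2⟩ := mellin_hasDerivAt_of_isBigO_rpow hloc htop hz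
    (indicator_Ioi_isBigO _ ((1 - s).re - 1)) (by linarith)
  have hfun : (fun t : ℝ => Real.log t • indicator (Ioi (1 : ℝ)) (fun _ => (1 : ℂ)) t)
      = indicator (Ioi (1 : ℝ)) fun t => (Real.log t : ℂ) := by
    ext t
    by_cases ht : t ∈ Ioi (1 : ℝ)
    · rw [indicator_of_mem ht, indicator_of_mem ht, Complex.real_smul, mul_one]
    · rw [indicator_of_notMem ht, indicator_of_notMem ht, smul_zero]
  rw [hfun] at h1 h2
  rw [mellinConvergent_indicator_Ioi, show 1 - s - 1 = -s by ring] at h1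
  refine ⟨h1, ?_⟩
  rw [mellin_indicator_Ioi, show 1 - s - 1 = -s by ring] at h2
  have hne : (1 - s) ≠ 0 := by intro h; rw [h] at hz; simp at hz
  have h3 : HasDerivAt (fun z : ℂ => -z⁻¹) (1 / (s - 1) ^ 2) (1 - s) := by
    have := (hasDerivAt_inv hne).fun_neg
    rwa [neg_neg, show (1 - s) ^ 2 = (s - 1) ^ 2 by ring, ← one_div] at this
  refine h2.unique (h3.congr_of_eventuallyEq ?_)
  have hopen : {z : ℂ | z.re < 0} ∈ 𝓝 (1 - s) :=
    (isOpen_lt Complex.continuous_re continuous_const).mem_nhds hz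
  filter_upwards [hopen] with z hz'
  have hz'' : z.re < 0 := hz'
  have h4 := (integral_Ioi_cpow_neg (s := 1 - z)
    (by rw [Complex.sub_re, Complex.one_re]; linarith)).2
  rw [mellin_indicator_Ioi]
  simp only [mul_one]
  rw [show z - 1 = -(1 - z) by ring, h4, show (1 - z - 1) = -z by ring, one_div, inv_neg]

/-- The Dirichlet series of a sequence whose summatory function is
`A x log x + B x + O(x ^ θ (1 + log x))`. -/
lemma LSeries_eq_of_summatory {f : ℕ → ℝ} (hf : ∀ n, 0 ≤ f n) {A B C θ : ℝ} (hθ : θ < 1)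
    (h : ∀ x, 1 ≤ x → |summatory f x - (A * (x * Real.log x) + B * x)|
      ≤ C * (x ^ θ * (1 + Real.log x))) :
    (∀ s : ℂ, 1 < s.re → LSeriesSummable (fun n => (f n : ℂ)) s) ∧
      ∃ g : ℂ → ℂ, AnalyticAt ℂ g 1 ∧ ∀ s : ℂ, 1 < s.re →
        LSeries (fun n => (f n : ℂ)) s = A / (s - 1) ^ 2 + (A + B) / (s - 1) + g s := by
  -- An exponent strictly between θ and 1 absorbs the logarithm and leaves a half-plane of
  -- holomorphy Re s > η containing 1.
  obtain ⟨η, hη, hη1⟩ := exists_between hθ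
  set E : ℝ → ℝ := fun x => summatory f x - (A * (x * Real.log x) + B * x) with hE
  have hEO : E =O[atTop] fun x => x ^ η := by
    refine IsBigO.trans (IsBigO.of_bound C ?_) (rpow_mul_one_add_log_isBigO hη)
    filter_upwards [eventually_ge_atTop 1] with x hx
    have h2 := one_le_one_add_log hx
    rw [Real.norm_eq_abs, Real.norm_of_nonneg (by positivity)]
    exact h x hx
  have hSO : ∀ r : ℝ, 1 < r → (summatory f) =O[atTop] fun x => x ^ r := by
    intro r hr
    have h1 : (fun x : ℝ => x * Real.log x) =O[atTop] fun x => x ^ r := by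
      refine IsBigO.trans (IsBigO.of_bound 1 ?_) (rpow_mul_one_add_log_isBigO hr)
      filter_upwards [eventually_ge_atTop 1] with x hx
      have := Real.log_nonneg hx
      rw [Real.rpow_one, one_mul, Real.norm_of_nonneg (by positivity),
        Real.norm_of_nonneg (by positivity)]
      gcongr
      linarith
    have h2 : (fun x : ℝ => x) =O[atTop] fun x => x ^ r := by
      refine IsBigO.of_bound 1 ?_
      filter_upwards [eventually_ge_atTop 1] with x hx
      rw [one_mul, Real.norm_of_nonneg (by positivity), Real.norm_of_nonneg (by positivity)]
      exact Real.self_le_rpow_of_one_le hx hr.le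
    have h3 : E =O[atTop] fun x => x ^ r := by
      refine hEO.trans (IsBigO.of_bound 1 ?_)
      filter_upwards [eventually_ge_atTop 1] with x hx
      rw [one_mul, Real.norm_of_nonneg (by positivity), Real.norm_of_nonneg (by positivity)]
      exact Real.rpow_le_rpow_of_exponent_le hx (by linarith)
    refine (h3.add ((h1.const_mul_left A).add (h2.const_mul_left B))).congr_left fun x => ?_
    simp only [hE]
    ring
  have hSN : ∀ r : ℝ, 1 < r →
      (fun n : ℕ => ∑ k ∈ Finset.Icc 1 n, f k) =O[atTop] fun n : ℕ => (n : ℝ) ^ r := by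
    intro r hr
    have := (hSO r hr).comp_tendsto (tendsto_natCast_atTop_atTop (R := ℝ))
    refine this.congr_left fun n => ?_
    simp only [Function.comp_apply, summatory_natCast]
  have hsum : ∀ s : ℂ, 1 < s.re → LSeriesSummable (fun n => (f n : ℂ)) s := by
    intro s hs
    obtain ⟨r, hr1, hr2⟩ := exists_between hs
    exact LSeriesSummable_of_sum_norm_bigO_and_nonneg (hSN r hr1) hf (by linarith) hr2
  refine ⟨hsum, ?_⟩
  -- the contribution of the error term
  have hEloc : LocallyIntegrable (fun t : ℝ => (E t : ℂ)) := by
    have h1 : LocallyIntegrable (summatory f) :=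
      Monotone.locallyIntegrable fun x y hxy => summatory_mono hf hxy
    have h2 : LocallyIntegrable (fun x : ℝ => A * (x * Real.log x) + B * x) :=
      ((Real.continuous_mul_log.const_mul A).add (continuous_id.const_mul B)).locallyIntegrable
    have h3 : LocallyIntegrable E := h1.sub h2
    intro x
    obtain ⟨u, hu, hi⟩ := h3 x
    exact ⟨u, hu, hi.ofReal⟩
  have hEtop : (indicator (Ioi (1 : ℝ)) (fun t => (E t : ℂ))) =O[atTop] fun t : ℝ => t ^ (-(-η)) := by
    rw [neg_neg]
    refine IsBigO.trans (IsBigO.of_bound 1 (Eventually.of_forall fun t => ?_)) hEO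
    rw [one_mul]
    by_cases ht : t ∈ Ioi (1 : ℝ)
    · rw [indicator_of_mem ht, Complex.norm_real]
    · rw [indicator_of_notMem ht, norm_zero]; exact norm_nonneg _
  have hmellin : ∀ z : ℂ, z.re < -η →
      MellinConvergent (indicator (Ioi (1 : ℝ)) (fun t => (E t : ℂ))) z ∧
      DifferentiableAt ℂ (mellin (indicator (Ioi (1 : ℝ)) (fun t => (E t : ℂ)))) z := by
    intro z hz
    have hloc := (hEloc.indicator (measurableSet_Ioi (a := (1 : ℝ)))).locallyIntegrableOn (Ioi 0)
    have hb := indicator_Ioi_isBigO (fun t => (E t : ℂ)) (z.re - 1)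
    exact ⟨mellinConvergent_of_isBigO_rpow hloc hEtop hz hb (by linarith),
      mellin_differentiableAt_of_isBigO_rpow hloc hEtop hz hb (by linarith)⟩
  set H := mellin (indicator (Ioi (1 : ℝ)) (fun t => (E t : ℂ))) with hH
  -- Abel summation writes the series as s times the integral of the summatory function against
  -- t^(-s-1). Its main terms give A s/(s-1)² + B s/(s-1) = A/(s-1)² + (A+B)/(s-1) + B.
  refine ⟨fun s => B + s * H (-s), ?_, ?_⟩
  · have hopen : IsOpen {s : ℂ | η < s.re} := isOpen_lt continuous_const Complex.continuous_re
    refine DifferentiableOn.analyticAt (s := {s : ℂ | η < s.re}) ?_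
      (hopen.mem_nhds (by simpa using hη1))
    intro s hs
    have hs' : η < s.re := hs
    have h1 := (hmellin (-s) (by simpa using hs')).2
    have h2 : DifferentiableAt ℂ (fun s => H (-s)) s :=
      DifferentiableAt.comp s (f := fun s : ℂ => -s) (g := H) h1 differentiableAt_id.neg
    exact ((differentiableAt_const _).add (differentiableAt_id.mul h2)).differentiableWithinAt
  · intro s hs
    obtain ⟨r, hr1, hr2⟩ := exists_between hs
    rw [LSeries_eq_mul_integral_of_nonneg f (by linarith : (0 : ℝ) ≤ r) hr2 (hSN r hr1) hf]
    obtain ⟨i1, v1⟩ := integral_Ioi_cpow_neg hs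
    obtain ⟨i2, v2⟩ := integral_Ioi_cpow_neg_mul_log hs
    have i3 := (hmellin (-s) (by simp only [Complex.neg_re]; linarith)).1
    rw [mellinConvergent_indicator_Ioi] at i3
    have hint : ∫ t in Ioi (1 : ℝ), (∑ k ∈ Finset.Icc 1 ⌊t⌋₊, (f k : ℂ)) * (t : ℂ) ^ (-(s + 1))
        = ∫ t in Ioi (1 : ℝ), ((A : ℂ) * ((t : ℂ) ^ (-s) * (Real.log t : ℂ)) + B * (t : ℂ) ^ (-s)
          + (t : ℂ) ^ (-s - 1) * (E t : ℂ)) := by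
      refine setIntegral_congr_fun measurableSet_Ioi fun t ht => ?_
      have ht0 : (t : ℂ) ≠ 0 := by
        have : (1 : ℝ) < t := ht
        exact_mod_cast (by linarith : t ≠ 0)
      have e1 : (t : ℂ) ^ (-s) = t * (t : ℂ) ^ (-s - 1) := by
        rw [Complex.cpow_sub _ _ ht0, Complex.cpow_one]; field_simp
      have e2 : (∑ k ∈ Finset.Icc 1 ⌊t⌋₊, (f k : ℂ)) = (summatory f t : ℂ) := by
        rw [summatory]; push_cast; rfl
      simp only [e2, hE, show -(s + 1) = -s - 1 by ring]
      rw [e1]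
      push_cast
      ring
    have i12 : IntegrableOn (fun t : ℝ => (A : ℂ) * ((t : ℂ) ^ (-s) * (Real.log t : ℂ))
        + B * (t : ℂ) ^ (-s)) (Ioi 1) := (i2.const_mul _).add (i1.const_mul _)
    rw [hint, integral_add i12 i3,
      integral_add (i2.const_mul _) (i1.const_mul _), integral_const_mul, integral_const_mul, v1, v2]
    have hHs : H (-s) = ∫ t in Ioi (1 : ℝ), (t : ℂ) ^ (-s - 1) * (E t : ℂ) :=
      mellin_indicator_Ioi _ _
    simp only [hHs]
    have hs1 : s - 1 ≠ 0 := by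
      intro h0
      rw [sub_eq_zero.1 h0] at hs
      simp at hs
    field_simp
    ring


/-! ### The cone series as s tends to 1 from the right -/

/-- The integral of `t ^ (-1 - u)` over `[x, ∞)`. -/
noncomputable def powTail (u x : ℝ) : ℝ := x ^ (-u) / u

lemma powTail_sub_bounds {u x : ℝ} (hu : 0 < u) (hx : 0 < x) :
    (x + 1) ^ (-1 - u) ≤ powTail u x - powTail u (x + 1) ∧
      powTail u x - powTail u (x + 1) ≤ x ^ (-1 - u) := by
  have hd : ∀ t, 0 < t → HasDerivAt (fun t => -powTail u t) (t ^ (-1 - u)) t := by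
    intro t ht
    have := ((Real.hasDerivAt_rpow_const (p := -u) (Or.inl ht.ne')).div_const u).fun_neg
    refine this.congr_deriv ?_
    rw [show -u - 1 = -1 - u by ring]
    field_simp
  obtain ⟨ξ, hξ, h⟩ := exists_hasDerivAt_eq_slope (fun t => -powTail u t) (fun t => t ^ (-1 - u))
    (lt_add_one x) (fun t ht => (hd t (lt_of_lt_of_le hx ht.1)).continuousAt.continuousWithinAt)
    (fun t ht => hd t (hx.trans ht.1))
  have e : powTail u x - powTail u (x + 1) = ξ ^ (-1 - u) := by
    rw [h, add_sub_cancel_left, div_one]; ring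
  rw [e]
  have hξ0 : 0 < ξ := hx.trans hξ.1
  exact ⟨Real.rpow_le_rpow_of_nonpos hξ0 hξ.2.le (by linarith),
    Real.rpow_le_rpow_of_nonpos hx hξ.1.le (by linarith)⟩

lemma powTail_anti {u x y : ℝ} (hu : 0 < u) (hx : 0 < x) (h : x ≤ y) :
    powTail u y ≤ powTail u x := by
  exact div_le_div_of_nonneg_right (Real.rpow_le_rpow_of_nonpos hx h (by linarith)) hu.le

lemma sum_rpow_bounds {u p : ℝ} (hu : 0 < u) (hp : 0 < p) (n : ℕ) :
    powTail u (p + 1) - powTail u (p + n + 1) ≤ ∑ j ∈ Finset.range n, (p + j + 1) ^ (-1 - u) ∧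
      ∑ j ∈ Finset.range n, (p + j + 1) ^ (-1 - u) ≤ powTail u p - powTail u (p + n) := by
  induction n with
  | zero => simp
  | succ n ih =>
    rw [Finset.sum_range_succ]
    have h1 := powTail_sub_bounds hu (by positivity : 0 < p + n)
    have h2 := powTail_sub_bounds hu (by positivity : 0 < p + n + 1)
    push_cast
    rw [← add_assoc p (n : ℝ) 1]
    constructor <;> linarith

/-- The inner sum of the Dirichlet series of the points of the cone. -/
noncomputable def coneInnerSum (u p : ℝ) : ℝ :=
  ∑ j ∈ Finset.range ⌊(√3 - 1) * p⌋₊, (p + j + 1) ^ (-1 - u)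

/-- The error in replacing the inner sum by an integral. -/
noncomputable def coneError (u p : ℝ) : ℝ :=
  p ^ (-1 - u) * (powTail u p - powTail u (√3 * p) - coneInnerSum u p)

/-- For the decreasing function t^(-1-u), integrals over unit steps squeeze the inner sum. The error
is non-negative and at most one unit integral at the start, hence at most p^(-1-u) before
multiplying by the outer factor. -/
lemma coneError_bounds {u p : ℝ} (hu : 0 < u) (hp : 0 < p) :
    0 ≤ coneError u p ∧ coneError u p ≤ p ^ (-2 - 2 * u) := by
  obtain ⟨hl, -⟩ := sqrt_three_bounds
  obtain ⟨h1, h2⟩ := sum_rpow_bounds hu hp ⌊(√3 - 1) * p⌋₊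
  have h3 := Nat.floor_le (a := (√3 - 1) * p) (mul_nonneg (by linarith) hp.le)
  have h4 := Nat.lt_floor_add_one ((√3 - 1) * p)
  have h5 := powTail_anti hu (x := p + ⌊(√3 - 1) * p⌋₊) (y := √3 * p) (by positivity) (by linarith)
  have h6 := powTail_anti hu (x := √3 * p) (y := p + ⌊(√3 - 1) * p⌋₊ + 1) (by positivity)
    (by linarith)
  have h7 := (powTail_sub_bounds hu hp).2
  have hp0 : 0 ≤ p ^ (-1 - u) := by positivity
  rw [coneError, coneInnerSum]
  constructor
  · exact mul_nonneg hp0 (by linarith)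
  · rw [show -2 - 2 * u = (-1 - u) + (-1 - u) by ring, Real.rpow_add hp]
    exact mul_le_mul_of_nonneg_left (by linarith) hp0

/-- The logarithmic mean `(1 - 3 ^ (-u / 2)) / u`. -/
lemma powTail_sub_sqrt_three {u p : ℝ} (hp : 0 < p) :
    powTail u p - powTail u (√3 * p) = p ^ (-u) * ((1 - Real.exp (-(u * (Real.log 3 / 2)))) / u) := by
  have : √3 ^ (-u) = Real.exp (-(u * (Real.log 3 / 2))) := by
    rw [Real.rpow_def_of_pos (by positivity), Real.log_sqrt (by norm_num)]
    congr 1; ring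
  rw [powTail, powTail, Real.mul_rpow (by positivity) hp.le, this]
  ring

lemma tendsto_one_sub_exp_div (L : ℝ) :
    Tendsto (fun u : ℝ => (1 - Real.exp (-(u * L))) / u) (𝓝[>] 0) (𝓝 L) := by
  have h : HasDerivAt (fun u : ℝ => 1 - Real.exp (-(u * L))) L 0 := by
    have := ((hasDerivAt_id (0 : ℝ)).mul_const L).fun_neg.exp.const_sub 1
    simpa using this
  have h2 := (hasDerivAt_iff_tendsto_slope.1 h).mono_left
    (nhdsWithin_mono 0 fun x (hx : 0 < x) => hx.ne')
  refine h2.congr fun u => ?_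
  simp [slope_def_field]

lemma tendsto_coneError {p : ℝ} (hp : 0 < p) :
    Tendsto (fun u => coneError u p) (𝓝[>] 0) (𝓝 (coneTerm p)) := by
  have hpow : ∀ (x : ℝ), 0 < x → ∀ a : ℝ,
      Tendsto (fun u : ℝ => x ^ (a - u)) (𝓝[>] 0) (𝓝 (x ^ a)) := by
    intro x hx a
    have : Continuous fun u : ℝ => x ^ (a - u) :=
      Continuous.rpow continuous_const (by fun_prop) fun _ => Or.inl hx.ne'
    have h := this.tendsto 0
    rw [sub_zero] at h
    exact h.mono_left nhdsWithin_le_nhds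
  have h1 := hpow p hp (-1)
  have h2 : Tendsto (fun u => powTail u p - powTail u (√3 * p)) (𝓝[>] 0) (𝓝 (Real.log 3 / 2)) := by
    have h := (hpow p hp 0).mul (tendsto_one_sub_exp_div (Real.log 3 / 2))
    rw [Real.rpow_zero, one_mul] at h
    refine h.congr fun u => ?_
    rw [powTail_sub_sqrt_three hp, zero_sub]
  have h3 : Tendsto (fun u => coneInnerSum u p) (𝓝[>] 0)
      (𝓝 (∑ j ∈ Finset.range ⌊(√3 - 1) * p⌋₊, (p + j + 1) ^ (-1 : ℝ))) :=
    tendsto_finsetSum _ fun j _ => hpow _ (by positivity) _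
  have h4 := h1.mul (h2.sub h3)
  have e : coneTerm p = p ^ (-1 : ℝ) * (Real.log 3 / 2
      - ∑ j ∈ Finset.range ⌊(√3 - 1) * p⌋₊, (p + j + 1) ^ (-1 : ℝ)) := by
    simp only [coneTerm, Real.rpow_neg_one, one_div]
  rw [e]
  exact h4

lemma summable_rpow_add {τ r : ℝ} (hτ : 0 < τ) (hr : r < -1) :
    Summable fun k : ℕ => ((k : ℝ) + τ) ^ r := by
  have h := (Real.summable_one_div_nat_add_rpow τ (-r)).2 (by linarith)
  refine h.congr fun k => ?_
  rw [abs_of_pos (by positivity), one_div, ← Real.rpow_neg (by positivity), neg_neg]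

lemma coneError_le {u p : ℝ} (hu : 0 < u) (hu1 : u ≤ 1) (hp : 0 < p) :
    coneError u p ≤ p ^ (-2 : ℝ) + p ^ (-4 : ℝ) := by
  refine (coneError_bounds hu hp).2.trans ?_
  have h1 : 0 < p ^ (-2 : ℝ) := by positivity
  have h2 : 0 < p ^ (-4 : ℝ) := by positivity
  rcases le_total 1 p with h | h
  · have := Real.rpow_le_rpow_of_exponent_le h (by linarith : -2 - 2 * u ≤ -2)
    linarith
  · have := Real.rpow_le_rpow_of_exponent_ge hp h (by linarith : -4 ≤ -2 - 2 * u)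
    linarith

/-- Dominated convergence; the bound p^(-2) + p^(-4) is uniform for 0 < u ≤ 1, the second summand
covering p < 1. -/
lemma tendsto_tsum_coneError {τ : ℝ} (hτ : 0 < τ) :
    Tendsto (fun u => ∑' k : ℕ, coneError u (k + τ)) (𝓝[>] 0) (𝓝 (∑' k : ℕ, coneTerm (k + τ))) := by
  refine tendsto_tsum_of_dominated_convergence
    (bound := fun k : ℕ => ((k : ℝ) + τ) ^ (-2 : ℝ) + ((k : ℝ) + τ) ^ (-4 : ℝ))
    ((summable_rpow_add hτ (by norm_num)).add (summable_rpow_add hτ (by norm_num)))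
    (fun k => tendsto_coneError (by positivity)) ?_
  filter_upwards [Ioc_mem_nhdsGT (zero_lt_one' ℝ)] with u hu k
  have hp : 0 < (k : ℝ) + τ := by positivity
  rw [Real.norm_of_nonneg (coneError_bounds hu.1 hp).1]
  exact coneError_le hu.1 hu.2 hp

/-- Replacing the inner sum by its integral from p to √3 p produces p^(-u) (1 - 3^(-u/2))/u, so the
main part is a multiple of a Hurwitz zeta value at 1 + 2u. -/
lemma hasSum_coneInnerSum {τ u : ℝ} (hτ : 0 < τ) (hu : 0 < u) :
    HasSum (fun k : ℕ => ((k : ℝ) + τ) ^ (-1 - u) * coneInnerSum u (k + τ))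
      ((1 - Real.exp (-(u * (Real.log 3 / 2)))) / u * ∑' k : ℕ, ((k : ℝ) + τ) ^ (-1 - 2 * u)
        - ∑' k : ℕ, coneError u (k + τ)) := by
  have h1 := (summable_rpow_add hτ (by linarith : -1 - 2 * u < -1)).hasSum.mul_left
    ((1 - Real.exp (-(u * (Real.log 3 / 2)))) / u)
  have h2 : Summable fun k : ℕ => coneError u (k + τ) :=
    Summable.of_nonneg_of_le (fun k => (coneError_bounds hu (by positivity)).1)
      (fun k => (coneError_bounds hu (by positivity)).2) (summable_rpow_add hτ (by linarith))
  refine (congrArg (fun f => HasSum f _) (funext fun k => ?_)).mpr (h1.sub h2.hasSum)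
  have hp : 0 < (k : ℝ) + τ := by positivity
  rw [coneError, powTail_sub_sqrt_three hp, show -1 - 2 * u = (-1 - u) + -u by ring,
    Real.rpow_add hp]
  ring


/-! ### Dirichlet series of the factors in closed form -/

/-- The Dirichlet series of the cone points, as a sum over columns. -/
lemma hasSum_fiberCount_isConePoint {c : ℕ} (hc : 0 < c) {u a : ℝ}
    (h : HasSum (fun k : ℕ => ((k : ℝ) + 1 / c) ^ (-1 - u) * coneInnerSum u (k + 1 / c)) a) :
    HasSum (fun n : ℕ => fiberCount (IsConePoint c) n * (n : ℝ) ^ (-1 - u))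
      ((c : ℝ) ^ (-2 - 2 * u) * a) := by
  classical
  have hc' : (0 : ℝ) < c := by exact_mod_cast hc
  set w : ℕ → ℕ := fun k => ⌊(√3 - 1) * ((k : ℝ) + 1 / c)⌋₊ with hw
  set H : ℕ × ℕ → ℝ := fun x =>
    if IsConePoint c x.1 x.2 then ((x.1 * x.2 : ℕ) : ℝ) ^ (-1 - u) else 0 with hH
  set φ : ℕ × ℕ → ℕ × ℕ := fun y => (c * y.1 + 1, c * y.1 + 1 + c * (y.2 + 1)) with hφ
  have hφinj : Function.Injective φ := by
    rintro ⟨k, j⟩ ⟨k', j'⟩ h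
    simp only [hφ, Prod.mk.injEq] at h
    have : k = k' := Nat.eq_of_mul_eq_mul_left hc (by omega)
    subst this
    have : j + 1 = j' + 1 := Nat.eq_of_mul_eq_mul_left hc (by omega)
    simpa using this
  have hcone : ∀ k j, IsConePoint c (φ (k, j)).1 (φ (k, j)).2 ↔ j < w k := by
    intro k j
    rw [isConePoint_iff hc]
    constructor
    · rintro ⟨k', j', h1, h2, h3⟩
      have := hφinj (a₁ := (k, j)) (a₂ := (k', j')) (Prod.ext h1 h2)
      simp only [Prod.mk.injEq] at this
      rw [this.1, this.2]
      exact h3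
    · intro h
      exact ⟨k, j, rfl, rfl, h⟩
  have hHφ : ∀ k j, H (φ (k, j)) = if j < w k then (c : ℝ) ^ (-2 - 2 * u)
      * (((k : ℝ) + 1 / c) ^ (-1 - u) * ((k : ℝ) + 1 / c + j + 1) ^ (-1 - u)) else 0 := by
    intro k j
    simp only [hH, hcone]
    congr 1
    have e : (((φ (k, j)).1 * (φ (k, j)).2 : ℕ) : ℝ)
        = (c : ℝ) ^ (2 : ℝ) * (((k : ℝ) + 1 / c) * ((k : ℝ) + 1 / c + j + 1)) := by
      simp only [hφ]
      push_cast
      rw [Real.rpow_two]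
      field_simp
      ring
    rw [e, Real.mul_rpow (by positivity) (by positivity), ← Real.rpow_mul hc'.le,
      Real.mul_rpow (by positivity) (by positivity)]
    ring_nf
  have hinner : ∀ k, HasSum (fun j => H (φ (k, j)))
      ((c : ℝ) ^ (-2 - 2 * u) * (((k : ℝ) + 1 / c) ^ (-1 - u) * coneInnerSum u (k + 1 / c))) := by
    intro k
    have h1 : HasSum (fun j => H (φ (k, j))) (∑ j ∈ Finset.range (w k), H (φ (k, j))) :=
      hasSum_sum_of_ne_finset_zero (fun j hj => by rw [hHφ, if_neg (by simpa using hj)])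
    have e : (c : ℝ) ^ (-2 - 2 * u) * (((k : ℝ) + 1 / c) ^ (-1 - u) * coneInnerSum u (k + 1 / c))
        = ∑ j ∈ Finset.range (w k), H (φ (k, j)) := ?_
    · rw [e]; exact h1
    rw [coneInnerSum, Finset.mul_sum, Finset.mul_sum]
    refine Finset.sum_congr rfl fun j hj => ?_
    rw [hHφ, if_pos (Finset.mem_range.1 hj)]
  have hH0 : ∀ x, 0 ≤ H x := fun x => by
    simp only [hH]; split_ifs <;> positivity
  have hsum : HasSum (fun y : ℕ × ℕ => H (φ y)) ((c : ℝ) ^ (-2 - 2 * u) * a) := by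
    have hout := h.mul_left ((c : ℝ) ^ (-2 - 2 * u))
    have hs : Summable (fun y : ℕ × ℕ => H (φ y)) := by
      rw [summable_prod_of_nonneg fun y => hH0 _]
      refine ⟨fun k => (hinner k).summable, ?_⟩
      simp only [(hinner _).tsum_eq]
      exact hout.summable
    have h2 := hs.hasSum.prod_fiberwise hinner
    have := hs.hasSum
    rwa [h2.unique hout] at this
  have hsumH : HasSum H ((c : ℝ) ^ (-2 - 2 * u) * a) := by
    refine (hφinj.hasSum_iff ?_).1 hsum
    rintro ⟨p, q⟩ hpq
    simp only [hH]
    refine if_neg fun hR => hpq ?_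
    obtain ⟨k, j, h1, h2, -⟩ := (isConePoint_iff hc).1 hR
    exact ⟨(k, j), Prod.ext h1.symm h2.symm⟩
  refine (congrArg (fun f => HasSum f _) (funext fun n => ?_)).mpr
    (hsumH.tsum_fiberwise (fun x : ℕ × ℕ => x.1 * x.2))
  rcases Nat.eq_zero_or_pos n with rfl | hn
  · rw [ArithmeticFunction.map_zero, zero_mul, eq_comm]
    have : ∀ x : (fun x : ℕ × ℕ => x.1 * x.2) ⁻¹' {0}, H x = 0 := by
      rintro ⟨⟨p, q⟩, hx⟩
      have hx' : p * q = 0 := hx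
      simp only [hH]
      refine if_neg fun hR => ?_
      have := Nat.mul_pos hR.1 (hR.1.trans hR.2.1)
      omega
    simp only [this, tsum_zero]
  · have hset : (fun x : ℕ × ℕ => x.1 * x.2) ⁻¹' {n} = ↑(n.divisorsAntidiagonal) := by
      ext x
      simp [hn.ne']
    rw [hset, Finset.tsum_subtype' n.divisorsAntidiagonal H, fiberCount_eq_sum, Finset.sum_mul]
    refine Finset.sum_congr rfl fun x hx => ?_
    rw [ite_mul, one_mul, zero_mul]
    simp only [hH, (Nat.mem_divisorsAntidiagonal.1 hx).1]


lemma LSeriesHasSum_ofReal {f : ℕ → ℝ} {s a : ℝ} (h0 : f 0 = 0)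
    (h : HasSum (fun n : ℕ => f n * (n : ℝ) ^ (-s)) a) :
    LSeriesHasSum (fun n => (f n : ℂ)) s a := by
  have h1 : HasSum (fun n : ℕ => ((f n * (n : ℝ) ^ (-s) : ℝ) : ℂ)) (a : ℂ) := by
    exact_mod_cast h
  refine (congrArg (fun f => HasSum f _) (funext fun n => ?_)).mpr h1
  rcases Nat.eq_zero_or_pos n with rfl | hn
  · simp [h0]
  · rw [LSeries.term_of_ne_zero hn.ne', Complex.ofReal_mul, Complex.ofReal_cpow (Nat.cast_nonneg n),
      Complex.ofReal_neg, Complex.cpow_neg, Complex.ofReal_natCast, div_eq_mul_inv]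

lemma LSeriesHasSum_mul {f g : ArithmeticFunction ℝ} {s a b : ℂ}
    (hf : LSeriesHasSum (fun n => (f n : ℂ)) s a) (hg : LSeriesHasSum (fun n => (g n : ℂ)) s b) :
    LSeriesHasSum (fun n => (((f * g : ArithmeticFunction ℝ) n : ℝ) : ℂ)) s (a * b) := by
  have h := hf.convolution hg
  rw [LSeries.convolution_def] at h
  refine (congrArg (fun F => LSeriesHasSum F s (a * b)) (funext fun n => ?_)).mpr h
  rw [ArithmeticFunction.mul_apply]
  push_cast
  rfl

lemma trivChar_apply {c : ℕ} (hc : ∀ d : ℕ, d % c = 1 % c ↔ d.Coprime c) (d : ℕ) :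
    (1 : DirichletCharacter ℂ c) (d : ZMod c) = if d % c = 1 % c then 1 else 0 := by
  split_ifs with h
  · exact MulChar.one_apply ((ZMod.isUnit_iff_coprime d c).2 ((hc d).1 h))
  · exact MulChar.map_nonunit _ fun hu => h ((hc d).2 ((ZMod.isUnit_iff_coprime d c).1 hu))

/-- Only squares d² contribute, and (d²)^(-s) = d^(-2s), so this is the Möbius series of the trivial
character at 2s. The hypothesis on `c` turns the congruence into coprimality. -/
lemma LSeriesHasSum_squareMoebius {c : ℕ} [NeZero c]
    (hc : ∀ d : ℕ, d % c = 1 % c ↔ d.Coprime c) {s : ℂ} (hs : 1 < (2 * s).re) :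
    LSeriesHasSum (fun n => (squareMoebius (fun d => d % c = 1 % c) n : ℂ)) s
      (DirichletCharacter.LFunctionTrivChar c (2 * s))⁻¹ := by
  classical
  set χ : DirichletCharacter ℂ c := 1 with hχ
  have h1 := DirichletCharacter.LSeries.mul_mu_eq_one χ hs
  rw [← DirichletCharacter.LFunction_eq_LSeries χ hs] at h1
  have h2 : LSeriesSummable ((fun n : ℕ => χ n) * fun n : ℕ => (ArithmeticFunction.moebius n : ℂ))
      (2 * s) :=
    DirichletCharacter.LSeriesSummable_mul χ (ArithmeticFunction.LSeriesSummable_moebius_iff.2 hs)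
  have h3 := h2.LSeriesHasSum
  rw [eq_inv_of_mul_eq_one_right h1] at h3
  have hinj : Function.Injective fun d : ℕ => d ^ 2 := fun a b hab =>
    Nat.pow_left_injective (n := 2) (by norm_num) hab
  refine (hinj.hasSum_iff ?_).1
    ((congrArg (fun F => HasSum F _) (funext fun d => ?_)).mpr h3)
  · intro n hn
    rcases Nat.eq_zero_or_pos n with rfl | hn0
    · simp
    · rw [LSeries.term_of_ne_zero hn0.ne', squareMoebius_of_not_sq _ fun d hd => hn ⟨d, hd⟩]
      simp
  · simp only [Function.comp_apply]
    rcases Nat.eq_zero_or_pos d with rfl | hd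
    · simp
    · have hd2 : (d : ℂ) ≠ 0 := by exact_mod_cast hd.ne'
      rw [LSeries.term_of_ne_zero (by positivity), LSeries.term_of_ne_zero hd.ne', squareMoebius_sq,
        Pi.mul_apply, hχ, trivChar_apply hc]
      have e : ((d ^ 2 : ℕ) : ℂ) ^ s = (d : ℂ) ^ (2 * s) := by
        rw [sq, Nat.cast_mul, Complex.natCast_mul_natCast_cpow, two_mul, Complex.cpow_add _ _ hd2]
      rw [e]
      split_ifs <;> simp

/-- The integers prime to `c` are exactly the numbers ck + 1 here, so scaling by `c` gives the
series of the trivial character. -/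
lemma tsum_progression {c : ℕ} [NeZero c]
    (hc : ∀ d : ℕ, d % c = 1 % c ↔ d.Coprime c) {u : ℝ} (hu : 0 < u) :
    ((∑' k : ℕ, ((k : ℝ) + 1 / c) ^ (-1 - 2 * u) : ℝ) : ℂ)
      = (c : ℂ) ^ (1 + 2 * (u : ℂ)) * DirichletCharacter.LFunctionTrivChar c (1 + 2 * u) := by
  have hc0 : 0 < c := Nat.pos_of_ne_zero (NeZero.ne c)
  have hc' : (0 : ℝ) < c := by exact_mod_cast hc0
  have hs : 1 < (1 + 2 * (u : ℂ)).re := by simp; linarith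
  have h1 := (DirichletCharacter.LSeriesSummable_of_one_lt_re (1 : DirichletCharacter ℂ c)
    hs).LSeriesHasSum
  rw [← DirichletCharacter.LFunction_eq_LSeries _ hs] at h1
  have hinj : Function.Injective fun k : ℕ => c * k + 1 := fun a b hab =>
    Nat.eq_of_mul_eq_mul_left hc0 (by simpa using hab)
  rw [LSeriesHasSum, ← hinj.hasSum_iff] at h1
  · rw [Complex.ofReal_tsum, ← (h1.mul_left ((c : ℂ) ^ (1 + 2 * (u : ℂ)))).tsum_eq]
    refine tsum_congr fun k => ?_
    have hk : (c : ℝ) * k + 1 = c * (k + 1 / c) := by field_simp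
    have hk0 : (0 : ℝ) < k + 1 / c := by positivity
    simp only [Function.comp_apply]
    rw [LSeries.term_of_ne_zero (by omega), trivChar_apply hc, if_pos (by simp [Nat.add_mod])]
    have e : ((c * k + 1 : ℕ) : ℂ) = ((c : ℝ) : ℂ) * ((k + 1 / c : ℝ) : ℂ) := by
      rw [← Complex.ofReal_mul, ← hk]; push_cast; rfl
    rw [e, Complex.mul_cpow_ofReal_nonneg hc'.le hk0.le, Complex.ofReal_cpow hk0.le]
    have e2 : ((-1 - 2 * u : ℝ) : ℂ) = -(1 + 2 * (u : ℂ)) := by push_cast; ring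
    have hcne : ((c : ℝ) : ℂ) ^ (1 + 2 * (u : ℂ)) ≠ 0 := by
      rw [Complex.cpow_ne_zero_iff]; left; exact_mod_cast hc0.ne'
    rw [e2, Complex.cpow_neg, Complex.ofReal_natCast] at *
    field_simp
  · intro n hn
    rcases Nat.eq_zero_or_pos n with rfl | hn0
    · simp
    · rw [LSeries.term_of_ne_zero hn0.ne', trivChar_apply hc, if_neg, zero_div]
      intro h
      obtain ⟨k, hk⟩ := (Nat.modEq_iff_dvd' hn0).1 h.symm
      exact hn ⟨k, by simp only; omega⟩

/-- The Dirichlet series of the primitive points of the cone. -/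
lemma LSeriesHasSum_primitiveConeCount {c : ℕ} [NeZero c]
    (hc : ∀ d : ℕ, d % c = 1 % c ↔ d.Coprime c) {u : ℝ} (hu : 0 < u) :
    LSeriesHasSum (fun n => (primitiveConeCount c n : ℂ)) (1 + u)
      ((DirichletCharacter.LFunctionTrivChar c (2 * (1 + u)))⁻¹ * ((c : ℂ) ^ (-2 - 2 * (u : ℂ)) *
        ((((1 - Real.exp (-(u * (Real.log 3 / 2)))) / u : ℝ) : ℂ) *
          ((c : ℂ) ^ (1 + 2 * (u : ℂ)) * DirichletCharacter.LFunctionTrivChar c (1 + 2 * u))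
            - ((∑' k : ℕ, coneError u (k + 1 / c) : ℝ) : ℂ)))) := by
  have hc0 : 0 < c := Nat.pos_of_ne_zero (NeZero.ne c)
  have hc' : (0 : ℝ) < c := by exact_mod_cast hc0
  refine LSeriesHasSum_mul (LSeriesHasSum_squareMoebius hc (by simp; linarith)) ?_
  have h1 := hasSum_fiberCount_isConePoint hc0
    (hasSum_coneInnerSum (τ := 1 / c) (by positivity) hu)
  have h2 := LSeriesHasSum_ofReal (f := fiberCount (IsConePoint c)) (s := 1 + u)
    ArithmeticFunction.map_zero (by
      rw [show -(1 + u) = -1 - u by ring]; exact h1)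
  rw [Complex.ofReal_mul, Complex.ofReal_sub, Complex.ofReal_mul _ (∑' k : ℕ, _),
    tsum_progression hc hu, Complex.ofReal_cpow hc'.le] at h2
  push_cast at h2 ⊢
  exact h2

lemma LSeriesHasSum_indicatorTwo (s : ℂ) :
    LSeriesHasSum (fun n => (indicatorTwo n : ℂ)) s ((2 : ℂ) ^ (-s)) := by
  have h : HasSum (LSeries.term (fun n => (indicatorTwo n : ℂ)) s)
      (LSeries.term (fun n => (indicatorTwo n : ℂ)) s 2) := by
    refine hasSum_single 2 fun n hn => ?_
    rcases Nat.eq_zero_or_pos n with rfl | hn0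
    · simp
    · rw [LSeries.term_of_ne_zero hn0.ne']
      simp [indicatorTwo, hn]
  rw [LSeries.term_of_ne_zero two_ne_zero] at h
  refine (congrArg (HasSum _ ·) ?_).mp h
  simp [indicatorTwo, Complex.cpow_neg]

lemma LSeriesHasSum_one (s : ℂ) :
    LSeriesHasSum (fun n => (((1 : ArithmeticFunction ℝ) n : ℝ) : ℂ)) s 1 := by
  have h : HasSum (LSeries.term (fun n => (((1 : ArithmeticFunction ℝ) n : ℝ) : ℂ)) s)
      (LSeries.term (fun n => (((1 : ArithmeticFunction ℝ) n : ℝ) : ℂ)) s 1) := by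
    refine hasSum_single 1 fun n hn => ?_
    rcases Nat.eq_zero_or_pos n with rfl | hn0
    · simp
    · rw [LSeries.term_of_ne_zero hn0.ne', ArithmeticFunction.one_apply_ne hn]
      simp
  rw [LSeries.term_of_ne_zero one_ne_zero] at h
  refine (congrArg (HasSum _ ·) ?_).mp h
  simp

lemma LSeriesHasSum_shapeArith {s a b : ℂ}
    (h1 : LSeriesHasSum (fun n => (primitiveConeCount 1 n : ℂ)) s a)
    (h2 : LSeriesHasSum (fun n => (primitiveConeCount 2 n : ℂ)) s b) :
    LSeriesHasSum (fun n => (shapeArith n : ℂ)) s (1 + 2 * b + 2 ^ (-s) * (2 * (a - b))) := by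
  have h3 := LSeriesHasSum_mul (LSeriesHasSum_indicatorTwo s) h1
  have h4 := LSeriesHasSum_mul (LSeriesHasSum_indicatorTwo s) h2
  have h5 := ((LSeriesHasSum_one s).add (h2.smul 2)).add ((h3.smul 2).sub (h4.smul 2))
  have e : (1 + 2 * b + (2 : ℂ) ^ (-s) * (2 * (a - b)))
      = 1 + (2 : ℂ) • b + ((2 : ℂ) • (2 ^ (-s) * a) - (2 : ℂ) • (2 ^ (-s) * b)) := by
    simp only [smul_eq_mul]; ring
  rw [e]
  refine (congrArg (fun F => LSeriesHasSum F s _) (funext fun n => ?_)).mpr h5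
  have e1 : shapeArith = 1 + (primitiveConeCount 2 + primitiveConeCount 2)
      + (indicatorTwo * primitiveConeCount 1 + indicatorTwo * primitiveConeCount 1
        + -(indicatorTwo * primitiveConeCount 2 + indicatorTwo * primitiveConeCount 2)) := by
    rw [shapeArith]; ring
  simp only [e1, ArithmeticFunction.add_apply, ArithmeticFunction.neg_apply, Pi.add_apply,
    Pi.sub_apply, Pi.smul_apply, smul_eq_mul]
  push_cast
  ring

lemma LSeriesHasSum_chiSumArith {s : ℂ} (hs : 1 < s.re) :
    LSeriesHasSum (fun n => (chiSumArith n : ℂ)) s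
      (chiNegFour.LFunction s * riemannZeta s) := by
  refine LSeriesHasSum_mul ?_ ?_
  · have h := (DirichletCharacter.LSeriesSummable_of_one_lt_re chiNegFour hs).LSeriesHasSum
    rw [← DirichletCharacter.LFunction_eq_LSeries _ hs] at h
    refine (congrArg (fun F => LSeriesHasSum F s _) (funext fun n => ?_)).mpr h
    simp [chiArith_apply, chiNegFour]
  · have h := ArithmeticFunction.LSeriesHasSum_zeta hs
    refine (congrArg (fun F => LSeriesHasSum F s _) (funext fun n => ?_)).mpr h
    simp only [ArithmeticFunction.natCoe_apply, Complex.ofReal_natCast]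


/-! ### Comparison of principal parts at s = 1 -/

/-- The coefficients of a principal part are determined by the right derivative of the regular part
at the pole. -/
lemma principalPart_unique {Φ L g : ℝ → ℂ} {a c φ : ℂ} (hg : ContinuousWithinAt g (Set.Ioi 0) 0)
    (hL : ∀ u : ℝ, 0 < u → L u = a / (u : ℂ) ^ 2 + c / u + g u)
    (hΦ : ∀ u : ℝ, 0 < u → (u : ℂ) ^ 2 * L u = Φ u)
    (hd : HasDerivWithinAt Φ φ (Set.Ioi 0) 0) : a = Φ 0 ∧ c = φ := by
  have hid : HasDerivWithinAt (fun u : ℝ => (u : ℂ)) 1 (Set.Ioi 0) 0 :=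
    (hasDerivAt_id (0 : ℂ)).comp_ofReal.hasDerivWithinAt
  -- The regular part is bounded near 0, so u² g(u) does not affect the first-order expansion.
  have hq : HasDerivWithinAt (fun u : ℝ => (u : ℂ) ^ 2 * g u) 0 (Set.Ioi 0) 0 := by
    rw [hasDerivWithinAt_iff_tendsto_slope' (by simp)]
    have h1 : Tendsto (fun u : ℝ => (u : ℂ) * g u) (𝓝[>] 0) (𝓝 (((0 : ℝ) : ℂ) * g 0)) :=
      hid.continuousWithinAt.tendsto.mul hg
    rw [Complex.ofReal_zero, zero_mul] at h1
    refine h1.congr' ?_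
    filter_upwards [self_mem_nhdsWithin] with u hu
    have hu0 : (u : ℂ) ≠ 0 := by exact_mod_cast (ne_of_gt hu)
    simp only [slope, vsub_eq_sub, sub_zero, Complex.real_smul, Complex.ofReal_inv]
    field_simp
    simp
  have hΨ : HasDerivWithinAt (fun u : ℝ => a + c * (u : ℂ) + (u : ℂ) ^ 2 * g u) c (Set.Ioi 0) 0 := by
    refine (((hid.const_mul c).const_add a).add hq).congr_deriv ?_
    ring
  have heq : Set.EqOn (fun u : ℝ => a + c * (u : ℂ) + (u : ℂ) ^ 2 * g u) Φ (Set.Ioi 0) := by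
    intro u hu
    have hu0 : (u : ℂ) ≠ 0 := by exact_mod_cast (ne_of_gt hu)
    rw [← hΦ u hu, hL u hu]
    field_simp
  have h0 : a = Φ 0 := by
    have h1 := hΨ.continuousWithinAt.tendsto
    have h2 := hd.continuousWithinAt.tendsto
    have h3 := tendsto_nhds_unique (h1.congr' (by
      filter_upwards [self_mem_nhdsWithin] with u hu using heq hu)) h2
    simpa using h3
  refine ⟨h0, ?_⟩
  have h4 := hd.congr heq (by simpa using h0)
  exact UniqueDiffWithinAt.eq_deriv _ (uniqueDiffWithinAt_Ioi 0) hΨ h4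

/-- The function `(1 - exp (-u L)) / u`, extended continuously to `u = 0`. -/
noncomputable def expQuot (L u : ℝ) : ℝ := if u = 0 then L else (1 - Real.exp (-(u * L))) / u

/-- The second-order coefficient of 1 - exp(-uL), obtained from l'Hôpital's rule. -/
lemma hasDerivWithinAt_expQuot (L : ℝ) :
    HasDerivWithinAt (expQuot L) (-(L ^ 2 / 2)) (Set.Ioi 0) 0 := by
  rw [hasDerivWithinAt_iff_tendsto_slope' (by simp)]
  have h1 : Tendsto (fun u : ℝ => (1 - Real.exp (-(u * L)) - u * L) / u ^ 2) (𝓝[>] 0)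
      (𝓝 (-(L ^ 2 / 2))) := by
    refine HasDerivAt.lhopital_zero_nhdsGT (f' := fun u => Real.exp (-(u * L)) * L - L)
      (g' := fun u => 2 * u) ?_ ?_ ?_ ?_ ?_ ?_
    · refine Eventually.of_forall fun u => ?_
      have := (((hasDerivAt_id u).mul_const L).fun_neg.exp.const_sub 1).sub
        ((hasDerivAt_id u).mul_const L)
      refine this.congr_deriv ?_
      simp
    · refine Eventually.of_forall fun u => ?_
      simpa using hasDerivAt_pow 2 u
    · filter_upwards [self_mem_nhdsWithin] with u hu
      have : (0 : ℝ) < u := hu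
      positivity
    · have : Continuous fun u : ℝ => 1 - Real.exp (-(u * L)) - u * L := by fun_prop
      have h := this.tendsto 0
      simp only [zero_mul, neg_zero, Real.exp_zero, sub_self] at h
      exact h.mono_left nhdsWithin_le_nhds
    · have : Continuous fun u : ℝ => u ^ 2 := by fun_prop
      have h := this.tendsto 0
      rw [zero_pow two_ne_zero] at h
      exact h.mono_left nhdsWithin_le_nhds
    · have h := (tendsto_one_sub_exp_div L).const_mul (-(L / 2))
      rw [show -(L / 2) * L = -(L ^ 2 / 2) by ring] at h
      refine h.congr' ?_
      filter_upwards [self_mem_nhdsWithin] with u hu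
      have : (0 : ℝ) < u := hu
      field_simp
      ring
  refine h1.congr' ?_
  filter_upwards [self_mem_nhdsWithin] with u hu
  have hu0 : u ≠ 0 := ne_of_gt hu
  simp only [slope_def_field, expQuot, hu0, if_true, if_false, sub_zero]
  field_simp

/-- A pole-free expression for the generating Dirichlet series near its pole. -/
noncomputable def regularPart (u : ℝ) : ℂ :=
  chiNegFour.LFunction (1 + u) * riemannZeta₁ (1 + u) *
    (u + 2 / riemannZeta (2 + 2 * u) *
      ((expQuot (Real.log 3 / 2) u : ℂ) * riemannZeta₁ (1 + 2 * u) / 2 *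
        ((1 + 2 * (2 : ℂ) ^ (-1 - (u : ℂ))) / (2 * (1 + (2 : ℂ) ^ (-1 - (u : ℂ)))))
        - u * (((2 : ℂ) ^ (-1 - (u : ℂ))) ^ 2 / (1 + (2 : ℂ) ^ (-1 - (u : ℂ)))
            * ((∑' k : ℕ, coneError u (k + 1 / 2) : ℝ) : ℂ)
          + (2 : ℂ) ^ (-1 - (u : ℂ)) * ((∑' k : ℕ, coneError u (k + 1) : ℝ) : ℂ))))

lemma mod_one_eq_iff (d : ℕ) : d % 1 = 1 % 1 ↔ d.Coprime 1 := by simp [Nat.mod_one]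

lemma mod_two_eq_iff (d : ℕ) : d % 2 = 1 % 2 ↔ d.Coprime 2 := by
  rw [Nat.coprime_two_right, Nat.odd_iff]

lemma norm_two_cpow (u : ℝ) : ‖(2 : ℂ) ^ (-1 - (u : ℂ))‖ = (2 : ℝ) ^ (-1 - u) := by
  have : (2 : ℂ) ^ (-1 - (u : ℂ)) = (((2 : ℝ) ^ (-1 - u) : ℝ) : ℂ) := by
    rw [Complex.ofReal_cpow (by norm_num)]; push_cast; rfl
  rw [this, Complex.norm_real, Real.norm_of_nonneg (by positivity)]

/-- The factor u² removes the poles of ζ(1 + u) and ζ(1 + 2u), replaced by values of (s - 1) ζ(s).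
With y = 2^(-1-u), the Euler factors at 2 are 1 - y² and 1 - 2y²; all powers of 2 are polynomials in
y and its inverse. -/
lemma sq_mul_LSeries_eq_regularPart {u : ℝ} (hu : 0 < u) :
    (u : ℂ) ^ 2 * LSeries (fun n => (((chiSumArith * shapeArith : ArithmeticFunction ℝ) n : ℝ) : ℂ))
      (1 + u) = regularPart u := by
  have hs : 1 < (1 + (u : ℂ)).re := by simp [hu]
  have h1 := LSeriesHasSum_primitiveConeCount mod_one_eq_iff hu
  have h2 := LSeriesHasSum_primitiveConeCount mod_two_eq_iff hu
  have h := LSeriesHasSum_mul (LSeriesHasSum_chiSumArith hs) (LSeriesHasSum_shapeArith h1 h2)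
  rw [h.LSeries_eq]
  have hu0 : (u : ℂ) ≠ 0 := by exact_mod_cast hu.ne'
  have hs2 : 1 < (2 * (1 + (u : ℂ))).re := by simp; linarith
  have ne1 : 2 * (1 + (u : ℂ)) ≠ 1 := by
    intro h; rw [h] at hs2; simp at hs2
  have ne2 : 1 + 2 * (u : ℂ) ≠ 1 := by simpa using hu0
  rw [DirichletCharacter.LFunctionTrivChar_eq_mul_riemannZeta ne1,
    DirichletCharacter.LFunctionTrivChar_eq_mul_riemannZeta ne2,
    DirichletCharacter.LFunctionTrivChar_eq_mul_riemannZeta ne1,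
    DirichletCharacter.LFunctionTrivChar_eq_mul_riemannZeta ne2,
    Nat.primeFactors_one, Nat.Prime.primeFactors Nat.prime_two, Finset.prod_empty,
    Finset.prod_empty, Finset.prod_singleton, Finset.prod_singleton, one_mul, one_mul,
    Nat.cast_one, Nat.cast_one, Complex.one_cpow, Complex.one_cpow, Nat.cast_two, Nat.cast_two,
    div_one, one_mul, one_mul, regularPart, expQuot, if_neg hu.ne']
  have hz1 : riemannZeta (1 + u) = riemannZeta₁ (1 + u) / u := by
    rw [riemannZeta_eq_inv_sub_mul (by simpa using hu0), add_sub_cancel_left, inv_mul_eq_div]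
  have hz2 : riemannZeta (1 + 2 * u) = riemannZeta₁ (1 + 2 * u) / (2 * u) := by
    rw [riemannZeta_eq_inv_sub_mul ne2, add_sub_cancel_left, inv_mul_eq_div]
  have hzne : riemannZeta (2 + 2 * u) ≠ 0 := riemannZeta_ne_zero_of_one_le_re (by simp; linarith)
  set y := (2 : ℂ) ^ (-1 - (u : ℂ)) with hy
  -- This makes 1 + y and 1 - y non-zero; the factor 1 - y in the weight of the odd shapes cancels
  -- against 1 - y² = (1 - y)(1 + y).
  have hynorm : ‖y‖ < 1 := by
    rw [hy, norm_two_cpow]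
    exact Real.rpow_lt_one_of_one_lt_of_neg (by norm_num) (by linarith)
  have hy0 : y ≠ 0 := by rw [hy, Complex.cpow_ne_zero_iff]; left; norm_num
  have e1 : (2 : ℂ) ^ (-(1 + (u : ℂ))) = y := by rw [hy]; ring_nf
  have e2 : (2 : ℂ) ^ (-2 - 2 * (u : ℂ)) = y ^ 2 := by
    rw [hy, ← Complex.cpow_nat_mul]; push_cast; ring_nf
  have e3 : (2 : ℂ) ^ (-(2 * (1 + (u : ℂ)))) = y ^ 2 := by
    rw [← e2]; ring_nf
  have e4 : (2 : ℂ) ^ (-(1 + 2 * (u : ℂ))) = 2 * y ^ 2 := by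
    rw [← e2, show -(1 + 2 * (u : ℂ)) = 1 + (-2 - 2 * u) by ring, Complex.cpow_add _ _ two_ne_zero,
      Complex.cpow_one]
  have e5 : (2 : ℂ) ^ (1 + 2 * (u : ℂ)) = (2 * y ^ 2)⁻¹ := by
    rw [← e4, Complex.cpow_neg, inv_inv]
  have n1 : 1 + y ≠ 0 := by
    intro h0
    rw [eq_neg_of_add_eq_zero_right h0, norm_neg, norm_one] at hynorm
    exact lt_irrefl _ hynorm
  have n2 : 1 - y ≠ 0 := by
    intro h0
    rw [← sub_eq_zero.1 h0, norm_one] at hynorm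
    exact lt_irrefl _ hynorm
  have n3 : 1 - y ^ 2 = (1 - y) * (1 + y) := by ring
  rw [e1, e2, e3, e4, e5, hz1, hz2, n3, show 2 * (1 + (u : ℂ)) = 2 + 2 * u by ring]
  generalize chiNegFour.LFunction (1 + u) = X
  generalize riemannZeta₁ (1 + u) = Z1
  generalize riemannZeta₁ (1 + 2 * u) = Z2
  generalize riemannZeta (2 + 2 * u) = W at *
  generalize (((1 - Real.exp (-(u * (Real.log 3 / 2)))) / u : ℝ) : ℂ) = D
  generalize ((∑' k : ℕ, coneError u (k + 1) : ℝ) : ℂ) = E1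
  generalize ((∑' k : ℕ, coneError u (k + 1 / 2) : ℝ) : ℂ) = E2
  field_simp
  ring

lemma hasDerivWithinAt_id_mul {J : ℝ → ℂ} {j : ℂ} (h : Tendsto J (𝓝[>] 0) (𝓝 j)) :
    HasDerivWithinAt (fun u : ℝ => (u : ℂ) * J u) j (Set.Ioi 0) 0 := by
  rw [hasDerivWithinAt_iff_tendsto_slope' (by simp)]
  refine h.congr' ?_
  filter_upwards [self_mem_nhdsWithin] with u hu
  have hu0 : (u : ℂ) ≠ 0 := by exact_mod_cast (ne_of_gt hu)
  simp only [slope, vsub_eq_sub, sub_zero, Complex.real_smul, Complex.ofReal_inv]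
  field_simp
  simp

lemma hasDerivWithinAt_comp_affine {F : ℂ → ℂ} {p F' : ℂ} (hF : HasDerivAt F F' p) (k : ℂ) :
    HasDerivWithinAt (fun u : ℝ => F (p + k * u)) (F' * k) (Set.Ioi 0) 0 := by
  have h1 : HasDerivAt (fun z : ℂ => p + k * z) k ((0 : ℝ) : ℂ) := by
    simpa using ((hasDerivAt_id ((0 : ℝ) : ℂ)).const_mul k).const_add p
  have h2 : HasDerivAt F F' (p + k * ((0 : ℝ) : ℂ)) := by simpa using hF
  exact (h2.comp ((0 : ℝ) : ℂ) h1).comp_ofReal.hasDerivWithinAt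

lemma regularPart_zero : regularPart 0
    = ((Real.log 3 / 3 : ℝ) : ℂ) * (LOne / riemannZeta 2) := by
  rw [regularPart, expQuot, if_pos rfl, LOne]
  simp only [Complex.ofReal_zero, mul_zero, add_zero, sub_zero, zero_mul, zero_add,
    riemannZeta₁_one, Complex.cpow_neg_one]
  have : riemannZeta 2 ≠ 0 := riemannZeta_ne_zero_of_one_le_re (by norm_num)
  push_cast
  field_simp
  norm_num
  ring

/-- The product rule accounts for each summand of the constant. The shape (1, 1) contributes ζ(2),
the derivative of (s - 1) ζ(s) at 1 contributes γ and 2γ, and the expansion of (1 - 3^(-u/2))/u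
contributes -log 3/4. The parity factor (1 + 2y)/(2(1 + y)) contributes -log 2/6, and the error
sums, multiplied by u, contribute their limits. -/
lemma hasDerivWithinAt_regularPart :
    HasDerivWithinAt regularPart cSquareFormula (Set.Ioi 0) 0 := by
  have hζ : riemannZeta 2 ≠ 0 := riemannZeta_ne_zero_of_one_le_re (by norm_num)
  have h1 := hasDerivWithinAt_comp_affine
    (DirichletCharacter.differentiable_LFunction chiNegFour_ne_one 1).hasDerivAt 1
  have h2 := hasDerivWithinAt_comp_affine (differentiable_riemannZeta₁ 1).hasDerivAt 1
  have h3 := hasDerivWithinAt_comp_affine (differentiable_riemannZeta₁ 1).hasDerivAt 2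
  have h4 := hasDerivWithinAt_comp_affine
    (differentiableAt_riemannZeta (s := 2) (by norm_num)).hasDerivAt 2
  have h5 := hasDerivWithinAt_comp_affine
    ((hasDerivAt_id (-1 : ℂ)).const_cpow (c := 2) (Or.inl two_ne_zero)) (-1)
  have h6 := (hasDerivWithinAt_expQuot (Real.log 3 / 2)).ofReal_comp
  simp only [id, neg_one_mul, one_mul, mul_one, ← sub_eq_add_neg] at h1 h2 h5
  rw [deriv_riemannZeta₁_one] at h2 h3
  have hid : HasDerivWithinAt (fun u : ℝ => (u : ℂ)) 1 (Set.Ioi 0) 0 :=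
    (hasDerivAt_id (0 : ℂ)).comp_ofReal.hasDerivWithinAt
  have hy : Tendsto (fun u : ℝ => (2 : ℂ) ^ (-1 - (u : ℂ))) (𝓝[>] 0) (𝓝 (1 / 2)) := by
    have := h5.continuousWithinAt.tendsto
    simpa [Complex.cpow_neg_one] using this
  have hE : ∀ τ : ℝ, 0 < τ →
      Tendsto (fun u => ((∑' k : ℕ, coneError u (k + τ) : ℝ) : ℂ)) (𝓝[>] 0)
        (𝓝 ((∑' k : ℕ, coneTerm (k + τ) : ℝ) : ℂ)) := fun τ hτ =>
    (Complex.continuous_ofReal.tendsto _).comp (tendsto_tsum_coneError hτ)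
  have hJ := hasDerivWithinAt_id_mul ((((hy.pow 2).div (hy.const_add 1) (by norm_num)).mul
    (hE (1 / 2) (by norm_num))).add (hy.mul (hE 1 one_pos)))
  have h7 := (h5.const_mul 2).const_add 1
  have h8 := (h5.const_add 1).const_mul 2
  have hval : (2 : ℂ) ^ (-1 - ((0 : ℝ) : ℂ)) = 1 / 2 := by
    simp [Complex.cpow_neg_one]
  have h9 := h7.div h8 (by rw [hval]; norm_num)
  have h10 := ((h4.fun_inv (by simpa using hζ)).const_mul 2).mul
    ((((h6.mul h3).div_const 2).mul h9).sub hJ)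
  have h11 := (h1.mul h2).mul (hid.add h10)
  have t1 : ∑' p : ℕ, seriesTermOne (p + 1) = ∑' k : ℕ, coneTerm (k + 1) :=
    tsum_congr seriesTermOne_eq
  have t2 : ∑' k : ℕ, seriesTermTwo k = (∑' k : ℕ, coneTerm (k + 1 / 2)) / 4 := by
    rw [← tsum_div_const]; exact tsum_congr seriesTermTwo_eq
  have hfun : ∀ u : ℝ, regularPart u = _ := fun u => by
    rw [regularPart, div_eq_mul_inv 2 (riemannZeta (2 + 2 * u))]
  refine (h11.congr_deriv ?_).congr (fun u _ => hfun u) (hfun 0)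
  simp only [Pi.mul_apply, Pi.div_apply, Pi.add_apply, Pi.sub_apply, Complex.ofReal_zero,
    mul_zero, add_zero, sub_zero, expQuot, if_true, riemannZeta₁_one, zero_mul, mul_one, zero_add,
    Complex.cpow_neg_one]
  have hL : LOne ≠ 0 := by
    rw [LOne_eq]; exact_mod_cast (by positivity : Real.pi / 4 ≠ 0)
  have hlog : Complex.log 2 = (Real.log 2 : ℂ) := by
    rw [Complex.ofReal_log (by norm_num)]; norm_num
  rw [cSquareFormula, t1, t2, ← LOne, ← LDerivOne, hlog, Complex.ofReal_div (∑' k : ℕ, _)]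
  generalize ((∑' k : ℕ, coneTerm (k + 1) : ℝ) : ℂ) = E1
  generalize ((∑' k : ℕ, coneTerm (k + 1 / 2) : ℝ) : ℂ) = E2
  push_cast
  norm_num
  field_simp
  ring

/-! ### Identification of the constants and conclusion -/

/-- The asymptotic growth of the number of well-rounded sublattices and the principal part of the
generating Dirichlet series. -/
lemma exists_abs_ASquare_sub_le {c : ℝ} (hc : (c : ℂ) = cSquareFormula) :
    (∃ C, ∀ x, 1 ≤ x → |ASquare x - (Real.log 3 / (2 * Real.pi) * (x * Real.log x)
        + (c - Real.log 3 / (2 * Real.pi)) * x)| ≤ C * (x ^ (3 / 4 : ℝ) * (1 + Real.log x))) ∧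
      (∀ s : ℂ, 1 < s.re → LSeriesSummable (fun n => (aSquare n : ℂ)) s) ∧
      ∃ g : ℂ → ℂ, AnalyticAt ℂ g 1 ∧ ∀ s : ℂ, 1 < s.re →
        LSeries (fun n => (aSquare n : ℂ)) s
          = ((Real.log 3 / (2 * Real.pi) : ℝ) : ℂ) / (s - 1) ^ 2 + (c : ℂ) / (s - 1) + g s := by
  obtain ⟨α, hα⟩ := hasMeanValue_chiSum
  obtain ⟨β, hβ⟩ := hasMeanValue_shapeArith
  have hpos1 : ∀ n, 0 ≤ chiSumArith n := by
    intro n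
    rcases Nat.eq_zero_or_pos n with rfl | hn
    · simp
    · rw [chiSumArith_apply]; exact_mod_cast chiSum_nonneg hn.ne'
  have hpos2 : ∀ n, 0 ≤ shapeArith n := by
    intro n; rw [shapeArith_apply]; positivity
  obtain ⟨B, C, hC⟩ := hα.summatory_mul hβ (hα.hasBoundedMean (by norm_num) hpos1)
    (hβ.hasBoundedMean (by norm_num) hpos2) (by norm_num) (by norm_num)
  rw [show ((1 : ℝ) + 1 / 2) / 2 = 3 / 4 by norm_num] at hC
  have hpos : ∀ n, 0 ≤ (chiSumArith * shapeArith : ArithmeticFunction ℝ) n := by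
    intro n
    rcases Nat.eq_zero_or_pos n with rfl | hn
    · simp
    · rw [← aSquare_eq_convolution hn.ne']; positivity
  have hcongr : ∀ {n : ℕ}, n ≠ 0 → (aSquare n : ℂ)
      = (((chiSumArith * shapeArith : ArithmeticFunction ℝ) n : ℝ) : ℂ) := by
    intro n hn
    rw [← aSquare_eq_convolution hn, Complex.ofReal_natCast]
  obtain ⟨hsum, g, hg, hL⟩ := LSeries_eq_of_summatory hpos (by norm_num : (3 / 4 : ℝ) < 1) hC
  have hgc : ContinuousWithinAt (fun u : ℝ => g (1 + u)) (Set.Ioi 0) 0 := by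
    refine ContinuousAt.continuousWithinAt ?_
    refine ContinuousAt.comp (g := g) (f := fun u : ℝ => 1 + (u : ℂ)) ?_ (by fun_prop)
    simpa using hg.continuousAt
  -- The principal part forced by the asymptotics and the explicit expression on s = 1 + u describe
  -- the same function, which identifies α β and α β + B.
  obtain ⟨e1, e2⟩ := principalPart_unique hgc
    (L := fun u : ℝ => LSeries
      (fun n => (((chiSumArith * shapeArith : ArithmeticFunction ℝ) n : ℝ) : ℂ)) (1 + u))
    (fun u hu => by
      have := hL (1 + u) (by simpa using hu)
      rwa [add_sub_cancel_left] at this)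
    (fun u hu => sq_mul_LSeries_eq_regularPart hu) hasDerivWithinAt_regularPart
  have hA : α * β = Real.log 3 / (2 * Real.pi) := by
    rw [regularPart_zero, LOne_eq, riemannZeta_two] at e1
    have : α * β = Real.log 3 / 3 * (Real.pi / 4 / (Real.pi ^ 2 / 6)) := by exact_mod_cast e1
    rw [this]
    field_simp
    norm_num
  have hB : B = c - Real.log 3 / (2 * Real.pi) := by
    rw [← hc] at e2
    have : α * β + B = c := by exact_mod_cast e2
    rw [← hA, ← this]
    ring
  refine ⟨⟨C, fun x hx => ?_⟩, fun s hs => ?_, g, hg, fun s hs => ?_⟩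
  · rw [ASquare_eq_summatory, ← hB, ← hA]
    exact hC x hx
  · exact (LSeriesSummable_congr s hcongr).2 (hsum s hs)
  · rw [LSeries_congr hcongr s, hL s hs, e2, ← hc, hA]

lemma ASquare_sub_isBigO {c : ℝ} (hc : (c : ℂ) = cSquareFormula) :
    (fun x : ℝ => ASquare x - (Real.log 3 / (2 * Real.pi) * x * Real.log x
      + (c - Real.log 3 / (2 * Real.pi)) * x))
      =O[atTop] fun x : ℝ => x ^ (3 / 4 : ℝ) * Real.log x := by
  obtain ⟨⟨C, hC⟩, -⟩ := exists_abs_ASquare_sub_le hc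
  have hC0 : 0 ≤ C := by simpa using (abs_nonneg _).trans (hC 1 le_rfl)
  refine IsBigO.of_bound (C * 2) ?_
  -- From e onwards 1 + log x ≤ 2 log x, hence the factor 2 in the constant.
  filter_upwards [eventually_ge_atTop (Real.exp 1)] with x hx
  have hx1 : 1 ≤ x := (Real.one_le_exp zero_le_one).trans hx
  have hlog : 1 ≤ Real.log x := (Real.le_log_iff_exp_le (by linarith)).2 hx
  rw [Real.norm_eq_abs, Real.norm_of_nonneg (by positivity), mul_assoc (_ / _) x]
  refine (hC x hx1).trans ?_
  rw [mul_assoc]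
  refine mul_le_mul_of_nonneg_left ?_ hC0
  rw [mul_left_comm]
  gcongr
  linarith

lemma ofReal_ASquare_sub_isBigO {c : ℝ} (hc : (c : ℂ) = cSquareFormula) :
    (fun x : ℝ => (ASquare x : ℂ) - ((Real.log 3 : ℂ) / 3 * (LOne / riemannZeta 2)
        * (x : ℂ) * ((Real.log x : ℂ) - 1) + (c : ℂ) * (x : ℂ)))
      =O[atTop] fun x : ℝ => x ^ (3 / 4 : ℝ) * Real.log x := by
  have h : (Real.log 3 : ℂ) / 3 * (LOne / riemannZeta 2)
      = ((Real.log 3 / (2 * Real.pi) : ℝ) : ℂ) := by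
    rw [LOne_eq, riemannZeta_two]
    have hpi : (Real.pi : ℂ) ≠ 0 := by exact_mod_cast Real.pi_ne_zero
    push_cast
    field_simp
    norm_num
    ring
  refine (Complex.isBigO_ofReal_left.2 (ASquare_sub_isBigO hc)).congr_left fun x => ?_
  rw [h]
  push_cast
  ring

end WellRounded

theorem theorem2 :
    -- the two series in the formula for the constant converge
    Summable (fun p : ℕ => WellRounded.seriesTermOne (p + 1)) ∧
    Summable WellRounded.seriesTermTwo ∧
    ∃ c : ℝ,
      (c : ℂ) = WellRounded.cSquareFormula ∧
      |c - 0.6272237| < 5 / 10 ^ 8 ∧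
      -- the two forms of the asymptotic growth
      ((fun x : ℝ => (WellRounded.ASquare x : ℂ) -
          ((Real.log 3 : ℂ) / 3 * (WellRounded.LOne / riemannZeta 2)
              * (x : ℂ) * ((Real.log x : ℂ) - 1) + (c : ℂ) * (x : ℂ)))
        =O[atTop] fun x : ℝ => x ^ (3 / 4 : ℝ) * Real.log x) ∧
      ((fun x : ℝ => WellRounded.ASquare x -
          (Real.log 3 / (2 * Real.pi) * x * Real.log x
            + (c - Real.log 3 / (2 * Real.pi)) * x))
        =O[atTop] fun x : ℝ => x ^ (3 / 4 : ℝ) * Real.log x) ∧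
      -- `c` is the coefficient of `(s - 1)⁻¹` in the Laurent series of the generating function
      (∀ s : ℂ, 1 < s.re → LSeriesSummable (fun n => (WellRounded.aSquare n : ℂ)) s) ∧
      ∃ g : ℂ → ℂ, AnalyticAt ℂ g 1 ∧
        ∀ᶠ s in 𝓝[{s : ℂ | 1 < s.re}] 1,
          LSeries (fun n => (WellRounded.aSquare n : ℂ)) s =
            ((Real.log 3 / (2 * Real.pi) : ℝ) : ℂ) / (s - 1) ^ 2 + (c : ℂ) / (s - 1) + g s := by
  have hc := WellRounded.cSquareFormula_eq.symm
  obtain ⟨-, hsum, g, hg, hL⟩ := WellRounded.exists_abs_ASquare_sub_le hc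
  refine ⟨(WellRounded.summable_coneTerm one_pos).congr fun k =>
      (WellRounded.seriesTermOne_eq k).symm,
    ((WellRounded.summable_coneTerm one_half_pos).div_const 4).congr fun k =>
      (WellRounded.seriesTermTwo_eq k).symm,
    _, hc, WellRounded.constantBracket_approx, WellRounded.ofReal_ASquare_sub_isBigO hc,
    WellRounded.ASquare_sub_isBigO hc, hsum, g, hg, ?_⟩
  filter_upwards [self_mem_nhdsWithin] with s hs using hL s hs
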